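/- **Setting.** Let $K$ be a non-archimedean local field with ring of integers $\mathcal{O}_K$ and residue field $k$, $q=\sharp k$, and let $G$ be a finite group. An $\mathcal{O}_K$-variety of dimension $d$ is a reduced flat scheme of finite type over $\mathcal{O}_K$, all of whose irreducible components have relative dimension $d$, and which is smooth over $\mathcal{O}_K$ on an open dense subset. For normal $X$ let $\omega_X$ be the canonical sheaf over $\mathcal{O}_K$: the reflexive sheaf which at the points of codimension one is $\det\Omega_{\mathbb{A}^N}\otimes\det(I/I^2)^{-1}$ for a local embedding $X\subset\mathbb{A}^N_{\mathcal{O}_K}$ with ideal $I$, and which is $\Omega^d_{X/\mathcal{O}_K}$ on the smooth locus. A log pair $(X,D)$ is a normal $\mathcal{O}_K$-variety $X$ with a $\mathbb{Q}$-divisor $D$ such that $r(K_X+D)$ is Cartier for some $r\ge1$; then $\mathcal{O}_X(r(K_X+D))$ is a subsheaf of $(\Omega^d_{X/\mathcal{O}_K})^{\otimes r}\otimes K(X)$. A dominant morphism $f:(Y,E)\to(X,D)$ of log pairs is crepant if pull-back of forms induces an isomorphism $f^*\mathcal{O}_X(r(K_X+D))\to\mathcal{O}_Y(r(K_Y+E))$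 whenever $r(K_X+D)$ and $r(K_Y+E)$ are both Cartier. The measure $\mu_{X,D}$ on $X(\mathcal{O}_K)$ is given on the $K$-analytic manifold of points generically in the smooth locus by $\int|\eta|^{1/r}$, where $\eta$ is a local generator of $\mathcal{O}_X(r(K_X+D))$ (the Haar measure of $K$ being normalized by $\mathcal{O}_K\mapsto1$), and is zero on the remaining points. For a subset $C\subset X_k$ let $X(\mathcal{O}_K)_C$ be the set of points sending the closed point of $\mathrm{Spec}\,\mathcal{O}_K$ into $C$, and put $$\sharp_{\mathrm{st}}(X,D)_C:=q^d\,\mu_{X,D}(X(\mathcal{O}_K)_C)\in[0,\infty],\qquad \sharp_{\mathrm{st}}(X,D):=\sharp_{\mathrm{st}}(X,D)_{X_k}.$$ **$G$-log pairs.** A $G$-log pair $(V,E)$ is a log pair with a $G$-action on $V$ over $\mathcal{O}_K$ that is faithful, in the sense that no $g\ne1$ restricts to the identity of an irreducible component of $V$, and such that $E$ is $G$-stable. Let $(V,E)$ be a $G$-log pair with $V$ affine, of dimension $d$, let $X=V/G$, and let $D$ be the unique $\mathbb{Q}$-divisor on $X$ such that $(X,D)$ is a log pair and $(V,E)\to(X,D)$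 is crepant. **Untwisting.** Fix a $G$-equivariant closed embedding of $V$ into $\mathbb{A}^n_{\mathcal{O}_K,x}=\mathrm{Spec}\,\mathcal{O}_K[x_1,\dots,x_n]$ with a faithful linear $G$-action, and let $\overline X$ be the image of $V$ in $\mathbb{A}^n_{\mathcal{O}_K,x}/G$. A $G$-étale $K$-algebra is a finite étale $K$-algebra $M$ of degree $\sharp G$ with a $G$-action such that $M^G=K$; let $G\text{-Ét}(K)$ be a set of representatives of their isomorphism classes, and for each $M$ let $H\subset G$ be the stabilizer of a connected component of $\mathrm{Spec}\,M$, with centralizer $C_G(H)$, and let $\mathcal{O}_M$ be the integral closure of $\mathcal{O}_K$ in $M$. The $\mathcal{O}_K$-module $\Xi_M$ of $G$-equivariant $\mathcal{O}_K$-linear maps $\bigoplus_i\mathcal{O}_Kx_i\to\mathcal{O}_M$ is free of rank $n$; fix a basis $\phi_1,\dots,\phi_n$ and let $u^*:\mathcal{O}_K[x]\to\mathcal{O}_M[y_1,\dots,y_n]$ be given by $x_i\mapsto\sum_j\phi_j(x_i)y_j$. Then $u^*(\mathcal{O}_K[x]^G)\subset\mathcal{O}_K[y]$, so that both $\mathbb{A}^n_{\mathcal{O}_M,y}$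 and $\mathbb{A}^n_{\mathcal{O}_K,y}$ map to $\mathbb{A}^n_{\mathcal{O}_K,x}/G$. Let $V^{\langle M\rangle}\subset\mathbb{A}^n_{\mathcal{O}_M,y}$ and $V^{|M|}\subset\mathbb{A}^n_{\mathcal{O}_K,y}$ be the preimages of $\overline X$, or more precisely the closures of the generic fibres of these preimages, with the reduced structures; let $V^{\langle M\rangle,\nu}$ and $V^{|M|,\nu}$ be their normalizations, and let $E^{\langle M\rangle,\nu}$ and $E^{|M|,\nu}$ be the unique $\mathbb{Q}$-divisors making these log pairs over $\mathcal{O}_K$ such that both natural morphisms $$(V,E)\longleftarrow(V^{\langle M\rangle,\nu},E^{\langle M\rangle,\nu})\longrightarrow(V^{|M|,\nu},E^{|M|,\nu})$$ are crepant. For a $G$-stable subset $C\subset V_k$ let $C^{|M|,\nu}\subset V^{|M|,\nu}$ be the image of the preimage of $C$ in $V^{\langle M\rangle,\nu}$, and put $$\sharp^G_{\mathrm{st}}(V,E)_C:=\sum_{M\in G\text{-Ét}(K)}\frac{\sharp_{\mathrm{st}}(V^{|M|,\nu},E^{|M|,\nu})_{C^{|M|,\nu}}}{\sharp C_G(H)},\qquad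 \sharp^G_{\mathrm{st}}(V,E):=\sharp^G_{\mathrm{st}}(V,E)_{V_k}.$$ **Theorem.** For every $G$-stable subset $C\subset V_k$ with image $\overline C\subset X_k$, $$\sharp^G_{\mathrm{st}}(V,E)_C=\sharp_{\mathrm{st}}(X,D)_{\overline C}\quad\text{in }[0,\infty],$$ for any choice of the embedding, of the representatives $M$, of the components of the $\mathrm{Spec}\,M$ and of the bases of the $\Xi_M$. In particular, $\sharp^G_{\mathrm{st}}(V,E)=\sharp_{\mathrm{st}}(X,D)$. -/

import Mathlib

universe u v w

open ValuativeRel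
open scoped ENNReal NNReal TensorProduct

namespace WildMcKay

noncomputable section

/-! ## Affine varieties and Weil divisors -/

/-- `Spec A` is a variety over `O` of relative dimension `d`: reduced, flat and of finite type,
every irreducible component has relative dimension `d`, and `Spec A → Spec O` is smooth on an
open dense subset. -/
structure IsVariety (O : Type*) (A : Type*) [CommRing O] [CommRing A] [Algebra O A] (d : ℕ) :
    Prop where
  isReduced : IsReduced A
  finiteType : Algebra.FiniteType O A
  flat : Module.Flat O A
  trdeg_eq : ∀ P ∈ minimalPrimes A, Algebra.trdeg O (A ⧸ P) = d
  dense_smoothLocus : Dense (Algebra.smoothLocus O A)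

/-- `Spec A` is normal: all local rings are integrally closed domains. -/
def IsNormal (A : Type*) [CommRing A] : Prop :=
  ∀ p : PrimeSpectrum A, IsDomain (Localization.AtPrime p.asIdeal) ∧
    IsIntegrallyClosed (Localization.AtPrime p.asIdeal)

/-- The points of codimension one of `Spec A`, i.e. (the generic points of) its prime divisors. -/
abbrev PrimeDivisor (A : Type*) [CommRing A] : Type _ :=
  {P : PrimeSpectrum A // P.asIdeal.height = 1}

/-- Weil divisors with rational coefficients on `Spec A`. -/
abbrev QDivisor (A : Type*) [CommRing A] : Type _ := PrimeDivisor A →₀ ℚ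

/-! ## Rational pluricanonical forms -/

section Forms

variable (O : Type*) (A : Type*) [CommRing O] [CommRing A] [Algebra O A] (d r : ℕ)

/-- `(Ω^d_{A/O})^{⊗ r} ⊗ K(A)`, where `K(A)` is the total ring of fractions. -/
abbrev RationalForms : Type _ :=
  ⨂[FractionRing A]^r (⋀[FractionRing A]^d Ω[FractionRing A⁄O])

variable {A d}

/-- The rational `d`-form `df₁ ∧ ⋯ ∧ df_d`. -/
def wedgeD (f : Fin d → A) : ⋀[FractionRing A]^d Ω[FractionRing A⁄O] :=
  exteriorPower.ιMulti (FractionRing A) d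
    fun i => KaehlerDifferential.D O (FractionRing A) (algebraMap A (FractionRing A) (f i))

/-- The rational `r`-fold `d`-form `(df₁ ∧ ⋯ ∧ df_d)^{⊗ r}`. -/
def wedgeDPow (f : Fin d → A) : RationalForms O A d r :=
  PiTensorProduct.tprod (FractionRing A) fun _ : Fin r => wedgeD O f

variable (A d)

/-- The `d`-th Fitting ideal of an `A`-module `N`: for generators `m` of `N` indexed by `d + c`
elements and `c` relations among them, it contains the minor of the matrix of relations that
omits the `d` columns `Sum.inl`, and it is generated by all such minors. -/
def fittingIdeal (N : Type*) [AddCommGroup N] [Module A N] : Ideal A :=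
  Ideal.span {a | ∃ (c : ℕ) (m : Fin d ⊕ Fin c → N) (R : Matrix (Fin c) (Fin d ⊕ Fin c) A),
    Submodule.span A (Set.range m) = ⊤ ∧ (∀ i, ∑ j, R i j • m j = 0) ∧
      a = (R.submatrix id Sum.inr).det}

/-- The global sections of the canonical sheaf `ω_{A/O}` of a normal variety `Spec A`, as rational
`d`-forms.  The sheaf is reflexive, hence determined at the points `P` of codimension one.  There
`Spec A` is a local complete intersection in an affine space `𝔸^N_O`, with ideal `I`, say, and
`ω = det Ω_{𝔸^N} ⊗ det(I/I²)⁻¹`.  If `I = (f₁, …, f_c)` near `P`, then `ω` has the generator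
`θ` with `dx_J = ± det (∂f_i/∂x_j)_{j ∉ J} θ` for all `J` with `d` elements.  Hence the image of
`Ω^d_{A/O}` in `ω` is `Fitt_d(Ω_{A/O}) ω`, and `ω` consists of the forms `θ` such that
`Fitt_d(Ω_{A/O}) θ` lies in the image of `Ω^d_{A/O}`.  On the smooth locus, where the Fitting ideal
is trivial, this is `Ω^d_{A/O}`. -/
def canonicalSections : Set (⋀[FractionRing A]^d Ω[FractionRing A⁄O]) :=
  {θ | ∀ P : PrimeDivisor A, ∃ s ∉ P.1.asIdeal, ∀ j ∈ fittingIdeal A d Ω[A⁄O],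
    (s * j) • θ ∈ Submodule.span A (Set.range (wedgeD O : (Fin d → A) → _))}

/-- The `A`-submodule generated by the `r`-fold tensors of sections of `ω_{A/O}`. -/
def canonicalPower : Submodule A (RationalForms O A d r) :=
  Submodule.span A {η | ∃ θ : Fin r → ⋀[FractionRing A]^d Ω[FractionRing A⁄O],
    (∀ i, θ i ∈ canonicalSections O A d) ∧ η = PiTensorProduct.tprod (FractionRing A) θ}

variable {A}

/-- The global sections of `𝒪(r(K + D))` as rational `r`-fold `d`-forms `η`: the condition at
the prime divisor `P` says that the order of `η` along `P`, with respect to a generator of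
`ω^{⊗ r}` at `P`, is at least `-n`, where `n = r D(P)` is the coefficient of `P` in `r D`. -/
def logSections (D : QDivisor A) : Set (RationalForms O A d r) :=
  {η | ∀ P : PrimeDivisor A, ∃ s ∉ P.1.asIdeal,
    ∀ t ∈ P.1.asIdeal ^ (⌊(r : ℚ) * D P⌋).toNat,
      (s * t) • η ∈ (P.1.asIdeal ^ (-⌊(r : ℚ) * D P⌋).toNat) • canonicalPower O A d r}

variable {d r}

/-- The rational form `η` is a generator of the sheaf `𝒪(r(K + D))` at the point `p`. -/
def IsLocalGenerator (D : QDivisor A) (p : PrimeSpectrum A) (η : RationalForms O A d r) : Prop :=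
  (∃ s ∉ p.asIdeal, s • η ∈ logSections O d r D) ∧
    ∀ ξ ∈ logSections O d r D, ∃ s ∉ p.asIdeal, ∃ a : A, s • ξ = a • η

variable (d) (r)

/-- `r(K + D)` is Cartier (and `r` is positive): `r D` is integral and `𝒪(r(K + D))` is
invertible. -/
structure IsCartierIndex (D : QDivisor A) : Prop where
  pos : 0 < r
  integral : ∀ P, ∃ m : ℤ, (r : ℚ) * D P = m
  invertible : ∀ p : PrimeSpectrum A, ∃ η : RationalForms O A d r, IsLocalGenerator O D p η

/-- `(Spec A, D)` is a log pair of relative dimension `d` over `O`. -/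
structure IsLogPair (D : QDivisor A) : Prop where
  isVariety : IsVariety O A d
  isNormal : IsNormal A
  qCartier : ∃ r, IsCartierIndex O d r D

end Forms

/-! ## Pull-back of forms and crepant morphisms -/

section Crepant

variable (O : Type*) [CommRing O] (d r : ℕ)

/-- Pull-back `(Ω^d_{F/O})^{⊗ r} → (Ω^d_{F'/O})^{⊗ r}` along `F → F'`. -/
def baseChangeForms (F F' : Type*) [CommRing F] [CommRing F'] [Algebra O F] [Algebra O F']
    [Algebra F F'] [IsScalarTower O F F'] :
    (⨂[F]^r (⋀[F]^d Ω[F⁄O])) →ₗ[F] ⨂[F']^r (⋀[F']^d Ω[F'⁄O]) :=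
  let wedge : (⋀[F]^d Ω[F⁄O]) →ₗ[F] ⋀[F']^d Ω[F'⁄O] :=
    exteriorPower.alternatingMapLinearEquiv
      { ((exteriorPower.ιMulti F' d (M := Ω[F'⁄O])).toMultilinearMap.restrictScalars
          F).compLinearMap fun _ => KaehlerDifferential.map O O F F' with
        map_eq_zero_of_eq' := fun v i j hij hne =>
          (exteriorPower.ιMulti F' d).map_eq_zero_of_eq
            (fun i => KaehlerDifferential.map O O F F' (v i)) (by simp [hij]) hne }
  PiTensorProduct.lift
    (((PiTensorProduct.tprod F' (s := fun _ : Fin r => ⋀[F']^d Ω[F'⁄O])).restrictScalars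
      F).compLinearMap fun _ => wedge)

variable {O} {A B : Type*} [CommRing A] [CommRing B] [Algebra O A] [Algebra O B]

/-- The extension of `φ : A → B` to total rings of fractions, if `φ` preserves
nonzerodivisors. -/
def fractionMap (φ : A →ₐ[O] B)
    (h : nonZeroDivisors A ≤ (nonZeroDivisors B).comap φ.toRingHom) :
    FractionRing A →ₐ[O] FractionRing B :=
  { IsLocalization.map (M := nonZeroDivisors A) (S := FractionRing A) (FractionRing B)
      φ.toRingHom h with
    commutes' := fun c => by
      simp only [RingHom.toMonoidHom_eq_coe, OneHom.toFun_eq_coe, MonoidHom.toOneHom_coe,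
        MonoidHom.coe_coe]
      rw [IsScalarTower.algebraMap_apply O A (FractionRing A), IsLocalization.map_eq,
        IsScalarTower.algebraMap_apply O B (FractionRing B)]
      simp }

/-- Pull-back of rational `r`-fold `d`-forms along `φ : A → B`. -/
def pullbackForms (φ : A →ₐ[O] B)
    (h : nonZeroDivisors A ≤ (nonZeroDivisors B).comap φ.toRingHom) :
    RationalForms O A d r → RationalForms O B d r :=
  letI : Algebra (FractionRing A) (FractionRing B) := (fractionMap φ h).toRingHom.toAlgebra
  haveI : IsScalarTower O (FractionRing A) (FractionRing B) :=
    IsScalarTower.of_algebraMap_eq fun c => ((fractionMap φ h).commutes c).symm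
  baseChangeForms O d r (FractionRing A) (FractionRing B)

/-- The morphism `(Spec B, E) → (Spec A, D)` given by `φ : A → B` is crepant: pull-back of rational
forms is defined, and for all `r` such that `r(K + D)` and `r(K + E)` are both Cartier it
induces an isomorphism from the pull-back of `𝒪(r(K + D))` to `𝒪(r(K + E))`, i.e. takes local
generators to local generators. -/
def IsCrepant (φ : A →ₐ[O] B) (D : QDivisor A) (E : QDivisor B) : Prop :=
  ∃ h : nonZeroDivisors A ≤ (nonZeroDivisors B).comap φ.toRingHom,
    ∀ r, IsCartierIndex O d r D → IsCartierIndex O d r E →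
      ∀ (p : PrimeSpectrum B) (η : RationalForms O A d r),
        IsLocalGenerator O D (PrimeSpectrum.comap φ.toRingHom p) η →
          IsLocalGenerator O E p (pullbackForms d r φ h η)

end Crepant

/-! ## Integral points, p-adic measures and stringy point counts -/

section Measure

variable (K : Type u) [Field K] [ValuativeRel K] [TopologicalSpace K]
  [IsNonarchimedeanLocalField K] (A : Type v) [CommRing A] [Algebra 𝒪[K] A]

/-- The set `X(𝒪_K)` of `𝒪_K`-points of `X = Spec A`. -/
def IntegralPoint : Type (max u v) := A →ₐ[𝒪[K]] 𝒪[K]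

/-- The `p`-adic topology on `X(𝒪_K)`: the coarsest one for which the evaluation of all regular
functions is continuous. -/
instance : TopologicalSpace (IntegralPoint K A) :=
  TopologicalSpace.induced (fun (x : A →ₐ[𝒪[K]] 𝒪[K]) (a : A) => x a) Pi.topologicalSpace

variable {K A}

/-- The value of a regular function at an `𝒪_K`-point. -/
def IntegralPoint.eval (x : IntegralPoint K A) : A →ₐ[𝒪[K]] 𝒪[K] := x

/-- The image in `X` of the closed point of `Spec 𝒪_K`. -/
def IntegralPoint.special (x : IntegralPoint K A) : PrimeSpectrum A :=
  PrimeSpectrum.comap x.eval.toRingHom (IsLocalRing.closedPoint 𝒪[K])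

/-- The image in `X` of the generic point of `Spec 𝒪_K`. -/
def IntegralPoint.generic (x : IntegralPoint K A) : PrimeSpectrum A :=
  PrimeSpectrum.comap x.eval.toRingHom ⊥

/-- The normalized absolute value on `𝒪_K`, for which a uniformizer has absolute value `q⁻¹`. -/
def normalizedAbs (x : 𝒪[K]) : ℝ≥0 :=
  open Classical in
  if x = 0 then 0
  else ((Nat.card 𝓀[K] : ℝ≥0)⁻¹) ^ (IsDiscreteValuationRing.addVal 𝒪[K] x).toNat

variable (K) in
/-- The Haar measure of `K^d`, normalized so that `𝒪_K^d` has measure one. -/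
def haar [MeasurableSpace K] [BorelSpace K] (d : ℕ) : MeasureTheory.Measure (Fin d → K) :=
  MeasureTheory.Measure.pi fun _ => MeasureTheory.Measure.addHaarMeasure
    { carrier := (𝒪[K] : Set K)
      isCompact' := by
        simpa [Valuation.mem_integer_iff] using!
          IsNonarchimedeanLocalField.isCompact_closedBall K 1
      interior_nonempty' := ⟨0, by
        rw [mem_interior_iff_mem_nhds]
        refine ((IsValuativeTopology.hasBasis_nhds_zero' K).mem_iff).mpr
          ⟨1, one_ne_zero, fun x hx => ?_⟩
        exact (Valuation.mem_integer_iff _ _).mpr (le_of_lt (by simpa using hx))⟩ }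

/-- The functions `f₁, …, f_d` are étale coordinates of `Spec A` at `p`: the morphism
`(f₁, …, f_d)` to the affine space is étale at `p`. -/
def IsEtaleCoordinates {d : ℕ} (f : Fin d → A) (p : PrimeSpectrum A) : Prop :=
  letI : Algebra (MvPolynomial (Fin d) 𝒪[K]) A :=
    (MvPolynomial.aeval (R := 𝒪[K]) f).toRingHom.toAlgebra
  Algebra.IsEtaleAt (MvPolynomial (Fin d) 𝒪[K]) p.asIdeal

/-- A compact open analytic chart of the `K`-analytic manifold `X(𝒪_K)°` (the `𝒪_K`-points whose
generic point lies in the smooth locus), contained in `U(𝒪_K)` for a Zariski open `U ⊆ X` on which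
`𝒪(r(K_X + D))` has the generator `form`.  The coordinates `t = (f₁, …, f_d)` identify the chart
with the compact set `source ⊆ K^d`, the inverse map is `param`, and in these coordinates
`form = (num / den) (dt₁ ∧ ⋯ ∧ dt_d)^{⊗ r}`. -/
structure Chart {d : ℕ} (r : ℕ) (D : QDivisor A) where
  coord : Fin d → A
  source : Set (Fin d → K)
  param : (Fin d → K) → IntegralPoint K A
  isCompact_source : IsCompact source
  isOpen_image : IsOpen (param '' source)
  continuousOn_param : ContinuousOn param source
  coord_param : ∀ t ∈ source, ∀ i, ((param t).eval (coord i) : K) = t i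
  etale : ∀ t ∈ source, IsEtaleCoordinates (K := K) coord (param t).generic
  form : RationalForms 𝒪[K] A d r
  isLocalGenerator : ∀ t ∈ source, IsLocalGenerator 𝒪[K] D (param t).special form
  num : A
  den : A
  den_mem : den ∈ nonZeroDivisors A
  form_eq : den • form = num • wedgeDPow 𝒪[K] r coord

/-- The part of `X(𝒪_K)` covered by the chart. -/
def Chart.image {d r : ℕ} {D : QDivisor A} (c : Chart (K := K) (d := d) r D) :
    Set (IntegralPoint K A) :=
  c.param '' c.source

variable [MeasurableSpace K] [BorelSpace K]

/-- The integral of `|form|^{1/r}` over the chart.  (The value of the integrand on the null set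
where `den` vanishes does not matter.) -/
def Chart.volume {d r : ℕ} {D : QDivisor A} (c : Chart (K := K) (d := d) r D) : ℝ≥0∞ :=
  ∫⁻ t in c.source, (((normalizedAbs ((c.param t).eval c.num) /
    normalizedAbs ((c.param t).eval c.den)) ^ (1 / r : ℝ) : ℝ≥0) : ℝ≥0∞) ∂(haar K d)

variable (K) in
/-- The measure `μ_{X,D}(S)` of an open subset `S` of `X(𝒪_K)`: the supremum of the measures of the
compact open subsets of `S ∩ X(𝒪_K)°`, i.e. of the finite disjoint unions of charts in `S`.  Here
`r` is such that `r(K_X + D)` is Cartier; the value is the same for all such `r`. -/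
def stringyMeasure (d : ℕ) (D : QDivisor A) (S : Set (IntegralPoint K A)) : ℝ≥0∞ :=
  ⨆ (r : ℕ) (_ : IsCartierIndex 𝒪[K] d r D) (m : ℕ) (c : Fin m → Chart (K := K) (d := d) r D)
    (_ : Pairwise fun i j => Disjoint (c i).image (c j).image) (_ : ∀ i, (c i).image ⊆ S),
    ∑ i, (c i).volume

variable (K) in
/-- The stringy point count `♯_st(X, D)_C = q^d μ_{X,D}(X(𝒪_K)_C)`, where `X(𝒪_K)_C` (an open set)
consists of the points whose special point lies in `C`. -/
def stringyCount (d : ℕ) (D : QDivisor A) (C : Set (PrimeSpectrum A)) : ℝ≥0∞ :=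
  (Nat.card 𝓀[K] : ℝ≥0∞) ^ d * stringyMeasure K d D {x | x.special ∈ C}

variable (K A) in
/-- The underlying set of the special fibre `X_k` of `X = Spec A`. -/
def specialFibre : Set (PrimeSpectrum A) :=
  {p | ∀ c ∈ 𝓂[K], algebraMap 𝒪[K] A c ∈ p.asIdeal}

end Measure

/-! ## Group actions and log pairs -/

section GroupAction

/-- `g` maps the point `p` of `Spec A` to the point `p'`. -/
def IsTranslate {A G : Type*} [CommRing A] [Group G] [MulSemiringAction G A] (g : G)
    (p p' : PrimeSpectrum A) : Prop :=
  ∀ a : A, a ∈ p.asIdeal ↔ g • a ∈ p'.asIdeal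

/-- The subset `C` of `Spec A` is `G`-stable. -/
def IsStableSet (G : Type*) {A : Type*} [CommRing A] [Group G] [MulSemiringAction G A]
    (C : Set (PrimeSpectrum A)) : Prop :=
  ∀ (g : G) (p p' : PrimeSpectrum A), IsTranslate g p p' → p ∈ C → p' ∈ C

/-- `(Spec A, E)` is a `G`-log pair: a log pair with a faithful `G`-action for which `E` is
`G`-stable.  If `Spec A` is reducible, then faithful means that no nontrivial element of `G`
restricts to the identity of an irreducible component. -/
structure IsGLogPair (O G : Type*) {A : Type*} [CommRing O] [CommRing A] [Algebra O A] [Group G]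
    [MulSemiringAction G A] (d : ℕ) (E : QDivisor A) : Prop where
  isLogPair : IsLogPair O d E
  faithful : ∀ g : G, g ≠ 1 → ∀ P ∈ minimalPrimes A, ∃ a : A, g • a - a ∉ P
  stable : ∀ (g : G) (P P' : PrimeDivisor A), IsTranslate g P.1 P'.1 → E P = E P'

/-- The coordinate ring `A^G` of the quotient `Spec A / G`. -/
abbrev QuotientRing (O G A : Type*) [CommRing O] [CommRing A] [Algebra O A] [Group G]
    [MulSemiringAction G A] [SMulCommClass G O A] : Subalgebra O A :=
  FixedPoints.subalgebra O A G

/-- A closed `G`-equivariant embedding of `Spec A` into the affine space `𝔸^n_O` with a faithful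
linear `G`-action: a representation of `G` on the module `⨁ O x_i = (Fin n → O)` of linear forms,
and an equivariant linear map to `A` whose image generates `A`. -/
structure EquivariantEmbedding (O G A : Type*) [CommRing O] [CommRing A] [Algebra O A] [Group G]
    [MulSemiringAction G A] (n : ℕ) where
  rep : Representation O G (Fin n → O)
  faithful : Function.Injective rep
  toLinearMap : (Fin n → O) →ₗ[O] A
  equivariant : ∀ g v, toLinearMap (rep g v) = g • toLinearMap v
  generates : Algebra.adjoin O (Set.range toLinearMap) = ⊤

namespace EquivariantEmbedding

variable {O G A : Type*} [CommRing O] [CommRing A] [Algebra O A] [Group G]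
  [MulSemiringAction G A] {n : ℕ} (i : EquivariantEmbedding O G A n)

/-- The `i`-th coordinate as a linear form. -/
abbrev basisForm (O : Type*) [CommRing O] {n : ℕ} (j : Fin n) : Fin n → O := Pi.single j 1

/-- The surjection `O[x₁, …, x_n] → A`. -/
def restrict : MvPolynomial (Fin n) O →ₐ[O] A :=
  MvPolynomial.aeval fun j => i.toLinearMap (basisForm O j)

/-- The action of `g` on `O[x₁, …, x_n]`. -/
def act (g : G) : MvPolynomial (Fin n) O →ₐ[O] MvPolynomial (Fin n) O :=
  MvPolynomial.aeval fun j => ∑ l, MvPolynomial.C (i.rep g (basisForm O j) l) * MvPolynomial.X l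

/-- The ideal in `O[x₁, …, x_n]^G` of the image of `Spec A` in `𝔸^n/G`. -/
def imageIdeal : Set (MvPolynomial (Fin n) O) :=
  {f | i.restrict f = 0 ∧ ∀ g, i.act g f = f}

lemma linearMap_eq_sum {N : Type*} [AddCommGroup N] [Module O N] (f : (Fin n → O) →ₗ[O] N)
    (v : Fin n → O) : f v = ∑ l, v l • f (basisForm O l) := by
  conv_lhs => rw [pi_eq_sum_univ' v]
  simp [map_sum, basisForm]

lemma restrict_surjective : Function.Surjective i.restrict := by
  rw [← AlgHom.range_eq_top, eq_top_iff, ← i.generates, Algebra.adjoin_le_iff]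
  rintro _ ⟨v, rfl⟩
  rw [linearMap_eq_sum]
  refine sum_mem fun l _ => Subalgebra.smul_mem _ ?_ _
  exact ⟨MvPolynomial.X l, by simp [restrict]⟩

lemma restrict_act (g : G) (f : MvPolynomial (Fin n) O) [SMulCommClass G O A] :
    i.restrict (i.act g f) = g • i.restrict f := by
  have : (i.restrict.comp (i.act g)) = (MulSemiringAction.toAlgHom O A g).comp i.restrict := by
    refine MvPolynomial.algHom_ext fun j => ?_
    simp only [AlgHom.comp_apply, act, restrict, MvPolynomial.aeval_X,
      MulSemiringAction.toAlgHom_apply, map_sum, map_mul, MvPolynomial.algHom_C]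
    rw [← i.equivariant, linearMap_eq_sum i.toLinearMap (i.rep g _)]
    simp [Algebra.smul_def]
  exact DFunLike.congr_fun this f

lemma act_act (g h : G) (f : MvPolynomial (Fin n) O) :
    i.act g (i.act h f) = i.act (g * h) f := by
  have : ((i.act g).comp (i.act h)) = i.act (g * h) := by
    refine MvPolynomial.algHom_ext fun j => ?_
    have key : ∀ k, i.rep g (i.rep h (basisForm O j)) k =
        ∑ l, i.rep h (basisForm O j) l * i.rep g (basisForm O l) k := fun k => by
      rw [linearMap_eq_sum (i.rep g)]
      simp
    simp only [AlgHom.comp_apply, act, MvPolynomial.aeval_X, map_sum, map_mul,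
      MvPolynomial.algHom_C, Module.End.mul_apply, key, Finset.sum_mul, Finset.mul_sum, MvPolynomial.algebraMap_eq]
    rw [Finset.sum_comm]
    simp [mul_assoc]
  exact DFunLike.congr_fun this f

lemma act_one (f : MvPolynomial (Fin n) O) : i.act 1 f = f := by
  have : i.act 1 = AlgHom.id O _ := by
    refine MvPolynomial.algHom_ext fun j => ?_
    simp [act, Pi.single_apply]
  exact DFunLike.congr_fun this f

/-- Every function vanishing on `Spec A` is integral over the ideal of its image in `𝔸^n/G`. -/
lemma exists_pow_mem_span [Finite G] [SMulCommClass G O A] (f : MvPolynomial (Fin n) O)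
    (hf : i.restrict f = 0) : ∃ m : ℕ, f ^ m ∈ Ideal.span i.imageIdeal := by
  have := Fintype.ofFinite G
  rcases subsingleton_or_nontrivial (MvPolynomial (Fin n) O) with _ | _
  · exact ⟨0, by rw [Subsingleton.elim (f ^ 0) 0]; exact zero_mem _⟩
  let F : Polynomial (MvPolynomial (Fin n) O) :=
    ∏ g : G, (Polynomial.X - Polynomial.C (i.act g f))
  have hmonic : F.Monic := Polynomial.monic_prod_X_sub_C _ _
  have heval : F.eval f = 0 := by
    rw [Polynomial.eval_prod]
    exact Finset.prod_eq_zero (Finset.mem_univ 1) (by simp [i.act_one])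
  have hcoeff : ∀ k < F.natDegree, F.coeff k ∈ i.imageIdeal := by
    intro k hk
    refine ⟨?_, fun g => ?_⟩
    · have hmap : F.map i.restrict.toRingHom = Polynomial.X ^ F.natDegree := by
        have : F.natDegree = Fintype.card G := by simp [F]
        rw [this]
        simp [F, Polynomial.map_prod, i.restrict_act, hf]
      have := congrArg (Polynomial.coeff · k) hmap
      simpa [Polynomial.coeff_map, Polynomial.coeff_X_pow, hk.ne] using this
    · have hmap : F.map (i.act g).toRingHom = F := by
        simp only [F, Polynomial.map_prod, Polynomial.map_sub, Polynomial.map_X, Polynomial.map_C,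
          AlgHom.toRingHom_eq_coe, RingHom.coe_coe, i.act_act]
        exact Fintype.prod_equiv (Equiv.mulLeft g) _ _ fun h => rfl
      have := congrArg (Polynomial.coeff · k) hmap
      simpa [Polynomial.coeff_map] using this
  refine ⟨F.natDegree, ?_⟩
  rw [Polynomial.eval_eq_sum_range, Finset.sum_range_succ, hmonic.coeff_natDegree, one_mul,
    add_comm, add_eq_zero_iff_eq_neg] at heval
  rw [heval]
  exact neg_mem (sum_mem fun k hk => Ideal.mul_mem_right _ _
    (Ideal.subset_span (hcoeff k (Finset.mem_range.mp hk))))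

end EquivariantEmbedding

end GroupAction

/-! ## Normalization -/

section Normalization

/-- The normalization of a reduced ring: its integral closure in the total ring of fractions. -/
def Normalization (R : Type*) [CommRing R] : Type _ := integralClosure R (FractionRing R)

instance (R : Type*) [CommRing R] : CommRing (Normalization R) :=
  inferInstanceAs (CommRing (integralClosure R (FractionRing R)))

instance (O R : Type*) [CommRing O] [CommRing R] [Algebra O R] : Algebra O (Normalization R) :=
  inferInstanceAs (Algebra O (integralClosure R (FractionRing R)))

instance (O R : Type*) [CommRing O] [CommRing R] [Algebra O R] :
    IsScalarTower O R (Normalization R) :=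
  inferInstanceAs (IsScalarTower O R (integralClosure R (FractionRing R)))

variable {O R S : Type*} [CommRing O] [CommRing R] [CommRing S] [Algebra O R] [Algebra O S]

lemma fractionMap_algebraMap (φ : R →ₐ[O] S)
    (h : nonZeroDivisors R ≤ (nonZeroDivisors S).comap φ.toRingHom) (a : R) :
    fractionMap φ h (algebraMap R (FractionRing R) a) = algebraMap S (FractionRing S) (φ a) :=
  IsLocalization.map_eq h a

lemma isIntegral_fractionMap (φ : R →ₐ[O] S)
    (h : nonZeroDivisors R ≤ (nonZeroDivisors S).comap φ.toRingHom) (x : FractionRing R)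
    (hx : IsIntegral R x) : IsIntegral S (fractionMap φ h x) := by
  generalize hψ : fractionMap φ h = ψ
  have hcomp : (algebraMap S (FractionRing S)).comp φ.toRingHom =
      ψ.toRingHom.comp (algebraMap R (FractionRing R)) := by
    ext a
    rw [← hψ]
    exact (fractionMap_algebraMap φ h a).symm
  exact hx.map_of_comp_eq φ.toRingHom ψ.toRingHom hcomp

/-- The morphism of normalizations induced by a morphism that preserves nonzerodivisors. -/
def normalizationMap (φ : R →ₐ[O] S)
    (h : nonZeroDivisors R ≤ (nonZeroDivisors S).comap φ.toRingHom) :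
    Normalization R →ₐ[O] Normalization S where
  toFun x := (⟨fractionMap φ h x.1, isIntegral_fractionMap φ h x.1 x.2⟩ :
    integralClosure S (FractionRing S))
  map_one' := Subtype.ext (map_one (fractionMap φ h))
  map_mul' x y := Subtype.ext (map_mul (fractionMap φ h) x.1 y.1)
  map_zero' := Subtype.ext (map_zero (fractionMap φ h))
  map_add' x y := Subtype.ext (map_add (fractionMap φ h) x.1 y.1)
  commutes' c := Subtype.ext ((fractionMap φ h).commutes c)

/-- The ideal in `R[y]` of the closure, with its reduced structure, of the generic fibre of the
closed subscheme with ideal `I`; here `F = R ⊗ K` is the coordinate ring of the generic fibre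
of `Spec R`. -/
def closureIdeal (R F : Type*) [CommRing R] [CommRing F] [Algebra R F] {σ : Type*}
    (I : Ideal (MvPolynomial σ R)) : Ideal (MvPolynomial σ R) :=
  (I.map (MvPolynomial.map (algebraMap R F))).radical.comap (MvPolynomial.map (algebraMap R F))

lemma subset_closureIdeal (R F : Type*) [CommRing R] [CommRing F] [Algebra R F] {σ : Type*}
    (I : Ideal (MvPolynomial σ R)) (f : MvPolynomial σ R) (m : ℕ) (hf : f ^ m ∈ I) :
    f ∈ closureIdeal R F I :=
  ⟨m, by rw [← map_pow]; exact Ideal.mem_map_of_mem _ hf⟩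

/-- Nonzerodivisors modulo an ideal stay so under flat base change. -/
lemma mem_map_of_flat {R S : Type*} [CommRing R] [CommRing S] [Algebra R S] [Module.Flat R S]
    (I : Ideal R) (b : R) (hb : ∀ r, b * r ∈ I → r ∈ I) (s : S)
    (hs : algebraMap R S b * s ∈ I.map (algebraMap R S)) : s ∈ I.map (algebraMap R S) := by
  have hinj : Function.Injective (LinearMap.mulLeft R (Ideal.Quotient.mk I b)) := by
    rw [← LinearMap.ker_eq_bot, LinearMap.ker_eq_bot']
    intro x hx
    obtain ⟨x, rfl⟩ := Ideal.Quotient.mk_surjective x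
    rw [LinearMap.mulLeft_apply, ← map_mul, Ideal.Quotient.eq_zero_iff_mem] at hx
    exact Ideal.Quotient.eq_zero_iff_mem.mpr (hb x hx)
  have hinj' := Module.Flat.lTensor_preserves_injective_linearMap (M := S) _ hinj
  have h0 : ∀ t : S, t ∈ I.map (algebraMap R S) ↔ t ⊗ₜ[R] (1 : R ⧸ I) = 0 := fun t => by
    rw [← Ideal.Quotient.eq_zero_iff_mem, ← map_eq_zero_iff _
      (Algebra.TensorProduct.quotIdealMapEquivTensorQuot S I).injective]
    rfl
  rw [h0] at hs ⊢
  apply hinj'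
  rw [map_zero, LinearMap.lTensor_tmul, LinearMap.mulLeft_apply, mul_one, ← hs]
  have : (Ideal.Quotient.mk I b) = b • (1 : R ⧸ I) := by
    rw [Algebra.smul_def, mul_one]; rfl
  rw [this, TensorProduct.tmul_smul, TensorProduct.smul_tmul', Algebra.smul_def]

end Normalization

/-! ## `G`-étale algebras -/

section Etale

/-- A `G`-étale `K`-algebra: a finite étale `K`-algebra of degree `♯G` with a `G`-action whose
invariants are `K`, so that its spectrum is an étale `G`-torsor over `Spec K`. -/
structure GEtaleAlgebra (K : Type u) (G : Type w) [Field K] [Group G] where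
  carrier : Type u
  [commRing : CommRing carrier]
  [algebra : Algebra K carrier]
  [action : MulSemiringAction G carrier]
  [smulCommClass : SMulCommClass G K carrier]
  [finite : Module.Finite K carrier]
  [etale : Algebra.Etale K carrier]
  finrank_eq : Module.finrank K carrier = Nat.card G
  exists_of_fixed : ∀ m : carrier, (∀ g : G, g • m = m) → ∃ c : K, algebraMap K carrier c = m

attribute [instance] GEtaleAlgebra.commRing GEtaleAlgebra.algebra GEtaleAlgebra.action
  GEtaleAlgebra.smulCommClass GEtaleAlgebra.finite GEtaleAlgebra.etale

variable {K : Type u} {G : Type w} [Field K] [Group G]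

/-- Two `G`-étale algebras are isomorphic. -/
def GEtaleAlgebra.Iso (M N : GEtaleAlgebra K G) : Prop :=
  ∃ e : M.carrier ≃ₐ[K] N.carrier, ∀ (g : G) (m : M.carrier), e (g • m) = g • e m

/-- `S` is a set of representatives of the isomorphism classes of `G`-étale algebras. -/
def IsSetOfRepresentatives (S : Set (GEtaleAlgebra K G)) : Prop :=
  ∀ M : GEtaleAlgebra K G, ∃! N, N ∈ S ∧ M.Iso N

open scoped Pointwise in
/-- The stabilizer `H` of a connected component (that is, of a point) of `Spec M`. -/
def GEtaleAlgebra.stabilizer (M : GEtaleAlgebra K G) (p : PrimeSpectrum M.carrier) : Subgroup G :=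
  MulAction.stabilizer G p.asIdeal

/-- The ring of integers `𝒪_M`. -/
abbrev GEtaleAlgebra.integers [ValuativeRel K] (M : GEtaleAlgebra K G) :
    Subalgebra 𝒪[K] M.carrier :=
  integralClosure 𝒪[K] M.carrier

end Etale

/-! ## Untwisting -/

section Untwisting

variable {K : Type u} [Field K] [ValuativeRel K] {G : Type w} [Group G] {A : Type v} [CommRing A]
  [Algebra 𝒪[K] A] [MulSemiringAction G A] {n : ℕ} (i : EquivariantEmbedding 𝒪[K] G A n)
  (M : GEtaleAlgebra K G)

/-- The tuning module `Ξ_M`: the `G`-equivariant linear maps from the linear forms to `𝒪_M`. -/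
def tuningModule : Submodule 𝒪[K] ((Fin n → 𝒪[K]) →ₗ[𝒪[K]] M.integers) where
  carrier := {φ | ∀ (g : G) (v : Fin n → 𝒪[K]),
    (φ (i.rep g v) : M.carrier) = g • (φ v : M.carrier)}
  add_mem' {φ ψ} hφ hψ g v := by simp [hφ g v, hψ g v]
  zero_mem' g v := by simp
  smul_mem' c φ hφ g v := by
    simp only [LinearMap.smul_apply, Subalgebra.coe_smul, hφ g v]
    exact (smul_comm g (c : K) (φ v : M.carrier)).symm

variable {i M} (φ : Module.Basis (Fin n) 𝒪[K] (tuningModule i M))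

/-- The map `u^* : 𝒪_K[x] → 𝒪_M[y]`, `x_i ↦ ∑ φ_j(x_i) y_j`. -/
def uMap : MvPolynomial (Fin n) 𝒪[K] →ₐ[𝒪[K]] MvPolynomial (Fin n) M.integers :=
  MvPolynomial.aeval fun l =>
    ∑ j, MvPolynomial.C ((φ j).1 (EquivariantEmbedding.basisForm 𝒪[K] l)) * MvPolynomial.X j

/-- The inclusion `𝒪_K[y] → 𝒪_M[y]`. -/
abbrev scalarExtension (M : GEtaleAlgebra K G) (n : ℕ) :
    MvPolynomial (Fin n) 𝒪[K] →ₐ[𝒪[K]] MvPolynomial (Fin n) M.integers :=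
  MvPolynomial.mapAlgHom (Algebra.ofId 𝒪[K] M.integers)

/-- The ideal of the preimage in `𝔸^n_{𝒪_M,y}` of the image `X̄` of `V = Spec A` in
`𝔸^n_{𝒪_K,x}/G`. -/
def twistedIdeal : Ideal (MvPolynomial (Fin n) M.integers) :=
  Ideal.span (uMap φ '' i.imageIdeal)

/-- The ideal of the preimage of `X̄` in `𝔸^n_{𝒪_K,y}`, under the morphism to `𝔸^n_{𝒪_K,x}/G` given
by `u^* : 𝒪_K[x]^G → 𝒪_K[y] ⊆ 𝒪_M[y]`. -/
def untwistedIdeal : Ideal (MvPolynomial (Fin n) 𝒪[K]) :=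
  Ideal.span {h | scalarExtension M n h ∈ uMap φ '' i.imageIdeal}

/-- The coordinate ring of `V^{⟨M⟩}`. -/
def TwistedRing : Type _ :=
  MvPolynomial (Fin n) M.integers ⧸ closureIdeal M.integers M.carrier (twistedIdeal φ)

instance : CommRing (TwistedRing φ) :=
  inferInstanceAs (CommRing (MvPolynomial (Fin n) M.integers ⧸ _))

instance : Algebra 𝒪[K] (TwistedRing φ) :=
  inferInstanceAs (Algebra 𝒪[K] (MvPolynomial (Fin n) M.integers ⧸ _))

/-- The coordinate ring of `V^{|M|}`. -/
def UntwistedRing : Type _ :=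
  MvPolynomial (Fin n) 𝒪[K] ⧸ closureIdeal 𝒪[K] K (untwistedIdeal φ)

instance : CommRing (UntwistedRing φ) :=
  inferInstanceAs (CommRing (MvPolynomial (Fin n) 𝒪[K] ⧸ _))

instance : Algebra 𝒪[K] (UntwistedRing φ) :=
  inferInstanceAs (Algebra 𝒪[K] (MvPolynomial (Fin n) 𝒪[K] ⧸ _))

lemma uMap_mem_closureIdeal [Finite G] [SMulCommClass G 𝒪[K] A] (f : MvPolynomial (Fin n) 𝒪[K])
    (hf : i.restrict f = 0) : uMap φ f ∈ closureIdeal M.integers M.carrier (twistedIdeal φ) := by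
  obtain ⟨m, hm⟩ := i.exists_pow_mem_span f hf
  refine subset_closureIdeal _ _ _ _ m ?_
  have := Ideal.mem_map_of_mem (uMap φ) hm
  rwa [map_pow, Ideal.map_span] at this

/-- The morphism `V^{⟨M⟩} → V`. -/
def twistedToSource [Finite G] [SMulCommClass G 𝒪[K] A] : A →ₐ[𝒪[K]] TwistedRing φ :=
  (Ideal.Quotient.liftₐ (RingHom.ker i.restrict)
    ((Ideal.Quotient.mkₐ 𝒪[K] (closureIdeal M.integers M.carrier (twistedIdeal φ))).comp (uMap φ))
    fun f hf => Ideal.Quotient.eq_zero_iff_mem.mpr (uMap_mem_closureIdeal φ f hf)).comp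
  (Ideal.quotientKerAlgEquivOfSurjective i.restrict_surjective).symm.toAlgHom

/-- The morphism `V^{⟨M⟩,ν} → V`. -/
def twistedNormalizationToSource [Finite G] [SMulCommClass G 𝒪[K] A] :
    A →ₐ[𝒪[K]] Normalization (TwistedRing φ) :=
  (IsScalarTower.toAlgHom 𝒪[K] (TwistedRing φ) (Normalization (TwistedRing φ))).comp
    (twistedToSource φ)

lemma map_comp_scalarExtension :
    (MvPolynomial.map (algebraMap M.integers M.carrier)).comp (scalarExtension M n).toRingHom =
      (MvPolynomial.map (algebraMap K M.carrier)).comp (MvPolynomial.map (algebraMap 𝒪[K] K)) := by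
  refine MvPolynomial.ringHom_ext (fun c => ?_) fun j => ?_
  · simp
    rfl
  · simp

lemma map_untwistedIdeal_le :
    ((untwistedIdeal φ).map (MvPolynomial.map (algebraMap 𝒪[K] K))).map
        (MvPolynomial.map (algebraMap K M.carrier)) ≤
      (twistedIdeal φ).map (MvPolynomial.map (algebraMap M.integers M.carrier)) := by
  rw [Ideal.map_map, ← map_comp_scalarExtension, ← Ideal.map_map]
  refine Ideal.map_mono ?_
  rw [untwistedIdeal, Ideal.map_span, Ideal.span_le]
  rintro _ ⟨h, hh, rfl⟩
  exact Ideal.subset_span hh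

lemma scalarExtension_mem (h : MvPolynomial (Fin n) 𝒪[K])
    (hh : h ∈ closureIdeal 𝒪[K] K (untwistedIdeal φ)) :
    scalarExtension M n h ∈ closureIdeal M.integers M.carrier (twistedIdeal φ) := by
  obtain ⟨m, hm⟩ := hh
  refine ⟨m, ?_⟩
  have := map_untwistedIdeal_le φ (Ideal.mem_map_of_mem
    (MvPolynomial.map (algebraMap K M.carrier)) hm)
  rw [map_pow] at this
  convert this using 2
  exact DFunLike.congr_fun (map_comp_scalarExtension (M := M) (n := n)) h

lemma uMap_act (g : G) (f : MvPolynomial (Fin n) 𝒪[K]) :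
    MvPolynomial.map (algebraMap M.integers M.carrier) (uMap φ (i.act g f)) =
      MvPolynomial.map (MulSemiringAction.toRingHom G M.carrier g)
        (MvPolynomial.map (algebraMap M.integers M.carrier) (uMap φ f)) := by
  have : ((MvPolynomial.map (algebraMap M.integers M.carrier)).comp (uMap φ).toRingHom).comp
      (i.act g).toRingHom = (MvPolynomial.map (MulSemiringAction.toRingHom G M.carrier g)).comp
        ((MvPolynomial.map (algebraMap M.integers M.carrier)).comp (uMap φ).toRingHom) := by
    refine MvPolynomial.ringHom_ext (fun c => ?_) fun j => ?_
    · have : g • algebraMap 𝒪[K] M.carrier c = algebraMap 𝒪[K] M.carrier c :=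
        smul_algebraMap g (c : K)
      simp only [RingHom.comp_apply, AlgHom.toRingHom_eq_coe, RingHom.coe_coe,
        MvPolynomial.algHom_C, MvPolynomial.algebraMap_eq, MvPolynomial.algebraMap_apply,
        MvPolynomial.map_C]
      exact congrArg MvPolynomial.C this.symm
    · simp only [RingHom.comp_apply, AlgHom.toRingHom_eq_coe, RingHom.coe_coe,
        EquivariantEmbedding.act, MvPolynomial.aeval_X, map_sum, map_mul, uMap,
        MvPolynomial.algHom_C, MvPolynomial.map_C, MvPolynomial.map_X, MvPolynomial.algebraMap_apply,
        Finset.mul_sum]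
      rw [Finset.sum_comm]
      refine Finset.sum_congr rfl fun k _ => ?_
      simp_rw [← mul_assoc, ← Finset.sum_mul, ← map_mul, ← map_sum]
      congr 2
      have h1 := (φ k).2 g (EquivariantEmbedding.basisForm 𝒪[K] j)
      rw [EquivariantEmbedding.linearMap_eq_sum (φ k).1] at h1
      refine Eq.trans ?_ h1
      simp [Algebra.smul_def]
  exact DFunLike.congr_fun this f

/-- The morphism `u^*` maps `𝒪_K[x]^G` to `𝒪_K[y]`. -/
lemma exists_scalarExtension_eq [Finite G] (f : MvPolynomial (Fin n) 𝒪[K]) (hf : ∀ g, i.act g f = f) :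
    ∃ h, scalarExtension M n h = uMap φ f := by
  have : uMap φ f ∈ Set.range (MvPolynomial.map (σ := Fin n) (algebraMap 𝒪[K] M.integers)) := by
    rw [MvPolynomial.mem_range_map_iff_coeffs_subset]
    intro m hm
    obtain ⟨a, -, ha⟩ := MvPolynomial.mem_coeffs_iff.mp hm
    have hfix : ∀ g : G, g • (m : M.carrier) = m := fun g => by
      have := congrArg (MvPolynomial.coeff a) (uMap_act φ g f)
      rw [hf g] at this
      simpa [MvPolynomial.coeff_map, ← ha] using! this.symm
    obtain ⟨c, hc⟩ := M.exists_of_fixed m hfix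
    have : Nontrivial M.carrier := Module.nontrivial_of_finrank_pos (R := K)
      (by rw [M.finrank_eq]; exact Nat.card_pos)
    have hint : IsIntegral 𝒪[K] c := by
      rw [← isIntegral_algebraMap_iff (algebraMap K M.carrier).injective, hc]
      exact m.2
    obtain ⟨c, rfl⟩ := IsIntegrallyClosed.isIntegral_iff.mp hint
    exact ⟨c, Subtype.ext hc⟩
  exact this

lemma twistedIdeal_le [Finite G] :
    (twistedIdeal φ).map (MvPolynomial.map (algebraMap M.integers M.carrier)) ≤
      ((untwistedIdeal φ).map (MvPolynomial.map (algebraMap 𝒪[K] K))).map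
        (MvPolynomial.map (algebraMap K M.carrier)) := by
  rw [Ideal.map_map, ← map_comp_scalarExtension, ← Ideal.map_map]
  refine Ideal.map_mono ?_
  rw [twistedIdeal, Ideal.span_le]
  rintro _ ⟨f, hf, rfl⟩
  obtain ⟨h, hh⟩ := exists_scalarExtension_eq φ f hf.2
  rw [← hh]
  exact Ideal.mem_map_of_mem _ (Ideal.subset_span ⟨f, hf, hh.symm⟩)

/-- The morphism `V^{⟨M⟩} → V^{|M|}`. -/
def untwistedToTwisted : UntwistedRing φ →ₐ[𝒪[K]] TwistedRing φ :=
  Ideal.quotientMapₐ (closureIdeal M.integers M.carrier (twistedIdeal φ)) (scalarExtension M n)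
    fun h hh => scalarExtension_mem φ h hh

attribute [local instance] MvPolynomial.algebraMvPolynomial in
lemma untwistedToTwisted_mem_nonZeroDivisors [Finite G] :
    nonZeroDivisors (UntwistedRing φ) ≤
      (nonZeroDivisors (TwistedRing φ)).comap (untwistedToTwisted φ).toRingHom := by
  intro b hb
  obtain ⟨b, rfl⟩ := Ideal.Quotient.mk_surjective b
  set I := (untwistedIdeal φ).map (MvPolynomial.map (algebraMap 𝒪[K] K)) with hI
  have hreg : ∀ r, MvPolynomial.map (algebraMap 𝒪[K] K) b * r ∈ I.radical → r ∈ I.radical := by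
    intro r hr
    obtain ⟨⟨r₀, ⟨_, c, hc, rfl⟩⟩, hrc⟩ := IsLocalization.surj
      ((nonZeroDivisors 𝒪[K]).map (MvPolynomial.C (σ := Fin n))) r
    have hunit : IsUnit (algebraMap (MvPolynomial (Fin n) 𝒪[K]) (MvPolynomial (Fin n) K)
        (MvPolynomial.C c)) := IsLocalization.map_units (MvPolynomial (Fin n) K)
          (⟨_, c, hc, rfl⟩ : (nonZeroDivisors 𝒪[K]).map (MvPolynomial.C (σ := Fin n)))
    have hr₀ : r₀ * b ∈ closureIdeal 𝒪[K] K (untwistedIdeal φ) := by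
      change MvPolynomial.map (algebraMap 𝒪[K] K) (r₀ * b) ∈ I.radical
      rw [map_mul, mul_comm]
      change _ * algebraMap (MvPolynomial (Fin n) 𝒪[K]) (MvPolynomial (Fin n) K) r₀ ∈ _
      rw [← hrc, ← mul_assoc]
      exact Ideal.mul_mem_right _ _ hr
    have hr₁ : r₀ ∈ closureIdeal 𝒪[K] K (untwistedIdeal φ) := by
      rw [← Ideal.Quotient.eq_zero_iff_mem]
      refine (mem_nonZeroDivisors_iff_right.mp hb) _ ?_
      rw [← Ideal.Quotient.eq_zero_iff_mem, map_mul] at hr₀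
      exact hr₀
    have hr₂ : algebraMap (MvPolynomial (Fin n) 𝒪[K]) (MvPolynomial (Fin n) K) r₀ ∈ I.radical :=
      hr₁
    rw [← hrc, mul_comm] at hr₂
    exact (Ideal.unit_mul_mem_iff_mem _ hunit).mp hr₂
  have hpow : ∀ k r, MvPolynomial.map (algebraMap 𝒪[K] K) b ^ k * r ∈ I.radical →
      r ∈ I.radical := by
    intro k
    induction k with
    | zero => intro r hr; simpa using hr
    | succ k ih => intro r hr; exact hreg r (ih _ (by rwa [pow_succ, mul_assoc] at hr))
  change untwistedToTwisted φ (Ideal.Quotient.mk _ b) ∈ nonZeroDivisors (TwistedRing φ)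
  rw [mem_nonZeroDivisors_iff_right]
  intro x hx
  obtain ⟨x, rfl⟩ := Ideal.Quotient.mk_surjective x
  have hx' : x * scalarExtension M n b ∈
      closureIdeal M.integers M.carrier (twistedIdeal φ) := by
    rw [← Ideal.Quotient.eq_zero_iff_mem, map_mul]
    exact hx
  obtain ⟨k, hk⟩ := hx'
  have hk' := twistedIdeal_le φ hk
  have hflat : Module.Flat (MvPolynomial (Fin n) K) (MvPolynomial (Fin n) M.carrier) :=
    Module.Flat.isBaseChange K (MvPolynomial (Fin n) K) M.carrier
      (MvPolynomial (Fin n) M.carrier) (Algebra.IsPushout.out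
        (R := K) (S := MvPolynomial (Fin n) K) (R' := M.carrier)
        (S' := MvPolynomial (Fin n) M.carrier))
  have hcomm : MvPolynomial.map (algebraMap M.integers M.carrier) (scalarExtension M n b) =
      algebraMap (MvPolynomial (Fin n) K) (MvPolynomial (Fin n) M.carrier)
        (MvPolynomial.map (algebraMap 𝒪[K] K) b) :=
    DFunLike.congr_fun (map_comp_scalarExtension (M := M) (n := n)) b
  rw [map_mul, mul_comm, mul_pow, hcomm, ← map_pow] at hk'
  have hmem := mem_map_of_flat I.radical _ (hpow k) _ (Ideal.map_mono Ideal.le_radical hk')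
  obtain ⟨l, hl⟩ := Ideal.map_radical_le _ hmem
  refine Ideal.Quotient.eq_zero_iff_mem.mpr ⟨k * l, ?_⟩
  rw [pow_mul]
  exact map_untwistedIdeal_le φ hl

/-- The morphism `V^{⟨M⟩,ν} → V^{|M|,ν}`. -/
def untwistedToTwistedNormalization [Finite G] :
    Normalization (UntwistedRing φ) →ₐ[𝒪[K]] Normalization (TwistedRing φ) :=
  normalizationMap (untwistedToTwisted φ) (untwistedToTwisted_mem_nonZeroDivisors φ)

/-- The subset `C^{|M|,ν}` of `V^{|M|,ν}`: the image of the preimage of `C` in `V^{⟨M⟩,ν}`. -/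
def untwistedSet [Finite G] [SMulCommClass G 𝒪[K] A] (C : Set (PrimeSpectrum A)) :
    Set (PrimeSpectrum (Normalization (UntwistedRing φ))) :=
  PrimeSpectrum.comap (untwistedToTwistedNormalization φ).toRingHom ''
    (PrimeSpectrum.comap (twistedNormalizationToSource φ).toRingHom ⁻¹' C)

end Untwisting

/-! ## The `G`-stringy point count -/

section GStringy

variable {K : Type u} [Field K] [ValuativeRel K] [TopologicalSpace K]
  [IsNonarchimedeanLocalField K] {G : Type w} [Group G] [Finite G] {A : Type v} [CommRing A]
  [Algebra 𝒪[K] A] [MulSemiringAction G A] [SMulCommClass G 𝒪[K] A] {n : ℕ}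
  {i : EquivariantEmbedding 𝒪[K] G A n}

/-- `E'` is the divisor `E^{|M|,ν}` on `V^{|M|,ν}`: there is a divisor `E^{⟨M⟩,ν}` on `V^{⟨M⟩,ν}` such
that both morphisms of log pairs
`(V, E) ← (V^{⟨M⟩,ν}, E^{⟨M⟩,ν}) → (V^{|M|,ν}, E^{|M|,ν})` are crepant. -/
def IsUntwistedDivisor (d : ℕ) {M : GEtaleAlgebra K G}
    (φ : Module.Basis (Fin n) 𝒪[K] (tuningModule i M)) (E : QDivisor A)
    (E' : QDivisor (Normalization (UntwistedRing φ))) : Prop :=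
  IsLogPair 𝒪[K] d E' ∧
    ∃ E'' : QDivisor (Normalization (TwistedRing φ)), IsLogPair 𝒪[K] d E'' ∧
      IsCrepant d (twistedNormalizationToSource φ) E E'' ∧
      IsCrepant d (untwistedToTwistedNormalization φ) E' E''

variable [MeasurableSpace K] [BorelSpace K]

/-- The `M`-stringy point count `♯^M_st(V, E)_C = ♯_st(V^{|M|,ν}, E^{|M|,ν})_{C^{|M|,ν}} / ♯C_G(H)`, where
`E' = E^{|M|,ν}` and `H` is the stabilizer of the component `p` of `Spec M`. -/
def mStringyCount (d : ℕ) {M : GEtaleAlgebra K G}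
    (φ : Module.Basis (Fin n) 𝒪[K] (tuningModule i M)) (p : PrimeSpectrum M.carrier)
    (E' : QDivisor (Normalization (UntwistedRing φ))) (C : Set (PrimeSpectrum A)) : ℝ≥0∞ :=
  stringyCount K d E' (untwistedSet φ C) /
    Nat.card (Subgroup.centralizer (M.stabilizer p : Set G))

/-- The `G`-stringy point count `♯^G_st(V, E)_C = ∑_M ♯^M_st(V, E)_C`, the sum over the set `R` of
representatives of the isomorphism classes of `G`-étale `K`-algebras. -/
def gStringyCount (d : ℕ) {R : Set (GEtaleAlgebra K G)}
    (φ : ∀ M : R, Module.Basis (Fin n) 𝒪[K] (tuningModule i M.1))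
    (p : ∀ M : R, PrimeSpectrum M.1.carrier)
    (E' : ∀ M : R, QDivisor (Normalization (UntwistedRing (φ M))))
    (C : Set (PrimeSpectrum A)) : ℝ≥0∞ :=
  ∑' M : R, mStringyCount d (φ M) (p M) (E' M) C

end GStringy

end

end WildMcKay

namespace WildMcKay

noncomputable section

section LocalField

variable (K : Type u) [Field K] [ValuativeRel K] [TopologicalSpace K]
  [IsNonarchimedeanLocalField K]

lemma metrizable_localField : T2Space K ∧ SecondCountableTopology K ∧
    TopologicalSpace.PseudoMetrizableSpace K := by
  let := IsTopologicalAddGroup.rightUniformSpace K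
  have := isUniformAddGroup_of_addCommGroup (G := K)
  let : (Valued.v (R := K)).RankOne :=
  { hom' := IsRankLeOne.nonempty.some.emb (R := K).comp MonoidWithZeroHom.ValueGroup₀.embedding
    strictMono' := IsRankLeOne.nonempty.some.strictMono.comp
        MonoidWithZeroHom.ValueGroup₀.embedding_strictMono }
  open scoped Valued in
  have : ProperSpace K := .of_nontriviallyNormedField_of_weaklyLocallyCompactSpace K
  exact ⟨inferInstance, inferInstance, inferInstance⟩

instance : T2Space K := (metrizable_localField K).1
instance : SecondCountableTopology K := (metrizable_localField K).2.1
instance : TopologicalSpace.PseudoMetrizableSpace K := (metrizable_localField K).2.2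

lemma isOpen_integer : IsOpen (𝒪[K] : Set K) := by
  have h0 : (𝒪[K] : Set K) ∈ nhds 0 := by
    refine ((IsValuativeTopology.hasBasis_nhds_zero' K).mem_iff).mpr ⟨1, one_ne_zero, fun x hx => ?_⟩
    exact (Valuation.mem_integer_iff _ _).mpr (le_of_lt (by simpa using hx))
  exact AddSubgroup.isOpen_of_mem_nhds (𝒪[K].toAddSubgroup) h0

/-- The additive subgroup `𝔪^m` of `K`. -/
def maxPow (m : ℕ) : AddSubgroup K :=
  (𝓂[K] ^ m : Ideal 𝒪[K]).toAddSubgroup.map (𝒪[K].subtype : 𝒪[K] →+ K)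

variable {K}

lemma coe_mem_maxPow {m : ℕ} {x : 𝒪[K]} : (x : K) ∈ maxPow K m ↔ x ∈ 𝓂[K] ^ m :=
  ⟨fun ⟨c, hc, h⟩ => Subtype.ext h ▸ hc, fun h => ⟨x, h, rfl⟩⟩

lemma mem_maximalIdeal_pow {ϖ : 𝒪[K]} (hϖ : Irreducible ϖ) {m : ℕ} {x : 𝒪[K]} :
    x ∈ 𝓂[K] ^ m ↔ ϖ ^ m ∣ x := by
  rw [hϖ.maximalIdeal_eq, Ideal.span_singleton_pow, Ideal.mem_span_singleton]

lemma integer_eq_maxPow_zero : (maxPow K 0 : Set K) = 𝒪[K] := by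
  ext x
  exact ⟨fun ⟨c, _, h⟩ => h ▸ c.2, fun h => ⟨⟨x, h⟩, by simp, rfl⟩⟩

lemma maxPow_anti {m n : ℕ} (h : m ≤ n) : maxPow K n ≤ maxPow K m := by
  rintro _ ⟨c, hc, rfl⟩
  exact ⟨c, Ideal.pow_le_pow_right h hc, rfl⟩

lemma maxPow_eq_image {ϖ : 𝒪[K]} (hϖ : Irreducible ϖ) (m : ℕ) :
    (maxPow K m : Set K) = (fun x => (ϖ : K) ^ m * x) '' (𝒪[K] : Set K) := by
  ext x
  constructor
  · rintro ⟨c, hc, rfl⟩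
    obtain ⟨b, rfl⟩ := (mem_maximalIdeal_pow hϖ).mp hc
    exact ⟨b, b.2, by simp⟩
  · rintro ⟨b, hb, rfl⟩
    exact ⟨ϖ ^ m * ⟨b, hb⟩, (mem_maximalIdeal_pow hϖ).mpr (dvd_mul_right _ _), by simp⟩

lemma coe_ne_zero_of_irreducible {ϖ : 𝒪[K]} (hϖ : Irreducible ϖ) : (ϖ : K) ≠ 0 := by
  intro h
  exact hϖ.ne_zero (Subtype.ext h)

lemma isOpen_maxPow (m : ℕ) : IsOpen (maxPow K m : Set K) := by
  obtain ⟨ϖ, hϖ⟩ := IsDiscreteValuationRing.exists_irreducible 𝒪[K]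
  rw [maxPow_eq_image hϖ]
  exact (Homeomorph.mulLeft₀ ((ϖ : K) ^ m)
    (pow_ne_zero _ (coe_ne_zero_of_irreducible hϖ))).isOpenMap _ (isOpen_integer K)

lemma exists_maxPow_subset {s : Set K} (hs : s ∈ nhds 0) : ∃ m, (maxPow K m : Set K) ⊆ s := by
  obtain ⟨γ, hγ, hs⟩ := (IsValuativeTopology.hasBasis_nhds_zero' K).mem_iff.mp hs
  obtain ⟨a, rfl⟩ := ValuativeRel.valuation_surjective γ
  have ha : a ≠ 0 := by simpa using hγ
  obtain ⟨ϖ, hϖ⟩ := IsDiscreteValuationRing.exists_irreducible 𝒪[K]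
  have hlt : valuation K (ϖ : K) < 1 := by
    refine lt_of_le_of_ne ((Valuation.mem_integer_iff _ _).mp ϖ.2) fun h => hϖ.not_isUnit ?_
    exact (Valuation.integer.integers (valuation K)).isUnit_iff_valuation_eq_one.mpr h
  rcases le_or_gt (valuation K a) 1 with h | h
  · obtain ⟨n, u, hu⟩ := IsDiscreteValuationRing.eq_unit_mul_pow_irreducible
      (x := (⟨a, (Valuation.mem_integer_iff _ _).mpr h⟩ : 𝒪[K]))
      (by intro h0; exact ha (congrArg Subtype.val h0)) hϖ
    have hva : valuation K a = valuation K (ϖ : K) ^ n := by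
      have h1 : a = (u : 𝒪[K]) * (ϖ : K) ^ n := congrArg Subtype.val hu
      have h2 : valuation K ((u : 𝒪[K]) : K) = 1 := by
        exact (Valuation.integer.integers (valuation K)).isUnit_iff_valuation_eq_one.mp u.isUnit
      rw [h1, map_mul, map_pow, h2, one_mul]
    refine ⟨n + 1, ?_⟩
    rw [maxPow_eq_image hϖ]
    rintro _ ⟨b, hb, rfl⟩
    apply hs
    simp only [Set.mem_ofPred_eq, hva, map_mul, map_pow]
    have hb' : valuation K b ≤ 1 := (Valuation.mem_integer_iff _ _).mp hb
    have h0 : valuation K (ϖ : K) ≠ 0 := by simpa using hϖ.ne_zero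
    calc _ ≤ valuation K (ϖ : K) ^ (n + 1) * 1 := by gcongr
      _ < _ := by
        rw [mul_one, pow_succ]
        have : 0 < valuation K (ϖ : K) ^ n := zero_lt_iff.mpr (pow_ne_zero _ h0)
        calc _ < valuation K (ϖ : K) ^ n * 1 := by gcongr
          _ = _ := mul_one _
  · refine ⟨0, ?_⟩
    rw [integer_eq_maxPow_zero]
    intro x hx
    exact hs (lt_of_le_of_lt ((Valuation.mem_integer_iff _ _).mp hx) h)

lemma exists_maxPow_add_subset {s : Set K} {x : K} (hs : s ∈ nhds x) :
    ∃ m, ∀ y, y - x ∈ maxPow K m → y ∈ s := by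
  have : (fun y => x + y) ⁻¹' s ∈ nhds (0 : K) :=
    (by fun_prop : Continuous fun y : K => x + y).continuousAt.preimage_mem_nhds (by simpa using hs)
  obtain ⟨m, hm⟩ := exists_maxPow_subset this
  exact ⟨m, fun y hy => by simpa using hm hy⟩

lemma isOpen_sub_mem_maxPow (m : ℕ) (x : K) : IsOpen {y | y - x ∈ maxPow K m} :=
  (isOpen_maxPow m).preimage (by fun_prop : Continuous fun y : K => y - x)

/-! ### The lattices `(𝔪^m)^d` -/

variable (K) in
/-- The lattice `(𝔪^m)^d` in `K^d`. -/
def latt (d m : ℕ) : AddSubgroup (Fin d → K) := AddSubgroup.pi Set.univ fun _ => maxPow K m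

lemma mem_latt {d m : ℕ} {t : Fin d → K} : t ∈ latt K d m ↔ ∀ i, t i ∈ maxPow K m := by
  simp [latt, AddSubgroup.mem_pi]

lemma latt_anti (d : ℕ) {m n : ℕ} (h : m ≤ n) : latt K d n ≤ latt K d m := fun t ht =>
  mem_latt.mpr fun i => maxPow_anti h (mem_latt.mp ht i)

lemma isOpen_latt (d m : ℕ) : IsOpen (latt K d m : Set (Fin d → K)) := by
  have : (latt K d m : Set (Fin d → K)) = Set.univ.pi fun _ => (maxPow K m : Set K) := by
    ext t; simp [mem_latt]
  rw [this]
  exact isOpen_set_pi Set.finite_univ fun _ _ => isOpen_maxPow m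

lemma exists_latt_subset {d : ℕ} {s : Set (Fin d → K)} {x : Fin d → K} (hs : s ∈ nhds x) :
    ∃ m, ∀ y, y - x ∈ latt K d m → y ∈ s := by
  rw [nhds_pi, Filter.mem_pi'] at hs
  obtain ⟨I, t, ht, hts⟩ := hs
  choose m hm using fun i => exists_maxPow_add_subset (ht i)
  refine ⟨Finset.univ.sup m, fun y hy => hts fun i _ => hm i _ ?_⟩
  exact maxPow_anti (Finset.le_sup (Finset.mem_univ i)) (mem_latt.mp hy i)

section Haar

variable [MeasurableSpace K] [BorelSpace K]

lemma haar_eq_pi (d : ℕ) : ∃ μ : MeasureTheory.Measure K, μ.IsAddHaarMeasure ∧ μ (𝒪[K] : Set K) = 1 ∧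
    haar K d = MeasureTheory.Measure.pi fun _ => μ :=
  ⟨_, inferInstance, MeasureTheory.Measure.addHaarMeasure_self, rfl⟩

instance (d : ℕ) : (haar K d).IsAddHaarMeasure := by
  unfold haar; infer_instance

lemma haar_coset {d m : ℕ} (t : Fin d → K) :
    haar K d {y | y - t ∈ latt K d m} = haar K d (latt K d m : Set (Fin d → K)) := by
  rw [← MeasureTheory.measure_preimage_add_right (haar K d) (-t) (latt K d m)]
  simp [sub_eq_add_neg, Set.preimage]

/-- A map that is `1`-Lipschitz with respect to the lattices does not increase the measure. -/
lemma haar_image_le {d : ℕ} {W : Type*} (s : Set W) (φ ψ : W → Fin d → K)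
    (h : ∀ x ∈ s, ∀ y ∈ s, ∀ m, φ x - φ y ∈ latt K d m → ψ x - ψ y ∈ latt K d m) :
    haar K d (ψ '' s) ≤ haar K d (φ '' s) := by
  refine le_of_forall_gt fun r hr => ?_
  obtain ⟨U, hU, hUo, hUr⟩ := (φ '' s).exists_isOpen_lt_of_lt r hr
  refine lt_of_le_of_lt ?_ hUr
  let 𝓑 : Set (Set (Fin d → K)) := {B | ∃ t m, B = {y | y - t ∈ latt K d m} ∧ B ⊆ U ∧
    ∀ n < m, ¬ {y | y - t ∈ latt K d n} ⊆ U}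
  have key : ∀ z t m, z - t ∈ latt K d m →
      {y | y - t ∈ latt K d m} = {y | y - z ∈ latt K d m} := by
    intro z t m hz
    ext y
    simp only [Set.mem_ofPred_eq]
    constructor
    · intro hy; simpa using sub_mem hy hz
    · intro hy; simpa using add_mem hy hz
  have hdisj : 𝓑.PairwiseDisjoint id := by
    rintro B ⟨t, m, rfl, hB, hm⟩ B' ⟨t', m', rfl, hB', hm'⟩ hne
    rw [Function.onFun, id, id, Set.disjoint_left]
    intro z hz hz'
    apply hne
    rw [key z t m hz, key z t' m' hz']
    rcases lt_trichotomy m m' with hlt | rfl | hlt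
    · refine absurd ?_ (hm' m hlt)
      rw [key z t' m (latt_anti d hlt.le hz'), ← key z t m hz]
      exact hB
    · rfl
    · refine absurd ?_ (hm m' hlt)
      rw [key z t m' (latt_anti d hlt.le hz), ← key z t' m' hz']
      exact hB'
  have hopen : ∀ B ∈ 𝓑, IsOpen B := by
    rintro B ⟨t, m, rfl, -, -⟩
    exact (isOpen_latt d m).preimage (by fun_prop : Continuous fun y : Fin d → K => y - t)
  have hcount : 𝓑.Countable := hdisj.countable_of_isOpen hopen (by
    rintro B ⟨t, m, rfl, -, -⟩
    exact ⟨t, by simp [zero_mem]⟩)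
  have hcover : ∀ x ∈ s, ∃ B ∈ 𝓑, φ x ∈ B := by
    classical
    intro x hx
    have hex : ∃ m, {y | y - φ x ∈ latt K d m} ⊆ U := by
      obtain ⟨m, hm⟩ := exists_latt_subset (hUo.mem_nhds (hU ⟨x, hx, rfl⟩))
      exact ⟨m, hm⟩
    exact ⟨_, ⟨φ x, Nat.find hex, rfl, Nat.find_spec hex, fun n hn => Nat.find_min hex hn⟩,
      by simp [zero_mem]⟩
  have hsub : ψ '' s ⊆ ⋃ B ∈ 𝓑, ψ '' (s ∩ φ ⁻¹' B) := by
    rintro _ ⟨x, hx, rfl⟩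
    obtain ⟨B, hB, hxB⟩ := hcover x hx
    exact Set.mem_biUnion hB ⟨x, ⟨hx, hxB⟩, rfl⟩
  have hle : ∀ B ∈ 𝓑, haar K d (ψ '' (s ∩ φ ⁻¹' B)) ≤ haar K d B := by
    rintro B ⟨t, m, rfl, -, -⟩
    rcases (s ∩ φ ⁻¹' {y | y - t ∈ latt K d m}).eq_empty_or_nonempty with he | ⟨x, hx, hxB⟩
    · rw [he]; simp
    · rw [haar_coset, ← haar_coset (ψ x)]
      apply MeasureTheory.measure_mono
      rintro _ ⟨y, ⟨hy, hyB⟩, rfl⟩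
      refine h y hy x hx m ?_
      have := (latt K d m).sub_mem (x := φ y - t) (y := φ x - t) hyB hxB
      simpa using this
  calc haar K d (ψ '' s) ≤ haar K d (⋃ B ∈ 𝓑, ψ '' (s ∩ φ ⁻¹' B)) := MeasureTheory.measure_mono hsub
    _ ≤ ∑' B : 𝓑, haar K d (ψ '' (s ∩ φ ⁻¹' B)) := MeasureTheory.measure_biUnion_le _ hcount _
    _ ≤ ∑' B : 𝓑, haar K d (B : Set _) := ENNReal.tsum_le_tsum fun B => hle B B.2
    _ = haar K d (⋃ B ∈ 𝓑, B) :=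
      (MeasureTheory.measure_biUnion hcount hdisj fun B hB => (hopen B hB).measurableSet).symm
    _ ≤ haar K d U := MeasureTheory.measure_mono (Set.iUnion₂_subset fun B hB => by
        obtain ⟨t, m, rfl, hBU, -⟩ := hB
        exact hBU)

end Haar

end LocalField

section AbsoluteValue

variable {K : Type u} [Field K] [ValuativeRel K] [TopologicalSpace K]
  [IsNonarchimedeanLocalField K]

variable (K) in
/-- The normalized absolute value of `K`: the factor by which multiplication scales the Haar
measure. -/
def absK : K →*₀ ℝ≥0 :=
  open Classical in
  { toFun := fun x => if h : x = 0 then 0 else MeasureTheory.distribHaarChar K (Units.mk0 x h)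
    map_zero' := by simp
    map_one' := by
      have : Units.mk0 (1 : K) one_ne_zero = 1 := Units.ext rfl
      simp [this]
    map_mul' := fun x y => by
      by_cases hx : x = 0
      · simp [hx]
      by_cases hy : y = 0
      · simp [hy]
      simp [hx, hy, Units.mk0_mul, ← map_mul] }

lemma absK_of_ne_zero {x : K} (h : x ≠ 0) :
    absK K x = MeasureTheory.distribHaarChar K (Units.mk0 x h) := by
  simp [absK, h]

open Pointwise in
lemma measure_image_mul [MeasurableSpace K] [BorelSpace K] (μ : MeasureTheory.Measure K)
    [μ.IsAddHaarMeasure] {x : K} (h : x ≠ 0) (s : Set K) :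
    μ ((fun y => x * y) '' s) = absK K x * μ s := by
  rw [absK_of_ne_zero h, MeasureTheory.distribHaarChar_mul μ]
  congr 1

lemma absK_unit (a : (𝒪[K])ˣ) : absK K (a : 𝒪[K]) = 1 := by
  borelize K
  obtain ⟨μ, hμ, h1, -⟩ := haar_eq_pi (K := K) 0
  have ha : ((a : 𝒪[K]) : K) ≠ 0 := by simp
  have := measure_image_mul μ ha (𝒪[K] : Set K)
  have himg : (fun y => ((a : 𝒪[K]) : K) * y) '' (𝒪[K] : Set K) = 𝒪[K] := by
    ext y
    constructor
    · rintro ⟨b, hb, rfl⟩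
      exact mul_mem (S := Subring K) a.1.2 hb
    · intro hy
      refine ⟨((a⁻¹ : (𝒪[K])ˣ) : 𝒪[K]) * y, mul_mem (S := Subring K) (a⁻¹).1.2 hy, ?_⟩
      have : ((a : 𝒪[K]) : K) * (((a⁻¹ : (𝒪[K])ˣ) : 𝒪[K]) : K) = 1 := by
        rw [← Subring.coe_mul, Units.mul_inv]; rfl
      change ((a : 𝒪[K]) : K) * ((((a⁻¹ : (𝒪[K])ˣ) : 𝒪[K]) : K) * y) = y
      rw [← mul_assoc, this, one_mul]
  rw [himg, h1, mul_one] at this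
  exact_mod_cast this.symm

lemma absK_irreducible {ϖ : 𝒪[K]} (hϖ : Irreducible ϖ) :
    absK K ϖ = (Nat.card 𝓀[K] : ℝ≥0)⁻¹ := by
  borelize K
  obtain ⟨μ, hμ, h1, -⟩ := haar_eq_pi (K := K) 0
  have h0 := coe_ne_zero_of_irreducible hϖ
  have hscale := measure_image_mul μ h0 (𝒪[K] : Set K)
  rw [h1, mul_one] at hscale
  have himg : (fun y => (ϖ : K) * y) '' (𝒪[K] : Set K) = maxPow K 1 := by
    rw [maxPow_eq_image hϖ]; simp
  rw [himg] at hscale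
  have := Fintype.ofFinite 𝓀[K]
  let rep : 𝓀[K] → 𝒪[K] := fun a => (IsLocalRing.residue_surjective a).choose
  have hrep : ∀ a, IsLocalRing.residue 𝒪[K] (rep a) = a := fun a =>
    (IsLocalRing.residue_surjective a).choose_spec
  have hunion : (𝒪[K] : Set K) = ⋃ a : 𝓀[K], {y : K | y - (rep a : K) ∈ maxPow K 1} := by
    ext y
    simp only [Set.mem_iUnion, Set.mem_ofPred_eq, SetLike.mem_coe]
    constructor
    · intro hy
      refine ⟨IsLocalRing.residue 𝒪[K] ⟨y, hy⟩, ?_⟩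
      have : (⟨y, hy⟩ : 𝒪[K]) - rep (IsLocalRing.residue 𝒪[K] ⟨y, hy⟩) ∈ 𝓂[K] ^ 1 := by
        rw [pow_one, ← IsLocalRing.residue_eq_zero_iff, map_sub, hrep, sub_self]
      exact coe_mem_maxPow.mpr this
    · rintro ⟨a, c, -, hc⟩
      have : y = (c : K) + rep a := by
        have hc' : (c : K) = y - rep a := hc
        rw [hc']; ring
      rw [this]
      exact (c + rep a).2
  have hdisj : Pairwise fun a b : 𝓀[K] =>
      Disjoint {y : K | y - rep a ∈ maxPow K 1} {y : K | y - rep b ∈ maxPow K 1} := by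
    intro a b hab
    rw [Set.disjoint_left]
    intro y hy hy'
    apply hab
    have : ((rep a - rep b : 𝒪[K]) : K) ∈ maxPow K 1 := by
      have := (maxPow K 1).sub_mem hy' hy
      simpa using this
    rw [coe_mem_maxPow, pow_one, ← IsLocalRing.residue_eq_zero_iff, map_sub, hrep, hrep,
      sub_eq_zero] at this
    exact this
  have hsum := MeasureTheory.measure_iUnion (μ := μ) hdisj
    (fun a => (isOpen_sub_mem_maxPow 1 (rep a : K)).measurableSet)
  have htrans : ∀ a : 𝓀[K], μ {y : K | y - rep a ∈ maxPow K 1} = μ (maxPow K 1) := by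
    intro a
    rw [← MeasureTheory.measure_preimage_add_right μ (-(rep a : K)) (maxPow K 1)]
    simp [sub_eq_add_neg, Set.preimage]
  rw [← hunion, h1] at hsum
  simp only [htrans, hscale, tsum_fintype, Finset.sum_const, Finset.card_univ, nsmul_eq_mul] at hsum
  rw [Nat.card_eq_fintype_card]
  have h2 : (1 : ℝ≥0) = (Fintype.card 𝓀[K] : ℝ≥0) * absK K ϖ := by exact_mod_cast hsum
  exact eq_inv_of_mul_eq_one_right h2.symm

lemma absK_coe (c : 𝒪[K]) : absK K c = normalizedAbs c := by
  classical
  unfold normalizedAbs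
  split_ifs with h
  · simp [h]
  obtain ⟨ϖ, hϖ⟩ := IsDiscreteValuationRing.exists_irreducible 𝒪[K]
  obtain ⟨n, a, ha⟩ := IsDiscreteValuationRing.eq_unit_mul_pow_irreducible h hϖ
  have hv : IsDiscreteValuationRing.addVal 𝒪[K] c = n := by
    rw [ha]
    exact IsDiscreteValuationRing.addVal_def' a hϖ n
  rw [hv, ha]
  simp only [Subring.coe_mul, Subring.coe_pow, map_mul, map_pow, absK_unit, one_mul,
    absK_irreducible hϖ]
  rfl

lemma absK_ne_zero {x : K} : absK K x ≠ 0 ↔ x ≠ 0 := by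
  simp

lemma absK_eq_of_dvd_of_dvd {a b : 𝒪[K]} (h : a ∣ b) (h' : b ∣ a) : absK K a = absK K b := by
  obtain ⟨c, rfl⟩ := associated_of_dvd_dvd h h'
  simp [absK_unit]

/-! ### Linear change of variables -/

variable [MeasurableSpace K] [BorelSpace K] {d : ℕ}

lemma map_diagonal_haar {D : Fin d → K} (h : (Matrix.diagonal D).det ≠ 0) :
    MeasureTheory.Measure.map (Matrix.toLin' (Matrix.diagonal D)) (haar K d) =
      ((absK K (Matrix.diagonal D).det)⁻¹ : ℝ≥0) • haar K d := by
  obtain ⟨μ, hμ, -, hpi⟩ := haar_eq_pi (K := K) d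
  have hD : ∀ i, D i ≠ 0 := by
    rw [Matrix.det_diagonal] at h
    exact fun i => Finset.prod_ne_zero_iff.mp h i (Finset.mem_univ i)
  have hpre : ∀ i (s : Set K), μ ((D i * ·) ⁻¹' s) = ((absK K (D i))⁻¹ : ℝ≥0) * μ s := by
    intro i s
    have : ((D i * ·) ⁻¹' s) = (fun y => (D i)⁻¹ * y) '' s := by
      ext y
      constructor
      · intro hy
        exact ⟨D i * y, hy, by simp [hD i]⟩
      · rintro ⟨z, hz, rfl⟩
        simpa [hD i] using hz
    rw [this, measure_image_mul μ (inv_ne_zero (hD i)), map_inv₀]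
  have hdet : (absK K (Matrix.diagonal D).det) ≠ 0 := absK_ne_zero.mpr h
  suffices H : haar K d = (absK K (Matrix.diagonal D).det : ℝ≥0) •
      MeasureTheory.Measure.map (Matrix.toLin' (Matrix.diagonal D)) (haar K d) by
    conv_rhs => rw [H]
    rw [smul_smul, inv_mul_cancel₀ hdet, one_smul]
  rw [hpi]
  refine (MeasureTheory.Measure.pi_eq fun s hs => ?_)
  rw [MeasureTheory.Measure.smul_apply, MeasureTheory.Measure.map_apply _
    (MeasurableSet.univ_pi hs)]
  swap
  · exact (LinearMap.continuous_on_pi _).measurable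
  have : (Matrix.toLin' (Matrix.diagonal D) ⁻¹' Set.pi Set.univ fun i => s i) =
      Set.pi Set.univ fun i => (D i * ·) ⁻¹' s i := by
    ext f
    simp [Matrix.toLin'_apply, Matrix.mulVec_diagonal]
  rw [this, MeasureTheory.Measure.pi_pi]
  simp_rw [hpre]
  rw [Finset.prod_mul_distrib, Matrix.det_diagonal, map_prod, ENNReal.smul_def, smul_eq_mul,
    ← mul_assoc]
  rw [← ENNReal.ofNNReal_finsetProd, ← ENNReal.coe_mul, ← Finset.prod_mul_distrib,
    Finset.prod_eq_one, ENNReal.coe_one, one_mul]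
  intro i _
  exact mul_inv_cancel₀ (absK_ne_zero.mpr (hD i))

open MeasureTheory in
lemma measurePreserving_transvection (t : Matrix.TransvectionStruct (Fin d) K) :
    MeasurePreserving (Matrix.toLin' t.toMatrix) (haar K d) (haar K d) := by
  obtain ⟨μ, hμ, -, hpi⟩ := haar_eq_pi (K := K) d
  rw [hpi]
  have ht : Measurable (Matrix.toLin' t.toMatrix) :=
    (LinearMap.continuous_on_pi _).measurable
  refine ⟨ht, ?_⟩
  refine (Measure.pi_eq fun s hs ↦ ?_).symm
  have h2s : MeasurableSet (Set.univ.pi s) := .pi Set.countable_univ fun i _ ↦ hs i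
  rw [← Measure.pi_pi (fun _ => μ) s]
  simp_rw [← lintegral_indicator_one h2s]
  rw [lintegral_map (measurable_one.indicator h2s) ht]
  refine lintegral_eq_of_lmarginal_eq {t.i} ((measurable_one.indicator h2s).comp ht)
    (measurable_one.indicator h2s) ?_
  simp_rw [lmarginal_singleton]
  ext x
  cases t with | mk t_i t_j t_hij t_c =>
  simp [Matrix.transvection, Matrix.single_mulVec, t_hij.symm, ← Function.update_add,
    lintegral_add_right_eq_self fun xᵢ ↦ Set.indicator (Set.univ.pi s) 1 (Function.update x t_i xᵢ)]

lemma map_matrix_haar {M : Matrix (Fin d) (Fin d) K} (hM : M.det ≠ 0) :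
    MeasureTheory.Measure.map (Matrix.toLin' M) (haar K d) =
      ((absK K M.det)⁻¹ : ℝ≥0) • haar K d := by
  apply Matrix.diagonal_transvection_induction_of_det_ne_zero _ M hM
  · exact fun D hD => map_diagonal_haar hD
  · intro t
    simp [(measurePreserving_transvection t).map_eq]
  · intro A B _ _ IHA IHB
    rw [Matrix.toLin'_mul, Matrix.det_mul, LinearMap.coe_comp, ← MeasureTheory.Measure.map_map, IHB,
      MeasureTheory.Measure.map_smul, IHA, smul_smul, map_mul, mul_inv, mul_comm]
    · exact (LinearMap.continuous_on_pi _).measurable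
    · exact (LinearMap.continuous_on_pi _).measurable

lemma haar_image_mulVec {M : Matrix (Fin d) (Fin d) K} (hM : M.det ≠ 0) (s : Set (Fin d → K)) :
    haar K d (M.mulVec '' s) = absK K M.det * haar K d s := by
  have hu : IsUnit M.det := isUnit_iff_ne_zero.mpr hM
  have hM' : (M⁻¹).det ≠ 0 := by
    rw [Matrix.det_nonsing_inv]
    simpa using hM
  let e : (Fin d → K) ≃ₜ (Fin d → K) :=
    { toFun := Matrix.toLin' M⁻¹
      invFun := Matrix.toLin' M
      left_inv := fun x => by simp [Matrix.mul_nonsing_inv _ hu]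
      right_inv := fun x => by simp [Matrix.nonsing_inv_mul _ hu]
      continuous_toFun := LinearMap.continuous_on_pi _
      continuous_invFun := LinearMap.continuous_on_pi _ }
  have h := map_matrix_haar hM'
  have h2 := congrArg (fun μ => μ s) h
  have h3 : MeasureTheory.Measure.map (Matrix.toLin' M⁻¹) (haar K d) s =
      haar K d (Matrix.toLin' M⁻¹ ⁻¹' s) := e.toMeasurableEquiv.map_apply s
  have h4 : Matrix.toLin' M⁻¹ ⁻¹' s = M.mulVec '' s := (e.symm.image_eq_preimage_symm s).symm
  rw [← h4, ← h3, h]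
  rw [MeasureTheory.Measure.smul_apply, ENNReal.smul_def, smul_eq_mul, Matrix.det_nonsing_inv,
    Ring.inverse_eq_inv', map_inv₀, inv_inv]

end AbsoluteValue

section Area

variable {K : Type u} [Field K] [ValuativeRel K] [TopologicalSpace K]
  [IsNonarchimedeanLocalField K]

lemma exists_dvd_of_notMem {a : 𝒪[K]} {k : ℕ} (h : a ∉ 𝓂[K] ^ k) (m : ℕ) {z : 𝒪[K]}
    (hz : z ∈ 𝓂[K] ^ (m + k)) : ∃ y ∈ 𝓂[K] ^ (m + 1), z = a * y := by
  obtain ⟨ϖ, hϖ⟩ := IsDiscreteValuationRing.exists_irreducible 𝒪[K]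
  have ha : a ≠ 0 := by rintro rfl; exact h (zero_mem _)
  obtain ⟨n, u, rfl⟩ := IsDiscreteValuationRing.eq_unit_mul_pow_irreducible ha hϖ
  have hn : n < k := by
    by_contra hk
    push Not at hk
    exact h ((mem_maximalIdeal_pow hϖ).mpr ((pow_dvd_pow _ hk).mul_left _))
  obtain ⟨y, rfl⟩ := (mem_maximalIdeal_pow hϖ).mp hz
  refine ⟨(↑u⁻¹ : 𝒪[K]) * (ϖ ^ (m + k - n) * y), ?_, ?_⟩
  · exact (mem_maximalIdeal_pow hϖ).mpr
      (((pow_dvd_pow _ (by omega)).mul_right _).mul_left _)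
  · have : ϖ ^ (m + k) = ϖ ^ n * ϖ ^ (m + k - n) := by rw [← pow_add]; congr 1; omega
    rw [this]
    have hu : (u : 𝒪[K]) * (↑u⁻¹ : 𝒪[K]) = 1 := u.mul_inv
    linear_combination (-(ϖ ^ n * ϖ ^ (m + k - n) * y)) * hu

lemma exists_notMem_maximalIdeal_pow {a : 𝒪[K]} (h : a ≠ 0) : ∃ k, a ∉ 𝓂[K] ^ k := by
  obtain ⟨ϖ, hϖ⟩ := IsDiscreteValuationRing.exists_irreducible 𝒪[K]
  obtain ⟨n, u, rfl⟩ := IsDiscreteValuationRing.eq_unit_mul_pow_irreducible h hϖ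
  refine ⟨n + 1, fun hm => ?_⟩
  rw [mem_maximalIdeal_pow hϖ, pow_succ, mul_comm (u : 𝒪[K])] at hm
  have := (mul_dvd_mul_iff_left (pow_ne_zero n hϖ.ne_zero)).mp hm
  exact hϖ.not_isUnit (isUnit_of_dvd_unit this u.isUnit)

variable [MeasurableSpace K] [BorelSpace K] {d : ℕ}

/-- The vector in `K^d` with the given integral coordinates. -/
def coeVec (t : Fin d → 𝒪[K]) : Fin d → K := fun i => t i

omit [TopologicalSpace K] [IsNonarchimedeanLocalField K] [MeasurableSpace K] [BorelSpace K] in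
lemma coeVec_sub (t t' : Fin d → 𝒪[K]) : coeVec t - coeVec t' = coeVec (t - t') := by
  ext i; simp [coeVec]

lemma coeVec_mem_latt {t : Fin d → 𝒪[K]} {m : ℕ} :
    coeVec t ∈ latt K d m ↔ ∀ i, t i ∈ 𝓂[K] ^ m := by
  simp [mem_latt, coeVec, coe_mem_maxPow]

lemma haar_image_smul {W : Type*} (s : Set W) (f : W → Fin d → 𝒪[K]) {b : 𝒪[K]} (hb : b ≠ 0) :
    haar K d ((fun x => coeVec (b • f x)) '' s) =
      absK K b ^ d * haar K d ((fun x => coeVec (f x)) '' s) := by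
  have hdet : (Matrix.diagonal fun _ : Fin d => (b : K)).det ≠ 0 := by
    rw [Matrix.det_diagonal]
    exact Finset.prod_ne_zero_iff.mpr fun i _ h => hb (Subtype.ext h)
  have := haar_image_mulVec hdet ((fun x => coeVec (f x)) '' s)
  rw [Matrix.det_diagonal, Finset.prod_const, Finset.card_univ, Fintype.card_fin, map_pow,
    ENNReal.coe_pow] at this
  rw [← this, Set.image_image]
  congr 2
  ext x i
  simp [coeVec, Matrix.mulVec_diagonal]

/-- The change of variables formula: if `b f` and `C f'` have the same increments up to terms of
higher order, then the measures of the images under `f` and `f'` differ by `|det C / b^d|`. -/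
lemma haar_image_area {W : Type*} (s : Set W) (f f' : W → Fin d → 𝒪[K])
    (C : Matrix (Fin d) (Fin d) 𝒪[K]) {b : 𝒪[K]} (hb : b ≠ 0) (k : ℕ) (hC : C.det ∉ 𝓂[K] ^ k)
    (h : ∀ x ∈ s, ∀ y ∈ s, ∀ m, (∀ i, f' x i - f' y i ∈ 𝓂[K] ^ m) →
      ∀ i, b * (f x i - f y i) - C.mulVec (f' x - f' y) i ∈ 𝓂[K] ^ (m + k)) :
    absK K b ^ d * haar K d ((fun x => coeVec (f x)) '' s) =
      absK K C.det * haar K d ((fun x => coeVec (f' x)) '' s) := by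
  have hC0 : C.det ≠ 0 := by
    intro h0; rw [h0] at hC; exact hC (zero_mem _)
  set M : Matrix (Fin d) (Fin d) K := C.map (algebraMap 𝒪[K] K) with hM
  have hMC : M.det = (C.det : K) := by
    have := (algebraMap 𝒪[K] K).map_det C
    exact this.symm
  have hMdet : M.det ≠ 0 := by
    rw [hMC]; exact fun h0 => hC0 (Subtype.ext h0)
  have hMu : IsUnit M.det := isUnit_iff_ne_zero.mpr hMdet
  have hMv : ∀ v : Fin d → 𝒪[K], M.mulVec (coeVec v) = coeVec (C.mulVec v) := by
    intro v
    ext i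
    simp [Matrix.mulVec, dotProduct, coeVec, hM]
    rfl
  let g : W → Fin d → K := fun x => M⁻¹.mulVec (coeVec (b • f x))
  have hg : ∀ x ∈ s, ∀ y ∈ s, ∀ m, coeVec (f' x) - coeVec (f' y) ∈ latt K d m →
      g x - g y - (coeVec (f' x) - coeVec (f' y)) ∈ latt K d (m + 1) := by
    intro x hx y hy m hm
    rw [coeVec_sub, coeVec_mem_latt] at hm
    have h1 := h x hx y hy m hm
    choose w hw hw' using fun i => exists_dvd_of_notMem hC m (h1 i)
    have h2 : g x - g y - (coeVec (f' x) - coeVec (f' y)) = coeVec (C.adjugate.mulVec w) := by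
      have h3 : M.mulVec (g x - g y - (coeVec (f' x) - coeVec (f' y))) =
          M.mulVec (coeVec (C.adjugate.mulVec w)) := by
        rw [hMv, Matrix.mulVec_mulVec, Matrix.mul_adjugate, Matrix.mulVec_sub, Matrix.mulVec_sub,
          Matrix.mulVec_mulVec, Matrix.mulVec_mulVec, Matrix.mul_nonsing_inv _ hMu,
          Matrix.one_mulVec, Matrix.one_mulVec, coeVec_sub, coeVec_sub, hMv, coeVec_sub]
        congr 1
        ext i
        simp only [Pi.sub_apply, Pi.smul_apply, smul_eq_mul, Matrix.smul_mulVec,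
          Matrix.one_mulVec, ← hw']
        ring
      have h4 := congrArg (M⁻¹.mulVec) h3
      simpa [Matrix.mulVec_mulVec, Matrix.nonsing_inv_mul _ hMu] using h4
    rw [h2, coeVec_mem_latt]
    intro i
    rw [Matrix.mulVec, dotProduct]
    exact Ideal.sum_mem (I := 𝓂[K] ^ (m + 1)) fun j _ => Ideal.mul_mem_left _ _ (hw j)
  have hgeq : haar K d (g '' s) = haar K d ((fun x => coeVec (f' x)) '' s) := by
    apply le_antisymm
    · refine haar_image_le s _ _ fun x hx y hy m hm => ?_
      have := add_mem (latt_anti d m.le_succ (hg x hx y hy m hm)) hm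
      simpa using this
    · refine haar_image_le s _ _ fun x hx y hy m hm => ?_
      have : ∀ j ≤ m, coeVec (f' x) - coeVec (f' y) ∈ latt K d j := by
        intro j
        induction j with
        | zero =>
          intro _
          rw [coeVec_sub, coeVec_mem_latt]
          simp
        | succ j ih =>
          intro hj
          have h5 := (latt K d (j + 1)).sub_mem (latt_anti d hj hm) (hg x hx y hy j (ih (by omega)))
          simpa using h5
      exact this m le_rfl
  rw [← haar_image_smul s f hb, ← hgeq, ← hMC, ← haar_image_mulVec hMdet, Set.image_image]
  congr 2
  ext x i
  simp [g, Matrix.mulVec_mulVec, Matrix.mul_nonsing_inv _ hMu]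

end Area

/-! ### Increments of regular functions -/

section Increments

variable {O A : Type*} [CommRing O] [CommRing A] [Algebra O A]

/-- The ideal generated by the differences of the values of functions at two points. -/
def diffIdeal (x y : A →ₐ[O] O) : Ideal O := Ideal.span (Set.range fun a => x a - y a)

lemma sub_mem_diffIdeal (x y : A →ₐ[O] O) (a : A) : x a - y a ∈ diffIdeal x y :=
  Ideal.subset_span ⟨a, rfl⟩

/-- A relation between differentials is a relation between increments up to second order. -/
lemma increment_mem {ι : Type*} [Fintype ι] {s b : A} {c f : ι → A}
    (h : s • KaehlerDifferential.D O A b = ∑ i, c i • KaehlerDifferential.D O A (f i))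
    (x y : A →ₐ[O] O) :
    x s * (x b - y b) - ∑ i, x (c i) * (x (f i) - y (f i)) ∈ diffIdeal x y ^ 2 := by
  let J := diffIdeal x y ^ 2
  let : Module A (O ⧸ J) := Module.compHom (O ⧸ J) x.toRingHom
  have hsmul : ∀ (a : A) (z : O), a • (Ideal.Quotient.mk J z) = Ideal.Quotient.mk J (x a * z) :=
    fun _ _ => rfl
  have : IsScalarTower O A (O ⧸ J) := by
    refine ⟨fun o a z => ?_⟩
    obtain ⟨z, rfl⟩ := Ideal.Quotient.mk_surjective z
    rw [hsmul, hsmul, map_smul, smul_eq_mul, mul_assoc]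
    rfl
  let D : Derivation O A (O ⧸ J) := Derivation.mk'
    { toFun := fun a => Ideal.Quotient.mk J (x a - y a)
      map_add' := fun a b => by rw [← map_add]; congr 1; simp only [map_add]; ring
      map_smul' := fun o a => by
        have : x (o • a) - y (o • a) = o • (x a - y a) := by rw [map_smul, map_smul, smul_sub]
        rw [this]
        rfl }
    fun a b => by
      simp only [LinearMap.coe_mk, AddHom.coe_mk, hsmul, ← map_add]
      rw [Ideal.Quotient.eq]
      have : x (a * b) - y (a * b) - (x a * (x b - y b) + x b * (x a - y a)) =
          -((x a - y a) * (x b - y b)) := by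
        simp only [map_mul]; ring
      rw [this]
      refine neg_mem ?_
      change _ ∈ diffIdeal x y ^ 2
      rw [pow_two]
      exact Ideal.mul_mem_mul (sub_mem_diffIdeal x y a) (sub_mem_diffIdeal x y b)
  have h1 := congrArg D.liftKaehlerDifferential h
  simp only [map_smul, map_sum, Derivation.liftKaehlerDifferential_comp_D] at h1
  have h2 : ∀ a, D a = Ideal.Quotient.mk J (x a - y a) := fun _ => rfl
  simp only [h2, hsmul, ← map_sum] at h1
  exact Ideal.Quotient.eq.mp h1

variable {K : Type u} [Field K] [ValuativeRel K] [TopologicalSpace K]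
  [IsNonarchimedeanLocalField K] {A : Type v} [CommRing A] [Algebra 𝒪[K] A] {d : ℕ}

/-- The points `x` and `y` agree modulo `𝔪^k`. -/
def CongrMod (k : ℕ) (x y : A →ₐ[𝒪[K]] 𝒪[K]) : Prop := ∀ a, x a - y a ∈ 𝓂[K] ^ k

variable {s : A} {f : Fin d → A} {x₀ x y : A →ₐ[𝒪[K]] 𝒪[K]} {e j : ℕ}

/-- Near a point where `f` is unramified, all increments are controlled by those of `f`. -/
lemma mul_diffIdeal_le
    (hs : ∀ a, s • KaehlerDifferential.D 𝒪[K] A a ∈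
      Submodule.span A (Set.range fun i => KaehlerDifferential.D 𝒪[K] A (f i)))
    (he : x₀ s ∉ 𝓂[K] ^ e) (hx : CongrMod (e + j) x x₀) (hy : CongrMod (e + j) y x₀) :
    Ideal.span {x s} * diffIdeal x y ≤ Ideal.span (Set.range fun i => x (f i) - y (f i)) ∧
    𝓂[K] ^ (e + j) * diffIdeal x y ≤
      𝓂[K] ^ (j + 1) * Ideal.span (Set.range fun i => x (f i) - y (f i)) := by
  set 𝔞 := diffIdeal x y
  set 𝔱 := Ideal.span (Set.range fun i => x (f i) - y (f i))
  have hxs : x s ∉ 𝓂[K] ^ e := by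
    intro h
    apply he
    have : x₀ s = x s - (x s - x₀ s) := by ring
    rw [this]
    exact sub_mem h (Ideal.pow_le_pow_right (by omega) (hx s))
  have h𝔞 : 𝔞 ≤ 𝓂[K] ^ (e + j) := by
    refine Ideal.span_le.mpr ?_
    rintro _ ⟨a, rfl⟩
    have : x a - y a = (x a - x₀ a) - (y a - x₀ a) := by ring
    change x a - y a ∈ 𝓂[K] ^ (e + j)
    rw [this]
    exact sub_mem (hx a) (hy a)
  have hpow : 𝓂[K] ^ (e + j) ≤ 𝓂[K] ^ (j + 1) * Ideal.span {x s} := by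
    intro z hz
    rw [add_comm] at hz
    obtain ⟨w, hw, rfl⟩ := exists_dvd_of_notMem hxs j hz
    rw [mul_comm (x s)]
    exact Ideal.mul_mem_mul hw (Ideal.mem_span_singleton_self _)
  have h1 : Ideal.span {x s} * 𝔞 ≤ 𝔱 ⊔ 𝓂[K] • (Ideal.span {x s} * 𝔞) := by
    rw [Ideal.span_singleton_mul_le_iff]
    suffices H : 𝔞 ≤ Submodule.comap (LinearMap.mulLeft 𝒪[K] (x s))
        (𝔱 ⊔ 𝓂[K] • (Ideal.span {x s} * 𝔞)) from fun z hz => H hz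
    refine Submodule.span_le.mpr ?_
    rintro _ ⟨a, rfl⟩
    obtain ⟨c, hc⟩ := (Submodule.mem_span_range_iff_exists_fun A).mp (hs a)
    have h2 := increment_mem hc.symm x y
    have h3 : ∑ i, x (c i) * (x (f i) - y (f i)) ∈ 𝔱 :=
      sum_mem fun i _ => Ideal.mul_mem_left _ _ (Ideal.subset_span ⟨i, rfl⟩)
    have h4 : diffIdeal x y ^ 2 ≤ 𝓂[K] • (Ideal.span {x s} * 𝔞) := by
      rw [pow_two, smul_eq_mul, ← mul_assoc]
      refine Ideal.mul_mono_left (h𝔞.trans (hpow.trans (Ideal.mul_mono_left ?_)))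
      exact Ideal.pow_le_self (by omega)
    have : x s * (x a - y a) = ∑ i, x (c i) * (x (f i) - y (f i)) +
      (x s * (x a - y a) - ∑ i, x (c i) * (x (f i) - y (f i))) := by ring
    change x s * (x a - y a) ∈ 𝔱 ⊔ 𝓂[K] • (Ideal.span {x s} * 𝔞)
    rw [this]
    exact Submodule.add_mem_sup h3 (h4 h2)
  have h6 : Ideal.span {x s} * 𝔞 ≤ 𝔱 := by
    refine Submodule.le_of_le_smul_of_le_jacobson_bot (I := 𝓂[K]) (IsNoetherian.noetherian _) ?_ h1
    exact IsLocalRing.maximalIdeal_le_jacobson _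
  refine ⟨h6, ?_⟩
  calc 𝓂[K] ^ (e + j) * 𝔞 ≤ 𝓂[K] ^ (j + 1) * Ideal.span {x s} * 𝔞 := Ideal.mul_mono_left hpow
    _ ≤ _ := by rw [mul_assoc]; exact Ideal.mul_mono_right h6

/-- Regular functions are strictly differentiable functions of unramified coordinates. -/
lemma increment_sub_mem
    (hs : ∀ a, s • KaehlerDifferential.D 𝒪[K] A a ∈
      Submodule.span A (Set.range fun i => KaehlerDifferential.D 𝒪[K] A (f i)))
    (he : x₀ s ∉ 𝓂[K] ^ e) (hx : CongrMod (e + j) x x₀) (hy : CongrMod (e + j) y x₀)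
    {s' b : A} {c : Fin d → A}
    (h : s' • KaehlerDifferential.D 𝒪[K] A b = ∑ i, c i • KaehlerDifferential.D 𝒪[K] A (f i))
    {m : ℕ} (hm : ∀ i, x (f i) - y (f i) ∈ 𝓂[K] ^ m) :
    x₀ s' * (x b - y b) - ∑ i, x₀ (c i) * (x (f i) - y (f i)) ∈ 𝓂[K] ^ (m + (j + 1)) := by
  obtain ⟨-, h2⟩ := mul_diffIdeal_le hs he hx hy
  have he1 : 1 ≤ e := by
    by_contra h0
    apply he
    have : e = 0 := by omega
    simp [this]
  have h𝔱 : Ideal.span (Set.range fun i => x (f i) - y (f i)) ≤ 𝓂[K] ^ m := by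
    rw [Ideal.span_le]
    rintro _ ⟨i, rfl⟩
    exact hm i
  have h3 : 𝓂[K] ^ (e + j) * diffIdeal x y ≤ 𝓂[K] ^ (m + (j + 1)) := by
    refine h2.trans ?_
    rw [add_comm m, pow_add _ (j + 1)]
    exact Ideal.mul_mono_right h𝔱
  have h𝔞 : diffIdeal x y ≤ 𝓂[K] ^ (e + j) := by
    rw [diffIdeal, Ideal.span_le]
    rintro _ ⟨a, rfl⟩
    have : x a - y a = (x a - x₀ a) - (y a - x₀ a) := by ring
    change x a - y a ∈ 𝓂[K] ^ (e + j)
    rw [this]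
    exact sub_mem (hx a) (hy a)
  have h4 := increment_mem h x y
  have h5 : diffIdeal x y ^ 2 ≤ 𝓂[K] ^ (m + (j + 1)) := by
    rw [pow_two]
    exact (Ideal.mul_mono_left h𝔞).trans h3
  have h6 : (x s' - x₀ s') * (x b - y b) ∈ 𝓂[K] ^ (m + (j + 1)) :=
    h3 (Ideal.mul_mem_mul (hx s') (sub_mem_diffIdeal x y b))
  have h7 : ∑ i, (x (c i) - x₀ (c i)) * (x (f i) - y (f i)) ∈ 𝓂[K] ^ (m + (j + 1)) := by
    refine sum_mem fun i _ => ?_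
    have := Ideal.mul_mem_mul (hx (c i)) (hm i)
    rw [← pow_add] at this
    exact Ideal.pow_le_pow_right (by omega) this
  have : x₀ s' * (x b - y b) - ∑ i, x₀ (c i) * (x (f i) - y (f i)) =
      (x s' * (x b - y b) - ∑ i, x (c i) * (x (f i) - y (f i))) - (x s' - x₀ s') * (x b - y b) +
        ∑ i, (x (c i) - x₀ (c i)) * (x (f i) - y (f i)) := by
    simp only [sub_mul (x (c _)), Finset.sum_sub_distrib]
    ring
  rw [this]
  exact add_mem (sub_mem (h5 h4) h6) h7

/-- Near a point where `f` is unramified, `f` is injective. -/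
lemma eq_of_coords_eq
    (hs : ∀ a, s • KaehlerDifferential.D 𝒪[K] A a ∈
      Submodule.span A (Set.range fun i => KaehlerDifferential.D 𝒪[K] A (f i)))
    (he : x₀ s ∉ 𝓂[K] ^ e) (hx : CongrMod e x x₀) (hy : CongrMod e y x₀)
    (h : ∀ i, x (f i) = y (f i)) : x = y := by
  obtain ⟨h1, -⟩ := mul_diffIdeal_le (j := 0) hs he hx hy
  have hxs : x s ≠ 0 := by
    intro h0
    apply he
    have : x₀ s = -(x s - x₀ s) := by rw [h0]; ring
    rw [this]
    exact neg_mem (hx s)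
  ext1 a
  have h2 := h1 (Ideal.mul_mem_mul (Ideal.mem_span_singleton_self (x s)) (sub_mem_diffIdeal x y a))
  have h3 : Ideal.span (Set.range fun i => x (f i) - y (f i)) = ⊥ := by
    rw [Ideal.span_eq_bot]
    rintro _ ⟨i, rfl⟩
    simp [h i]
  rw [h3, Ideal.mem_bot, mul_eq_zero] at h2
  exact sub_eq_zero.mp (h2.resolve_left hxs)

end Increments

section EtaleAlgebra

variable {O : Type*} [CommRing O] {κ : Type*} {A : Type*} [CommRing A] [Algebra O A]
  [Algebra (MvPolynomial κ O) A] [IsScalarTower O (MvPolynomial κ O) A]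

/-- Differentials are generated by those of unramified coordinates. -/
lemma exists_smul_D_mem_span [Algebra.FiniteType O A] (p : Ideal A) [p.IsPrime]
    [Algebra.FormallyUnramified (MvPolynomial κ O) (Localization.AtPrime p)] :
    ∃ s ∉ p, ∀ ω : Ω[A⁄O], s • ω ∈ Submodule.span A
      (Set.range fun i : κ => KaehlerDifferential.D O A (algebraMap (MvPolynomial κ O) A (.X i))) := by
  have hft : Algebra.FiniteType (MvPolynomial κ O) A :=
    Algebra.FiniteType.of_restrictScalars_finiteType O _ A
  have hsub : Subsingleton (LocalizedModule p.primeCompl Ω[A⁄MvPolynomial κ O]) := by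
    have h₁ := IsLocalizedModule.iso p.primeCompl
      (KaehlerDifferential.map (MvPolynomial κ O) (MvPolynomial κ O) A (Localization.AtPrime p))
    exact h₁.subsingleton_congr.mpr inferInstance
  have hsupp : (⟨p, inferInstance⟩ : PrimeSpectrum A) ∉ Module.support A Ω[A⁄MvPolynomial κ O] :=
    Module.notMem_support_iff.mpr hsub
  rw [Module.support_eq_zeroLocus, PrimeSpectrum.mem_zeroLocus, Set.not_subset] at hsupp
  obtain ⟨s, hs, hsp⟩ := hsupp
  refine ⟨s, hsp, fun ω => ?_⟩
  have h0 : KaehlerDifferential.map O (MvPolynomial κ O) A A (s • ω) = 0 := by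
    rw [map_smul]
    exact Module.mem_annihilator.mp hs _
  obtain ⟨y, hy⟩ := (KaehlerDifferential.exact_mapBaseChange_map O (MvPolynomial κ O) A _).mp h0
  rw [← hy]
  refine TensorProduct.induction_on y (by simp) (fun a ω' => ?_) fun a b ha hb => by
    rw [map_add]; exact add_mem ha hb
  rw [KaehlerDifferential.mapBaseChange_tmul]
  refine Submodule.smul_mem _ _ ?_
  have hω' : ω' ∈ Submodule.span (MvPolynomial κ O) (Set.range (KaehlerDifferential.mvPolynomialBasis O κ)) := by
    rw [Module.Basis.span_eq]; trivial
  refine Submodule.span_induction ?_ (by simp) (fun a b _ _ ha hb => by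
    rw [map_add]; exact add_mem ha hb) (fun c a _ ha => ?_) hω'
  · rintro _ ⟨i, rfl⟩
    rw [KaehlerDifferential.mvPolynomialBasis_apply, KaehlerDifferential.map_D]
    exact Submodule.subset_span ⟨i, rfl⟩
  · rw [map_smul, ← algebraMap_smul A c]
    exact Submodule.smul_mem _ _ ha

lemma finitePresentation_of_coordinates [IsNoetherianRing O] [Finite κ] [Algebra.FiniteType O A] :
    Algebra.FinitePresentation (MvPolynomial κ O) A :=
  Algebra.FinitePresentation.of_finiteType.mp (Algebra.FiniteType.of_restrictScalars_finiteType O _ A)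

/-- Coordinates are étale at all generizations of a point at which they are étale. -/
lemma isEtaleAt_of_le [IsNoetherianRing O] [Finite κ] [Algebra.FiniteType O A] {p Q : Ideal A}
    [p.IsPrime] [Q.IsPrime] (h : Algebra.IsEtaleAt (MvPolynomial κ O) p) (hQ : Q ≤ p) :
    Algebra.IsEtaleAt (MvPolynomial κ O) Q := by
  have := finitePresentation_of_coordinates (O := O) (κ := κ) (A := A)
  have hs : (⟨Q, ‹_›⟩ : PrimeSpectrum A) ⤳ ⟨p, ‹_›⟩ :=
    (PrimeSpectrum.le_iff_specializes _ _).mp hQ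
  exact hs.mem_open (Algebra.isOpen_etaleLocus (R := MvPolynomial κ O) (A := A)) h

/-- The differentials of étale coordinates form a basis. -/
def etaleBasis (O κ T : Type*) [CommRing O] [CommRing T] [Algebra O T]
    [Algebra (MvPolynomial κ O) T] [IsScalarTower O (MvPolynomial κ O) T]
    [Algebra.FormallyEtale (MvPolynomial κ O) T] : Module.Basis κ T Ω[T⁄O] :=
  ((KaehlerDifferential.mvPolynomialBasis O κ).baseChange T).map
    (KaehlerDifferential.tensorKaehlerEquivOfFormallyEtale O (MvPolynomial κ O) T)

lemma etaleBasis_apply (O κ T : Type*) [CommRing O] [CommRing T] [Algebra O T]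
    [Algebra (MvPolynomial κ O) T] [IsScalarTower O (MvPolynomial κ O) T]
    [Algebra.FormallyEtale (MvPolynomial κ O) T] (i : κ) :
    etaleBasis O κ T i = KaehlerDifferential.D O T (algebraMap (MvPolynomial κ O) T (.X i)) := by
  simp [etaleBasis, KaehlerDifferential.tensorKaehlerEquivOfFormallyEtale_apply]

lemma algebraMap_notMem_of_etale [IsNoetherianRing O] [IsDomain O] [Finite κ]
    [Algebra.FiniteType O A] {p Q : Ideal A} [p.IsPrime]
    (h : Algebra.IsEtaleAt (MvPolynomial κ O) p) (hQ : Q ∈ minimalPrimes A) (hQp : Q ≤ p)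
    {c : MvPolynomial κ O} (hc : c ≠ 0) : algebraMap _ A c ∉ Q := by
  have := finitePresentation_of_coordinates (O := O) (κ := κ) (A := A)
  obtain ⟨g, hg, hge⟩ := Algebra.exists_etale_of_isEtaleAt (R := MvPolynomial κ O) p
  have := Algebra.Smooth.flat (MvPolynomial κ O) (Localization.Away g)
  intro hcQ
  have hQprime : Q.IsPrime := hQ.1.1
  have hgQ : g ∉ Q := fun h => hg (hQp h)
  have hloc : (Q.map (algebraMap A (Localization.Away g))) ∈ minimalPrimes (Localization.Away g) := by
    have hd : Disjoint (Submonoid.powers g : Set A) Q :=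
      (Ideal.disjoint_powers_iff_notMem_of_isPrime g).mpr hgQ
    refine ⟨⟨IsLocalization.isPrime_of_isPrime_disjoint (.powers g) _ _ hQprime hd, bot_le⟩, ?_⟩
    rintro P ⟨hP, -⟩ hPQ
    have hle : P.comap (algebraMap A (Localization.Away g)) ≤ Q := by
      rw [← IsLocalization.under_map_of_isPrime_disjoint (.powers g) (Localization.Away g) hQprime hd]
      exact Ideal.comap_mono hPQ
    exact Ideal.map_le_iff_le_comap.mpr (hQ.2 ⟨inferInstance, bot_le⟩ hle)
  have hmem : algebraMap (MvPolynomial κ O) (Localization.Away g) c ∈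
      Q.map (algebraMap A (Localization.Away g)) := by
    rw [IsScalarTower.algebraMap_apply (MvPolynomial κ O) A]
    exact Ideal.mem_map_of_mem _ hcQ
  refine notMem_nonZeroDivisors_of_mem_mem_minimalPrimes hmem hloc ?_
  rw [mem_nonZeroDivisors_iff_right]
  intro x hx
  have hreg : IsSMulRegular (MvPolynomial κ O) c := (IsRegular.of_ne_zero hc).left
  refine IsSMulRegular.of_flat (S := Localization.Away g) hreg ?_
  simpa [mul_comm] using hx

lemma mk_algebraMap (Q : Ideal A) (c : MvPolynomial κ O) :
    Ideal.Quotient.mk Q (algebraMap (MvPolynomial κ O) A c) = MvPolynomial.aeval (fun i : κ =>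
      Ideal.Quotient.mk Q (algebraMap (MvPolynomial κ O) A (.X i))) c := by
  have : ((Ideal.Quotient.mkₐ O Q).comp (IsScalarTower.toAlgHom O (MvPolynomial κ O) A)) =
      MvPolynomial.aeval fun i : κ =>
        Ideal.Quotient.mk Q (algebraMap (MvPolynomial κ O) A (.X i)) := by
    refine MvPolynomial.algHom_ext fun i => ?_
    simp
  exact DFunLike.congr_fun this c

lemma algebraicIndependent_of_etale [IsNoetherianRing O] [IsDomain O] [Finite κ]
    [Algebra.FiniteType O A] {p Q : Ideal A} [p.IsPrime]
    (h : Algebra.IsEtaleAt (MvPolynomial κ O) p) (hQ : Q ∈ minimalPrimes A) (hQp : Q ≤ p) :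
    AlgebraicIndependent O fun i : κ =>
      Ideal.Quotient.mk Q (algebraMap (MvPolynomial κ O) A (.X i)) := by
  rw [algebraicIndependent_iff]
  intro c hc
  by_contra hne
  refine algebraMap_notMem_of_etale h hQ hQp hne ?_
  rw [← Ideal.Quotient.eq_zero_iff_mem, ← hc]
  exact mk_algebraMap Q c

/-- If the coordinates are a transcendence basis of `A / Q`, then any function not vanishing
on the component `Q` divides modulo `Q` a nonzero polynomial in the coordinates. -/
lemma exists_polynomial_mem_of_notMem [IsDomain O] {Q : Ideal A} [Q.IsPrime]
    (h : IsTranscendenceBasis O fun i : κ =>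
      Ideal.Quotient.mk Q (algebraMap (MvPolynomial κ O) A (.X i))) {b : A} (hb : b ∉ Q) :
    ∃ c : MvPolynomial κ O, c ≠ 0 ∧ ∃ a, algebraMap _ A c - a * b ∈ Q := by
  have halg := h.isAlgebraic
  have h0 : Ideal.Quotient.mk Q b ≠ 0 := by rwa [Ne, Ideal.Quotient.eq_zero_iff_mem]
  obtain ⟨r, hr0, a, ha⟩ := (halg.isAlgebraic (Ideal.Quotient.mk Q b)).exists_nonzero_dvd
    (mem_nonZeroDivisors_of_ne_zero h0)
  obtain ⟨c, hc⟩ := (Algebra.adjoin_range_eq_range_aeval O _).le r.2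
  have hc' : Ideal.Quotient.mk Q (algebraMap _ A c) = (r : A ⧸ Q) :=
    (mk_algebraMap Q c).trans hc
  refine ⟨c, ?_, ?_⟩
  · rintro rfl
    exact hr0 (Subtype.ext (by rw [← hc', map_zero, map_zero]; rfl))
  · obtain ⟨a, rfl⟩ := Ideal.Quotient.mk_surjective a
    refine ⟨a, ?_⟩
    rw [← Ideal.Quotient.eq_zero_iff_mem, map_sub, map_mul, hc', sub_eq_zero, mul_comm]
    exact ha

lemma bijective_algebraMap_residueField [IsReduced A] {Q : Ideal A} [Q.IsPrime]
    (hQ : Q ∈ minimalPrimes A) :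
    Function.Bijective (algebraMap (Localization.AtPrime Q) Q.ResidueField) := by
  have hred : IsReduced (Localization.AtPrime Q) :=
    isReduced_localizationPreserves Q.primeCompl _ inferInstance
  have hmax : IsLocalRing.maximalIdeal (Localization.AtPrime Q) = ⊥ := by
    rw [← IsLocalization.AtPrime.map_eq_maximalIdeal Q,
      ← IsLocalization.AtPrime.radical_map_of_mem_minimalPrimes (A := Localization.AtPrime Q) Q ⊥ hQ,
      Ideal.map_bot]
    exact nilradical_eq_zero _
  refine ⟨?_, IsLocalRing.residue_surjective⟩
  rw [injective_iff_map_eq_zero]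
  intro a ha
  have : a ∈ IsLocalRing.maximalIdeal (Localization.AtPrime Q) :=
    (IsLocalRing.residue_eq_zero_iff a).mp ha
  rwa [hmax] at this

/-- The function field of a component is étale over the affine space. -/
lemma formallyEtale_residueField [IsReduced A] [IsNoetherianRing O] [Finite κ]
    [Algebra.FiniteType O A] {p Q : Ideal A} [p.IsPrime] [Q.IsPrime]
    (h : Algebra.IsEtaleAt (MvPolynomial κ O) p) (hQ : Q ∈ minimalPrimes A) (hQp : Q ≤ p) :
    Algebra.FormallyEtale (MvPolynomial κ O) Q.ResidueField := by
  have := isEtaleAt_of_le h hQp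
  exact Algebra.FormallyEtale.of_equiv (AlgEquiv.ofBijective
    (IsScalarTower.toAlgHom (MvPolynomial κ O) (Localization.AtPrime Q) Q.ResidueField)
    (bijective_algebraMap_residueField hQ))

lemma isTranscendenceBasis_of_etale [IsReduced A] [IsNoetherianRing O] [IsDomain O] [Finite κ]
    [Algebra.FiniteType O A] {p Q : Ideal A} [p.IsPrime] [Q.IsPrime]
    (h : Algebra.IsEtaleAt (MvPolynomial κ O) p) (hQ : Q ∈ minimalPrimes A) (hQp : Q ≤ p) :
    IsTranscendenceBasis O fun i : κ =>
      Ideal.Quotient.mk Q (algebraMap (MvPolynomial κ O) A (.X i)) := by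
  have hind := algebraicIndependent_of_etale h hQ hQp
  rw [hind.isTranscendenceBasis_iff_isAlgebraic]
  have := formallyEtale_residueField h hQ hQp
  have hinj : Function.Injective (algebraMap (MvPolynomial κ O) Q.ResidueField) := by
    rw [injective_iff_map_eq_zero]
    intro c hc
    by_contra hne
    refine algebraMap_notMem_of_etale h hQ hQp hne ?_
    rwa [IsScalarTower.algebraMap_apply (MvPolynomial κ O) A,
      Ideal.algebraMap_residueField_eq_zero] at hc
  have : FaithfulSMul (MvPolynomial κ O) Q.ResidueField :=
    (faithfulSMul_iff_algebraMap_injective _ _).mpr hinj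
  let L := FractionRing (MvPolynomial κ O)
  letI : Algebra L Q.ResidueField := FractionRing.liftAlgebra _ _
  have : IsScalarTower (MvPolynomial κ O) L Q.ResidueField := FractionRing.isScalarTower_liftAlgebra _ _
  have : Algebra.FiniteType (MvPolynomial κ O) A :=
    Algebra.FiniteType.of_restrictScalars_finiteType O _ A
  have : Algebra.EssFiniteType A Q.ResidueField :=
    .comp A (A ⧸ Q) _ (h₂ := .of_isLocalization _ (nonZeroDivisors (A ⧸ Q)))
  have : Algebra.EssFiniteType (MvPolynomial κ O) Q.ResidueField := .comp _ A _
  have : Algebra.EssFiniteType L Q.ResidueField := .of_comp (MvPolynomial κ O) L _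
  have : Algebra.FormallyUnramified L Q.ResidueField :=
    Algebra.FormallyUnramified.of_restrictScalars (MvPolynomial κ O) L _
  have := Algebra.FormallyUnramified.isSeparable L Q.ResidueField
  have halg : Algebra.IsAlgebraic (MvPolynomial κ O) Q.ResidueField :=
    (IsFractionRing.comap_isAlgebraic_iff (K := L)).mpr inferInstance
  have halg' : Algebra.IsAlgebraic (MvPolynomial κ O) (A ⧸ Q) :=
    Algebra.IsAlgebraic.of_ringHom_of_comp_eq (RingHom.id _) (algebraMap (A ⧸ Q) Q.ResidueField)
      Function.surjective_id (IsFractionRing.injective (A ⧸ Q) Q.ResidueField) 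
      (IsScalarTower.algebraMap_eq (MvPolynomial κ O) (A ⧸ Q) Q.ResidueField)
  refine Algebra.IsAlgebraic.ringHom_of_comp_eq hind.aevalEquiv.toRingHom (RingHom.id (A ⧸ Q))
    hind.aevalEquiv.injective Function.surjective_id ?_
  exact RingHom.ext fun c => (hind.algebraMap_aevalEquiv c).trans (mk_algebraMap Q c).symm

/-- Functions whose differentials form a basis at a smooth point are étale coordinates. -/
lemma formallyEtale_of_basis {T : Type*} [CommRing T] [Algebra O T] [Algebra (MvPolynomial κ O) T]
    [IsScalarTower O (MvPolynomial κ O) T] [Algebra.FormallySmooth O T]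
    (b : Module.Basis κ T Ω[T⁄O])
    (hb : ∀ i, b i = KaehlerDifferential.D O T (algebraMap (MvPolynomial κ O) T (.X i))) :
    Algebra.FormallyEtale (MvPolynomial κ O) T := by
  have hbij : Function.Bijective (KaehlerDifferential.mapBaseChange O (MvPolynomial κ O) T) := by
    have : KaehlerDifferential.mapBaseChange O (MvPolynomial κ O) T =
        (((KaehlerDifferential.mvPolynomialBasis O κ).baseChange T).equiv b
          (Equiv.refl κ)).toLinearMap := by
      refine ((KaehlerDifferential.mvPolynomialBasis O κ).baseChange T).ext fun i => ?_
      rw [LinearEquiv.coe_coe, Module.Basis.equiv_apply]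
      simp [hb]
    rw [this]
    exact LinearEquiv.bijective _
  rw [Algebra.formallyEtale_iff]
  constructor
  · refine subsingleton_of_forall_eq 0 fun ω => ?_
    obtain ⟨x, rfl⟩ := KaehlerDifferential.map_surjective O (MvPolynomial κ O) T ω
    exact (KaehlerDifferential.exact_mapBaseChange_map O (MvPolynomial κ O) T x).mpr (hbij.2 x)
  · refine subsingleton_of_forall_eq 0 fun ω => ?_
    have h1 : Algebra.H1Cotangent.δ O (MvPolynomial κ O) T ω = 0 :=
      hbij.1 (((Algebra.H1Cotangent.exact_δ_mapBaseChange O (MvPolynomial κ O) T _).mpr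
        ⟨ω, rfl⟩).trans (map_zero _).symm)
    obtain ⟨x, rfl⟩ := (Algebra.H1Cotangent.exact_map_δ O (MvPolynomial κ O) T ω).mp h1
    rw [Subsingleton.elim x 0, map_zero]

end EtaleAlgebra

section Coordinates

variable {O : Type*} [CommRing O] {A : Type*} [CommRing A] [Algebra O A]

lemma isEtaleAt_of_basis (p : Ideal A) [p.IsPrime] (hs : Algebra.IsSmoothAt O p) {κ : Type*}
    (f : κ → A) (b : Module.Basis κ (Localization.AtPrime p) Ω[Localization.AtPrime p⁄O])
    (hb : ∀ i, b i = KaehlerDifferential.D O (Localization.AtPrime p) (algebraMap A _ (f i))) :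
    letI : Algebra (MvPolynomial κ O) A := (MvPolynomial.aeval (R := O) f).toRingHom.toAlgebra
    Algebra.IsEtaleAt (MvPolynomial κ O) p := by
  letI : Algebra (MvPolynomial κ O) A := (MvPolynomial.aeval (R := O) f).toRingHom.toAlgebra
  have : IsScalarTower O (MvPolynomial κ O) A :=
    IsScalarTower.of_algebraMap_eq fun c => by
      simp [RingHom.algebraMap_toAlgebra]
  have : IsScalarTower O (MvPolynomial κ O) (Localization.AtPrime p) :=
    IsScalarTower.of_algebraMap_eq fun c => by
      rw [IsScalarTower.algebraMap_apply (MvPolynomial κ O) A,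
        ← IsScalarTower.algebraMap_apply O (MvPolynomial κ O) A, ← IsScalarTower.algebraMap_apply]
  refine formallyEtale_of_basis b fun i => ?_
  rw [hb, IsScalarTower.algebraMap_apply (MvPolynomial κ O) A]
  congr 2
  simp [RingHom.algebraMap_toAlgebra]

/-- A smooth point of a variety of relative dimension `d` has `d` étale coordinates. -/
lemma exists_isEtaleAt_of_isSmoothAt [IsReduced A] [IsNoetherianRing O] [IsDomain O]
    [Algebra.FiniteType O A] {d : ℕ} (htr : ∀ Q ∈ minimalPrimes A, Algebra.trdeg O (A ⧸ Q) = d)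
    (p : Ideal A) [p.IsPrime] (hs : Algebra.IsSmoothAt O p) :
    ∃ f : Fin d → A,
      letI : Algebra (MvPolynomial (Fin d) O) A :=
        (MvPolynomial.aeval (R := O) f).toRingHom.toAlgebra
      Algebra.IsEtaleAt (MvPolynomial (Fin d) O) p := by
  have : Algebra.FinitePresentation O A := Algebra.FinitePresentation.of_finiteType.mp inferInstance
  obtain ⟨κ, a, b, hb⟩ := Module.exists_basis_of_span_of_flat _
    (KaehlerDifferential.span_range_map_derivation_of_isLocalization O A (Localization.AtPrime p)
      p.primeCompl)
  have hb' : ∀ i, b i = KaehlerDifferential.D O (Localization.AtPrime p) (algebraMap A _ (a i)) :=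
    fun i => by rw [hb, Function.comp_apply, KaehlerDifferential.map_D]
  have hfin : Finite κ := Module.Finite.finite_basis b
  obtain ⟨Q, hQ, hQp⟩ := Ideal.exists_minimalPrimes_le (bot_le (a := p))
  have hQprime : Q.IsPrime := hQ.1.1
  have hcard : Nat.card κ = d := by
    have het := isEtaleAt_of_basis p hs a b hb'
    letI : Algebra (MvPolynomial κ O) A := (MvPolynomial.aeval (R := O) a).toRingHom.toAlgebra
    have : IsScalarTower O (MvPolynomial κ O) A :=
      IsScalarTower.of_algebraMap_eq fun c => by
        simp [RingHom.algebraMap_toAlgebra]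
    have h := (isTranscendenceBasis_of_etale het hQ hQp).lift_cardinalMk_eq_trdeg
    rw [htr Q hQ, Cardinal.lift_natCast, Cardinal.lift_eq_nat_iff] at h
    rw [Nat.card, h, Cardinal.toNat_natCast]
  let e : κ ≃ Fin d := (Finite.equivFin κ).trans (finCongr hcard)
  exact ⟨fun i => a (e.symm i), isEtaleAt_of_basis p hs _ (b.reindex e) fun i => by
    rw [Module.Basis.reindex_apply, hb']⟩

end Coordinates

section EtaleCoordinates

variable {K : Type u} [Field K] [ValuativeRel K] [TopologicalSpace K]
  [IsNonarchimedeanLocalField K] {A : Type v} [CommRing A] [Algebra 𝒪[K] A] {d : ℕ}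

/-- The affine space algebra structure given by functions `f`. -/
abbrev coordAlgebra (f : Fin d → A) : Algebra (MvPolynomial (Fin d) 𝒪[K]) A :=
  (MvPolynomial.aeval (R := 𝒪[K]) f).toRingHom.toAlgebra

lemma coordAlgebra_isScalarTower (f : Fin d → A) :
    letI := coordAlgebra (K := K) f
    IsScalarTower 𝒪[K] (MvPolynomial (Fin d) 𝒪[K]) A :=
  letI := coordAlgebra (K := K) f
  IsScalarTower.of_algebraMap_eq fun c => by simp [RingHom.algebraMap_toAlgebra]

lemma coordAlgebra_algebraMap (f : Fin d → A) (c : MvPolynomial (Fin d) 𝒪[K]) :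
    letI := coordAlgebra (K := K) f
    algebraMap (MvPolynomial (Fin d) 𝒪[K]) A c = MvPolynomial.aeval f c := rfl

lemma IsEtaleCoordinates.exists_smul_D_mem_span [Algebra.FiniteType 𝒪[K] A] {f : Fin d → A}
    {p : PrimeSpectrum A} (h : IsEtaleCoordinates (K := K) f p) :
    ∃ s ∉ p.asIdeal, ∀ ω : Ω[A⁄𝒪[K]], s • ω ∈ Submodule.span A
      (Set.range fun i => KaehlerDifferential.D 𝒪[K] A (f i)) := by
  letI := coordAlgebra (K := K) f
  have := coordAlgebra_isScalarTower (K := K) f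
  have h' : Algebra.IsEtaleAt (MvPolynomial (Fin d) 𝒪[K]) p.asIdeal := h
  have : Algebra.FormallyUnramified (MvPolynomial (Fin d) 𝒪[K])
    (Localization.AtPrime p.asIdeal) := inferInstance
  simpa [coordAlgebra_algebraMap] using
    WildMcKay.exists_smul_D_mem_span (O := 𝒪[K]) (κ := Fin d) p.asIdeal

lemma IsEtaleCoordinates.of_le [Algebra.FiniteType 𝒪[K] A] {f : Fin d → A}
    {p q : PrimeSpectrum A} (h : IsEtaleCoordinates (K := K) f p) (hq : q ≤ p) :
    IsEtaleCoordinates (K := K) f q := by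
  letI := coordAlgebra (K := K) f
  have := coordAlgebra_isScalarTower (K := K) f
  exact isEtaleAt_of_le (p := p.asIdeal) (Q := q.asIdeal) h hq

/-- The functions `f` are étale coordinates at the points of a nonempty open set. -/
lemma IsEtaleCoordinates.isOpen [Algebra.FiniteType 𝒪[K] A] (f : Fin d → A) :
    IsOpen {p : PrimeSpectrum A | IsEtaleCoordinates (K := K) f p} := by
  letI := coordAlgebra (K := K) f
  have := coordAlgebra_isScalarTower (K := K) f
  have := finitePresentation_of_coordinates (O := 𝒪[K]) (κ := Fin d) (A := A)
  exact Algebra.isOpen_etaleLocus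

lemma IsEtaleCoordinates.exists_polynomial [Algebra.FiniteType 𝒪[K] A] [IsReduced A] {f : Fin d → A}
    {p Q : PrimeSpectrum A} (h : IsEtaleCoordinates (K := K) f p)
    (hQ : Q.asIdeal ∈ minimalPrimes A) (hQp : Q ≤ p) {b : A} (hb : b ∉ Q.asIdeal) :
    ∃ c : MvPolynomial (Fin d) 𝒪[K], c ≠ 0 ∧ ∃ a, MvPolynomial.aeval f c - a * b ∈ Q.asIdeal := by
  letI := coordAlgebra (K := K) f
  have := coordAlgebra_isScalarTower (K := K) f
  exact exists_polynomial_mem_of_notMem (isTranscendenceBasis_of_etale (p := p.asIdeal) h hQ hQp) hb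

/-- The differentials of étale coordinates form a basis over the function field of a component. -/
lemma IsEtaleCoordinates.exists_basis [Algebra.FiniteType 𝒪[K] A] [IsReduced A] {f : Fin d → A}
    {p Q : PrimeSpectrum A} (h : IsEtaleCoordinates (K := K) f p)
    (hQ : Q.asIdeal ∈ minimalPrimes A) (hQp : Q ≤ p) :
    ∃ b : Module.Basis (Fin d) Q.asIdeal.ResidueField Ω[Q.asIdeal.ResidueField⁄𝒪[K]],
      ∀ i, b i = KaehlerDifferential.D 𝒪[K] Q.asIdeal.ResidueField (algebraMap A _ (f i)) := by
  letI := coordAlgebra (K := K) f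
  have := coordAlgebra_isScalarTower (K := K) f
  have := formallyEtale_residueField (p := p.asIdeal) (Q := Q.asIdeal) h hQ hQp
  have : IsScalarTower 𝒪[K] (MvPolynomial (Fin d) 𝒪[K]) Q.asIdeal.ResidueField :=
    IsScalarTower.of_algebraMap_eq fun c => by
      rw [IsScalarTower.algebraMap_apply (MvPolynomial (Fin d) 𝒪[K]) A,
        ← IsScalarTower.algebraMap_apply 𝒪[K] (MvPolynomial (Fin d) 𝒪[K]) A,
        ← IsScalarTower.algebraMap_apply]
  refine ⟨etaleBasis 𝒪[K] (Fin d) Q.asIdeal.ResidueField, fun i => ?_⟩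
  rw [etaleBasis_apply, IsScalarTower.algebraMap_apply (MvPolynomial (Fin d) 𝒪[K]) A]
  simp [coordAlgebra_algebraMap]

lemma IsVariety.exists_isEtaleCoordinates (hA : IsVariety 𝒪[K] A d) {p : PrimeSpectrum A}
    (hp : p ∈ Algebra.smoothLocus 𝒪[K] A) : ∃ f : Fin d → A, IsEtaleCoordinates (K := K) f p := by
  have := hA.isReduced
  have := hA.finiteType
  exact exists_isEtaleAt_of_isSmoothAt hA.trdeg_eq p.asIdeal hp

end EtaleCoordinates

section NormalDomain

/-- An ideal quotient equal to the maximal ideal forces the maximal ideal to be principal. -/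
lemma isPrincipal_maximalIdeal_of_mul {S : Type*} [CommRing S] [IsDomain S] [IsNoetherianRing S]
    [IsLocalRing S] [IsIntegrallyClosed S] {c y : S} (hc : c ≠ 0) (hy : ¬ c ∣ y)
    (h : ∀ r ∈ IsLocalRing.maximalIdeal S, c ∣ r * y) :
    (IsLocalRing.maximalIdeal S).IsPrincipal := by
  by_cases hm : IsLocalRing.maximalIdeal S = ⊥
  · rw [hm]; infer_instance
  by_cases hall : ∀ r ∈ IsLocalRing.maximalIdeal S, ∀ g, r * y = c * g →
      g ∈ IsLocalRing.maximalIdeal S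
  · exfalso
    let F := FractionRing S
    have hcF : algebraMap S F c ≠ 0 := by
      rwa [Ne, IsFractionRing.to_map_eq_zero_iff]
    have hint : IsIntegral S (algebraMap S F y / algebraMap S F c) := by
      refine isIntegral_of_smul_mem_submodule (R := S) (A := F) (M := F)
        (Submodule.map (Algebra.linearMap S F) (IsLocalRing.maximalIdeal S)) ?_ ?_ _ ?_
      · intro h0
        refine hm (eq_bot_iff.mpr fun x hx => ?_)
        have hx0 : algebraMap S F x = 0 := by
          have := Submodule.mem_map_of_mem (f := Algebra.linearMap S F) hx
          rwa [h0] at this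
        exact IsFractionRing.to_map_eq_zero_iff.mp hx0
      · exact Submodule.FG.map _ (IsNoetherian.noetherian _)
      · rintro _ ⟨r, hr, rfl⟩
        obtain ⟨g, hg⟩ := h r hr
        refine ⟨g, hall r hr g hg, ?_⟩
        rw [Algebra.linearMap_apply, Algebra.linearMap_apply, smul_eq_mul, div_mul_eq_mul_div,
          eq_div_iff hcF, ← map_mul, ← map_mul, mul_comm y r, hg, mul_comm]
    obtain ⟨z, hz⟩ := IsIntegrallyClosed.isIntegral_iff.mp hint
    refine hy ⟨z, ?_⟩
    rw [eq_div_iff hcF, ← map_mul] at hz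
    rw [← IsFractionRing.injective S F hz, mul_comm]
  · push Not at hall
    obtain ⟨r, hr, g, hg, hgm⟩ := hall
    rw [IsLocalRing.mem_maximalIdeal, mem_nonunits_iff, not_not] at hgm
    obtain ⟨g, rfl⟩ := hgm
    refine ⟨r, le_antisymm (fun x hx => ?_) ((Ideal.span_singleton_le_iff_mem _).mpr hr)⟩
    obtain ⟨k, hk⟩ := h x hx
    refine Ideal.mem_span_singleton'.mpr ⟨k * ↑g⁻¹, ?_⟩
    have hy0 : y ≠ 0 := fun h0 => hy (h0 ▸ dvd_zero c)
    refine mul_right_cancel₀ (mul_ne_zero hc hy0) ?_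
    calc k * ↑g⁻¹ * r * (c * y) = (c * k) * (r * y) * ↑g⁻¹ := by ring
      _ = (x * y) * (c * (g * ↑g⁻¹)) := by rw [hg, ← hk]; ring
      _ = x * (c * y) := by rw [Units.mul_inv]; ring

lemma height_eq_one_of_isPrincipal {R : Type*} [CommRing R] [IsDomain R] [IsNoetherianRing R]
    (P : Ideal R) [P.IsPrime] (hP : P ≠ ⊥)
    (h : (IsLocalRing.maximalIdeal (Localization.AtPrime P)).IsPrincipal) : P.height = 1 := by
  have hh : (IsLocalRing.maximalIdeal (Localization.AtPrime P)).height = P.height := by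
    have h1 := IsLocalization.height_under P.primeCompl
      (IsLocalRing.maximalIdeal (Localization.AtPrime P))
    rw [← h1, IsLocalization.AtPrime.under_maximalIdeal (Localization.AtPrime P) P]
  refine le_antisymm ?_ ?_
  · rw [← hh]
    exact Ideal.height_le_one_of_isPrincipal_of_mem_minimalPrimes (IsLocalRing.maximalIdeal (Localization.AtPrime P)) _
      (by rw [Ideal.minimalPrimes_eq_subsingleton_self]; rfl)
  · rwa [Order.one_le_iff_ne_zero, Ne, Ideal.height_eq_zero_iff_eq_bot]

/-- In a noetherian normal domain a fraction is integral if it is so in codimension one. -/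
lemma exists_height_eq_one_of_not_dvd {R : Type*} [CommRing R] [IsDomain R] [IsNoetherianRing R]
    [IsIntegrallyClosed R] {b c : R} (hc : c ≠ 0) (hb : ¬ c ∣ b) :
    ∃ P : Ideal R, P.IsPrime ∧ P.height = 1 ∧ ∀ s ∉ P, ¬ c ∣ s * b := by
  have hmk : Ideal.Quotient.mk (Ideal.span {c}) b ≠ 0 := by
    rwa [Ne, Ideal.Quotient.eq_zero_iff_mem, Ideal.mem_span_singleton]
  have hmem : ∀ r x : R, r ∈ (⊥ : Submodule R (R ⧸ Ideal.span {c})).colon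
      {Ideal.Quotient.mk (Ideal.span {c}) x} ↔ c ∣ r * x := fun r x => by
    rw [Submodule.mem_colon_singleton, Submodule.mem_bot, ← Ideal.mem_span_singleton,
      ← Ideal.Quotient.eq_zero_iff_mem, map_mul]
    rfl
  obtain ⟨P, hP, hle⟩ := exists_le_isAssociatedPrime_of_isNoetherianRing R _ hmk
  obtain ⟨hPprime, y, hy⟩ := isAssociatedPrime_iff.mp hP
  obtain ⟨y, rfl⟩ := Ideal.Quotient.mk_surjective y
  have hmemP : ∀ r, r ∈ P ↔ c ∣ r * y := fun r => by rw [hy, hmem]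
  refine ⟨P, hPprime, height_eq_one_of_isPrincipal P ?_ ?_, fun s hs hd => hs (hle ((hmem s b).mpr hd))⟩
  · rintro rfl
    exact hc (by simpa using (hmemP c).mpr (dvd_mul_right c y))
  · have hinj : Function.Injective (algebraMap R (Localization.AtPrime P)) :=
      IsLocalization.injective _ P.primeCompl_le_nonZeroDivisors
    have : IsIntegrallyClosed (Localization.AtPrime P) :=
      isIntegrallyClosed_of_isLocalization _ P.primeCompl P.primeCompl_le_nonZeroDivisors
    refine isPrincipal_maximalIdeal_of_mul (c := algebraMap R _ c) (y := algebraMap R _ y) ?_ ?_ ?_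
    · rwa [Ne, map_eq_zero_iff _ hinj]
    · rintro ⟨z, hz⟩
      obtain ⟨⟨a, s⟩, has⟩ := IsLocalization.surj P.primeCompl z
      refine s.2 ((hmemP _).mpr ⟨a, hinj ?_⟩)
      rw [map_mul, map_mul, hz, ← has]
      ring
    · intro r hr
      obtain ⟨⟨a, s⟩, has⟩ := IsLocalization.surj P.primeCompl r
      have ha : a ∈ P := by
        rw [← IsLocalization.AtPrime.to_map_mem_maximal_iff (Localization.AtPrime P) P, ← has]
        exact Ideal.mul_mem_right _ _ hr
      have hu : IsUnit (algebraMap R (Localization.AtPrime P) s) :=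
        IsLocalization.map_units _ s
      have hd := map_dvd (algebraMap R (Localization.AtPrime P)) ((hmemP a).mp ha)
      rw [map_mul, ← has, mul_right_comm] at hd
      exact (hu.dvd_mul_right).mp hd

end NormalDomain

section NormalRing

variable {A : Type*} [CommRing A]

lemma exists_uniform_smul_mem {M : Type*} [AddCommGroup M] [Module A M] (P : Ideal A) [P.IsPrime]
    {N : Submodule A M} (hN : N.FG) (N' : Submodule A M) (h : ∀ x ∈ N, ∃ s ∉ P, s • x ∈ N') :
    ∃ s ∉ P, ∀ x ∈ N, s • x ∈ N' := by
  induction N, hN using Submodule.fg_induction with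
  | singleton x =>
    obtain ⟨s, hs, hx⟩ := h x (Submodule.mem_span_singleton_self x)
    refine ⟨s, hs, fun y hy => ?_⟩
    obtain ⟨a, rfl⟩ := Submodule.mem_span_singleton.mp hy
    rw [smul_comm]
    exact N'.smul_mem a hx
  | sup N₁ N₂ _ _ h₁ h₂ =>
    obtain ⟨s₁, hs₁, hx₁⟩ := h₁ fun x hx => h x (Submodule.mem_sup_left hx)
    obtain ⟨s₂, hs₂, hx₂⟩ := h₂ fun x hx => h x (Submodule.mem_sup_right hx)
    refine ⟨s₁ * s₂, Ideal.IsPrime.mul_notMem ‹_› hs₁ hs₂, fun x hx => ?_⟩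
    obtain ⟨y, hy, z, hz, rfl⟩ := Submodule.mem_sup.mp hx
    rw [smul_add, mul_smul, mul_smul, smul_comm]
    exact N'.add_mem (N'.smul_mem _ (hx₁ y hy)) (N'.smul_mem _ (hx₂ z hz))

lemma IsNormal.ker_algebraMap (hA : IsNormal A) {p Q : Ideal A} [hp : p.IsPrime]
    (hQ : Q ∈ minimalPrimes A) (hQp : Q ≤ p) :
    RingHom.ker (algebraMap A (Localization.AtPrime p)) = Q := by
  have := (hA ⟨p, hp⟩).1
  have hprime : (RingHom.ker (algebraMap A (Localization.AtPrime p))).IsPrime :=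
    RingHom.ker_isPrime _
  have hle : RingHom.ker (algebraMap A (Localization.AtPrime p)) ≤ Q := by
    intro a ha
    obtain ⟨s, hs⟩ := (IsLocalization.map_eq_zero_iff p.primeCompl _ a).mp ha
    have hQ' : Q.IsPrime := hQ.1.1
    exact (hQ'.mem_or_mem (hs ▸ Q.zero_mem : (s : A) * a ∈ Q)).resolve_left fun h => s.2 (hQp h)
  exact le_antisymm hle (hQ.2 ⟨hprime, bot_le⟩ hle)

lemma IsNormal.algebraMap_eq_zero_iff (hA : IsNormal A) {p Q : Ideal A} [hp : p.IsPrime]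
    (hQ : Q ∈ minimalPrimes A) (hQp : Q ≤ p) {a : A} :
    algebraMap A (Localization.AtPrime p) a = 0 ↔ a ∈ Q := by
  rw [← RingHom.mem_ker, hA.ker_algebraMap hQ hQp]

lemma IsNormal.eq_of_le (hA : IsNormal A) {p Q Q' : Ideal A} [hp : p.IsPrime]
    (hQ : Q ∈ minimalPrimes A) (hQp : Q ≤ p) (hQ' : Q' ∈ minimalPrimes A) (hQp' : Q' ≤ p) :
    Q = Q' :=
  (hA.ker_algebraMap hQ hQp).symm.trans (hA.ker_algebraMap hQ' hQp')

/-- The idempotent of a component of a normal scheme. -/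
lemma IsNormal.exists_idempotent [IsNoetherianRing A] (hA : IsNormal A) {Q : Ideal A}
    (hQ : Q ∈ minimalPrimes A) :
    ∃ e : A, 1 - e ∈ Q ∧ ∀ Q' ∈ minimalPrimes A, Q' ≠ Q → e ∈ Q' := by
  have hfin : (minimalPrimes A).Finite := minimalPrimes.finite_of_isNoetherianRing A
  have hcop : IsCoprime Q (⨅ Q' ∈ (hfin.toFinset.erase Q : Finset (Ideal A)), Q') := by
    refine Ideal.isCoprime_biInf fun Q' hQ' => ?_
    rw [Finset.mem_erase, Set.Finite.mem_toFinset] at hQ'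
    rw [Ideal.isCoprime_iff_sup_eq]
    by_contra hne
    obtain ⟨m, hm, hle⟩ := Ideal.exists_le_maximal _ hne
    have := hm.isPrime
    exact hQ'.1 (hA.eq_of_le hQ (le_sup_left.trans hle) hQ'.2 (le_sup_right.trans hle)).symm
  obtain ⟨x, hx, e, he, hxe⟩ := Ideal.isCoprime_iff_exists.mp hcop
  refine ⟨e, by rwa [← hxe, add_sub_cancel_right], fun Q' hQ' hne => ?_⟩
  have := (Submodule.mem_iInf _).mp he Q'
  exact (Submodule.mem_iInf _).mp this (by simp [hne, hQ'])

/-- Functions on a normal noetherian scheme extend over sets of codimension two. -/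
lemma IsNormal.exists_mul_sub_mem [IsNoetherianRing A] (hA : IsNormal A) {p Q : Ideal A}
    [hp : p.IsPrime] (hQ : Q ∈ minimalPrimes A) (hQp : Q ≤ p) {b c : A} (hc : c ∉ Q)
    (h : ∀ P : Ideal A, P.IsPrime → P.height = 1 → P ≤ p → Q ≤ P → ∃ s ∉ P, ∃ a, s * b - a * c ∈ Q) :
    ∃ s ∉ p, ∃ a, s * b - a * c ∈ Q := by
  have := (hA ⟨p, hp⟩).1
  have := (hA ⟨p, hp⟩).2
  have hz : ∀ a : A, algebraMap A (Localization.AtPrime p) a = 0 ↔ a ∈ Q :=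
    fun a => hA.algebraMap_eq_zero_iff hQ hQp
  by_cases hd : algebraMap A (Localization.AtPrime p) c ∣ algebraMap A (Localization.AtPrime p) b
  · obtain ⟨z, hzz⟩ := hd
    obtain ⟨⟨a, s⟩, has⟩ := IsLocalization.surj p.primeCompl z
    refine ⟨s, s.2, a, (hz _).mp ?_⟩
    rw [map_sub, map_mul, map_mul, hzz, ← has]
    ring
  · exfalso
    obtain ⟨P, hP, hht, hP'⟩ := exists_height_eq_one_of_not_dvd (by rwa [Ne, hz]) hd
    have hht' : (P.under A).height = 1 := by
      rw [IsLocalization.height_under p.primeCompl, hht]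
    have hPp : P.under A ≤ p :=
      (Ideal.comap_mono (IsLocalRing.le_maximalIdeal hP.ne_top)).trans_eq
        (IsLocalization.AtPrime.under_maximalIdeal (Localization.AtPrime p) p)
    have hQP : Q ≤ P.under A := fun a ha => by
      rw [Ideal.mem_comap, (hz a).mpr ha]
      exact P.zero_mem
    obtain ⟨s, hs, a, ha⟩ := h (P.under A) inferInstance hht' hPp hQP
    refine hP' (algebraMap A _ s) hs ⟨algebraMap A _ a, ?_⟩
    rw [← sub_eq_zero, ← map_mul, ← map_mul, ← map_sub, mul_comm c, hz]
    exact ha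

lemma IsNormal.exists_maximalIdeal_pow_eq [IsNoetherianRing A] (hA : IsNormal A) {P : Ideal A}
    [hP : P.IsPrime] (hht : P.height = 1) :
    (IsLocalRing.maximalIdeal (Localization.AtPrime P)).IsPrincipal ∧
    ∀ I : Ideal (Localization.AtPrime P), I ≠ ⊥ →
      ∃ n : ℕ, I = IsLocalRing.maximalIdeal (Localization.AtPrime P) ^ n := by
  have := (hA ⟨P, hP⟩).1
  have := (hA ⟨P, hP⟩).2
  have htfae := tfae_of_isNoetherianRing_of_isLocalRing_of_isDomain (Localization.AtPrime P)
  have h4 : IsIntegrallyClosed (Localization.AtPrime P) ∧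
      ∀ J : Ideal (Localization.AtPrime P), J ≠ ⊥ → J.IsPrime →
        J = IsLocalRing.maximalIdeal (Localization.AtPrime P) := by
    refine ⟨inferInstance, fun J hJ hJp => ?_⟩
    have hm : (IsLocalRing.maximalIdeal (Localization.AtPrime P)).height = 1 := by
      rw [← IsLocalization.height_under P.primeCompl,
        IsLocalization.AtPrime.under_maximalIdeal (Localization.AtPrime P) P, hht]
    by_contra hne
    have hlt : J < IsLocalRing.maximalIdeal (Localization.AtPrime P) :=
      lt_of_le_of_ne (IsLocalRing.le_maximalIdeal hJp.ne_top) hne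
    have h1 := Ideal.height_add_one_le_of_lt_of_isPrime hlt
    rw [hm] at h1
    refine hJ (Ideal.height_eq_zero_iff_eq_bot.mp ?_)
    have h2 : J.height + 1 ≤ 0 + 1 := by simpa using h1
    exact le_bot_iff.mp ((ENat.addLECancellable_of_ne_top ENat.one_ne_top).add_le_add_iff_right.mp h2)
  exact ⟨(htfae.out 3 4).mp h4, (htfae.out 3 6).mp h4⟩

lemma IsNormal.notMem_of_height_eq_one {P Q : Ideal A} [P.IsPrime] (hht : P.height = 1)
    (hQ : Q ∈ minimalPrimes A) : ∃ x ∈ P, x ∉ Q := by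
  by_contra! h
  have hQ' : Q.IsPrime := hQ.1.1
  have : P = Q := le_antisymm h (hQ.2 ⟨‹_›, bot_le⟩ h)
  subst this
  rw [Ideal.height_eq_zero_iff.mpr hQ] at hht
  exact zero_ne_one hht

/-- A local equation of a prime divisor. -/
lemma IsNormal.exists_uniformizer [IsNoetherianRing A] (hA : IsNormal A) {P : Ideal A}
    [hP : P.IsPrime] (hht : P.height = 1) :
    ∃ π ∈ P, (∀ Q ∈ minimalPrimes A, Q ≤ P → π ∉ Q) ∧ ∃ σ ∉ P, ∀ x ∈ P, ∃ a, σ * x = a * π := by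
  obtain ⟨⟨t, ht⟩, -⟩ := hA.exists_maximalIdeal_pow_eq hht
  obtain ⟨⟨π, u⟩, hπ⟩ := IsLocalization.surj P.primeCompl t
  have hu : IsUnit (algebraMap A (Localization.AtPrime P) u) := IsLocalization.map_units _ u
  have hspan : ∀ x ∈ P, ∃ z, algebraMap A (Localization.AtPrime P) x =
      z * algebraMap A (Localization.AtPrime P) π := by
    intro x hx
    have := (IsLocalization.AtPrime.to_map_mem_maximal_iff (Localization.AtPrime P) P x).mpr hx
    rw [ht, Ideal.submodule_span_eq, Ideal.mem_span_singleton'] at this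
    obtain ⟨z, hz⟩ := this
    obtain ⟨w, hw⟩ := hu
    refine ⟨z * ↑w⁻¹, ?_⟩
    rw [← hπ, ← hz, ← hw]
    calc z * t = z * t * (↑w⁻¹ * ↑w) := by rw [Units.inv_mul, mul_one]
      _ = _ := by ring
  have hπP : π ∈ P := by
    rw [← IsLocalization.AtPrime.to_map_mem_maximal_iff (Localization.AtPrime P) P, ← hπ]
    refine Ideal.mul_mem_right _ _ ?_
    rw [ht]
    exact Submodule.mem_span_singleton_self t
  have hσ : ∃ σ ∉ P, ∀ x ∈ P, σ • x ∈ Ideal.span {π} := by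
    refine exists_uniform_smul_mem P (IsNoetherian.noetherian P) _ fun x hx => ?_
    obtain ⟨z, hz⟩ := hspan x hx
    obtain ⟨⟨a, s⟩, has⟩ := IsLocalization.surj P.primeCompl z
    have : algebraMap A (Localization.AtPrime P) (s * x) = algebraMap A _ (a * π) := by
      rw [map_mul, map_mul, hz, ← has]; ring
    obtain ⟨k, hk⟩ := (IsLocalization.eq_iff_exists P.primeCompl _).mp this
    refine ⟨k * s, Ideal.IsPrime.mul_notMem ‹_› k.2 s.2, Ideal.mem_span_singleton'.mpr ⟨k * a, ?_⟩⟩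
    rw [smul_eq_mul, mul_assoc, mul_assoc, hk]
  obtain ⟨σ, hσP, hσ⟩ := hσ
  have hσ' : ∀ x ∈ P, ∃ a, σ * x = a * π := fun x hx => by
    obtain ⟨a, ha⟩ := Ideal.mem_span_singleton'.mp (hσ x hx)
    exact ⟨a, ha.symm⟩
  refine ⟨π, hπP, fun Q hQ hQP hπQ => ?_, σ, hσP, hσ'⟩
  obtain ⟨x, hx, hxQ⟩ := IsNormal.notMem_of_height_eq_one hht hQ
  obtain ⟨a, ha⟩ := hσ' x hx
  have hQ' : Q.IsPrime := hQ.1.1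
  exact (hQ'.mul_notMem (fun h => hσP (hQP h)) hxQ) (ha ▸ Q.mul_mem_left a hπQ)

/-- Every function that does not vanish on the component divides a power of the ideal of a prime
divisor. -/
lemma IsNormal.exists_pow_dvd [IsNoetherianRing A] (hA : IsNormal A) {P Q : Ideal A}
    [hP : P.IsPrime] (hht : P.height = 1) (hQ : Q ∈ minimalPrimes A) (hQP : Q ≤ P) {y : A}
    (hy : y ∉ Q) :
    ∃ m : ℕ, ∃ σ ∉ P, ∀ k, ∀ s ∈ P ^ (m + k), ∃ a ∈ P ^ k, σ * s = a * y := by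
  obtain ⟨-, hpow⟩ := hA.exists_maximalIdeal_pow_eq hht
  obtain ⟨m, hm⟩ := hpow (Ideal.span {algebraMap A _ y}) (by
    rw [Ne, Ideal.span_singleton_eq_bot, hA.algebraMap_eq_zero_iff hQ hQP]
    exact hy)
  have hσ : ∃ σ ∉ P, ∀ x ∈ P ^ m, σ • x ∈ Ideal.span {y} := by
    refine exists_uniform_smul_mem P (IsNoetherian.noetherian (P ^ m)) _ fun x hx => ?_
    have hx' : algebraMap A (Localization.AtPrime P) x ∈ Ideal.span {algebraMap A _ y} := by
      rw [hm, ← IsLocalization.AtPrime.map_eq_maximalIdeal P, ← Ideal.map_pow]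
      exact Ideal.mem_map_of_mem _ hx
    obtain ⟨z, hz⟩ := Ideal.mem_span_singleton'.mp hx'
    obtain ⟨⟨a, s⟩, has⟩ := IsLocalization.surj P.primeCompl z
    have : algebraMap A (Localization.AtPrime P) (s * x) = algebraMap A _ (a * y) := by
      rw [map_mul, map_mul, ← hz, ← has]; ring
    obtain ⟨k, hk⟩ := (IsLocalization.eq_iff_exists P.primeCompl _).mp this
    refine ⟨k * s, Ideal.IsPrime.mul_notMem ‹_› k.2 s.2, Ideal.mem_span_singleton'.mpr ⟨k * a, ?_⟩⟩
    rw [smul_eq_mul, mul_assoc, mul_assoc, hk]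
  obtain ⟨σ, hσP, hσ⟩ := hσ
  refine ⟨m, σ, hσP, fun k s hs => ?_⟩
  rw [pow_add] at hs
  refine Submodule.mul_induction_on hs (fun x hx z hz => ?_) fun x z ⟨a, ha, hax⟩ ⟨b, hb, hbz⟩ => ?_
  · obtain ⟨a, ha⟩ := Ideal.mem_span_singleton'.mp (hσ x hx)
    refine ⟨a * z, Ideal.mul_mem_left _ _ hz, ?_⟩
    rw [← mul_assoc, ← smul_eq_mul σ, ← ha]; ring
  · exact ⟨a + b, add_mem ha hb, by rw [mul_add, hax, hbz, add_mul]⟩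

end NormalRing

section FractionalIdeals

variable {A : Type*} [CommRing A]

section Submodules

variable {F : Type*} [Field F] [Algebra A F]

lemma mul_mem_smul_mul {I J : Ideal A} {M N : Submodule A F} {x y : F} (hx : x ∈ I • M)
    (hy : y ∈ J • N) : x * y ∈ (I * J) • (M * N) := by
  refine Submodule.smul_induction_on hx (fun i hi m hm => ?_) fun a b ha hb => by
    rw [add_mul]; exact add_mem ha hb
  refine Submodule.smul_induction_on hy (fun j hj n hn => ?_) fun a b ha hb => by
    rw [mul_add]; exact add_mem ha hb
  rw [smul_mul_smul_comm]
  exact Submodule.smul_mem_smul (Ideal.mul_mem_mul hi hj) (Submodule.mul_mem_mul hm hn)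

lemma pow_smul_pow_mem {I J : Ideal A} {N : Submodule A F} {σ : A} {v : F}
    (h : ∀ t ∈ I, (σ * t) • v ∈ J • N) (k : ℕ) :
    ∀ t ∈ I ^ k, (σ ^ k * t) • v ^ k ∈ J ^ k • N ^ k := by
  induction k with
  | zero =>
    intro t _
    simp only [pow_zero, one_mul, Ideal.one_eq_top, Submodule.top_smul]
    rw [Algebra.smul_def, mul_one]
    exact Submodule.mem_one.mpr ⟨t, rfl⟩
  | succ k ih =>
    intro t ht
    rw [pow_succ I] at ht
    refine Submodule.mul_induction_on ht (fun x hx y hy => ?_) fun x y hx hy => by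
      rw [mul_add, add_smul]; exact add_mem hx hy
    have := mul_mem_smul_mul (ih x hx) (h y hy)
    rw [smul_mul_smul_comm, ← pow_succ, ← pow_succ, ← pow_succ] at this
    convert this using 2
    ring

/-- The elements that are integral multiples of `y` near the point `P`. -/
def locSpan (P : Ideal A) [P.IsPrime] (y : F) : Submodule A F where
  carrier := {x | ∃ s ∉ P, ∃ a : A, s • x = a • y}
  zero_mem' := ⟨1, (Ideal.ne_top_iff_one P).mp (Ideal.IsPrime.ne_top ‹_›), 0, by simp⟩
  add_mem' := by
    rintro x z ⟨s, hs, a, ha⟩ ⟨t, ht, b, hb⟩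
    refine ⟨s * t, Ideal.IsPrime.mul_notMem ‹_› hs ht, t * a + s * b, ?_⟩
    rw [smul_add, add_smul, mul_smul t a, mul_smul s b, ← ha, ← hb, mul_smul, mul_smul,
      smul_comm s t x]
  smul_mem' := by
    rintro c x ⟨s, hs, a, ha⟩
    exact ⟨s, hs, c * a, by rw [smul_comm, ha, mul_smul]⟩

lemma mul_mem_locSpan {P : Ideal A} [P.IsPrime] {x y x' y' : F} (h : x ∈ locSpan P y)
    (h' : x' ∈ locSpan P y') : x * x' ∈ locSpan P (y * y') := by
  obtain ⟨s, hs, a, ha⟩ := h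
  obtain ⟨t, ht, b, hb⟩ := h'
  exact ⟨s * t, Ideal.IsPrime.mul_notMem ‹_› hs ht, a * b, by
    rw [← smul_mul_smul_comm, ha, hb, smul_mul_smul_comm]⟩

lemma pow_le_locSpan {P : Ideal A} [P.IsPrime] {N : Submodule A F} {y : F} (h : N ≤ locSpan P y)
    (k : ℕ) : N ^ k ≤ locSpan P (y ^ k) := by
  induction k with
  | zero =>
    intro x hx
    obtain ⟨a, rfl⟩ := Submodule.mem_one.mp (by simpa using hx)
    exact ⟨1, (Ideal.ne_top_iff_one P).mp (Ideal.IsPrime.ne_top ‹_›), a, by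
      simp [Algebra.smul_def]⟩
  | succ k ih =>
    rw [pow_succ, pow_succ, Submodule.mul_le]
    exact fun m hm n hn => mul_mem_locSpan (ih hm) (h hn)

lemma smul_le_locSpan {P I : Ideal A} [P.IsPrime] {N : Submodule A F} {y : F} {π σ : A}
    (hN : N ≤ locSpan P y) (hσ : σ ∉ P) (h : ∀ x ∈ I, ∃ a, σ * x = a * π) :
    I • N ≤ locSpan P (π • y) := by
  rw [Submodule.smul_le]
  intro x hx n hn
  obtain ⟨a, ha⟩ := h x hx
  obtain ⟨s, hs, b, hb⟩ := hN hn
  refine ⟨σ * s, Ideal.IsPrime.mul_notMem ‹_› hσ hs, a * b, ?_⟩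
  rw [smul_smul, show σ * s * x = (σ * x) * s by ring, ha, mul_smul, hb, smul_smul, smul_smul]
  congr 1
  ring

end Submodules

lemma exists_pow_mul_eq {P : Ideal A} {π σ : A} (h : ∀ x ∈ P, ∃ a, σ * x = a * π) (k : ℕ) :
    ∀ x ∈ P ^ k, ∃ a, σ ^ k * x = a * π ^ k := by
  induction k with
  | zero => exact fun x _ => ⟨x, by simp⟩
  | succ k ih =>
    intro x hx
    rw [pow_succ] at hx
    refine Submodule.mul_induction_on hx (fun x hx y hy => ?_) fun x y ⟨a, ha⟩ ⟨b, hb⟩ =>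
      ⟨a + b, by rw [mul_add, ha, hb, add_mul]⟩
    obtain ⟨a, ha⟩ := ih x hx
    obtain ⟨b, hb⟩ := h y hy
    refine ⟨a * b, ?_⟩
    calc σ ^ (k + 1) * (x * y) = (σ ^ k * x) * (σ * y) := by ring
      _ = _ := by rw [ha, hb]; ring

lemma exists_notMem_forall_mem_pow {q : Ideal A} [q.IsPrime] {ι : Type*} (Z : Finset ι)
    (P : ι → Ideal A) (h : ∀ i ∈ Z, ¬ P i ≤ q) (N : ℕ) :
    ∃ s ∉ q, ∀ i ∈ Z, s ∈ P i ^ N := by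
  classical
  have hprod : ¬ (∏ i ∈ Z, P i ^ N) ≤ q := by
    rw [Ideal.IsPrime.prod_le ‹_›]
    rintro ⟨i, hi, hle⟩
    exact h i hi (Ideal.IsPrime.le_of_pow_le hle)
  obtain ⟨s, hs, hsq⟩ := Set.not_subset.mp hprod
  refine ⟨s, hsq, fun i hi => ?_⟩
  exact (Ideal.prod_le_inf.trans (Finset.inf_le hi)) hs

variable (Q : Ideal A) [Q.IsPrime]

/-- Sections of `𝒪(r(K + D))` at the prime divisor `P` as elements of the function field, where
`c` is the module of sections of the canonical sheaf. -/
def logLattice (c : Submodule A Q.ResidueField) (D : QDivisor A) (r : ℕ) (P : PrimeDivisor A) :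
    Set Q.ResidueField :=
  {w | ∃ s ∉ P.1.asIdeal, ∀ t ∈ P.1.asIdeal ^ (⌊(r : ℚ) * D P⌋).toNat,
    (s * t) • w ∈ (P.1.asIdeal ^ (-⌊(r : ℚ) * D P⌋).toNat) • c ^ r}

/-- The element `v` of the function field generates `𝒪(r(K + D))` at `p`. -/
def IsLatticeGenerator (c : Submodule A Q.ResidueField) (D : QDivisor A) (r : ℕ) (p : Ideal A)
    (v : Q.ResidueField) : Prop :=
  (∃ s ∉ p, ∀ P : PrimeDivisor A, Q ≤ P.1.asIdeal → s • v ∈ logLattice Q c D r P) ∧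
    ∀ w, (∀ P : PrimeDivisor A, Q ≤ P.1.asIdeal → w ∈ logLattice Q c D r P) →
      ∃ s ∉ p, ∃ a : A, s • w = a • v

variable {Q}

lemma exists_eq_div_residueField (x : Q.ResidueField) :
    ∃ a b : A, b ∉ Q ∧ b • x = algebraMap A Q.ResidueField a := by
  obtain ⟨a, b, hb, rfl⟩ := IsFractionRing.div_surjective (A := A ⧸ Q) x
  obtain ⟨a, rfl⟩ := Ideal.Quotient.mk_surjective a
  obtain ⟨b, rfl⟩ := Ideal.Quotient.mk_surjective b
  have hbQ : b ∉ Q := fun h => (nonZeroDivisors.ne_zero hb) (Ideal.Quotient.eq_zero_iff_mem.mpr h)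
  refine ⟨a, b, hbQ, ?_⟩
  have h1 : algebraMap (A ⧸ Q) Q.ResidueField (Ideal.Quotient.mk Q b) =
    algebraMap A Q.ResidueField b := rfl
  have h2 : algebraMap (A ⧸ Q) Q.ResidueField (Ideal.Quotient.mk Q a) =
    algebraMap A Q.ResidueField a := rfl
  have hb0 : algebraMap A Q.ResidueField b ≠ 0 := by
    rwa [Ne, Ideal.algebraMap_residueField_eq_zero]
  rw [h1, h2, Algebra.smul_def, mul_div_cancel₀ _ hb0]

variable {c : Submodule A Q.ResidueField} {D : QDivisor A} {r : ℕ}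

lemma floor_mul_pow (P : PrimeDivisor A) (h : ∃ m : ℤ, (r : ℚ) * D P = m) (k : ℕ) :
    ⌊((r * k : ℕ) : ℚ) * D P⌋ = k * ⌊(r : ℚ) * D P⌋ := by
  obtain ⟨m, hm⟩ := h
  have : ((r * k : ℕ) : ℚ) * D P = ((k * m : ℤ) : ℚ) := by
    push_cast
    rw [← hm]
    ring
  rw [this, hm, Int.floor_intCast, Int.floor_intCast]

lemma toNat_mul_floor (k : ℕ) (m : ℤ) : ((k : ℤ) * m).toNat = m.toNat * k := by
  rcases le_total 0 m with h | h
  · lift m to ℕ using h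
    norm_cast
    exact mul_comm _ _
  · rw [Int.toNat_of_nonpos h, Int.toNat_of_nonpos (mul_nonpos_of_nonneg_of_nonpos (by positivity) h),
      zero_mul]

lemma IsLatticeGenerator.ne_zero (h1 : 1 ∈ c) {p : Ideal A} (hQp : Q ≤ p)
    (hQ : Q ∈ minimalPrimes A) {v : Q.ResidueField}
    (hv : IsLatticeGenerator Q c D r p v) : v ≠ 0 := by
  classical
  obtain ⟨s, hs, hsP⟩ := exists_notMem_forall_mem_pow (q := Q) D.support (fun P => P.1.asIdeal)
    (fun P _ hle => by
      obtain ⟨x, hx, hxQ⟩ := IsNormal.notMem_of_height_eq_one P.2 hQ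
      exact hxQ (hle hx)) (D.support.sup fun P => (-⌊(r : ℚ) * D P⌋).toNat)
  obtain ⟨t, ht, a, hta⟩ := hv.2 (algebraMap A _ s) fun P _ => by
    refine ⟨1, (Ideal.ne_top_iff_one _).mp P.1.2.ne_top, fun t _ => ?_⟩
    have hsmem : s ∈ P.1.asIdeal ^ (-⌊(r : ℚ) * D P⌋).toNat := by
      by_cases hP : P ∈ D.support
      · exact Ideal.pow_le_pow_right (Finset.le_sup (f := fun P => (-⌊(r : ℚ) * D P⌋).toNat) hP)
          (hsP P hP)
      · rw [Finsupp.notMem_support_iff.mp hP]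
        simp
    have : (1 * t) • algebraMap A Q.ResidueField s = s • (t • (1 : Q.ResidueField)) := by
      simp [Algebra.smul_def, mul_comm]
    rw [this]
    refine Submodule.smul_mem_smul hsmem (Submodule.smul_mem _ _ ?_)
    have := Submodule.pow_mem_pow c h1 r
    rwa [one_pow] at this
  rintro rfl
  rw [smul_zero, Algebra.smul_def, ← map_mul, Ideal.algebraMap_residueField_eq_zero] at hta
  exact (Ideal.IsPrime.mul_notMem ‹_› (fun h => ht (hQp h)) hs) hta

/-- Sections with prescribed order along a prime divisor. -/
lemma exists_mul_mem_logLattice [IsNoetherianRing A] (hA : IsNormal A) (hQ : Q ∈ minimalPrimes A)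
    (P₀ : PrimeDivisor A) (hQP : Q ≤ P₀.1.asIdeal) {π σ : A} (hπ : π ∈ P₀.1.asIdeal) (hπQ : π ∉ Q)
    (hσ : σ ∉ P₀.1.asIdeal) (hπσ : ∀ x ∈ P₀.1.asIdeal, ∃ a, σ * x = a * π) :
    ∃ s ∉ P₀.1.asIdeal, ∀ P : PrimeDivisor A, Q ≤ P.1.asIdeal → ∀ x ∈ c ^ r,
      s • (algebraMap A Q.ResidueField π ^ (-⌊(r : ℚ) * D P₀⌋) * x) ∈ logLattice Q c D r P := by
  classical
  set n := ⌊(r : ℚ) * D P₀⌋ with hn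
  have hπ0 : algebraMap A Q.ResidueField π ≠ 0 := by
    rwa [Ne, Ideal.algebraMap_residueField_eq_zero]
  -- the divisors on which the given function or the divisor `D` may have a pole
  have hfin : {P : PrimeDivisor A | Q ≤ P.1.asIdeal ∧ π ∈ P.1.asIdeal}.Finite := by
    have hf : ((Q ⊔ Ideal.span {π}).minimalPrimes).Finite := Ideal.finite_minimalPrimes_of_isNoetherianRing A _
    refine Set.Finite.of_finite_image (f := fun P : PrimeDivisor A => P.1.asIdeal)
      (hf.subset ?_) (fun P _ P' _ h => Subtype.ext (PrimeSpectrum.ext h))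
    rintro _ ⟨P, ⟨hQP, hπP⟩, rfl⟩
    refine ⟨⟨P.1.2, sup_le hQP ((Ideal.span_singleton_le_iff_mem _).mpr hπP)⟩, ?_⟩
    rintro I ⟨hI, hle⟩ hIP
    by_contra hne
    have hlt : I < P.1.asIdeal := lt_of_le_of_ne hIP fun h => hne h.ge
    have h1 := Ideal.height_add_one_le_of_lt_of_isPrime hlt
    have hI0 : I.height = 0 := by
      rw [P.2] at h1
      have h2 : I.height + 1 ≤ 0 + 1 := by simpa using h1
      exact le_bot_iff.mp ((ENat.addLECancellable_of_ne_top ENat.one_ne_top).add_le_add_iff_right.mp h2)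
    have hImin : I ∈ minimalPrimes A := Ideal.height_eq_zero_iff.mp hI0
    have hQI : I ≤ Q := hImin.2 ⟨‹_›, bot_le⟩ (le_sup_left.trans hle)
    exact hπQ (hQI (hle (Ideal.mem_sup_right (Ideal.mem_span_singleton_self π))))
  set Z : Finset (PrimeDivisor A) :=
    ((hfin.toFinset ∪ D.support).filter fun P => Q ≤ P.1.asIdeal).erase P₀ with hZ
  have hex : ∀ P : PrimeDivisor A, ∃ m : ℕ, Q ≤ P.1.asIdeal → ∃ τ ∉ P.1.asIdeal, ∀ k,
      ∀ s ∈ P.1.asIdeal ^ (m + k), ∃ a ∈ P.1.asIdeal ^ k, τ * s = a * π ^ n.toNat := by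
    intro P
    by_cases hP : Q ≤ P.1.asIdeal
    · obtain ⟨m, τ, h⟩ := hA.exists_pow_dvd P.2 hQ hP
        (fun h => hπQ (Ideal.IsPrime.mem_of_pow_mem ‹_› _ h) : π ^ n.toNat ∉ Q)
      exact ⟨m, fun _ => ⟨τ, h⟩⟩
    · exact ⟨0, fun h => absurd h hP⟩
  choose m hm using hex
  obtain ⟨s, hs, hsP⟩ := exists_notMem_forall_mem_pow (q := P₀.1.asIdeal) Z (fun P => P.1.asIdeal)
    (fun P hP hle => by
      rw [hZ, Finset.mem_erase] at hP
      refine hP.1 (Subtype.ext (PrimeSpectrum.ext ?_))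
      by_contra hne
      have h1 := Ideal.height_add_one_le_of_lt_of_isPrime (lt_of_le_of_ne hle hne)
      rw [P.2, P₀.2] at h1
      exact absurd h1 (by decide)) (Z.sup fun P => m P + (-⌊(r : ℚ) * D P⌋).toNat)
  refine ⟨s, hs, fun P hP x hx => ?_⟩
  have hpow : π ^ n.toNat • (s • (algebraMap A Q.ResidueField π ^ (-n) * x)) =
      (s * π ^ (-n).toNat) • x := by
    have hz : algebraMap A Q.ResidueField π ^ n.toNat * algebraMap A Q.ResidueField π ^ (-n) =
        algebraMap A Q.ResidueField π ^ (-n).toNat := by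
      rw [← zpow_natCast, ← zpow_natCast, ← zpow_add₀ hπ0]
      congr 1
      omega
    simp only [Algebra.smul_def, map_mul, map_pow]
    rw [← hz]
    ring
  by_cases hPP : P = P₀
  · subst hPP
    refine ⟨σ ^ n.toNat, fun h => hσ (Ideal.IsPrime.mem_of_pow_mem P.1.2 _ h), fun t ht => ?_⟩
    obtain ⟨a, ha⟩ := exists_pow_mul_eq hπσ _ t ht
    have : (σ ^ n.toNat * t) • s • (algebraMap A Q.ResidueField π ^ (-n) * x) =
        π ^ (-n).toNat • a • s • x := by
      rw [ha, mul_smul, ← hn, hpow, smul_smul, smul_smul, smul_smul]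
      congr 1
      ring
    rw [this]
    exact Submodule.smul_mem_smul (Ideal.pow_mem_pow hπ _)
      (Submodule.smul_mem _ _ (Submodule.smul_mem _ _ hx))
  · by_cases hPZ : P ∈ Z
    · obtain ⟨τ, hτ, hτm⟩ := hm P hP
      obtain ⟨a, ha, hta⟩ := hτm _ s (Ideal.pow_le_pow_right
        (Finset.le_sup (f := fun P => m P + (-⌊(r : ℚ) * D P⌋).toNat) hPZ) (hsP P hPZ))
      refine ⟨τ, hτ, fun t _ => ?_⟩
      have : (τ * t) • s • (algebraMap A Q.ResidueField π ^ (-n) * x) =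
          a • ((t * π ^ (-n).toNat) • x) := by
        have hz : algebraMap A Q.ResidueField π ^ n.toNat * algebraMap A Q.ResidueField π ^ (-n) =
            algebraMap A Q.ResidueField π ^ (-n).toNat := by
          rw [← zpow_natCast, ← zpow_natCast, ← zpow_add₀ hπ0]
          congr 1
          omega
        rw [smul_smul, show τ * t * s = t * (τ * s) by ring, hta]
        simp only [Algebra.smul_def, map_mul, map_pow]
        rw [← hz]
        ring
      rw [this]
      exact Submodule.smul_mem_smul ha (Submodule.smul_mem _ _ hx)
    · have hπP : π ∉ P.1.asIdeal := fun h => hPZ (by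
        rw [hZ, Finset.mem_erase, Finset.mem_filter, Finset.mem_union, Set.Finite.mem_toFinset]
        exact ⟨hPP, Or.inl ⟨hP, h⟩, hP⟩)
      have hDP : D P = 0 := by
        by_contra hne
        refine hPZ ?_
        rw [hZ, Finset.mem_erase, Finset.mem_filter, Finset.mem_union, Finsupp.mem_support_iff]
        exact ⟨hPP, Or.inr hne, hP⟩
      refine ⟨π ^ n.toNat, fun h => hπP (Ideal.IsPrime.mem_of_pow_mem P.1.2 _ h), fun t _ => ?_⟩
      rw [mul_comm (π ^ n.toNat), mul_smul, hpow, hDP]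
      simp only [mul_zero, Int.floor_zero, neg_zero, Int.toNat_zero, pow_zero, Ideal.one_eq_top,
        Submodule.top_smul]
      exact Submodule.smul_mem _ _ (Submodule.smul_mem _ _ hx)

/-- Powers of generators of `𝒪(r(K + D))` generate `𝒪(rk(K + D))`. -/
lemma IsLatticeGenerator.pow [IsNoetherianRing A] (hA : IsNormal A) (hQ : Q ∈ minimalPrimes A)
    (h1 : 1 ∈ c) {p : Ideal A} [p.IsPrime] (hQp : Q ≤ p)
    (hD : ∀ P : PrimeDivisor A, ∃ m : ℤ, (r : ℚ) * D P = m)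
    {v : Q.ResidueField} (hv : IsLatticeGenerator Q c D r p v) (k : ℕ) :
    IsLatticeGenerator Q c D (r * k) p (v ^ k) := by
  have hv0 := hv.ne_zero h1 hQp hQ
  constructor
  · obtain ⟨s, hs, hsv⟩ := hv.1
    refine ⟨s ^ k, fun h => hs (Ideal.IsPrime.mem_of_pow_mem ‹_› _ h), fun P hP => ?_⟩
    obtain ⟨σ, hσ, hσt⟩ := hsv P hP
    refine ⟨σ ^ k, fun h => hσ (Ideal.IsPrime.mem_of_pow_mem P.1.2 _ h), fun t ht => ?_⟩
    have hneg : (-(k * ⌊(r : ℚ) * D P⌋)).toNat = (-⌊(r : ℚ) * D P⌋).toNat * k := by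
      rw [← mul_neg, toNat_mul_floor]
    rw [floor_mul_pow P (hD P), toNat_mul_floor, pow_mul] at ht
    rw [floor_mul_pow P (hD P), hneg, pow_mul, pow_mul, ← smul_pow s v k]
    exact pow_smul_pow_mem hσt k t ht
  · intro w hw
    obtain ⟨b, g, hg, hgw⟩ := exists_eq_div_residueField (w * (v ^ k)⁻¹)
    have hgw' : g • w = b • v ^ k := by
      rw [Algebra.smul_def b, ← hgw, smul_mul_assoc, mul_assoc, inv_mul_cancel₀ (pow_ne_zero k hv0),
        mul_one]
    have key : ∀ (s a : A), s • w = a • v ^ k ↔ s * b - a * g ∈ Q := by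
      intro s a
      have hg0 : algebraMap A Q.ResidueField g ≠ 0 := by
        rwa [Ne, Ideal.algebraMap_residueField_eq_zero]
      rw [← Ideal.algebraMap_residueField_eq_zero, map_sub, sub_eq_zero, map_mul, map_mul]
      constructor
      · intro h
        refine mul_right_cancel₀ (pow_ne_zero k hv0) ?_
        simp only [Algebra.smul_def] at h hgw'
        rw [mul_assoc, ← hgw', mul_left_comm, h]
        ring
      · intro h
        refine mul_left_cancel₀ hg0 ?_
        simp only [Algebra.smul_def] at hgw' ⊢
        rw [mul_left_comm, hgw', ← mul_assoc, h]
        ring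
    obtain ⟨s, hs, a, hsa⟩ := hA.exists_mul_sub_mem hQ hQp hg (b := b) (by
      intro P hP hht hPp hQP
      obtain ⟨π, hπ, hπmin, σ, hσ, hπσ⟩ := hA.exists_uniformizer hht
      have hπQ := hπmin Q hQ hQP
      have hπ0 : algebraMap A Q.ResidueField π ≠ 0 := by
        rwa [Ne, Ideal.algebraMap_residueField_eq_zero]
      let P₀ : PrimeDivisor A := ⟨⟨P, hP⟩, hht⟩
      obtain ⟨s₀, hs₀, hs₀P⟩ := exists_mul_mem_logLattice (c := c) (D := D) (r := r) hA hQ P₀ hQP hπ hπQ hσ hπσ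
      set n := ⌊(r : ℚ) * D P₀⌋ with hn
      have hcr : c ^ r ≤ locSpan P (algebraMap A Q.ResidueField π ^ n * v) := by
        intro x hx
        obtain ⟨t, ht, a, hta⟩ := hv.2 _ fun P' hP' => hs₀P P' hP' x hx
        refine ⟨t * s₀, Ideal.IsPrime.mul_notMem ‹_› (fun h => ht (hPp h)) hs₀, a, ?_⟩
        rw [smul_smul] at hta
        calc (t * s₀) • x = algebraMap A Q.ResidueField π ^ n *
            ((t * s₀) • (algebraMap A Q.ResidueField π ^ (-n) * x)) := by
              rw [mul_smul_comm, ← mul_assoc, ← zpow_add₀ hπ0, add_neg_cancel, zpow_zero, one_mul]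
          _ = _ := by rw [hta, mul_smul_comm]
      obtain ⟨τ, hτ, hτt⟩ := hw P₀ hQP
      rw [floor_mul_pow P₀ (hD P₀), ← hn] at hτt
      have hmem := hτt (π ^ ((k : ℤ) * n).toNat) (Ideal.pow_mem_pow hπ _)
      rw [pow_mul c] at hmem
      obtain ⟨s, hs, a, hsa⟩ := smul_le_locSpan (P := P) (pow_le_locSpan hcr k)
        (fun h => hσ (Ideal.IsPrime.mem_of_pow_mem hP _ h))
        (exists_pow_mul_eq hπσ (-((k : ℤ) * n)).toNat) hmem
      refine ⟨s * τ, Ideal.IsPrime.mul_notMem hP hs hτ, a, (key _ _).mp ?_⟩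
      have hz : algebraMap A Q.ResidueField π ^ ((k : ℤ) * n).toNat =
          algebraMap A Q.ResidueField π ^ (-((k : ℤ) * n)).toNat *
            (algebraMap A Q.ResidueField π ^ n) ^ k := by
        rw [← zpow_natCast, ← zpow_natCast, ← zpow_natCast, ← zpow_mul, ← zpow_add₀ hπ0]
        congr 1
        rw [mul_comm n]
        omega
      refine mul_left_cancel₀ (pow_ne_zero ((k : ℤ) * n).toNat hπ0) ?_
      simp only [Algebra.smul_def, map_mul, map_pow] at hsa ⊢
      rw [mul_left_comm (_ ^ _) (algebraMap A Q.ResidueField a), hz]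
      rw [hz] at hsa
      rw [mul_pow] at hsa
      linear_combination hsa)
    exact ⟨s, hs, a, (key s a).mpr hsa⟩

/-- Two generators differ by a unit. -/
lemma IsLatticeGenerator.exists_unit (h1 : 1 ∈ c) {p : Ideal A} [p.IsPrime] (hQp : Q ≤ p)
    (hQ : Q ∈ minimalPrimes A)
    {v v' : Q.ResidueField} (hv : IsLatticeGenerator Q c D r p v)
    (hv' : IsLatticeGenerator Q c D r p v') : ∃ s ∉ p, ∃ a ∉ p, s • v' = a • v := by
  have hv0 := hv'.ne_zero h1 hQp hQ
  obtain ⟨s, hs, hsP⟩ := hv.1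
  obtain ⟨s', hs', hsP'⟩ := hv'.1
  obtain ⟨t, ht, a, hta⟩ := hv'.2 _ hsP
  obtain ⟨t', ht', a', hta'⟩ := hv.2 _ hsP'
  rw [smul_smul] at hta hta'
  refine ⟨t' * s', Ideal.IsPrime.mul_notMem ‹_› ht' hs', a', fun ha' => ?_, hta'⟩
  have : ((t' * s') * (t * s)) • v' = (a' * a) • v' := by
    rw [mul_comm, mul_smul, hta', smul_comm, hta, smul_smul]
  have hQ' : t' * s' * (t * s) - a' * a ∈ Q := by
    rw [← Ideal.algebraMap_residueField_eq_zero, map_sub, sub_eq_zero]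
    simp only [Algebra.smul_def] at this
    exact mul_right_cancel₀ hv0 this
  refine Ideal.IsPrime.mul_notMem ‹_› (Ideal.IsPrime.mul_notMem ‹_› ht' hs')
    (Ideal.IsPrime.mul_notMem ‹_› ht hs) ?_
  exact (Submodule.sub_mem_iff_left p (p.mul_mem_right a ha')).mp (hQp hQ')

end FractionalIdeals

section Forms

variable {A : Type*} [CommRing A] {Q : Ideal A} [Q.IsPrime]

/-- The total ring of fractions maps to the function field of a component. -/
def fracResidue (hQ : Q ∈ minimalPrimes A) : FractionRing A →+* Q.ResidueField :=
  IsLocalization.lift (M := nonZeroDivisors A) (g := algebraMap A Q.ResidueField) fun y =>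
    isUnit_iff_ne_zero.mpr fun h => by
      rw [Ideal.algebraMap_residueField_eq_zero] at h
      exact notMem_nonZeroDivisors_of_mem_mem_minimalPrimes h hQ y.2

@[simp]
lemma fracResidue_algebraMap (hQ : Q ∈ minimalPrimes A) (a : A) :
    fracResidue hQ (algebraMap A (FractionRing A) a) = algebraMap A Q.ResidueField a :=
  IsLocalization.lift_eq _ a

lemma mem_nonZeroDivisors_of_forall_notMem [IsReduced A] {a : A}
    (h : ∀ P ∈ minimalPrimes A, a ∉ P) : a ∈ nonZeroDivisors A := by
  rw [mem_nonZeroDivisors_iff_right]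
  intro x hx
  have : x ∈ nilradical A := by
    rw [nilradical, ← Ideal.sInf_minimalPrimes, Submodule.mem_sInf]
    intro P hP
    have hP' : Ideal.IsPrime P := hP.1.1
    exact (hP'.mem_or_mem (hx ▸ P.zero_mem : x * a ∈ P)).resolve_right (h P hP)
  rwa [nilradical_eq_zero] at this

lemma eq_zero_of_forall_mem [IsReduced A] {a : A} (h : ∀ P ∈ minimalPrimes A, a ∈ P) : a = 0 := by
  have : a ∈ nilradical A := by
    rw [nilradical, ← Ideal.sInf_minimalPrimes, Submodule.mem_sInf]
    exact h
  rwa [nilradical_eq_zero] at this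

/-- `e` is the idempotent of the component `Q`. -/
def IsComponentIdempotent (Q : Ideal A) (e : A) : Prop :=
  1 - e ∈ Q ∧ ∀ Q' ∈ minimalPrimes A, Q' ≠ Q → e ∈ Q'

lemma IsComponentIdempotent.algebraMap_eq_one {e : A} (he : IsComponentIdempotent Q e) :
    algebraMap A Q.ResidueField e = 1 := by
  have := (Ideal.algebraMap_residueField_eq_zero (I := Q)).mpr he.1
  rw [map_sub, map_one, sub_eq_zero] at this
  exact this.symm

lemma IsComponentIdempotent.mul_eq_zero [IsReduced A] {e a : A} (he : IsComponentIdempotent Q e)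
    (ha : a ∈ Q) : e * a = 0 := by
  refine eq_zero_of_forall_mem fun P hP => ?_
  by_cases h : P = Q
  · exact h ▸ Q.mul_mem_left e ha
  · exact P.mul_mem_right a (he.2 P hP h)

lemma IsComponentIdempotent.mem_nonZeroDivisors [IsReduced A] {e s : A}
    (he : IsComponentIdempotent Q e) (hs : s ∉ Q) : s * e + (1 - e) ∈ nonZeroDivisors A := by
  refine mem_nonZeroDivisors_of_forall_notMem fun P hP h => ?_
  have hP' : P.IsPrime := hP.1.1
  by_cases hPQ : P = Q
  · subst hPQ
    have h1 : s * e ∈ P := (Submodule.add_mem_iff_left P he.1).mp h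
    have h2 : e ∈ P := (hP'.mem_or_mem h1).resolve_left hs
    have := P.add_mem he.1 h2
    rw [sub_add_cancel] at this
    exact hP'.ne_top ((Ideal.eq_top_iff_one P).mpr this)
  · have he' := he.2 P hP hPQ
    have h1 : (1 - e) ∈ P := (Submodule.add_mem_iff_right P (P.mul_mem_left s he')).mp h
    have := P.add_mem h1 he'
    rw [sub_add_cancel] at this
    exact hP'.ne_top ((Ideal.eq_top_iff_one P).mpr this)

lemma IsComponentIdempotent.smul_eq_zero [IsReduced A] {e : A} (he : IsComponentIdempotent Q e)
    (hQ : Q ∈ minimalPrimes A) {x : FractionRing A} (hx : fracResidue hQ x = 0) : e • x = 0 := by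
  obtain ⟨⟨a, s⟩, has⟩ := IsLocalization.surj (nonZeroDivisors A) x
  have h1 : a ∈ Q := by
    rw [← Ideal.algebraMap_residueField_eq_zero, ← fracResidue_algebraMap hQ, ← has, map_mul, hx,
      zero_mul]
  have hu := IsLocalization.map_units (FractionRing A) s
  refine hu.mul_left_eq_zero.mp ?_
  rw [smul_mul_assoc, has, Algebra.smul_def, ← map_mul, he.mul_eq_zero h1, map_zero]

variable {O : Type*} [CommRing O] [Algebra O A] {d : ℕ}

/-- The value of a rational `d`-form with respect to a basis of the differentials of the function
field of a component. -/
def wedgeValue (hQ : Q ∈ minimalPrimes A) (b : Module.Basis (Fin d) Q.ResidueField Ω[Q.ResidueField⁄O]) :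
    (⋀[FractionRing A]^d Ω[FractionRing A⁄O]) →ₗ[A] Q.ResidueField :=
  letI : Algebra (FractionRing A) Q.ResidueField := (fracResidue hQ).toAlgebra
  haveI : IsScalarTower A (FractionRing A) Q.ResidueField :=
    IsScalarTower.of_algebraMap_eq fun a => (fracResidue_algebraMap hQ a).symm
  haveI : IsScalarTower O (FractionRing A) Q.ResidueField :=
    IsScalarTower.of_algebraMap_eq fun a => by
      rw [IsScalarTower.algebraMap_apply O A (FractionRing A),
        ← IsScalarTower.algebraMap_apply A (FractionRing A), ← IsScalarTower.algebraMap_apply]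
  LinearMap.restrictScalars A (exteriorPower.alternatingMapLinearEquiv (R := FractionRing A)
      { (b.det.toMultilinearMap.restrictScalars (FractionRing A)).compLinearMap
          fun _ => KaehlerDifferential.map O O (FractionRing A) Q.ResidueField with
        map_eq_zero_of_eq' := fun v i j hij hne =>
          b.det.map_eq_zero_of_eq
            (fun i => KaehlerDifferential.map O O (FractionRing A) Q.ResidueField (v i))
            (by simp [hij]) hne })

lemma wedgeValue_smul (hQ : Q ∈ minimalPrimes A) (b : Module.Basis (Fin d) Q.ResidueField Ω[Q.ResidueField⁄O])
    (x : FractionRing A) (θ : ⋀[FractionRing A]^d Ω[FractionRing A⁄O]) :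
    wedgeValue hQ b (x • θ) = fracResidue hQ x * wedgeValue hQ b θ := by
  letI : Algebra (FractionRing A) Q.ResidueField := (fracResidue hQ).toAlgebra
  unfold wedgeValue
  rw [LinearMap.restrictScalars_apply, LinearMap.map_smul]
  rfl

lemma wedgeValue_wedgeD (hQ : Q ∈ minimalPrimes A) (b : Module.Basis (Fin d) Q.ResidueField Ω[Q.ResidueField⁄O])
    (f : Fin d → A) : wedgeValue hQ b (wedgeD O f) =
      b.det fun i => KaehlerDifferential.D O Q.ResidueField (algebraMap A Q.ResidueField (f i)) := by
  letI : Algebra (FractionRing A) Q.ResidueField := (fracResidue hQ).toAlgebra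
  haveI : IsScalarTower A (FractionRing A) Q.ResidueField :=
    IsScalarTower.of_algebraMap_eq fun a => (fracResidue_algebraMap hQ a).symm
  haveI : IsScalarTower O (FractionRing A) Q.ResidueField :=
    IsScalarTower.of_algebraMap_eq fun a => by
      rw [IsScalarTower.algebraMap_apply O A (FractionRing A),
        ← IsScalarTower.algebraMap_apply A (FractionRing A), ← IsScalarTower.algebraMap_apply]
  unfold wedgeValue wedgeD
  rw [LinearMap.restrictScalars_apply, exteriorPower.alternatingMapLinearEquiv_apply_ιMulti]
  change b.det (fun i => KaehlerDifferential.map O O (FractionRing A) Q.ResidueField _) = _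
  simp only [KaehlerDifferential.map_D, ← IsScalarTower.algebraMap_apply A (FractionRing A)]

/-- The value of a rational `r`-fold `d`-form. -/
def formValue (hQ : Q ∈ minimalPrimes A) (b : Module.Basis (Fin d) Q.ResidueField Ω[Q.ResidueField⁄O])
    (r : ℕ) : RationalForms O A d r →ₗ[A] Q.ResidueField :=
  letI : Algebra (FractionRing A) Q.ResidueField := (fracResidue hQ).toAlgebra
  haveI : IsScalarTower A (FractionRing A) Q.ResidueField :=
    IsScalarTower.of_algebraMap_eq fun a => (fracResidue_algebraMap hQ a).symm
  LinearMap.restrictScalars A (PiTensorProduct.lift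
    ((MultilinearMap.mkPiAlgebra (FractionRing A) (Fin r) Q.ResidueField).compLinearMap fun _ =>
      { wedgeValue hQ b with map_smul' := fun x θ => wedgeValue_smul hQ b x θ }))

lemma formValue_smul (hQ : Q ∈ minimalPrimes A) (b : Module.Basis (Fin d) Q.ResidueField Ω[Q.ResidueField⁄O])
    {r : ℕ} (x : FractionRing A) (ξ : RationalForms O A d r) :
    formValue hQ b r (x • ξ) = fracResidue hQ x * formValue hQ b r ξ := by
  letI : Algebra (FractionRing A) Q.ResidueField := (fracResidue hQ).toAlgebra
  unfold formValue
  rw [LinearMap.restrictScalars_apply, LinearMap.map_smul]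
  rfl

lemma formValue_tprod (hQ : Q ∈ minimalPrimes A) (b : Module.Basis (Fin d) Q.ResidueField Ω[Q.ResidueField⁄O])
    {r : ℕ} (θ : Fin r → ⋀[FractionRing A]^d Ω[FractionRing A⁄O]) :
    formValue hQ b r (PiTensorProduct.tprod (FractionRing A) θ) = ∏ i, wedgeValue hQ b (θ i) := by
  letI : Algebra (FractionRing A) Q.ResidueField := (fracResidue hQ).toAlgebra
  unfold formValue
  rw [LinearMap.restrictScalars_apply, PiTensorProduct.lift.tprod]
  rfl

lemma formValue_wedgeDPow (hQ : Q ∈ minimalPrimes A) (b : Module.Basis (Fin d) Q.ResidueField Ω[Q.ResidueField⁄O])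
    {r : ℕ} (f : Fin d → A) : formValue hQ b r (wedgeDPow O r f) = wedgeValue hQ b (wedgeD O f) ^ r := by
  unfold wedgeDPow
  rw [formValue_tprod, Finset.prod_const, Finset.card_univ, Fintype.card_fin]

/-- The functions `f` are generic coordinates of the component `Q`: their differentials form the
basis `b` of the differentials of the function field, and generate the differentials. -/
structure IsGenericBasis (b : Module.Basis (Fin d) Q.ResidueField Ω[Q.ResidueField⁄O]) (f : Fin d → A) :
    Prop where
  basis_eq : ∀ i, b i = KaehlerDifferential.D O Q.ResidueField (algebraMap A Q.ResidueField (f i))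
  exists_smul_mem : ∃ s ∉ Q, ∀ ω : Ω[A⁄O], s • ω ∈ Submodule.span A
      (Set.range fun i => KaehlerDifferential.D O A (f i))

variable {b : Module.Basis (Fin d) Q.ResidueField Ω[Q.ResidueField⁄O]} {f : Fin d → A}

lemma IsGenericBasis.wedgeValue_eq_one (hQ : Q ∈ minimalPrimes A) (hf : IsGenericBasis b f) :
    wedgeValue hQ b (wedgeD O f) = 1 := by
  rw [wedgeValue_wedgeD]
  simp only [← hf.basis_eq]
  exact b.det_self

lemma IsGenericBasis.formValue_eq_one (hQ : Q ∈ minimalPrimes A) (hf : IsGenericBasis b f) (r : ℕ) :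
    formValue hQ b r (wedgeDPow O r f) = 1 := by
  rw [formValue_wedgeDPow, hf.wedgeValue_eq_one, one_pow]

lemma exists_smul_eq_smul_wedgeD {s : A} (hs : ∀ ω : Ω[A⁄O], s • ω ∈ Submodule.span A
      (Set.range fun i => KaehlerDifferential.D O A (f i)))
    (θ : ⋀[FractionRing A]^d Ω[FractionRing A⁄O]) :
    (algebraMap A (FractionRing A) s) ^ d • θ ∈ Submodule.span (FractionRing A) {wedgeD O f} := by
  set F := FractionRing A
  have h1 : ∀ ω : Ω[F⁄O], algebraMap A F s • ω ∈ Submodule.span F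
      (Set.range fun i => KaehlerDifferential.D O F (algebraMap A F (f i))) := by
    intro ω
    have hω : ω ∈ Submodule.span F (Set.range (KaehlerDifferential.map O O A F ∘ KaehlerDifferential.D O A)) := by
      rw [KaehlerDifferential.span_range_map_derivation_of_isLocalization O A F (nonZeroDivisors A)]
      trivial
    refine Submodule.span_induction ?_ (by simp) (fun a b _ _ ha hb => by
      rw [smul_add]; exact add_mem ha hb) (fun c a _ ha => by
      rw [smul_comm]; exact Submodule.smul_mem _ c ha) hω
    rintro _ ⟨a, rfl⟩
    have h2 := hs (KaehlerDifferential.D O A a)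
    rw [Function.comp_apply, algebraMap_smul, ← map_smul]
    refine Submodule.span_induction ?_ (by simp) (fun a b _ _ ha hb => by
      rw [map_add]; exact add_mem ha hb) (fun c a _ ha => by
      rw [map_smul, ← algebraMap_smul F c]; exact Submodule.smul_mem _ _ ha) h2
    rintro _ ⟨i, rfl⟩
    rw [KaehlerDifferential.map_D]
    exact Submodule.subset_span ⟨i, rfl⟩
  have hθ : θ ∈ Submodule.span F (Set.range (exteriorPower.ιMulti F d (M := Ω[F⁄O]))) := by
    rw [exteriorPower.ιMulti_span]; trivial
  refine Submodule.span_induction ?_ (by simp) (fun a b _ _ ha hb => by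
      rw [smul_add]; exact add_mem ha hb) (fun c a _ ha => by
      rw [smul_comm]; exact Submodule.smul_mem _ c ha) hθ
  rintro _ ⟨v, rfl⟩
  have h2 := fun i => h1 (v i)
  simp only [Submodule.mem_span_range_iff_exists_fun] at h2
  choose c hc using h2
  have h3 := (exteriorPower.ιMulti F d (M := Ω[F⁄O])).toMultilinearMap.map_smul_univ
    (fun _ => algebraMap A F s) v
  rw [Finset.prod_const, Finset.card_univ, Fintype.card_fin] at h3
  have h4 : (fun i => algebraMap A F s • v i) = fun i =>
      ∑ j, c i j • KaehlerDifferential.D O F (algebraMap A F (f j)) := by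
    funext i; exact (hc i).symm
  rw [h4, MultilinearMap.map_sum] at h3
  refine (h3 : _ = (algebraMap A F s) ^ d • exteriorPower.ιMulti F d v) ▸ Submodule.sum_mem _ fun σ _ => ?_
  rw [MultilinearMap.map_smul_univ (exteriorPower.ιMulti F d (M := Ω[F⁄O])).toMultilinearMap
    (fun i => c i (σ i)) (fun i => KaehlerDifferential.D O F (algebraMap A F (f (σ i))))]
  refine Submodule.smul_mem _ _ ?_
  by_cases hσ : Function.Injective σ
  · let τ : Equiv.Perm (Fin d) := Equiv.ofBijective σ (Finite.injective_iff_bijective.mp hσ)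
    have h5 := (exteriorPower.ιMulti F d (M := Ω[F⁄O])).map_perm
      (fun i => KaehlerDifferential.D O F (algebraMap A F (f i))) τ
    have h6 : (exteriorPower.ιMulti F d (M := Ω[F⁄O])).toMultilinearMap
        (fun i => KaehlerDifferential.D O F (algebraMap A F (f (σ i)))) =
        Equiv.Perm.sign τ • wedgeD O f := h5
    rw [h6, Units.smul_def]
    exact zsmul_mem (Submodule.mem_span_singleton_self _) _
  · have h6 : (exteriorPower.ιMulti F d (M := Ω[F⁄O])).toMultilinearMap
        (fun i => KaehlerDifferential.D O F (algebraMap A F (f (σ i)))) = 0 := by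
      rw [Function.not_injective_iff] at hσ
      obtain ⟨i, j, hij, hne⟩ := hσ
      exact (exteriorPower.ιMulti F d (M := Ω[F⁄O])).map_eq_zero_of_eq _
        (by simp only [hij]) hne
    rw [h6]
    exact zero_mem _

lemma exists_smul_eq_smul_wedgeDPow {s : A} (hs : ∀ ω : Ω[A⁄O], s • ω ∈ Submodule.span A
      (Set.range fun i => KaehlerDifferential.D O A (f i))) {r : ℕ} (ξ : RationalForms O A d r) :
    ∃ x : FractionRing A, s ^ (d * r) • ξ = x • wedgeDPow O r f := by
  set F := FractionRing A
  have key : (algebraMap A F s ^ d) ^ r • ξ ∈ Submodule.span F {wedgeDPow O r f} := by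
    have hξ : ξ ∈ Submodule.span F (Set.range (PiTensorProduct.tprod F
        (s := fun _ : Fin r => ⋀[F]^d Ω[F⁄O]))) := by
      rw [PiTensorProduct.span_tprod_eq_top]; trivial
    refine Submodule.span_induction ?_ (by simp) (fun a b _ _ ha hb => by
      rw [smul_add]; exact add_mem ha hb) (fun c a _ ha => by
      rw [smul_comm]; exact Submodule.smul_mem _ c ha) hξ
    rintro _ ⟨θ, rfl⟩
    have h2 := fun i => exists_smul_eq_smul_wedgeD (f := f) hs (θ i)
    simp only [Submodule.mem_span_singleton] at h2
    choose c hc using h2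
    have h3 := (PiTensorProduct.tprod F (s := fun _ : Fin r => ⋀[F]^d Ω[F⁄O])).map_smul_univ
      (fun _ => algebraMap A F s ^ d) θ
    rw [Finset.prod_const, Finset.card_univ, Fintype.card_fin] at h3
    rw [← h3]
    have h4 : (fun i => algebraMap A F s ^ d • θ i) = fun i => c i • wedgeD O f := by
      funext i; exact (hc i).symm
    rw [h4, MultilinearMap.map_smul_univ]
    exact Submodule.smul_mem _ _ (Submodule.mem_span_singleton_self _)
  obtain ⟨x, hx⟩ := Submodule.mem_span_singleton.mp key
  refine ⟨x, ?_⟩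
  rw [hx, ← pow_mul, ← map_pow, algebraMap_smul]

/-- Forms are determined on a component by their value. -/
lemma IsGenericBasis.smul_eq_zero [IsReduced A] (hQ : Q ∈ minimalPrimes A) (hf : IsGenericBasis b f)
    {e : A} (he : IsComponentIdempotent Q e) {r : ℕ} {ξ : RationalForms O A d r}
    (hξ : formValue hQ b r ξ = 0) : e • ξ = 0 := by
  obtain ⟨s, hs, hspan⟩ := hf.exists_smul_mem
  obtain ⟨x, hx⟩ := exists_smul_eq_smul_wedgeDPow hspan ξ
  have hx0 : fracResidue hQ x = 0 := by
    have := congrArg (formValue hQ b r) hx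
    rw [map_smul, hξ, smul_zero, formValue_smul, hf.formValue_eq_one hQ, mul_one] at this
    exact this.symm
  have h1 : (s ^ (d * r) * e) • ξ = 0 := by
    rw [mul_comm, mul_smul, hx, ← smul_assoc, he.smul_eq_zero hQ hx0, zero_smul]
  have hsQ : s ^ (d * r) ∉ Q := fun h => hs (Ideal.IsPrime.mem_of_pow_mem ‹_› _ h)
  have hn := he.mem_nonZeroDivisors hsQ
  have h2 : (s ^ (d * r) * e + (1 - e)) • e • ξ = 0 := by
    rw [add_smul, smul_comm, h1, smul_zero, zero_add, smul_smul, mul_comm, he.mul_eq_zero he.1, zero_smul]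
  have hu := IsLocalization.map_units (FractionRing A) ⟨_, hn⟩
  rw [← algebraMap_smul (FractionRing A) (s ^ (d * r) * e + (1 - e))] at h2
  exact (hu.smul_eq_zero).mp h2

end Forms

section Generators

variable {O : Type*} [CommRing O] {A : Type*} [CommRing A] [Algebra O A] {Q : Ideal A} [Q.IsPrime]
  {d : ℕ} {b : Module.Basis (Fin d) Q.ResidueField Ω[Q.ResidueField⁄O]} {f : Fin d → A} {r : ℕ}

/-- The values of the sections of the canonical sheaf on a component. -/
def canonicalModule (hQ : Q ∈ minimalPrimes A)
    (b : Module.Basis (Fin d) Q.ResidueField Ω[Q.ResidueField⁄O]) : Submodule A Q.ResidueField :=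
  Submodule.span A (wedgeValue hQ b '' canonicalSections O A d)

lemma IsGenericBasis.one_mem_canonicalModule (hQ : Q ∈ minimalPrimes A) (hf : IsGenericBasis b f) :
    1 ∈ canonicalModule hQ b := by
  refine Submodule.subset_span ⟨wedgeD O f, fun P => ⟨1, ?_, fun j _ => ?_⟩, hf.wedgeValue_eq_one hQ⟩
  · exact (Ideal.ne_top_iff_one _).mp P.1.2.ne_top
  · exact Submodule.smul_mem _ _ (Submodule.subset_span ⟨f, rfl⟩)

lemma map_canonicalPower (hQ : Q ∈ minimalPrimes A)
    (b : Module.Basis (Fin d) Q.ResidueField Ω[Q.ResidueField⁄O]) (r : ℕ) :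
    (canonicalPower O A d r).map (formValue hQ b r) = canonicalModule hQ b ^ r := by
  rw [canonicalPower, canonicalModule, Submodule.map_span, Submodule.span_pow]
  congr 1
  ext x
  rw [Set.mem_image, Set.mem_pow]
  constructor
  · rintro ⟨_, ⟨θ, hθ, rfl⟩, rfl⟩
    refine ⟨fun i => ⟨_, θ i, hθ i, rfl⟩, ?_⟩
    rw [formValue_tprod, List.prod_ofFn]
  · rintro ⟨g, rfl⟩
    choose θ hθ hg using fun i => (g i).2
    refine ⟨_, ⟨θ, hθ, rfl⟩, ?_⟩
    rw [formValue_tprod, List.prod_ofFn]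
    exact Finset.prod_congr rfl fun i _ => hg i

lemma map_smul_canonicalPower (hQ : Q ∈ minimalPrimes A)
    (b : Module.Basis (Fin d) Q.ResidueField Ω[Q.ResidueField⁄O]) (r : ℕ) (I : Ideal A) :
    (I • canonicalPower O A d r).map (formValue hQ b r) = I • canonicalModule hQ b ^ r := by
  rw [Submodule.map_smul'', map_canonicalPower]

lemma IsGenericBasis.smul_mem [IsReduced A] (hQ : Q ∈ minimalPrimes A) (hf : IsGenericBasis b f)
    {e : A} (he : IsComponentIdempotent Q e) {N : Submodule A (RationalForms O A d r)}
    {ξ : RationalForms O A d r} (h : formValue hQ b r ξ ∈ N.map (formValue hQ b r)) : e • ξ ∈ N := by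
  obtain ⟨ξ', hξ', heq⟩ := h
  have h0 : e • (ξ - ξ') = 0 := hf.smul_eq_zero hQ he (by rw [map_sub, heq, sub_self])
  rw [smul_sub, sub_eq_zero] at h0
  rw [h0]
  exact N.smul_mem e hξ'

lemma formValue_mem_logLattice (hQ : Q ∈ minimalPrimes A) {D : QDivisor A}
    {η : RationalForms O A d r} (hη : η ∈ logSections O d r D) (P : PrimeDivisor A) :
    formValue hQ b r η ∈ logLattice Q (canonicalModule hQ b) D r P := by
  obtain ⟨s, hs, h⟩ := hη P
  refine ⟨s, hs, fun t ht => ?_⟩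
  rw [← map_smul, ← map_smul_canonicalPower]
  exact Submodule.mem_map_of_mem (h t ht)

lemma IsGenericBasis.smul_mem_logSections [IsReduced A] (hQ : Q ∈ minimalPrimes A)
    (hf : IsGenericBasis b f) {e : A} (he : IsComponentIdempotent Q e) {D : QDivisor A}
    {η : RationalForms O A d r} (h : ∀ P : PrimeDivisor A, Q ≤ P.1.asIdeal →
      formValue hQ b r η ∈ logLattice Q (canonicalModule hQ b) D r P) :
    e • η ∈ logSections O d r D := by
  intro P
  by_cases hP : Q ≤ P.1.asIdeal
  · obtain ⟨s, hs, hst⟩ := h P hP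
    refine ⟨s, hs, fun t ht => ?_⟩
    rw [smul_comm]
    refine hf.smul_mem hQ he ?_
    rw [map_smul_canonicalPower, map_smul]
    exact hst t ht
  · obtain ⟨Q', hQ', hle⟩ := Ideal.exists_minimalPrimes_le (bot_le (a := P.1.asIdeal))
    have heP : e ∈ P.1.asIdeal := hle (he.2 Q' hQ' fun h => hP (h ▸ hle))
    refine ⟨1 - e, fun h => ?_, fun t ht => ?_⟩
    · have := P.1.asIdeal.add_mem h heP
      rw [sub_add_cancel] at this
      exact P.1.2.ne_top ((Ideal.eq_top_iff_one _).mpr this)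
    · rw [smul_smul, show (1 - e) * t * e = t * (e * (1 - e)) by ring, he.mul_eq_zero he.1,
        mul_zero, zero_smul]
      exact zero_mem _

lemma IsComponentIdempotent.notMem {e : A} (he : IsComponentIdempotent Q e) {p : Ideal A}
    [p.IsPrime] (hQp : Q ≤ p) : e ∉ p := fun h => by
  have := p.add_mem (hQp he.1) h
  rw [sub_add_cancel] at this
  exact Ideal.IsPrime.ne_top ‹_› ((Ideal.eq_top_iff_one p).mpr this)

lemma IsGenericBasis.exists_formValue_eq [IsReduced A] (hQ : Q ∈ minimalPrimes A)
    (hf : IsGenericBasis b f) {e : A} (he : IsComponentIdempotent Q e) (r : ℕ) (w : Q.ResidueField) :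
    ∃ ξ : RationalForms O A d r, formValue hQ b r ξ = w := by
  obtain ⟨a, t, ht, htw⟩ := exists_eq_div_residueField w
  have hn := he.mem_nonZeroDivisors ht
  refine ⟨(IsLocalization.mk' (FractionRing A) a ⟨_, hn⟩ : FractionRing A) • wedgeDPow O r f, ?_⟩
  have ht0 : algebraMap A Q.ResidueField t ≠ 0 := by
    rwa [Ne, Ideal.algebraMap_residueField_eq_zero]
  rw [formValue_smul, hf.formValue_eq_one hQ, mul_one]
  refine mul_left_cancel₀ ht0 ?_
  have h1 : algebraMap A Q.ResidueField t = algebraMap A Q.ResidueField (t * e + (1 - e)) := by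
    rw [map_add, map_mul, he.algebraMap_eq_one, mul_one, map_sub, map_one, he.algebraMap_eq_one,
      sub_self, add_zero]
  rw [← Algebra.smul_def t w, htw, h1, ← fracResidue_algebraMap hQ, ← map_mul, mul_comm,
    IsLocalization.mk'_spec (FractionRing A) a (⟨_, hn⟩ : nonZeroDivisors A), fracResidue_algebraMap]

lemma IsGenericBasis.isLocalGenerator_iff [IsReduced A] (hQ : Q ∈ minimalPrimes A)
    (hf : IsGenericBasis b f) {e : A} (he : IsComponentIdempotent Q e) {D : QDivisor A}
    {p : PrimeSpectrum A} (hQp : Q ≤ p.asIdeal) {η : RationalForms O A d r} :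
    IsLocalGenerator O D p η ↔
      IsLatticeGenerator Q (canonicalModule hQ b) D r p.asIdeal (formValue hQ b r η) := by
  constructor
  · rintro ⟨⟨s, hs, hsη⟩, h2⟩
    refine ⟨⟨s, hs, fun P _ => ?_⟩, fun w hw => ?_⟩
    · rw [← map_smul]
      exact formValue_mem_logLattice hQ hsη P
    · obtain ⟨ξ, rfl⟩ := hf.exists_formValue_eq hQ he r w
      obtain ⟨t, ht, a, hta⟩ := h2 _ (hf.smul_mem_logSections hQ he hw)
      refine ⟨t, ht, a, ?_⟩
      have := congrArg (formValue hQ b r) hta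
      rwa [map_smul, map_smul, map_smul, Algebra.smul_def e, he.algebraMap_eq_one, one_mul] at this
  · rintro ⟨⟨s, hs, hsη⟩, h2⟩
    refine ⟨⟨e * s, p.2.mul_notMem (he.notMem hQp) hs, ?_⟩, fun ξ hξ => ?_⟩
    · rw [mul_smul]
      refine hf.smul_mem_logSections hQ he fun P hP => ?_
      rw [map_smul]
      exact hsη P hP
    · obtain ⟨t, ht, a, hta⟩ := h2 (formValue hQ b r ξ) fun P _ => formValue_mem_logLattice hQ hξ P
      refine ⟨e * t, p.2.mul_notMem (he.notMem hQp) ht, e * a, ?_⟩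
      have h0 : e • (t • ξ - a • η) = 0 := hf.smul_eq_zero hQ he (by
        rw [map_sub, map_smul, map_smul, hta, sub_self])
      rw [smul_sub, sub_eq_zero] at h0
      rw [mul_smul, h0, mul_smul]

end Generators

section CartierIndex

variable {K : Type u} [Field K] [ValuativeRel K] [TopologicalSpace K]
  [IsNonarchimedeanLocalField K] {A : Type v} [CommRing A] [Algebra 𝒪[K] A] {d : ℕ}

lemma IsVariety.isNoetherianRing (hA : IsVariety 𝒪[K] A d) : IsNoetherianRing A :=
  have := hA.finiteType
  Algebra.FiniteType.isNoetherianRing 𝒪[K] A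

lemma minimalPrimes_mem_of_dense {U : Set (PrimeSpectrum A)} (hU : Dense U) (hUo : IsOpen U)
    [IsNoetherianRing A] {Q : PrimeSpectrum A} (hQ : Q.asIdeal ∈ minimalPrimes A) : Q ∈ U := by
  have hfin : (minimalPrimes A).Finite := minimalPrimes.finite_of_isNoetherianRing A
  -- the complement of the other components is an open set consisting of points of the component
  obtain ⟨s, hs, hsP⟩ := exists_notMem_forall_mem_pow (q := Q.asIdeal)
    (hfin.toFinset.erase Q.asIdeal) (fun P => P) (fun P hP hle => by
      rw [Finset.mem_erase, Set.Finite.mem_toFinset] at hP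
      exact hP.1 (le_antisymm hle (hQ.2 hP.2.1 hle))) 1
  obtain ⟨x, hxU, hxs⟩ := hU.exists_mem_open (PrimeSpectrum.isOpen_basicOpen (a := s)) ⟨Q, hs⟩
  obtain ⟨Q', hQ', hle⟩ := Ideal.exists_minimalPrimes_le (bot_le (a := x.asIdeal))
  have hQQ' : Q' = Q.asIdeal := by
    by_contra hne
    have hmem := hsP Q' (by rw [Finset.mem_erase, Set.Finite.mem_toFinset]; exact ⟨hne, hQ'⟩)
    rw [pow_one] at hmem
    exact hxs (hle hmem)
  have hspec : Q ⤳ x := (PrimeSpectrum.le_iff_specializes _ _).mp (by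
    rw [← PrimeSpectrum.asIdeal_le_asIdeal, ← hQQ']; exact hle)
  exact hspec.mem_open hUo hxU

lemma IsVariety.isOpen_smoothLocus (hA : IsVariety 𝒪[K] A d) :
    IsOpen (Algebra.smoothLocus 𝒪[K] A) := by
  have := hA.finiteType
  have : Algebra.FinitePresentation 𝒪[K] A := Algebra.FinitePresentation.of_finiteType.mp inferInstance
  exact Algebra.isOpen_smoothLocus

lemma IsEtaleCoordinates.exists_isGenericBasis [Algebra.FiniteType 𝒪[K] A] [IsReduced A]
    {f : Fin d → A} {p Q : PrimeSpectrum A} (h : IsEtaleCoordinates (K := K) f p)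
    (hQ : Q.asIdeal ∈ minimalPrimes A) (hQp : Q ≤ p) :
    ∃ b : Module.Basis (Fin d) Q.asIdeal.ResidueField Ω[Q.asIdeal.ResidueField⁄𝒪[K]],
      IsGenericBasis b f := by
  obtain ⟨b, hb⟩ := h.exists_basis hQ hQp
  obtain ⟨s, hs, h⟩ := (h.of_le hQp).exists_smul_D_mem_span
  exact ⟨b, hb, s, hs, h⟩

lemma IsVariety.exists_isGenericBasis (hA : IsVariety 𝒪[K] A d) {Q : PrimeSpectrum A}
    (hQ : Q.asIdeal ∈ minimalPrimes A) : ∃ f : Fin d → A,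
    ∃ b : Module.Basis (Fin d) Q.asIdeal.ResidueField Ω[Q.asIdeal.ResidueField⁄𝒪[K]],
      IsGenericBasis b f := by
  have := hA.isNoetherianRing
  have := hA.finiteType
  have := hA.isReduced
  obtain ⟨f, hf⟩ := hA.exists_isEtaleCoordinates
    (minimalPrimes_mem_of_dense hA.dense_smoothLocus hA.isOpen_smoothLocus hQ)
  exact ⟨f, hf.exists_isGenericBasis hQ le_rfl⟩

/-- Multiples of Cartier indices are Cartier indices. -/
lemma IsCartierIndex.mul (hA : IsVariety 𝒪[K] A d) (hn : IsNormal A) {D : QDivisor A} {r : ℕ}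
    (h : IsCartierIndex 𝒪[K] d r D) {k : ℕ} (hk : 0 < k) : IsCartierIndex 𝒪[K] d (r * k) D where
  pos := Nat.mul_pos h.pos hk
  integral P := by
    obtain ⟨m, hm⟩ := h.integral P
    refine ⟨m * k, ?_⟩
    push_cast
    rw [← hm]
    ring
  invertible p := by
    have := hA.isNoetherianRing
    have := hA.isReduced
    obtain ⟨Q, hQ, hQp⟩ := Ideal.exists_minimalPrimes_le (bot_le (a := p.asIdeal))
    have hQ' : Q.IsPrime := hQ.1.1
    obtain ⟨e, he⟩ : ∃ e, IsComponentIdempotent Q e := hn.exists_idempotent hQ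
    obtain ⟨f, b, hf⟩ := hA.exists_isGenericBasis (Q := ⟨Q, hQ'⟩) hQ
    obtain ⟨η, hη⟩ := h.invertible p
    rw [hf.isLocalGenerator_iff hQ he hQp] at hη
    obtain ⟨ξ, hξ⟩ := hf.exists_formValue_eq hQ he (r * k) (formValue hQ b r η ^ k)
    refine ⟨ξ, ?_⟩
    rw [hf.isLocalGenerator_iff hQ he hQp, hξ]
    exact hη.pow hn hQ (hf.one_mem_canonicalModule hQ) hQp h.integral k

end CartierIndex

section Partition

lemma exists_clopen_partition {X : Type*} [TopologicalSpace X] [SecondCountableTopology X]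
    {P : Set X → Prop} {S : Set X} (h0 : P ∅)
    (hmono : ∀ U V, IsClopen V → V ⊆ U → P U → P V)
    (h : ∀ x ∈ S, ∃ U, IsClopen U ∧ x ∈ U ∧ U ⊆ S ∧ P U) :
    ∃ W : ℕ → Set X, (∀ n, IsClopen (W n) ∧ P (W n)) ∧ Pairwise (Function.onFun Disjoint W) ∧
      ⋃ n, W n = S := by
  choose! U hU hxU hUS hPU using h
  obtain ⟨T, hTS, hTc, hT⟩ := TopologicalSpace.countable_cover_nhdsWithin (f := U) (s := S)
    fun x hx => nhdsWithin_le_nhds ((hU x hx).2.mem_nhds (hxU x hx))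
  rcases T.eq_empty_or_nonempty with rfl | hne
  · refine ⟨fun _ => ∅, fun _ => ⟨isClopen_empty, h0⟩, fun i j _ => disjoint_bot_left, ?_⟩
    rw [Set.iUnion_empty]
    exact (Set.subset_empty_iff.mp (by simpa using hT)).symm
  · obtain ⟨g, hg⟩ := hTc.exists_eq_range hne
    have hgS : ∀ n, g n ∈ S := fun n => hTS (hg ▸ Set.mem_range_self n)
    have hclopen : ∀ n, IsClopen (disjointed (fun n => U (g n)) n) := fun n =>
      disjointedRec (fun t i ht => ht.diff (hU _ (hgS _))) (hU _ (hgS n))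
    refine ⟨disjointed fun n => U (g n), fun n => ⟨hclopen n, ?_⟩, disjoint_disjointed _, ?_⟩
    · exact hmono _ _ (hclopen n) (disjointed_subset _ n) (hPU _ (hgS n))
    · rw [iUnion_disjointed]
      refine subset_antisymm (Set.iUnion_subset fun n => hUS _ (hgS n)) (hT.trans ?_)
      rw [hg, Set.biUnion_range]

end Partition

section Points

variable {K : Type u} [Field K] [ValuativeRel K] [TopologicalSpace K]
  [IsNonarchimedeanLocalField K] {A : Type v} [CommRing A] [Algebra 𝒪[K] A]

namespace IntegralPoint

@[ext]
lemma ext {x y : IntegralPoint K A} (h : ∀ a, x.eval a = y.eval a) : x = y :=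
  AlgHom.ext h

lemma mem_special {x : IntegralPoint K A} {a : A} : a ∈ x.special.asIdeal ↔ x.eval a ∈ 𝓂[K] :=
  Iff.rfl

lemma mem_generic {x : IntegralPoint K A} {a : A} : a ∈ x.generic.asIdeal ↔ x.eval a = 0 :=
  Iff.rfl

lemma generic_le_special (x : IntegralPoint K A) : x.generic ≤ x.special := fun a ha => by
  rw [mem_special, mem_generic.mp ha]
  exact zero_mem _

lemma isEmbedding_eval :
    Topology.IsEmbedding (fun (x : IntegralPoint K A) (a : A) => x.eval a) :=
  ⟨⟨rfl⟩, fun _ _ h => ext fun a => congrFun h a⟩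

lemma continuous_eval (a : A) : Continuous fun x : IntegralPoint K A => x.eval a :=
  (continuous_apply a).comp isEmbedding_eval.continuous

instance : T2Space (IntegralPoint K A) := isEmbedding_eval.t2Space

instance : CompactSpace (IntegralPoint K A) := by
  have hcl : IsClosed (Set.range fun (x : IntegralPoint K A) (a : A) => x.eval a) := by
    have : (Set.range fun (x : IntegralPoint K A) (a : A) => x.eval a) =
        {g : A → 𝒪[K] | g 1 = 1 ∧ (∀ a b, g (a * b) = g a * g b) ∧ g 0 = 0 ∧
          (∀ a b, g (a + b) = g a + g b) ∧ ∀ c, g (algebraMap 𝒪[K] A c) = c} := by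
      ext g
      constructor
      · rintro ⟨x, rfl⟩
        exact ⟨map_one _, map_mul _, map_zero _, map_add _, fun c => x.eval.commutes c⟩
      · rintro ⟨h1, h2, h3, h4, h5⟩
        exact ⟨({ toFun := g, map_one' := h1, map_mul' := h2, map_zero' := h3, map_add' := h4,
                  commutes' := h5 } : A →ₐ[𝒪[K]] 𝒪[K]), rfl⟩
    rw [this]
    simp only [Set.ofPred_and, Set.ofPred_forall]
    refine (isClosed_eq (continuous_apply _) continuous_const).inter
      (.inter (isClosed_iInter fun a => isClosed_iInter fun b => isClosed_eq (continuous_apply _)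
        ((continuous_apply a).mul (continuous_apply b))) (.inter
        (isClosed_eq (continuous_apply _) continuous_const) (.inter
        (isClosed_iInter fun a => isClosed_iInter fun b => isClosed_eq (continuous_apply _)
        ((continuous_apply a).add (continuous_apply b))) (isClosed_iInter fun c =>
        isClosed_eq (continuous_apply _) continuous_const))))
  exact (Topology.IsClosedEmbedding.mk isEmbedding_eval hcl).compactSpace

lemma exists_generators [Algebra.FiniteType 𝒪[K] A] :
    ∃ (n : ℕ) (g : Fin n → A), Algebra.adjoin 𝒪[K] (Set.range g) = ⊤ := by
  obtain ⟨s, hs⟩ := ‹Algebra.FiniteType 𝒪[K] A›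
  refine ⟨s.card, fun i => (s.equivFin.symm i : A), ?_⟩
  rw [← hs]
  congr 1
  ext a
  constructor
  · rintro ⟨i, rfl⟩
    exact (s.equivFin.symm i).2
  · intro ha
    exact ⟨s.equivFin ⟨a, ha⟩, by simp⟩

lemma isClosedEmbedding_generators {n : ℕ} {g : Fin n → A}
    (hg : Algebra.adjoin 𝒪[K] (Set.range g) = ⊤) :
    Topology.IsClosedEmbedding fun (x : IntegralPoint K A) i => (x.eval (g i) : K) := by
  refine Continuous.isClosedEmbedding (continuous_pi fun i =>
    continuous_subtype_val.comp (continuous_eval (g i))) fun x y h => ?_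
  refine AlgHom.ext_of_adjoin_eq_top hg ?_
  rintro _ ⟨i, rfl⟩
  exact Subtype.ext (congrFun h i)

instance [Algebra.FiniteType 𝒪[K] A] : SecondCountableTopology (IntegralPoint K A) := by
  obtain ⟨n, g, hg⟩ := exists_generators (K := K) (A := A)
  exact (isClosedEmbedding_generators hg).isEmbedding.secondCountableTopology

/-- The points congruent to `x` modulo `𝓂^k`. -/
def ball (x : IntegralPoint K A) (k : ℕ) : Set (IntegralPoint K A) :=
  {y | CongrMod k y.eval x.eval}

lemma mem_ball_self (x : IntegralPoint K A) (k : ℕ) : x ∈ x.ball k := fun a => by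
  rw [sub_self]; exact zero_mem _

lemma mem_ball_iff {n : ℕ} {g : Fin n → A} (hg : Algebra.adjoin 𝒪[K] (Set.range g) = ⊤)
    {x y : IntegralPoint K A} {k : ℕ} :
    y ∈ x.ball k ↔ ∀ i, y.eval (g i) - x.eval (g i) ∈ 𝓂[K] ^ k := by
  refine ⟨fun h i => h (g i), fun h a => ?_⟩
  have ha : a ∈ Algebra.adjoin 𝒪[K] (Set.range g) := hg ▸ Algebra.mem_top
  induction ha using Algebra.adjoin_induction with
  | mem a ha => obtain ⟨i, rfl⟩ := ha; exact h i
  | algebraMap c => rw [AlgHom.commutes, AlgHom.commutes, sub_self]; exact zero_mem _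
  | add a b _ _ ha hb => rw [map_add, map_add, add_sub_add_comm]; exact add_mem ha hb
  | mul a b _ _ ha hb =>
    rw [map_mul, map_mul, show y.eval a * y.eval b - x.eval a * x.eval b =
      y.eval a * (y.eval b - x.eval b) + x.eval b * (y.eval a - x.eval a) by ring]
    exact add_mem (Ideal.mul_mem_left _ _ hb) (Ideal.mul_mem_left _ _ ha)

lemma ball_subset {x y : IntegralPoint K A} {k l : ℕ} (h : y ∈ x.ball k) (hkl : k ≤ l) :
    y.ball l ⊆ x.ball k := fun z hz a => by
  have := add_mem (Ideal.pow_le_pow_right hkl (hz a)) (h a)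
  rwa [sub_add_sub_cancel] at this

lemma mem_ball_comm {x y : IntegralPoint K A} {k : ℕ} (h : y ∈ x.ball k) : x ∈ y.ball k :=
  fun a => by rw [← neg_sub]; exact neg_mem (h a)

lemma isOpen_ball [Algebra.FiniteType 𝒪[K] A] (x : IntegralPoint K A) (k : ℕ) :
    IsOpen (x.ball k) := by
  obtain ⟨n, g, hg⟩ := exists_generators (K := K) (A := A)
  have : x.ball k = ⋂ i : Fin n, (fun y : IntegralPoint K A => (y.eval (g i) : K)) ⁻¹'
      {t | t - (x.eval (g i) : K) ∈ maxPow K k} := by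
    ext y
    rw [mem_ball_iff hg, Set.mem_iInter]
    refine forall_congr' fun i => ?_
    rw [← coe_mem_maxPow]
    rfl
  rw [this]
  exact isOpen_iInter_of_finite fun i => (isOpen_sub_mem_maxPow _ _).preimage
    (continuous_subtype_val.comp (continuous_eval (g i)))

lemma isClopen_ball [Algebra.FiniteType 𝒪[K] A] (x : IntegralPoint K A) (k : ℕ) :
    IsClopen (x.ball k) := by
  refine ⟨⟨?_⟩, isOpen_ball x k⟩
  rw [isOpen_iff_forall_mem_open]
  exact fun y hy => ⟨y.ball k, fun z hz hzx =>
    hy (ball_subset hzx le_rfl (mem_ball_comm hz)), isOpen_ball y k, mem_ball_self y k⟩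

lemma exists_ball_subset [Algebra.FiniteType 𝒪[K] A] {x : IntegralPoint K A}
    {s : Set (IntegralPoint K A)} (hs : s ∈ nhds x) : ∃ k, x.ball k ⊆ s := by
  obtain ⟨n, g, hg⟩ := exists_generators (K := K) (A := A)
  rw [(isClosedEmbedding_generators hg).isEmbedding.nhds_eq_comap, Filter.mem_comap] at hs
  obtain ⟨t, ht, hts⟩ := hs
  rw [nhds_pi, Filter.mem_pi] at ht
  obtain ⟨I, _, u, hu, hut⟩ := ht
  choose m hm using fun i => exists_maxPow_add_subset (K := K) (hu i)
  refine ⟨Finset.univ.sup m, fun y hy => hts (hut fun i _ => hm i _ ?_)⟩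
  have h1 := (mem_ball_iff hg).mp hy i
  have h2 := Ideal.pow_le_pow_right (Finset.le_sup (Finset.mem_univ i) : m i ≤ Finset.univ.sup m) h1
  exact (coe_mem_maxPow (K := K)).mpr h2

lemma special_eq_of_mem_ball {x y : IntegralPoint K A} (h : y ∈ x.ball 1) : y.special = x.special := by
  refine PrimeSpectrum.ext (Ideal.ext fun a => ?_)
  rw [mem_special, mem_special]
  have := h a
  rw [pow_one] at this
  constructor
  · intro hy
    have := sub_mem hy this
    rwa [sub_sub_cancel] at this
  · intro hx
    have := add_mem this hx
    rwa [sub_add_cancel] at this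

lemma isOpen_special_mem [Algebra.FiniteType 𝒪[K] A] (C : Set (PrimeSpectrum A)) :
    IsOpen {x : IntegralPoint K A | x.special ∈ C} := by
  rw [isOpen_iff_forall_mem_open]
  refine fun x hx => ⟨x.ball 1, fun y hy => ?_, isOpen_ball x 1, mem_ball_self x 1⟩
  rw [Set.mem_ofPred_eq, special_eq_of_mem_ball hy]
  exact hx

lemma isOpen_eval_ne_zero (a : A) : IsOpen {x : IntegralPoint K A | x.eval a ≠ 0} :=
  isOpen_ne_fun (continuous_eval a) continuous_const

/-- The generic points of integral points vary continuously. -/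
lemma isOpen_generic_mem {U : Set (PrimeSpectrum A)} (hU : IsOpen U) :
    IsOpen {x : IntegralPoint K A | x.generic ∈ U} := by
  rw [isOpen_iff_forall_mem_open]
  intro x hx
  obtain ⟨_, ⟨_, ⟨a, rfl⟩, rfl⟩, hxa, ha⟩ :=
    PrimeSpectrum.isBasis_basic_opens.exists_subset_of_mem_open hx hU
  exact ⟨_, fun y hy => ha hy, isOpen_eval_ne_zero a, hxa⟩

/-- Pull-back of points along a morphism. -/
def map {B : Type w} [CommRing B] [Algebra 𝒪[K] B] (θ : A →ₐ[𝒪[K]] B) (y : IntegralPoint K B) :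
    IntegralPoint K A := AlgHom.comp (y.eval) θ

@[simp]
lemma eval_map {B : Type w} [CommRing B] [Algebra 𝒪[K] B] (θ : A →ₐ[𝒪[K]] B)
    (y : IntegralPoint K B) (a : A) : (y.map θ).eval a = y.eval (θ a) := rfl

lemma continuous_map {B : Type w} [CommRing B] [Algebra 𝒪[K] B] (θ : A →ₐ[𝒪[K]] B) :
    Continuous (map θ : IntegralPoint K B → IntegralPoint K A) :=
  isEmbedding_eval.continuous_iff.mpr (continuous_pi fun a => continuous_eval (θ a))

lemma special_map {B : Type w} [CommRing B] [Algebra 𝒪[K] B] (θ : A →ₐ[𝒪[K]] B)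
    (y : IntegralPoint K B) : (y.map θ).special = PrimeSpectrum.comap θ.toRingHom y.special := rfl

end IntegralPoint

end Points

section ZeroSets

variable {K : Type u} [Field K] [ValuativeRel K] [TopologicalSpace K]
  [IsNonarchimedeanLocalField K] [MeasurableSpace K] [BorelSpace K]

instance : (nhdsWithin (0 : K) {0}ᶜ).NeBot := by
  obtain ⟨ϖ, hϖ⟩ := IsDiscreteValuationRing.exists_irreducible 𝒪[K]
  rw [← mem_closure_iff_nhdsWithin_neBot, mem_closure_iff_nhds]
  intro s hs
  obtain ⟨m, hm⟩ := exists_maxPow_add_subset (K := K) hs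
  refine ⟨((ϖ ^ m : 𝒪[K]) : K), hm _ ?_, ?_⟩
  · rw [sub_zero, coe_mem_maxPow]
    exact (mem_maximalIdeal_pow hϖ).mpr dvd_rfl
  · rw [Set.mem_compl_iff, Set.mem_singleton_iff]
    exact_mod_cast pow_ne_zero m hϖ.ne_zero

/-- The zero set of a nonzero polynomial is a null set. -/
lemma haar_zeros_eq_zero {d : ℕ} {c : MvPolynomial (Fin d) K} (hc : c ≠ 0) :
    haar K d {t | MvPolynomial.eval t c = 0} = 0 := by
  obtain ⟨μ, hμ, hpi⟩ : ∃ μ : MeasureTheory.Measure K, μ.IsAddHaarMeasure ∧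
      ∀ d, haar K d = MeasureTheory.Measure.pi fun _ => μ :=
    ⟨_, MeasureTheory.Measure.isAddHaarMeasure_addHaarMeasure _, fun d => rfl⟩
  classical
  rw [hpi]
  have hσ : MeasureTheory.SigmaFinite μ := by infer_instance
  have hna : MeasureTheory.NullSingletonClass μ := by infer_instance
  induction d with
  | zero =>
    obtain ⟨x, rfl⟩ := MvPolynomial.C_surjective (Fin 0) c
    have : x ≠ 0 := fun h => hc (by rw [h, map_zero])
    simp [this]
  | succ d ih =>
    set P := MvPolynomial.finSuccEquiv K d c with hP
    have hP0 : P ≠ 0 := by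
      rw [hP]
      exact (map_ne_zero_iff _ (MvPolynomial.finSuccEquiv K d).injective).mpr hc
    have hl := ih (Polynomial.leadingCoeff_ne_zero.mpr hP0)
    have hmp := (MeasureTheory.measurePreserving_piFinSuccAbove (fun _ : Fin (d + 1) => μ) 0).symm
    have hcl : MeasurableSet {t : Fin (d + 1) → K | MvPolynomial.eval t c = 0} :=
      (isClosed_eq (MvPolynomial.continuous_eval c) continuous_const).measurableSet
    have hsw := MeasureTheory.Measure.measurePreserving_swap
      (μ := MeasureTheory.Measure.pi fun _ : Fin d => μ) (ν := μ)
    rw [← hmp.measure_preimage hcl.nullMeasurableSet]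
    refine (hsw.measure_preimage (hmp.measurable hcl).nullMeasurableSet).symm.trans
      (MeasureTheory.Measure.measure_prod_null_of_ae_null (hsw.measurable (hmp.measurable hcl)) ?_)
    have hae : ∀ᵐ s ∂(MeasureTheory.Measure.pi fun _ : Fin d => μ),
        MvPolynomial.eval s P.leadingCoeff ≠ 0 := by
      rw [MeasureTheory.ae_iff]
      simpa using hl
    filter_upwards [hae] with s hs
    have hPs : P.map (MvPolynomial.eval s) ≠ 0 := fun h => hs (by
      have := congrArg (Polynomial.coeff · P.natDegree) h
      simpa [Polynomial.coeff_map] using this)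
    refine Set.Finite.measure_zero ((P.map (MvPolynomial.eval s)).roots.toFinset.finite_toSet.subset
      fun y hy => ?_) μ
    have hy' : MvPolynomial.eval (Fin.cons y s : Fin (d + 1) → K) c = 0 := by
      have : MvPolynomial.eval (Fin.insertNth 0 y s : Fin (d + 1) → K) c = 0 := hy
      rwa [Fin.insertNth_zero] at this
    rw [MvPolynomial.eval_eq_eval_mv_eval'] at hy'
    simpa [hPs] using hy'

end ZeroSets

section Volume

open MeasureTheory

variable {K : Type u} [Field K] [ValuativeRel K] [TopologicalSpace K]
  [IsNonarchimedeanLocalField K] [MeasurableSpace K] [BorelSpace K] {d : ℕ}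
  {X : Type*}

/-- The volume of `W` in the coordinates `φ` for the density `ρ`. -/
def vol (φ : X → Fin d → K) (ρ : X → ℝ≥0) (W : Set X) : ℝ≥0∞ :=
  ∫⁻ t, ⨆ x ∈ W, ⨆ (_ : φ x = t), (ρ x : ℝ≥0∞) ∂(haar K d)

lemma vol_image {Y : Type*} (π : Y → X) (φ : X → Fin d → K) (ρ : X → ℝ≥0) (W : Set Y) :
    vol φ ρ (π '' W) = vol (φ ∘ π) (ρ ∘ π) W := by
  simp only [vol, iSup_image, Function.comp_apply]

lemma vol_congr_density {φ : X → Fin d → K} {ρ ρ' : X → ℝ≥0} {W : Set X} (h : Set.EqOn ρ ρ' W) :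
    vol φ ρ W = vol φ ρ' W := by
  unfold vol
  refine lintegral_congr fun t => iSup_congr fun x => iSup_congr fun hx => ?_
  rw [h hx]

@[simp]
lemma vol_empty (φ : X → Fin d → K) (ρ : X → ℝ≥0) : vol φ ρ ∅ = 0 := by
  simp [vol]

lemma iSup_eq_of_injOn {φ : X → Fin d → K} (ρ : X → ℝ≥0) {W : Set X} (hφ : W.InjOn φ) {x : X}
    (hx : x ∈ W) : (⨆ y ∈ W, ⨆ (_ : φ y = φ x), (ρ y : ℝ≥0∞)) = ρ x := by
  refine le_antisymm (iSup₂_le fun y hy => iSup_le fun h => ?_) ?_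
  · rw [hφ hy hx h]
  · exact (le_iSup_of_le rfl le_rfl).trans (le_iSup₂ (f := fun y (_ : y ∈ W) =>
      ⨆ (_ : φ y = φ x), (ρ y : ℝ≥0∞)) x hx)

variable [TopologicalSpace X] [CompactSpace X] {φ φ' : X → Fin d → K} {ρ ρ' : X → ℝ≥0} {W : Set X}

lemma measurableSet_image (hφ : Continuous φ) (hW : IsClosed W) : MeasurableSet (φ '' W) :=
  (hW.isCompact.image hφ).isClosed.measurableSet

lemma vol_eq_setLIntegral (hφ : Continuous φ) (hW : IsClosed W) :
    vol φ ρ W = ∫⁻ t in φ '' W, ⨆ x ∈ W, ⨆ (_ : φ x = t), (ρ x : ℝ≥0∞) ∂(haar K d) := by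
  rw [← lintegral_indicator (measurableSet_image hφ hW)]
  refine lintegral_congr fun t => ?_
  by_cases ht : t ∈ φ '' W
  · rw [Set.indicator_of_mem ht]
  · rw [Set.indicator_of_notMem ht]
    simp only [ENNReal.iSup_eq_zero]
    exact fun x hx h => (ht ⟨x, hx, h⟩).elim

lemma vol_const (hφ : Continuous φ) (hW : IsClosed W) {c : ℝ≥0} (hc : ∀ x ∈ W, ρ x = c) :
    vol φ ρ W = c * haar K d (φ '' W) := by
  rw [vol_eq_setLIntegral hφ hW, setLIntegral_congr_fun (measurableSet_image hφ hW)
    (g := fun _ => (c : ℝ≥0∞)), setLIntegral_const]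
  rintro _ ⟨x, hx, rfl⟩
  refine le_antisymm (iSup₂_le fun y hy => iSup_le fun h => ?_) ?_
  · rw [hc y hy]
  · rw [← hc x hx]
    exact (le_iSup_of_le rfl le_rfl).trans (le_iSup₂ (f := fun y (_ : y ∈ W) =>
      ⨆ (_ : φ y = φ x), (ρ y : ℝ≥0∞)) x hx)

lemma vol_eq_tsum {ι : Type*} [Countable ι] (hφ : Continuous φ) (hW : IsClosed W)
    (hinj : W.InjOn φ) {V : ι → Set X} (hV : ∀ i, IsClosed (V i)) (hVW : ∀ i, V i ⊆ W)
    (hdisj : Pairwise (Function.onFun Disjoint V))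
    (hnull : haar K d (φ '' (W \ ⋃ i, V i)) = 0) : vol φ ρ W = ∑' i, vol φ ρ (V i) := by
  have hae : (φ '' W : Set (Fin d → K)) =ᵐ[haar K d] (⋃ i, φ '' V i : Set (Fin d → K)) := by
    refine (ae_eq_set.mpr ⟨measure_mono_null ?_ hnull, ?_⟩)
    · rintro _ ⟨⟨x, hx, rfl⟩, h⟩
      refine ⟨x, ⟨hx, fun hx' => h ?_⟩, rfl⟩
      obtain ⟨i, hi⟩ := Set.mem_iUnion.mp hx'
      exact Set.mem_iUnion.mpr ⟨i, x, hi, rfl⟩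
    · rw [Set.sdiff_eq_empty.mpr (Set.iUnion_subset fun i => Set.image_mono (hVW i)), measure_empty]
  rw [vol_eq_setLIntegral hφ hW, setLIntegral_congr hae,
    lintegral_iUnion (fun i => measurableSet_image hφ (hV i))]
  · refine tsum_congr fun i => ?_
    rw [vol_eq_setLIntegral hφ (hV i)]
    refine setLIntegral_congr_fun (measurableSet_image hφ (hV i)) ?_
    rintro _ ⟨x, hx, rfl⟩
    dsimp only
    rw [iSup_eq_of_injOn ρ hinj (hVW i hx), iSup_eq_of_injOn ρ (hinj.mono (hVW i)) hx]
  · intro i j hij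
    refine Set.disjoint_left.mpr ?_
    rintro _ ⟨x, hx, rfl⟩ ⟨y, hy, hxy⟩
    rw [hinj (hVW j hy) (hVW i hx) hxy] at hy
    exact Set.disjoint_left.mp (hdisj hij) hx hy

lemma sum_vol_le (hφ : Continuous φ) (hW : IsClopen W) (hinj : W.InjOn φ) {ι : Type*} [Fintype ι]
    {V : ι → Set X} (hV : ∀ i, IsClopen (V i)) (hVW : ∀ i, V i ⊆ W)
    (hdisj : Pairwise (Function.onFun Disjoint V)) : ∑ i, vol φ ρ (V i) ≤ vol φ ρ W := by
  have hU : IsClopen (⋃ i, V i) := isClopen_iUnion_of_finite hV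
  rw [← tsum_fintype (L := .unconditional _),
    ← vol_eq_tsum (W := ⋃ i, V i) hφ hU.1 (hinj.mono (Set.iUnion_subset hVW))
    (fun i => (hV i).1) (fun i => Set.subset_iUnion V i) hdisj (by simp)]
  exact lintegral_mono fun t => biSup_mono fun x hx => Set.iUnion_subset hVW hx

lemma vol_eq_of_locally [SecondCountableTopology X] (hφ : Continuous φ) (hφ' : Continuous φ')
    (hW : IsClosed W)
    (hinj : W.InjOn φ) (hinj' : W.InjOn φ') {S : Set X} (hSW : S ⊆ W)
    (hnull : haar K d (φ '' (W \ S)) = 0) (hnull' : haar K d (φ' '' (W \ S)) = 0)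
    (h : ∀ x ∈ S, ∃ U, IsClopen U ∧ x ∈ U ∧ U ⊆ S ∧
      ∀ V ⊆ U, IsClopen V → vol φ ρ V = vol φ' ρ' V) : vol φ ρ W = vol φ' ρ' W := by
  obtain ⟨V, hV, hdisj, hVS⟩ := exists_clopen_partition
    (P := fun U => ∀ V ⊆ U, IsClopen V → vol φ ρ V = vol φ' ρ' V)
    (fun V hV _ => by rw [Set.subset_empty_iff.mp hV]; simp)
    (fun U V _ hVU hU V' hV' => hU V' (hV'.trans hVU)) h
  have hVW : ∀ n, V n ⊆ W := fun n => (hVS ▸ Set.subset_iUnion V n : V n ⊆ S).trans hSW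
  rw [vol_eq_tsum hφ hW hinj (fun n => (hV n).1.1) hVW hdisj (hVS ▸ hnull),
    vol_eq_tsum hφ' hW hinj' (fun n => (hV n).1.1) hVW hdisj (hVS ▸ hnull')]
  exact tsum_congr fun n => (hV n).2 _ subset_rfl (hV n).1

end Volume

section AnalyticCharts

variable {K : Type u} [Field K] [ValuativeRel K] [TopologicalSpace K]
  [IsNonarchimedeanLocalField K] {A : Type v} [CommRing A] [Algebra 𝒪[K] A] {d : ℕ}

/-- The analytic functions on the integral points given by regular functions. -/
def coordK (f : Fin d → A) (x : IntegralPoint K A) : Fin d → K := fun i => (x.eval (f i) : K)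

lemma continuous_coordK (f : Fin d → A) : Continuous (coordK f : IntegralPoint K A → Fin d → K) :=
  continuous_pi fun i => continuous_subtype_val.comp (IntegralPoint.continuous_eval (f i))

lemma exists_ball_absK_eq [Algebra.FiniteType 𝒪[K] A] (x : IntegralPoint K A) {a : A}
    (ha : x.eval a ≠ 0) :
    ∃ k, ∀ y ∈ x.ball k, absK K (y.eval a) = absK K (x.eval a) := by
  obtain ⟨k, hk⟩ := exists_notMem_maximalIdeal_pow ha
  have key : ∀ b c : 𝒪[K], b - c ∈ 𝓂[K] ^ k → b ∉ 𝓂[K] ^ k → b ∣ c := fun b c hbc hb => by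
    obtain ⟨z, hz⟩ := exists_dvd_of_notMem hb 0 (z := b - c) (by simpa using hbc)
    exact ⟨1 - z, by rw [mul_sub, mul_one, ← hz.2, sub_sub_cancel]⟩
  refine ⟨k, fun y hy => absK_eq_of_dvd_of_dvd (key _ _ (hy a) fun h => hk ?_) (key _ _ ?_ hk)⟩
  · have := sub_mem h (hy a)
    rwa [sub_sub_cancel] at this
  · rw [← neg_sub]
    exact neg_mem (hy a)

/-- The rational form `(num / den) (df₁ ∧ ⋯ ∧ df_d)^{⊗ r}`. -/
def chartForm (O : Type*) [CommRing O] [Algebra O A] (r : ℕ) (f : Fin d → A) (num : A)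
    (den : nonZeroDivisors A) : RationalForms O A d r :=
  (IsLocalization.mk' (FractionRing A) num den : FractionRing A) • wedgeDPow O r f

lemma smul_chartForm (O : Type*) [CommRing O] [Algebra O A] (r : ℕ) (f : Fin d → A) (num : A)
    (den : nonZeroDivisors A) :
    (den : A) • chartForm O r f num den = num • wedgeDPow O r f := by
  rw [chartForm, ← smul_assoc, Algebra.smul_def, mul_comm, IsLocalization.mk'_spec,
    algebraMap_smul]

lemma eq_chartForm (O : Type*) [CommRing O] [Algebra O A] {r : ℕ} {f : Fin d → A} {num : A}
    {den : nonZeroDivisors A} {η : RationalForms O A d r}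
    (h : (den : A) • η = num • wedgeDPow O r f) : η = chartForm O r f num den := by
  have h1 : (IsLocalization.mk' (FractionRing A) 1 den : FractionRing A) * algebraMap A _ den = 1 := by
    rw [IsLocalization.mk'_spec, map_one]
  have h2 : (IsLocalization.mk' (FractionRing A) 1 den : FractionRing A) * algebraMap A _ num =
      IsLocalization.mk' (FractionRing A) num den := by
    rw [IsLocalization.mk'_eq_mul_mk'_one num, mul_comm]
  rw [chartForm, ← h2, mul_smul, algebraMap_smul, ← h, ← algebraMap_smul (FractionRing A) (den : A) η,
    ← mul_smul, h1, one_smul]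

/-- The density of `|form|^{1/r}` for `form = (num / den) (dt₁ ∧ ⋯ ∧ dt_d)^{⊗ r}`. -/
def density (r : ℕ) (num den : A) (x : IntegralPoint K A) : ℝ≥0 :=
  (absK K (x.eval num) / absK K (x.eval den)) ^ (1 / r : ℝ)

lemma density_pow (r : ℕ) {k : ℕ} (hk : 0 < k) (num den : A) (x : IntegralPoint K A) :
    density (r * k) (num ^ k) (den ^ k) x = density r num den x := by
  unfold density
  rw [map_pow, map_pow]
  push_cast
  rw [map_pow, map_pow, ← div_pow, ← NNReal.rpow_natCast, ← NNReal.rpow_mul]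
  congr 1
  have : (k : ℝ) ≠ 0 := by positivity
  field_simp

/-- The functions `f` are coordinates of the compact open set `W`, and in these coordinates
`(num / den) (df₁ ∧ ⋯ ∧ df_d)^{⊗ r}` is a generator of `𝒪(r(K + D))` along `W`. -/
structure IsChartOn (D : QDivisor A) (r : ℕ) (f : Fin d → A) (num : A) (den : nonZeroDivisors A)
    (W : Set (IntegralPoint K A)) : Prop where
  isClopen : IsClopen W
  injOn : W.InjOn (coordK f)
  etale : ∀ x ∈ W, IsEtaleCoordinates (K := K) f x.generic
  isLocalGenerator : ∀ x ∈ W, IsLocalGenerator 𝒪[K] D x.special (chartForm 𝒪[K] r f num den)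

variable {D : QDivisor A} {r : ℕ} {f : Fin d → A} {num : A} {den : nonZeroDivisors A}
  {W : Set (IntegralPoint K A)}

lemma IsChartOn.mono (h : IsChartOn D r f num den W) {V : Set (IntegralPoint K A)}
    (hV : IsClopen V) (hVW : V ⊆ W) : IsChartOn D r f num den V :=
  ⟨hV, h.injOn.mono hVW, fun x hx => h.etale x (hVW hx), fun x hx => h.isLocalGenerator x (hVW hx)⟩

/-- The chart, as a structure. -/
def IsChartOn.toChart [Nonempty (IntegralPoint K A)] (h : IsChartOn D r f num den W) :
    Chart (K := K) (d := d) r D where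
  coord := f
  source := coordK f '' W
  param := Function.invFunOn (coordK f) W
  isCompact_source := h.isClopen.1.isCompact.image (continuous_coordK f)
  isOpen_image := by
    rw [h.injOn.invFunOn_image subset_rfl]
    exact h.isClopen.2
  continuousOn_param := by
    refine continuousOn_iff_isClosed.mpr fun t ht => ⟨coordK f '' (t ∩ W),
      ((ht.inter h.isClopen.1).isCompact.image (continuous_coordK f)).isClosed, ?_⟩
    ext s
    constructor
    · rintro ⟨hs, x, hx, rfl⟩
      rw [Set.mem_preimage, h.injOn.leftInvOn_invFunOn hx] at hs
      exact ⟨⟨x, ⟨hs, hx⟩, rfl⟩, x, hx, rfl⟩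
    · rintro ⟨⟨x, ⟨hxt, hx⟩, rfl⟩, -⟩
      refine ⟨?_, x, hx, rfl⟩
      rwa [Set.mem_preimage, h.injOn.leftInvOn_invFunOn hx]
  coord_param := by
    rintro _ ⟨x, hx, rfl⟩ i
    rw [h.injOn.leftInvOn_invFunOn hx]
    rfl
  etale := by
    rintro _ ⟨x, hx, rfl⟩
    rw [h.injOn.leftInvOn_invFunOn hx]
    exact h.etale x hx
  form := chartForm 𝒪[K] r f num den
  isLocalGenerator := by
    rintro _ ⟨x, hx, rfl⟩
    rw [h.injOn.leftInvOn_invFunOn hx]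
    exact h.isLocalGenerator x hx
  num := num
  den := den
  den_mem := den.2
  form_eq := smul_chartForm _ _ _ _ _

lemma IsChartOn.image_toChart [Nonempty (IntegralPoint K A)] (h : IsChartOn D r f num den W) :
    h.toChart.image = W :=
  h.injOn.invFunOn_image subset_rfl

lemma Chart.injOn_image (c : Chart (K := K) (d := d) r D) : c.image.InjOn (coordK c.coord) := by
  rintro _ ⟨t, ht, rfl⟩ _ ⟨t', ht', rfl⟩ h
  have h1 : coordK c.coord (c.param t) = t := funext fun i => c.coord_param t ht i
  have h2 : coordK c.coord (c.param t') = t' := funext fun i => c.coord_param t' ht' i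
  rw [h1, h2] at h
  rw [h]

lemma Chart.isChartOn (c : Chart (K := K) (d := d) r D) :
    IsChartOn D r c.coord c.num ⟨c.den, c.den_mem⟩ c.image where
  isClopen := ⟨(c.isCompact_source.image_of_continuousOn c.continuousOn_param).isClosed,
    c.isOpen_image⟩
  injOn := c.injOn_image
  etale := by rintro _ ⟨t, ht, rfl⟩; exact c.etale t ht
  isLocalGenerator := by
    rintro _ ⟨t, ht, rfl⟩
    rw [← eq_chartForm 𝒪[K] (den := ⟨c.den, c.den_mem⟩) c.form_eq]
    exact c.isLocalGenerator t ht

variable [MeasurableSpace K] [BorelSpace K]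

lemma Chart.volume_eq (c : Chart (K := K) (d := d) r D) :
    c.volume = vol (coordK c.coord) (density r c.num c.den) c.image := by
  have h1 : ∀ t ∈ c.source, coordK c.coord (c.param t) = t := fun t ht =>
    funext fun i => c.coord_param t ht i
  have h2 : coordK c.coord '' c.image = c.source := by
    rw [Chart.image, ← Set.image_comp]
    exact (Set.image_congr h1).trans (Set.image_id' _)
  rw [vol_eq_setLIntegral (continuous_coordK _) c.isChartOn.isClopen.1, h2, Chart.volume]
  refine MeasureTheory.setLIntegral_congr_fun c.isCompact_source.isClosed.measurableSet
    fun t ht => ?_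
  have h3 := iSup_eq_of_injOn (density r c.num c.den) c.injOn_image (x := c.param t) ⟨t, ht, rfl⟩
  rw [h1 t ht] at h3
  rw [h3, density, absK_coe, absK_coe]

lemma IsChartOn.volume_toChart [Nonempty (IntegralPoint K A)] (h : IsChartOn D r f num den W) :
    h.toChart.volume = vol (coordK f) (density r num den) W := by
  rw [h.toChart.volume_eq, h.image_toChart]
  rfl

end AnalyticCharts

section Compare

variable {O : Type*} [CommRing O] {A : Type*} [CommRing A] [Algebra O A] {Q : Ideal A} [Q.IsPrime]
  {d : ℕ}

lemma wedgeValue_mul_eq (hQ : Q ∈ minimalPrimes A)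
    (b : Module.Basis (Fin d) Q.ResidueField Ω[Q.ResidueField⁄O]) {g₁ g₂ : Fin d → A} {s : A}
    {C : Matrix (Fin d) (Fin d) A} (h : ∀ i, s • KaehlerDifferential.D O A (g₁ i) =
      ∑ j, C i j • KaehlerDifferential.D O A (g₂ j)) :
    algebraMap A Q.ResidueField s ^ d * wedgeValue hQ b (wedgeD O g₁) =
      algebraMap A Q.ResidueField C.det * wedgeValue hQ b (wedgeD O g₂) := by
  rw [wedgeValue_wedgeD, wedgeValue_wedgeD]
  set L := Q.ResidueField
  set v₁ : Fin d → Ω[L⁄O] := fun i => KaehlerDifferential.D O L (algebraMap A L (g₁ i))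
  set v₂ : Fin d → Ω[L⁄O] := fun i => KaehlerDifferential.D O L (algebraMap A L (g₂ i))
  have h1 : ∀ i, algebraMap A L s • v₁ i = ∑ j, algebraMap A L (C i j) • v₂ j := fun i => by
    have := congrArg (KaehlerDifferential.map O O A L) (h i)
    simpa [map_sum, v₁, v₂, algebraMap_smul] using this
  have h2 : b.det (fun i => algebraMap A L s • v₁ i) = algebraMap A L s ^ d * b.det v₁ := by
    rw [AlternatingMap.map_smul_univ b.det (fun _ => algebraMap A L s)]
    simp
  rw [← h2, funext h1, Module.Basis.det_apply, Module.Basis.det_apply, RingHom.map_det,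
    ← Matrix.det_transpose (RingHom.mapMatrix _ C), mul_comm, ← Matrix.det_mul]
  congr 1
  ext i j
  rw [Module.Basis.toMatrix_apply, Matrix.mul_apply, map_sum, Finsupp.finsetSum_apply]
  refine Finset.sum_congr rfl fun k _ => ?_
  rw [map_smul, Finsupp.smul_apply, smul_eq_mul, mul_comm]
  rfl

lemma smul_formValue_chartForm (hQ : Q ∈ minimalPrimes A)
    (b : Module.Basis (Fin d) Q.ResidueField Ω[Q.ResidueField⁄O]) (r : ℕ) (f : Fin d → A) (num : A)
    (den : nonZeroDivisors A) :
    algebraMap A Q.ResidueField den * formValue hQ b r (chartForm O r f num den) =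
      algebraMap A Q.ResidueField num * wedgeValue hQ b (wedgeD O f) ^ r := by
  have := congrArg (formValue hQ b r) (smul_chartForm O r f num den)
  rwa [map_smul, map_smul, formValue_wedgeDPow, Algebra.smul_def, Algebra.smul_def] at this

lemma algebraMap_nonZeroDivisors_ne_zero (hQ : Q ∈ minimalPrimes A) (den : nonZeroDivisors A) :
    algebraMap A Q.ResidueField den ≠ 0 := fun h => by
  rw [← fracResidue_algebraMap hQ] at h
  have := (IsLocalization.map_units (FractionRing A) den).map (fracResidue hQ)
  rw [h] at this
  exact not_isUnit_zero this

end Compare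

section Relation

variable {K : Type u} [Field K] [ValuativeRel K] [TopologicalSpace K]
  [IsNonarchimedeanLocalField K] {A : Type v} [CommRing A] [Algebra 𝒪[K] A] {d : ℕ}
  {D : QDivisor A} {r : ℕ}

/-- A local generator has no zeros on the component of its point. -/
lemma IsLocalGenerator.formValue_ne_zero (hA : IsVariety 𝒪[K] A d) (hn : IsNormal A)
    {Q p : PrimeSpectrum A} (hQ : Q.asIdeal ∈ minimalPrimes A) (hQp : Q ≤ p)
    {b : Module.Basis (Fin d) Q.asIdeal.ResidueField Ω[Q.asIdeal.ResidueField⁄𝒪[K]]} {f : Fin d → A}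
    (hf : IsGenericBasis b f) {η : RationalForms 𝒪[K] A d r} (hη : IsLocalGenerator 𝒪[K] D p η) :
    formValue hQ b r η ≠ 0 := by
  have := hA.isReduced
  have := hA.isNoetherianRing
  obtain ⟨e, he⟩ := hn.exists_idempotent hQ
  rw [hf.isLocalGenerator_iff hQ he hQp] at hη
  exact hη.ne_zero (hf.one_mem_canonicalModule hQ) hQp hQ

lemma num_notMem_of_isLocalGenerator (hA : IsVariety 𝒪[K] A d) (hn : IsNormal A)
    {Q p : PrimeSpectrum A} (hQ : Q.asIdeal ∈ minimalPrimes A) (hQp : Q ≤ p) {f : Fin d → A} {num : A}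
    {den : nonZeroDivisors A} (h : IsLocalGenerator 𝒪[K] D p (chartForm 𝒪[K] r f num den)) :
    num ∉ Q.asIdeal := fun hnum => by
  obtain ⟨f', b, hf⟩ := hA.exists_isGenericBasis hQ
  have h1 := smul_formValue_chartForm hQ b r f num den
  rw [Ideal.algebraMap_residueField_eq_zero.mpr hnum, zero_mul, mul_eq_zero] at h1
  exact h1.elim (algebraMap_nonZeroDivisors_ne_zero hQ den)
    (h.formValue_ne_zero hA hn hQ hQp hf)

/-- Two local generators written in different coordinates differ by a unit. -/
lemma exists_mul_sub_mem_of_isLocalGenerator (hA : IsVariety 𝒪[K] A d) (hn : IsNormal A)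
    {Q p : PrimeSpectrum A} (hQ : Q.asIdeal ∈ minimalPrimes A) (hQp : Q ≤ p) {g₁ g₂ : Fin d → A}
    {n₁ n₂ : A} {e₁ e₂ : nonZeroDivisors A}
    (h₁ : IsLocalGenerator 𝒪[K] D p (chartForm 𝒪[K] r g₁ n₁ e₁))
    (h₂ : IsLocalGenerator 𝒪[K] D p (chartForm 𝒪[K] r g₂ n₂ e₂)) {s : A}
    {C : Matrix (Fin d) (Fin d) A} (h : ∀ i, s • KaehlerDifferential.D 𝒪[K] A (g₁ i) =
      ∑ j, C i j • KaehlerDifferential.D 𝒪[K] A (g₂ j)) :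
    ∃ s' ∉ p.asIdeal, ∃ a ∉ p.asIdeal,
      s' * (n₂ * e₁ * s ^ (d * r)) - a * (n₁ * e₂ * C.det ^ r) ∈ Q.asIdeal := by
  have := hA.isReduced
  have := hA.isNoetherianRing
  obtain ⟨f', b, hf⟩ := hA.exists_isGenericBasis hQ
  obtain ⟨e, he⟩ := hn.exists_idempotent hQ
  have hv₁ := h₁
  have hv₂ := h₂
  have h0 := h₂.formValue_ne_zero hA hn hQ hQp hf
  rw [hf.isLocalGenerator_iff hQ he hQp] at hv₁ hv₂
  obtain ⟨s', hs', a, ha, hsa⟩ := hv₁.exists_unit (hf.one_mem_canonicalModule hQ) hQp hQ hv₂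
  refine ⟨s', hs', a, ha, ?_⟩
  have r₁ := smul_formValue_chartForm hQ b r g₁ n₁ e₁
  have r₂ := smul_formValue_chartForm hQ b r g₂ n₂ e₂
  have hw := congrArg (· ^ r) (wedgeValue_mul_eq hQ b h)
  simp only [mul_pow, ← pow_mul] at hw
  have he₂ := algebraMap_nonZeroDivisors_ne_zero hQ e₂
  have hw₂ : wedgeValue hQ b (wedgeD 𝒪[K] g₂) ^ r ≠ 0 := fun h => by
    rw [h, mul_zero] at r₂
    exact (mul_ne_zero he₂ h0) r₂
  rw [Algebra.smul_def, Algebra.smul_def] at hsa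
  rw [← Ideal.algebraMap_residueField_eq_zero, map_sub, sub_eq_zero]
  refine mul_right_cancel₀ hw₂ ?_
  simp only [map_mul, map_pow]
  set L := algebraMap A Q.asIdeal.ResidueField
  generalize formValue hQ b r (chartForm 𝒪[K] r g₁ n₁ e₁) = v₁ at *
  generalize formValue hQ b r (chartForm 𝒪[K] r g₂ n₂ e₂) = v₂ at *
  generalize wedgeValue hQ b (wedgeD 𝒪[K] g₁) = w₁ at *
  generalize wedgeValue hQ b (wedgeD 𝒪[K] g₂) = w₂ at *
  linear_combination (-(L s' * L e₁ * L s ^ (d * r))) * r₂ + L e₂ * L e₁ * L s ^ (d * r) * hsa +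
    L a * L e₂ * L s ^ (d * r) * r₁ + L a * L n₁ * L e₂ * hw

/-- Functions which differ by a unit at a point over `y.special` have the same absolute value
at `y`. -/
lemma absK_eval_eq {T : Type*} [CommRing T] [Algebra 𝒪[K] T] (β : A →ₐ[𝒪[K]] T)
    (y : IntegralPoint K A) {q p : PrimeSpectrum T} (hqp : q ≤ p)
    (hq : PrimeSpectrum.comap β.toRingHom q = y.generic)
    (hp : PrimeSpectrum.comap β.toRingHom p = y.special) {s a : T} (hs : s ∉ p.asIdeal)
    (ha : a ∉ p.asIdeal) {c₁ c₂ : A} (h : s * β c₁ - a * β c₂ ∈ q.asIdeal) :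
    absK K (y.eval c₁) = absK K (y.eval c₂) := by
  have hq' : ∀ c, β c ∈ q.asIdeal ↔ y.eval c = 0 := fun c => by
    rw [← IntegralPoint.mem_generic, ← hq]; rfl
  have hp' : ∀ c, β c ∈ p.asIdeal ↔ y.eval c ∈ 𝓂[K] := fun c => by
    rw [← IntegralPoint.mem_special, ← hp]; rfl
  have key : ∀ {s a : T} {c₁ c₂ : A}, s ∉ p.asIdeal → s * β c₁ - a * β c₂ ∈ q.asIdeal →
      y.eval c₁ ∣ y.eval c₂ → absK K (y.eval c₁) = absK K (y.eval c₂) := by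
    rintro s a c₁ c₂ hs h ⟨e, he⟩
    by_cases h0 : y.eval c₁ = 0
    · rw [he, h0, zero_mul]
    have h1 : β (c₂ - c₁ * algebraMap 𝒪[K] A e) ∈ q.asIdeal := by
      rw [hq', map_sub, map_mul, AlgHom.commutes, he]
      exact sub_self _
    have h2 : (s - a * algebraMap 𝒪[K] T e) * β c₁ ∈ q.asIdeal := by
      have : (s - a * algebraMap 𝒪[K] T e) * β c₁ = (s * β c₁ - a * β c₂) +
          a * β (c₂ - c₁ * algebraMap 𝒪[K] A e) := by
        rw [map_sub, map_mul, AlgHom.commutes]; ring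
      rw [this]
      exact add_mem h (Ideal.mul_mem_left _ _ h1)
    have h3 := hqp ((q.2.mem_or_mem h2).resolve_right fun h => h0 ((hq' _).mp h))
    have h4 : IsUnit e := by
      by_contra hu
      have h5 : algebraMap 𝒪[K] T e ∈ p.asIdeal := by
        rw [← AlgHom.commutes β, hp', AlgHom.commutes]
        exact (IsLocalRing.mem_maximalIdeal _).mpr hu
      have h6 := add_mem h3 (Ideal.mul_mem_left _ a h5)
      rw [sub_add_cancel] at h6
      exact hs h6
    obtain ⟨u, rfl⟩ := h4
    rw [he]
    push_cast
    rw [map_mul, absK_unit, mul_one]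
  rcases ValuationRing.dvd_total (y.eval c₁) (y.eval c₂) with h' | h'
  · exact key hs h h'
  · refine (key (a := s) ha ?_ h').symm
    rw [← neg_sub]
    exact neg_mem h

variable [MeasurableSpace K] [BorelSpace K]

/-- Zero sets of nonzerodivisors are null sets in étale coordinates. -/
lemma haar_image_zeros_eq_zero [Algebra.FiniteType 𝒪[K] A] [IsReduced A] {f : Fin d → A}
    {W : Set (IntegralPoint K A)} (hf : ∀ x ∈ W, IsEtaleCoordinates (K := K) f x.generic) {h : A}
    (hh : ∀ x ∈ W, ∀ Q : PrimeSpectrum A, Q.asIdeal ∈ minimalPrimes A → Q ≤ x.generic →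
      h ∉ Q.asIdeal) :
    haar K d (coordK f '' {x ∈ W | x.eval h = 0}) = 0 := by
  have hN : IsNoetherianRing A := Algebra.FiniteType.isNoetherianRing 𝒪[K] A
  have hfin : (minimalPrimes A).Finite := minimalPrimes.finite_of_isNoetherianRing A
  have hsub : coordK f '' {x ∈ W | x.eval h = 0} ⊆ ⋃ Q ∈ minimalPrimes A,
      coordK f '' {x ∈ W | x.eval h = 0 ∧ Q ≤ x.generic.asIdeal} := by
    rintro _ ⟨x, ⟨hx, hxh⟩, rfl⟩
    obtain ⟨Q, hQ, hQx⟩ := Ideal.exists_minimalPrimes_le (bot_le (a := x.generic.asIdeal))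
    exact Set.mem_biUnion hQ ⟨x, ⟨hx, hxh, hQx⟩, rfl⟩
  refine MeasureTheory.measure_mono_null hsub
    ((MeasureTheory.measure_biUnion_null_iff hfin.countable).mpr fun Q hQ => ?_)
  by_cases hne : ∃ x ∈ W, Q ≤ x.generic.asIdeal
  · obtain ⟨x, hx, hQx⟩ := hne
    have hQp : Q.IsPrime := hQ.1.1
    obtain ⟨c, hc, a, hca⟩ := (hf x hx).exists_polynomial (Q := ⟨Q, hQp⟩) hQ hQx
      (hh x hx ⟨Q, hQp⟩ hQ hQx)
    refine MeasureTheory.measure_mono_null ?_ (haar_zeros_eq_zero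
      (c := MvPolynomial.map (algebraMap 𝒪[K] K) c) ?_)
    · rintro _ ⟨y, ⟨hy, hyh, hQy⟩, rfl⟩
      have h1 : y.eval (MvPolynomial.aeval f c) = 0 := by
        have := hQy hca
        rw [IntegralPoint.mem_generic, map_sub, map_mul, hyh, mul_zero, sub_zero] at this
        exact this
      rw [Set.mem_ofPred_eq, MvPolynomial.eval_map]
      have h2 := MvPolynomial.map_aeval f ((algebraMap 𝒪[K] K).comp y.eval.toRingHom) c
      have h3 : ((algebraMap 𝒪[K] K).comp y.eval.toRingHom).comp (algebraMap 𝒪[K] A) =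
          algebraMap 𝒪[K] K := by
        ext z
        exact congrArg (algebraMap 𝒪[K] K) (y.eval.commutes z)
      rw [h3] at h2
      refine h2.symm.trans ?_
      exact (congrArg (algebraMap 𝒪[K] K) h1).trans (map_zero _)
    · exact (map_ne_zero_iff _ (MvPolynomial.map_injective _ Subtype.val_injective)).mpr hc
  · convert MeasureTheory.measure_empty (μ := haar K d)
    rw [Set.image_eq_empty, Set.eq_empty_iff_forall_notMem]
    exact fun x hx => hne ⟨x, hx.1, hx.2.2⟩

/-- The change of variables formula near a point. -/
lemma exists_ball_vol_eq [Algebra.FiniteType 𝒪[K] A] (hr : 0 < r) (x : IntegralPoint K A)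
    {f₁ f₂ : Fin d → A}
    (hf : IsEtaleCoordinates (K := K) f₂ x.generic) {n₁ e₁ n₂ e₂ : A}
    (hn₁ : x.eval n₁ ≠ 0) (he₁ : x.eval e₁ ≠ 0) (hn₂ : x.eval n₂ ≠ 0) (he₂ : x.eval e₂ ≠ 0)
    (h : ∀ (s : A) (C : Matrix (Fin d) (Fin d) A), (∀ i, s • KaehlerDifferential.D 𝒪[K] A (f₁ i) =
      ∑ j, C i j • KaehlerDifferential.D 𝒪[K] A (f₂ j)) →
      absK K (x.eval (n₂ * e₁ * s ^ (d * r))) = absK K (x.eval (n₁ * e₂ * C.det ^ r))) :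
    ∃ k, ∀ V ⊆ x.ball k, IsClosed V → vol (coordK f₁) (density r n₁ e₁) V =
      vol (coordK f₂) (density r n₂ e₂) V := by
  obtain ⟨s, hs, hspan⟩ := hf.exists_smul_D_mem_span
  have hs0 : x.eval s ≠ 0 := hs
  have hC : ∀ i, ∃ c : Fin d → A, s • KaehlerDifferential.D 𝒪[K] A (f₁ i) =
      ∑ j, c j • KaehlerDifferential.D 𝒪[K] A (f₂ j) := fun i => by
    obtain ⟨c, hc⟩ := (Submodule.mem_span_range_iff_exists_fun A).mp
      (hspan (KaehlerDifferential.D 𝒪[K] A (f₁ i)))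
    exact ⟨c, hc.symm⟩
  obtain ⟨C, hC⟩ : ∃ C : Matrix (Fin d) (Fin d) A, ∀ i,
      s • KaehlerDifferential.D 𝒪[K] A (f₁ i) =
        ∑ j, C i j • KaehlerDifferential.D 𝒪[K] A (f₂ j) := by
    choose C hC using hC
    exact ⟨Matrix.of C, hC⟩
  have habs := h s C hC
  have hr' : (r : ℝ) ≠ 0 := by positivity
  have hdet : x.eval (C.det) ≠ 0 := fun h0 => by
    have hz : x.eval (n₁ * e₂ * C.det ^ r) = 0 := by
      rw [map_mul, map_pow, h0, zero_pow hr.ne', mul_zero]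
    have : x.eval (n₂ * e₁ * s ^ (d * r)) = 0 := by
      have h1 : absK K (x.eval (n₂ * e₁ * s ^ (d * r)) : 𝒪[K]) = 0 := by rw [habs, hz]; simp
      by_contra h2
      exact (absK_ne_zero.mpr (by exact_mod_cast h2)) h1
    rw [map_mul, map_mul, map_pow] at this
    exact (mul_ne_zero (mul_ne_zero hn₂ he₁) (pow_ne_zero _ hs0)) this
  have hdens : density r n₂ e₂ x * absK K (x.eval s) ^ d =
      density r n₁ e₁ x * absK K (x.eval (C.det)) := by
    unfold density
    simp only [map_mul, map_pow] at habs
    push_cast at habs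
    simp only [map_mul, map_pow] at habs
    have e₁' := absK_ne_zero.mpr (by exact_mod_cast he₁ : (x.eval e₁ : K) ≠ 0)
    have e₂' := absK_ne_zero.mpr (by exact_mod_cast he₂ : (x.eval e₂ : K) ≠ 0)
    have h1 : ∀ z : ℝ≥0, (z ^ r) ^ (1 / r : ℝ) = z := fun z => by
      rw [← NNReal.rpow_natCast, ← NNReal.rpow_mul, mul_one_div_cancel hr', NNReal.rpow_one]
    rw [← h1 (absK K (x.eval s) ^ d), ← h1 (absK K (x.eval (C.det) : 𝒪[K])),
      ← NNReal.mul_rpow, ← NNReal.mul_rpow]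
    congr 1
    rw [div_mul_eq_mul_div, div_mul_eq_mul_div, div_eq_div_iff e₂' e₁', ← pow_mul]
    linear_combination habs
  obtain ⟨e, he⟩ := exists_notMem_maximalIdeal_pow hs0
  obtain ⟨m, hm⟩ := exists_notMem_maximalIdeal_pow hdet
  have hm' : x.eval (C.det) ∉ 𝓂[K] ^ (m + 1) := fun h =>
    hm (Ideal.pow_le_pow_right (Nat.le_succ m) h)
  obtain ⟨k₁, hk₁⟩ := exists_ball_absK_eq x hn₁
  obtain ⟨k₂, hk₂⟩ := exists_ball_absK_eq x he₁
  obtain ⟨k₃, hk₃⟩ := exists_ball_absK_eq x hn₂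
  obtain ⟨k₄, hk₄⟩ := exists_ball_absK_eq x he₂
  refine ⟨(e + m) + k₁ + k₂ + k₃ + k₄, fun V hV hVc => ?_⟩
  have hball : ∀ {y : IntegralPoint K A} {j}, j ≤ (e + m) + k₁ + k₂ + k₃ + k₄ → y ∈ V →
      y ∈ x.ball j := fun hj hy =>
    IntegralPoint.ball_subset (x.mem_ball_self _) hj (hV hy)
  rw [vol_const (continuous_coordK _) hVc (c := density r n₁ e₁ x),
    vol_const (continuous_coordK _) hVc (c := density r n₂ e₂ x)]
  · have harea := haar_image_area (K := K) V (fun y i => y.eval (f₁ i)) (fun y i => y.eval (f₂ i))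
      (C.map x.eval) hs0 (m + 1) (by
        have : (C.map x.eval).det = x.eval (C.det) := (AlgHom.map_det _ _).symm
        rwa [this]) (fun y hy z hz j hj i => by
        have := increment_sub_mem (j := m) (x₀ := x.eval) (f := f₂) (fun a => hspan _) he
          (hball (by omega) hy) (hball (by omega) hz) (hC i) hj
        simpa [Matrix.mulVec, dotProduct] using! this)
    have hdet' : (C.map x.eval).det = x.eval (C.det) := (AlgHom.map_det _ _).symm
    rw [hdet'] at harea
    have hsK : absK K (x.eval s) ≠ 0 := absK_ne_zero.mpr (by exact_mod_cast hs0)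
    have hsd : ((absK K (x.eval s) : ℝ≥0∞)) ^ d ≠ 0 := pow_ne_zero _ (by exact_mod_cast hsK)
    have hsd' : ((absK K (x.eval s) : ℝ≥0∞)) ^ d ≠ ⊤ := ENNReal.pow_ne_top ENNReal.coe_ne_top
    have hdens' : (density r n₂ e₂ x : ℝ≥0∞) * (absK K (x.eval s)) ^ d =
      density r n₁ e₁ x * absK K (x.eval C.det) := by exact_mod_cast hdens
    refine (ENNReal.mul_right_inj hsd hsd').mp ?_
    change _ * (_ * haar K d ((fun y => coeVec fun i => y.eval (f₁ i)) '' V)) =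
      _ * (_ * haar K d ((fun y => coeVec fun i => y.eval (f₂ i)) '' V))
    rw [mul_left_comm, harea, ← mul_assoc, ← mul_assoc, ← hdens', mul_comm (absK K _ ^ d : ℝ≥0∞)]
  · intro y hy
    unfold density
    rw [hk₃ y (hball (by omega) hy), hk₄ y (hball (by omega) hy)]
  · intro y hy
    unfold density
    rw [hk₁ y (hball (by omega) hy), hk₂ y (hball (by omega) hy)]

end Relation

section StringyMeasure

variable {K : Type u} [Field K] [ValuativeRel K] [TopologicalSpace K]
  [IsNonarchimedeanLocalField K] {A : Type v} [CommRing A] [Algebra 𝒪[K] A] {d : ℕ}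
  {D : QDivisor A} {r : ℕ} {f : Fin d → A} {num : A} {den : nonZeroDivisors A}
  {W : Set (IntegralPoint K A)}

lemma formValue_chartForm_pow {O : Type*} [CommRing O] [Algebra O A] {Q : Ideal A} [Q.IsPrime]
    (hQ : Q ∈ minimalPrimes A) (b : Module.Basis (Fin d) Q.ResidueField Ω[Q.ResidueField⁄O]) (k : ℕ) :
    formValue hQ b (r * k) (chartForm O (r * k) f (num ^ k) (den ^ k)) =
      formValue hQ b r (chartForm O r f num den) ^ k := by
  refine mul_left_cancel₀ (pow_ne_zero k (algebraMap_nonZeroDivisors_ne_zero hQ den)) ?_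
  rw [← mul_pow, smul_formValue_chartForm, ← map_pow, ← SubmonoidClass.coe_pow,
    smul_formValue_chartForm, mul_pow, map_pow, pow_mul]

lemma IsChartOn.pow (hA : IsVariety 𝒪[K] A d) (hn : IsNormal A) (hr : IsCartierIndex 𝒪[K] d r D)
    (h : IsChartOn D r f num den W) (k : ℕ) :
    IsChartOn D (r * k) f (num ^ k) (den ^ k) W where
  isClopen := h.isClopen
  injOn := h.injOn
  etale := h.etale
  isLocalGenerator x hx := by
    have := hA.isReduced
    have := hA.isNoetherianRing
    obtain ⟨Q, hQ, hQx⟩ := Ideal.exists_minimalPrimes_le (bot_le (a := x.special.asIdeal))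
    have hQp : Q.IsPrime := hQ.1.1
    obtain ⟨f', b, hf⟩ := hA.exists_isGenericBasis (Q := ⟨Q, hQp⟩) hQ
    obtain ⟨e, he⟩ := hn.exists_idempotent hQ
    have h1 := h.isLocalGenerator x hx
    rw [hf.isLocalGenerator_iff hQ he hQx] at h1 ⊢
    rw [formValue_chartForm_pow]
    exact h1.pow hn hQ (hf.one_mem_canonicalModule hQ) hQx hr.integral k

/-- Every point with smooth generic point has a chart. -/
lemma exists_isChartOn (hA : IsVariety 𝒪[K] A d) (hn : IsNormal A) (hr : IsCartierIndex 𝒪[K] d r D)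
    {x : IntegralPoint K A} (hx : x.generic ∈ Algebra.smoothLocus 𝒪[K] A) :
    ∃ (f : Fin d → A) (num : A) (den : nonZeroDivisors A) (U : Set (IntegralPoint K A)),
      x ∈ U ∧ IsChartOn D r f num den U := by
  have := hA.isReduced
  have := hA.isNoetherianRing
  have := hA.finiteType
  obtain ⟨Q, hQ, hQx⟩ := Ideal.exists_minimalPrimes_le (bot_le (a := x.generic.asIdeal))
  have hQp : Q.IsPrime := hQ.1.1
  obtain ⟨f, hf⟩ := hA.exists_isEtaleCoordinates hx
  obtain ⟨b, hb⟩ := hf.exists_isGenericBasis (Q := ⟨Q, hQp⟩) hQ hQx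
  obtain ⟨e, he'⟩ := hn.exists_idempotent hQ
  have he : IsComponentIdempotent Q e := he'
  obtain ⟨η, hη⟩ := hr.invertible x.special
  have hQs : Q ≤ x.special.asIdeal := hQx.trans x.generic_le_special
  rw [hb.isLocalGenerator_iff hQ he hQs] at hη
  obtain ⟨a, t, ht, hta⟩ := exists_eq_div_residueField (formValue hQ b r η)
  have hden := he.mem_nonZeroDivisors ht
  obtain ⟨s, hs, hspan⟩ := hf.exists_smul_D_mem_span
  obtain ⟨k, hk⟩ := exists_notMem_maximalIdeal_pow (a := x.eval s) hs
  obtain ⟨l, hl⟩ := IntegralPoint.exists_ball_subset (x := x) ((IntegralPoint.isOpen_generic_mem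
    (IsEtaleCoordinates.isOpen (K := K) f)).mem_nhds hf)
  refine ⟨f, a, ⟨_, hden⟩, x.ball (k + l + 1), x.mem_ball_self _, IntegralPoint.isClopen_ball _ _,
    fun y hy z hz hyz => ?_, fun y hy => hl (IntegralPoint.ball_subset (x.mem_ball_self _)
      (by omega) hy), fun y hy => ?_⟩
  · refine eq_of_coords_eq (f := f) (x₀ := x.eval) (fun a => hspan _) hk
      (IntegralPoint.ball_subset (x.mem_ball_self _) (by omega) hy)
      (IntegralPoint.ball_subset (x.mem_ball_self _) (by omega) hz) fun i => ?_
    exact Subtype.ext (congrFun hyz i)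
  · rw [IntegralPoint.special_eq_of_mem_ball (IntegralPoint.ball_subset (x.mem_ball_self _)
      (by omega) hy : y ∈ x.ball 1), hb.isLocalGenerator_iff hQ he hQs]
    convert hη using 1
    have ht0 : algebraMap A Q.ResidueField t ≠ 0 := fun h =>
      ht (Ideal.algebraMap_residueField_eq_zero.mp h)
    refine mul_left_cancel₀ ht0 ?_
    have h1 := smul_formValue_chartForm (O := 𝒪[K]) hQ b r f a ⟨_, hden⟩
    rw [hb.wedgeValue_eq_one hQ, one_pow, mul_one, ← hta, Algebra.smul_def, map_add, map_mul,
      map_sub, map_one, he.algebraMap_eq_one, mul_one, sub_self, add_zero] at h1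
    exact h1

variable [MeasurableSpace K] [BorelSpace K]

/-- The volume does not depend on the coordinates. -/
lemma IsChartOn.vol_eq (hA : IsVariety 𝒪[K] A d) (hn : IsNormal A) (hr : 0 < r)
    {f₁ f₂ : Fin d → A} {n₁ n₂ : A} {e₁ e₂ : nonZeroDivisors A}
    (h₁ : IsChartOn D r f₁ n₁ e₁ W) (h₂ : IsChartOn D r f₂ n₂ e₂ W) :
    vol (coordK f₁) (density r n₁ e₁) W = vol (coordK f₂) (density r n₂ e₂) W := by
  have := hA.isReduced
  have := hA.isNoetherianRing
  have := hA.finiteType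
  set h : A := n₁ * n₂ * (e₁ * e₂) with hh
  have hmem : ∀ x ∈ W, ∀ Q : PrimeSpectrum A, Q.asIdeal ∈ minimalPrimes A → Q ≤ x.generic →
      h ∉ Q.asIdeal := by
    intro x hx Q hQ hQx hQh
    have hQs : Q ≤ x.special := hQx.trans x.generic_le_special
    rcases Q.2.mem_or_mem hQh with h | h
    · rcases Q.2.mem_or_mem h with h | h
      · exact num_notMem_of_isLocalGenerator hA hn hQ hQs (h₁.isLocalGenerator x hx) h
      · exact num_notMem_of_isLocalGenerator hA hn hQ hQs (h₂.isLocalGenerator x hx) h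
    · exact algebraMap_nonZeroDivisors_ne_zero hQ (e₁ * e₂)
        (Ideal.algebraMap_residueField_eq_zero.mpr h)
  have hdiff : W \ {x ∈ W | x.eval h ≠ 0} = {x ∈ W | x.eval h = 0} := by
    ext x
    simp only [Set.mem_sdiff, Set.mem_ofPred_eq]
    tauto
  refine vol_eq_of_locally (continuous_coordK _) (continuous_coordK _) h₁.isClopen.1 h₁.injOn
    h₂.injOn (S := {x ∈ W | x.eval h ≠ 0}) (fun x hx => hx.1) ?_ ?_ fun x hx => ?_
  · rw [hdiff]; exact haar_image_zeros_eq_zero h₁.etale hmem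
  · rw [hdiff]; exact haar_image_zeros_eq_zero h₂.etale hmem
  · obtain ⟨hxW, hx0⟩ := hx
    have hx1 := hx0
    simp only [hh, map_mul, mul_ne_zero_iff] at hx1
    obtain ⟨k, hk⟩ := exists_ball_vol_eq hr x (f₁ := f₁) (h₂.etale x hxW) hx1.1.1 hx1.2.1 hx1.1.2
      hx1.2.2 fun s C hC => by
        obtain ⟨Q, hQ, hQx⟩ := Ideal.exists_minimalPrimes_le (bot_le (a := x.generic.asIdeal))
        have hQp : Q.IsPrime := hQ.1.1
        obtain ⟨s', hs', a, ha, hsa⟩ := exists_mul_sub_mem_of_isLocalGenerator hA hn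
          (Q := ⟨Q, hQp⟩) hQ (hQx.trans x.generic_le_special) (h₁.isLocalGenerator x hxW)
          (h₂.isLocalGenerator x hxW) hC
        exact absK_eval_eq (AlgHom.id 𝒪[K] A) x x.generic_le_special rfl rfl hs' ha (hQx hsa)
    obtain ⟨l, hl⟩ := IntegralPoint.exists_ball_subset (x := x)
      ((h₁.isClopen.2.inter (IntegralPoint.isOpen_eval_ne_zero h)).mem_nhds ⟨hxW, hx0⟩)
    refine ⟨x.ball (k + l), IntegralPoint.isClopen_ball _ _, x.mem_ball_self _, fun y hy => ?_,
      fun V hV hVc => hk V (hV.trans (IntegralPoint.ball_subset (x.mem_ball_self _)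
        (by omega))) hVc.1⟩
    exact hl (IntegralPoint.ball_subset (x.mem_ball_self _) (by omega) hy)

lemma IsChartOn.vol_eq' (hA : IsVariety 𝒪[K] A d) (hn : IsNormal A) {r₁ r₂ : ℕ}
    (hr₁ : IsCartierIndex 𝒪[K] d r₁ D) (hr₂ : IsCartierIndex 𝒪[K] d r₂ D)
    {f₁ f₂ : Fin d → A} {n₁ n₂ : A} {e₁ e₂ : nonZeroDivisors A}
    (h₁ : IsChartOn D r₁ f₁ n₁ e₁ W) (h₂ : IsChartOn D r₂ f₂ n₂ e₂ W) :
    vol (coordK f₁) (density r₁ n₁ e₁) W = vol (coordK f₂) (density r₂ n₂ e₂) W := by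
  have h₁' := h₁.pow hA hn hr₁ r₂
  have h₂' := h₂.pow hA hn hr₂ r₁
  rw [mul_comm] at h₂'
  have := h₁'.vol_eq hA hn (Nat.mul_pos hr₁.pos hr₂.pos) h₂'
  rw [SubmonoidClass.coe_pow, SubmonoidClass.coe_pow,
    vol_congr_density (fun x _ => density_pow r₁ hr₂.pos n₁ e₁ x)] at this
  rw [this]
  refine vol_congr_density fun x _ => ?_
  rw [mul_comm]
  exact density_pow r₂ hr₁.pos n₂ e₂ x

/-- The stringy measure can be computed by a covering by charts up to zero sets. -/
theorem stringyMeasure_eq_tsum (hA : IsVariety 𝒪[K] A d) (hn : IsNormal A)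
    (hr : IsCartierIndex 𝒪[K] d r D) {S : Set (IntegralPoint K A)} {ι : Type*}
    {W : ι → Set (IntegralPoint K A)} {f : ι → Fin d → A} {num : ι → A} {den : ι → nonZeroDivisors A}
    (hW : ∀ l, IsChartOn D r (f l) (num l) (den l) (W l)) (hWS : ∀ l, W l ⊆ S)
    (hdisj : Pairwise (Function.onFun Disjoint W)) {κ : Type*} [Countable κ] (h : κ → A)
    (hh : ∀ j, ∀ Q ∈ minimalPrimes A, h j ∉ Q)
    (hcov : ∀ x ∈ S, (∃ l, x ∈ W l) ∨ ∃ j, x.eval (h j) = 0) :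
    stringyMeasure K d D S = ∑' l, vol (coordK (f l)) (density r (num l) (den l)) (W l) := by
  classical
  have := hA.isReduced
  have := hA.finiteType
  set v : ι → ℝ≥0∞ := fun l => vol (coordK (f l)) (density r (num l) (den l)) (W l) with hv
  refine le_antisymm ?_ ?_
  · refine iSup₂_le fun r' hr' => iSup₂_le fun m c => iSup₂_le fun hc hcS => ?_
    set J : Set ι := {l | (W l).Nonempty} with hJ
    have hJc : Countable J := (Set.PairwiseDisjoint.countable_of_isOpen (a := J) (s := W)
      (hdisj.set_pairwise J) (fun l _ => (hW l).isClopen.2) fun l hl => hl).to_subtype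
    have h1 : ∀ i, (c i).volume = ∑' l : J, vol (coordK (f l)) (density r (num l) (den l))
        ((c i).image ∩ W l) := fun i => by
      rw [(c i).volume_eq, vol_eq_tsum (V := fun l : J => (c i).image ∩ W l) (continuous_coordK _)
        (c i).isChartOn.isClopen.1 (c i).injOn_image
        (fun l => ((c i).isChartOn.isClopen.inter (hW l).isClopen).1)
        (fun l => Set.inter_subset_left) (fun l l' hll => (hdisj (fun h => hll (Subtype.ext h))).mono
          Set.inter_subset_right Set.inter_subset_right)]
      · refine tsum_congr fun l => ?_
        have hcl := (c i).isChartOn.isClopen.inter (hW l).isClopen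
        exact ((c i).isChartOn.mono hcl Set.inter_subset_left).vol_eq' hA hn hr' hr
          ((hW l).mono hcl Set.inter_subset_right)
      · refine MeasureTheory.measure_mono_null (t := ⋃ j, coordK (c i).coord ''
          {x ∈ (c i).image | x.eval (h j) = 0}) ?_ (MeasureTheory.measure_iUnion_null fun j =>
          haar_image_zeros_eq_zero (c i).isChartOn.etale fun x _ Q hQ _ => hh j _ hQ)
        rintro _ ⟨x, ⟨hx, hxl⟩, rfl⟩
        rcases hcov x (hcS i hx) with ⟨l, hl⟩ | ⟨j, hj⟩
        · exact (hxl (Set.mem_iUnion.mpr ⟨⟨l, ⟨x, hl⟩⟩, hx, hl⟩)).elim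
        · exact Set.mem_iUnion.mpr ⟨j, x, ⟨hx, hj⟩, rfl⟩
    have h2 : ∑ i, (c i).volume = ∑' l : J, ∑ i, vol (coordK (f l))
        (density r (num l) (den l)) ((c i).image ∩ W l) := by
      rw [Finset.sum_congr rfl fun i _ => h1 i, Summable.tsum_finsetSum]
      exact fun i _ => ENNReal.summable
    calc ∑ i, (c i).volume ≤ ∑' l : J, v l := h2.trans_le <| ENNReal.tsum_le_tsum fun l => sum_vol_le (continuous_coordK _)
          (hW l).isClopen (hW l).injOn (fun i => (c i).isChartOn.isClopen.inter (hW l).isClopen)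
          (fun i => Set.inter_subset_right) fun i j hij => (hc hij).mono
            Set.inter_subset_left Set.inter_subset_left
      _ ≤ ∑' l, v l := ENNReal.tsum_comp_le_tsum_of_injective Subtype.val_injective v
  · rcases isEmpty_or_nonempty (IntegralPoint K A) with hE | hE
    · have : ∀ l, v l = 0 := fun l => by
        rw [hv]
        dsimp only
        rw [Set.eq_empty_of_isEmpty (W l), vol_empty]
      rw [ENNReal.tsum_eq_zero.mpr this]
      exact zero_le
    rw [ENNReal.tsum_eq_iSup_sum]
    refine iSup_le fun s => ?_
    refine le_iSup₂_of_le r hr (le_iSup₂_of_le s.card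
      (fun i => (hW (s.equivFin.symm i)).toChart) (le_iSup₂_of_le ?_ ?_ ?_))
    · intro i j hij
      rw [IsChartOn.image_toChart, IsChartOn.image_toChart]
      exact hdisj fun h => hij (s.equivFin.symm.injective (Subtype.ext h))
    · intro i
      rw [IsChartOn.image_toChart]
      exact hWS _
    · simp only [IsChartOn.volume_toChart]
      rw [Equiv.sum_comp s.equivFin.symm fun l : s => v l, Finset.sum_coe_sort]

end StringyMeasure

section PullBack

variable {O : Type*} [CommRing O] {A B T : Type*} [CommRing A] [CommRing B] [CommRing T]
  [Algebra O A] [Algebra O B] [Algebra O T] {d : ℕ}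

lemma baseChangeForms_tprod {F F' : Type*} [CommRing F] [CommRing F'] [Algebra O F] [Algebra O F']
    [Algebra F F'] [IsScalarTower O F F'] (r : ℕ) (v : Fin d → F) :
    baseChangeForms O d r F F' (PiTensorProduct.tprod F fun _ : Fin r =>
      exteriorPower.ιMulti F d fun i => KaehlerDifferential.D O F (v i)) =
    PiTensorProduct.tprod F' fun _ : Fin r =>
      exteriorPower.ιMulti F' d fun i => KaehlerDifferential.D O F' (algebraMap F F' (v i)) := by
  unfold baseChangeForms
  simp only [PiTensorProduct.lift.tprod]
  simp [exteriorPower.alternatingMapLinearEquiv_apply_ιMulti]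
  refine congrArg _ (funext fun _ => ?_)
  change exteriorPower.ιMulti F' d (fun i => KaehlerDifferential.map O O F F'
    (KaehlerDifferential.D O F (v i))) = _
  simp only [KaehlerDifferential.map_D]

lemma pullbackForms_chartForm (r : ℕ) (φ : A →ₐ[O] B)
    (h : nonZeroDivisors A ≤ (nonZeroDivisors B).comap φ.toRingHom) (f : Fin d → A) (num : A)
    (den : nonZeroDivisors A) :
    pullbackForms d r φ h (chartForm O r f num den) =
      chartForm O r (fun i => φ (f i)) (φ num) ⟨φ den, h den.2⟩ := by
  letI : Algebra (FractionRing A) (FractionRing B) := (fractionMap φ h).toRingHom.toAlgebra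
  haveI : IsScalarTower O (FractionRing A) (FractionRing B) :=
    IsScalarTower.of_algebraMap_eq fun c => ((fractionMap φ h).commutes c).symm
  have hmap : ∀ a, algebraMap (FractionRing A) (FractionRing B) (algebraMap A _ a) =
      algebraMap B _ (φ a) := fractionMap_algebraMap φ h
  change baseChangeForms O d r (FractionRing A) (FractionRing B) _ = _
  unfold chartForm wedgeDPow wedgeD
  rw [map_smul, baseChangeForms_tprod, ← algebraMap_smul (FractionRing B)]
  simp only [hmap]
  congr 1
  rw [IsLocalization.eq_mk'_iff_mul_eq, ← hmap, ← hmap, ← map_mul, IsLocalization.mk'_spec]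

/-- Local generators in coordinates pull back to local generators. -/
def PullsBackGenerators (d : ℕ) (α : A →ₐ[O] T) (D : QDivisor A) (D' : QDivisor T) (r : ℕ) : Prop :=
  ∃ h : nonZeroDivisors A ≤ (nonZeroDivisors T).comap α.toRingHom,
    ∀ (p : PrimeSpectrum T) (f : Fin d → A) (num : A) (den : nonZeroDivisors A),
      IsLocalGenerator O D (PrimeSpectrum.comap α.toRingHom p) (chartForm O r f num den) →
        IsLocalGenerator O D' p (chartForm O r (fun i => α (f i)) (α num) ⟨α den, h den.2⟩)

lemma IsCrepant.pullsBackGenerators {α : A →ₐ[O] T} {D : QDivisor A} {D' : QDivisor T} {r : ℕ}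
    (h : IsCrepant d α D D') (hr : IsCartierIndex O d r D) (hr' : IsCartierIndex O d r D') :
    PullsBackGenerators d α D D' r := by
  obtain ⟨hα, h⟩ := h
  refine ⟨hα, fun p f num den hp => ?_⟩
  have := h r hr hr' p _ hp
  rwa [pullbackForms_chartForm] at this

lemma PullsBackGenerators.comp {α : A →ₐ[O] B} {β : B →ₐ[O] T} {D : QDivisor A} {D' : QDivisor B}
    {D'' : QDivisor T} {r : ℕ} (hα : PullsBackGenerators d α D D' r)
    (hβ : PullsBackGenerators d β D' D'' r) : PullsBackGenerators d (β.comp α) D D'' r := by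
  obtain ⟨h₁, hα⟩ := hα
  obtain ⟨h₂, hβ⟩ := hβ
  exact ⟨fun a ha => h₂ (h₁ ha), fun p f num den hp =>
    hβ p _ _ ⟨α den, h₁ den.2⟩ (hα (PrimeSpectrum.comap β.toRingHom p) f num den hp)⟩

end PullBack

section Transfer

variable {K : Type u} [Field K] [ValuativeRel K] [TopologicalSpace K]
  [IsNonarchimedeanLocalField K] {A B T : Type*} [CommRing A] [Algebra 𝒪[K] A]
  [CommRing B] [Algebra 𝒪[K] B] [CommRing T] [Algebra 𝒪[K] T] {d r : ℕ}
  {D : QDivisor A} {D' : QDivisor B} {D'' : QDivisor T}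

lemma absK_eval_eq_of_isLocalGenerator (hT : IsVariety 𝒪[K] T d) (hTn : IsNormal T)
    (β : B →ₐ[𝒪[K]] T) (y : IntegralPoint K B) {q p : PrimeSpectrum T} (hqp : q ≤ p)
    (hq : PrimeSpectrum.comap β.toRingHom q = y.generic)
    (hp : PrimeSpectrum.comap β.toRingHom p = y.special) {g₁ g₂ : Fin d → B} {n₁ n₂ e₁ e₂ : B}
    {e₁' e₂' : nonZeroDivisors T} (he₁ : (e₁' : T) = β e₁) (he₂ : (e₂' : T) = β e₂)
    (h₁ : IsLocalGenerator 𝒪[K] D'' p (chartForm 𝒪[K] r (fun i => β (g₁ i)) (β n₁) e₁'))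
    (h₂ : IsLocalGenerator 𝒪[K] D'' p (chartForm 𝒪[K] r (fun i => β (g₂ i)) (β n₂) e₂')) {s : B}
    {C : Matrix (Fin d) (Fin d) B} (h : ∀ i, s • KaehlerDifferential.D 𝒪[K] B (g₁ i) =
      ∑ j, C i j • KaehlerDifferential.D 𝒪[K] B (g₂ j)) :
    absK K (y.eval (n₂ * e₁ * s ^ (d * r))) = absK K (y.eval (n₁ * e₂ * C.det ^ r)) := by
  obtain ⟨Q, hQ, hQq⟩ := Ideal.exists_minimalPrimes_le (bot_le (a := q.asIdeal))
  have hQp : Q.IsPrime := hQ.1.1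
  letI := β.toRingHom.toAlgebra
  haveI : IsScalarTower 𝒪[K] B T := IsScalarTower.of_algebraMap_eq fun c => (β.commutes c).symm
  have h' : ∀ i, β s • KaehlerDifferential.D 𝒪[K] T (β (g₁ i)) =
      ∑ j, C.map β i j • KaehlerDifferential.D 𝒪[K] T (β (g₂ j)) := fun i => by
    have := congrArg (KaehlerDifferential.map 𝒪[K] 𝒪[K] B T) (h i)
    simp only [map_smul, map_sum, KaehlerDifferential.map_D] at this
    have hsm : ∀ (b : B) (ω : Ω[T⁄𝒪[K]]), b • ω = β b • ω := fun b ω =>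
      (algebraMap_smul T b ω).symm
    simp only [hsm] at this
    exact this
  obtain ⟨s', hs', a, ha, hsa⟩ := exists_mul_sub_mem_of_isLocalGenerator hT hTn
    (Q := ⟨Q, hQp⟩) hQ (hQq.trans hqp) h₁ h₂ h'
  refine absK_eval_eq β y hqp hq hp hs' ha (hQq ?_)
  have hdet : (C.map β).det = β C.det := (AlgHom.map_det _ _).symm
  rw [he₁, he₂, hdet] at hsa
  simpa only [map_mul, map_pow] using! hsa

lemma notMem_minimalPrimes_of_mem_nonZeroDivisors {b : B} (hb : b ∈ nonZeroDivisors B) {Q : Ideal B}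
    (hQ : Q ∈ minimalPrimes B) : b ∉ Q := fun h => by
  have : Q.IsPrime := hQ.1.1
  exact algebraMap_nonZeroDivisors_ne_zero hQ ⟨b, hb⟩ (Ideal.algebraMap_residueField_eq_zero.mpr h)

variable [MeasurableSpace K] [BorelSpace K]

/-- Crepant correspondences preserve volumes. -/
lemma vol_eq_of_pullsBackGenerators (hA : IsVariety 𝒪[K] A d) (hAn : IsNormal A)
    (hB : IsVariety 𝒪[K] B d) (hBn : IsNormal B) (hT : IsVariety 𝒪[K] T d) (hTn : IsNormal T)
    (hr : 0 < r) {θ : A →ₐ[𝒪[K]] B} {β : B →ₐ[𝒪[K]] T}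
    (hα : PullsBackGenerators d (β.comp θ) D D'' r) (hβ : PullsBackGenerators d β D' D'' r)
    (hθ : nonZeroDivisors A ≤ (nonZeroDivisors B).comap θ.toRingHom)
    (hover : ∀ y : IntegralPoint K B, ∃ q p : PrimeSpectrum T, q ≤ p ∧
      PrimeSpectrum.comap β.toRingHom q = y.generic ∧ PrimeSpectrum.comap β.toRingHom p = y.special)
    (hnorm : ∀ b ∈ nonZeroDivisors B, ∃ c ∈ nonZeroDivisors A, ∀ y : IntegralPoint K B,
      y.eval b = 0 → y.eval (θ c) = 0)
    {W : Set (IntegralPoint K B)} (hinj : W.InjOn (IntegralPoint.map θ)) {f : Fin d → A} {num : A}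
    {den : nonZeroDivisors A} (h : IsChartOn D r f num den (IntegralPoint.map θ '' W))
    {f' : Fin d → B} {num' : B} {den' : nonZeroDivisors B} (h' : IsChartOn D' r f' num' den' W) :
    vol (coordK f) (density r num den) (IntegralPoint.map θ '' W) =
      vol (coordK f') (density r num' den') W := by
  have := hA.isReduced
  have := hA.finiteType
  have := hA.isNoetherianRing
  have := hB.isReduced
  have := hB.finiteType
  have := hB.isNoetherianRing
  obtain ⟨hα₀, hα⟩ := hα
  obtain ⟨hβ₀, hβ⟩ := hβ
  set b : B := θ num * num' * (θ den * den') with hb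
  have hmem : ∀ y ∈ W, ∀ Q : PrimeSpectrum B, Q.asIdeal ∈ minimalPrimes B → Q ≤ y.generic →
      b ∉ Q.asIdeal := by
    intro y hy Q hQ hQy hQb
    rcases Q.2.mem_or_mem hQb with h0 | h0
    · rcases Q.2.mem_or_mem h0 with h0 | h0
      · obtain ⟨q, p, hqp, hq, hp⟩ := hover y
        obtain ⟨Q', hQ', hQq⟩ := Ideal.exists_minimalPrimes_le (bot_le (a := q.asIdeal))
        have hQp : Q'.IsPrime := hQ'.1.1
        obtain ⟨Q'', hQ'', hQle⟩ := Ideal.exists_minimalPrimes_le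
          (bot_le (a := Q'.comap β.toRingHom))
        have hle : Q'.comap β.toRingHom ≤ y.generic.asIdeal := by
          rw [← hq]; exact Ideal.comap_mono hQq
        have heq := hBn.eq_of_le (p := y.generic.asIdeal) hQ hQy hQ'' (hQle.trans hle)
        have h1 := hα p f num den (by
          have := h.isLocalGenerator _ ⟨y, hy, rfl⟩
          rwa [IntegralPoint.special_map, ← hp] at this)
        exact num_notMem_of_isLocalGenerator hT hTn (Q := ⟨Q', hQp⟩) hQ' (hQq.trans hqp) h1
          (hQle (heq ▸ h0))
      · exact num_notMem_of_isLocalGenerator hB hBn hQ (hQy.trans y.generic_le_special)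
          (h'.isLocalGenerator y hy) h0
    · exact notMem_minimalPrimes_of_mem_nonZeroDivisors (mul_mem (hθ den.2) den'.2) hQ h0
  have hdiff : W \ {y ∈ W | y.eval b ≠ 0} = {y ∈ W | y.eval b = 0} := by
    ext y
    simp only [Set.mem_sdiff, Set.mem_ofPred_eq]
    tauto
  rw [vol_image]
  refine vol_eq_of_locally ((continuous_coordK _).comp (IntegralPoint.continuous_map θ))
    (continuous_coordK _) h'.isClopen.1 (h.injOn.comp hinj (Set.mapsTo_image _ _))
    h'.injOn (S := {y ∈ W | y.eval b ≠ 0}) (fun y hy => hy.1) ?_ ?_ fun y hy => ?_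
  · rw [hdiff]
    have hfin : (minimalPrimes B).Finite := minimalPrimes.finite_of_isNoetherianRing B
    refine MeasureTheory.measure_mono_null (t := ⋃ Q ∈ minimalPrimes B,
      (coordK f ∘ IntegralPoint.map θ) '' {y ∈ W | y.eval b = 0 ∧ Q ≤ y.generic.asIdeal}) ?_
      ((MeasureTheory.measure_biUnion_null_iff hfin.countable).mpr fun Q hQ => ?_)
    · rintro _ ⟨y, ⟨hy, hyb⟩, rfl⟩
      obtain ⟨Q, hQ, hQy⟩ := Ideal.exists_minimalPrimes_le (bot_le (a := y.generic.asIdeal))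
      exact Set.mem_biUnion hQ ⟨y, ⟨hy, hyb, hQy⟩, rfl⟩
    have hQp : Q.IsPrime := hQ.1.1
    by_cases hne : ∃ y ∈ W, Q ≤ y.generic.asIdeal
    · obtain ⟨y₀, hy₀, hQy₀⟩ := hne
      obtain ⟨e, he'⟩ := hBn.exists_idempotent hQ
      have he : IsComponentIdempotent Q e := he'
      obtain ⟨c, hc, hcy⟩ := hnorm _ (he.mem_nonZeroDivisors (hmem y₀ hy₀ ⟨Q, hQp⟩ hQ hQy₀))
      refine MeasureTheory.measure_mono_null ?_ (haar_image_zeros_eq_zero (h := c) h.etale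
        fun x _ Q' hQ' _ => notMem_minimalPrimes_of_mem_nonZeroDivisors hc hQ')
      rintro _ ⟨y, ⟨hy, hyb, hQy⟩, rfl⟩
      refine ⟨y.map θ, ⟨⟨y, hy, rfl⟩, hcy y ?_⟩, rfl⟩
      have h1 : y.eval (1 - e) = 0 := hQy he.1
      rw [map_add, map_mul, hyb, zero_mul, h1, add_zero]
    · convert MeasureTheory.measure_empty (μ := haar K d)
      rw [Set.image_eq_empty, Set.eq_empty_iff_forall_notMem]
      exact fun y hy => hne ⟨y, hy.1, hy.2.2⟩
  · rw [hdiff]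
    exact haar_image_zeros_eq_zero h'.etale hmem
  · obtain ⟨hyW, hy0⟩ := hy
    have hy1 := hy0
    simp only [hb, map_mul, mul_ne_zero_iff] at hy1
    obtain ⟨q, p, hqp, hq, hp⟩ := hover y
    obtain ⟨k, hk⟩ := exists_ball_vol_eq hr y (f₁ := fun i => θ (f i)) (h'.etale y hyW) hy1.1.1
      hy1.2.1 hy1.1.2 hy1.2.2 fun s C hC =>
        absK_eval_eq_of_isLocalGenerator hT hTn β y hqp hq hp (e₁' := ⟨_, hα₀ den.2⟩)
          (e₂' := ⟨_, hβ₀ den'.2⟩) rfl rfl (hα p f num den (by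
            have := h.isLocalGenerator _ ⟨y, hyW, rfl⟩
            rwa [IntegralPoint.special_map, ← hp] at this)) (hβ p f' num' den' (by
            rw [hp]; exact h'.isLocalGenerator y hyW)) hC
    obtain ⟨l, hl⟩ := IntegralPoint.exists_ball_subset (x := y)
      ((h'.isClopen.2.inter (IntegralPoint.isOpen_eval_ne_zero b)).mem_nhds ⟨hyW, hy0⟩)
    refine ⟨y.ball (k + l), IntegralPoint.isClopen_ball _ _, y.mem_ball_self _, fun z hz => ?_,
      fun V hV hVc => hk V (hV.trans (IntegralPoint.ball_subset (y.mem_ball_self _)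
        (by omega))) hVc.1⟩
    exact hl (IntegralPoint.ball_subset (y.mem_ball_self _) (by omega) hz)

end Transfer

section Orbits

open Polynomial

variable {O G A : Type*} [CommRing O] [CommRing A] [Algebra O A] [Group G]
  [MulSemiringAction G A] [SMulCommClass G O A]

lemma exists_lift_invariant_polynomial (F : A[X]) (hF : ∀ g : G, F.map (MulSemiringAction.toRingHom G A g) = F) :
    ∃ P : (QuotientRing O G A)[X], P.map (algebraMap (QuotientRing O G A) A) = F := by
  have : F ∈ Polynomial.lifts (algebraMap (QuotientRing O G A) A) := by
    rw [Polynomial.lifts_iff_coeff_lifts]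
    intro k
    refine ⟨⟨F.coeff k, fun g => ?_⟩, rfl⟩
    have := congrArg (Polynomial.coeff · k) (hF g)
    simpa [Polynomial.coeff_map] using this
  simpa [Polynomial.mem_lifts] using this

variable [Fintype G] [DecidableEq G]

/-- The polynomial with the conjugates of `a` as roots has invariant coefficients. -/
lemma exists_orbitPoly (O : Type*) [CommRing O] [Algebra O A] [SMulCommClass G O A] (a : A) :
    ∃ P : (QuotientRing O G A)[X], P.map (algebraMap (QuotientRing O G A) A) =
      ∏ g : G, (X - C (g • a)) := by
  refine exists_lift_invariant_polynomial _ fun g => ?_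
  rw [Polynomial.map_prod]
  refine Fintype.prod_equiv (Equiv.mulLeft g) _ _ fun h => ?_
  simp [mul_smul]

/-- The derivative at `a` of the polynomial with the conjugates of `a` as roots. -/
def orbitDeriv (G : Type*) [Group G] [Fintype G] [DecidableEq G] [MulSemiringAction G A] (a : A) : A :=
  ∏ h ∈ Finset.univ.erase (1 : G), (a - h • a)

lemma smul_orbitDeriv (a : A) (g : G) :
    g • orbitDeriv G a = ∏ h ∈ Finset.univ.erase g, (g • a - h • a) := by
  unfold orbitDeriv
  rw [Finset.smul_prod']
  refine Finset.prod_bij (fun h _ => g * h) (fun h hh => ?_) (fun h _ h' _ e => mul_left_cancel e)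
    (fun h hh => ⟨g⁻¹ * h, ?_, mul_inv_cancel_left g h⟩) fun h _ => by rw [smul_sub, mul_smul]
  · simpa using hh
  · simp only [Finset.mem_erase, Finset.mem_univ, and_true] at hh ⊢
    exact fun e => hh (by rw [inv_mul_eq_one] at e; exact e.symm)

/-- The discriminant of the orbit of `a`. -/
def orbitDisc (G : Type*) [Group G] [Fintype G] [DecidableEq G] [MulSemiringAction G A] (a : A) : A :=
  ∏ g : G, g • orbitDeriv G a

lemma smul_orbitDisc (a : A) (g : G) : g • orbitDisc G a = orbitDisc G a := by
  unfold orbitDisc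
  rw [Finset.smul_prod']
  exact Fintype.prod_equiv (Equiv.mulLeft g) _ _ fun h => by simp [mul_smul]

lemma orbitDeriv_dvd_orbitDisc (a : A) (g : G) : g • orbitDeriv G a ∣ orbitDisc G a :=
  Finset.dvd_prod_of_mem _ (Finset.mem_univ g)

lemma sub_dvd_orbitDisc (a : A) {g h : G} (hgh : g ≠ h) : g • a - h • a ∣ orbitDisc G a := by
  refine dvd_trans ?_ (orbitDeriv_dvd_orbitDisc a g)
  rw [smul_orbitDeriv]
  exact Finset.dvd_prod_of_mem (fun h => g • a - h • a)
    (Finset.mem_erase.mpr ⟨hgh.symm, Finset.mem_univ h⟩)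

/-- Lagrange interpolation: `b P'(a) = Q_b(a)` for a polynomial `Q_b` with invariant coefficients. -/
lemma exists_lagrangePoly (O : Type*) [CommRing O] [Algebra O A] [SMulCommClass G O A] (a b : A) :
    ∃ Q : (QuotientRing O G A)[X],
      (Q.map (algebraMap (QuotientRing O G A) A)).eval a = b * orbitDeriv G a := by
  obtain ⟨Q, hQ⟩ := exists_lift_invariant_polynomial (O := O) (G := G)
    (∑ g : G, C (g • b) * ∏ h ∈ Finset.univ.erase g, (X - C (h • a))) fun g => by
      rw [Polynomial.map_sum]
      refine Fintype.sum_equiv (Equiv.mulLeft g) _ _ fun h => ?_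
      rw [Polynomial.map_mul, Polynomial.map_prod]
      congr 1
      · simp [mul_smul]
      · refine Finset.prod_bij (fun k _ => g * k) (fun k hk => ?_) (fun k _ k' _ e =>
          mul_left_cancel e) (fun k hk => ⟨g⁻¹ * k, ?_, mul_inv_cancel_left g k⟩) fun k _ => by
            simp [mul_smul]
        · simpa using hk
        · simp only [Finset.mem_erase, Finset.mem_univ, and_true, Equiv.coe_mulLeft] at hk ⊢
          exact fun e => hk (by rw [← e, mul_inv_cancel_left])
  refine ⟨Q, ?_⟩
  rw [hQ, Polynomial.eval_finsetSum, Finset.sum_eq_single 1]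
  · simp [Polynomial.eval_prod, orbitDeriv]
  · intro g _ hg
    rw [Polynomial.eval_mul, Polynomial.eval_prod]
    rw [Finset.prod_eq_zero (i := 1) (by simpa using hg.symm) (by simp), mul_zero]
  · simp

/-- Homomorphisms are determined by their restriction to the invariants and their value at `a`. -/
lemma ringHom_eq_of_eq {C : Type*} [CommRing C] {φ φ' : A →+* C} {a : A}
    (hB : ∀ b : QuotientRing O G A, φ b = φ' b) (ha : φ a = φ' a)
    (hδ : IsLeftRegular (φ (orbitDisc G a))) : φ = φ' := by
  ext b
  obtain ⟨Q, hQ⟩ := exists_lagrangePoly (G := G) O a b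
  obtain ⟨Q', hQ'⟩ := exists_lagrangePoly (G := G) O a 1
  have hcomp : φ.comp (algebraMap (QuotientRing O G A) A) = φ'.comp (algebraMap _ A) :=
    RingHom.ext hB
  have key : ∀ Q : (QuotientRing O G A)[X], φ ((Q.map (algebraMap (QuotientRing O G A) A)).eval a) =
      φ' ((Q.map (algebraMap _ A)).eval a) := fun Q => by
    rw [← Polynomial.eval₂_eq_eval_map, Polynomial.hom_eval₂,
      Polynomial.hom_eval₂, hcomp, ha]
  have h1 := key Q
  have h2 := key Q'
  rw [hQ, map_mul, map_mul] at h1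
  rw [hQ', one_mul] at h2
  rw [← h2] at h1
  obtain ⟨c, hc⟩ := orbitDeriv_dvd_orbitDisc (G := G) a 1
  rw [one_smul] at hc
  apply hδ
  change φ (orbitDisc G a) * φ b = φ (orbitDisc G a) * φ' b
  rw [hc, map_mul]
  linear_combination φ c * h1

end Orbits

section Separating

variable {O G A : Type*} [CommRing O] [CommRing A] [Algebra O A] [Group G]
  [MulSemiringAction G A] [SMulCommClass G O A] [Fintype G] [DecidableEq G]

lemma exists_smul_sub_notMem (hfaith : ∀ g : G, g ≠ 1 → ∀ P ∈ minimalPrimes A, ∃ a : A, g • a - a ∉ P)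
    {P : Ideal A} (hP : P ∈ minimalPrimes A) {g h : G} (hgh : g ≠ h) : ∃ a : A, g • a - h • a ∉ P := by
  have hP' : P.IsPrime := hP.1.1
  have h1 : P.comap (MulSemiringAction.toRingEquiv G A h : A →+* A) ∈ minimalPrimes A := by
    have h2 := Ideal.comap_minimalPrimes_eq_of_surjective
      (f := (MulSemiringAction.toRingEquiv G A h : A →+* A))
      (MulSemiringAction.toRingEquiv G A h).surjective ⊥
    have h3 : (⊥ : Ideal A).comap (MulSemiringAction.toRingEquiv G A h : A →+* A) = ⊥ :=
      Ideal.comap_bot_of_injective _ (MulSemiringAction.toRingEquiv G A h).injective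
    rw [h3] at h2
    have h4 : P.comap (MulSemiringAction.toRingEquiv G A h : A →+* A) ∈
        (⊥ : Ideal A).minimalPrimes := by
      rw [h2]
      exact ⟨P, hP, rfl⟩
    exact h4
  obtain ⟨a, ha⟩ := hfaith (h⁻¹ * g) (fun e => hgh (inv_mul_eq_one.mp e).symm) _ h1
  refine ⟨a, fun hmem => ha ?_⟩
  change h • ((h⁻¹ * g) • a - a) ∈ P
  rwa [smul_sub, smul_smul, mul_inv_cancel_left]

/-- There is a function with different conjugates on all components. -/
lemma exists_orbitDisc_notMem [IsDomain O] [Infinite O] [IsNoetherianRing A]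
    (hinj : ∀ P ∈ minimalPrimes A, ∀ c : O, algebraMap O A c ∈ P → c = 0)
    (hfaith : ∀ g : G, g ≠ 1 → ∀ P ∈ minimalPrimes A, ∃ a : A, g • a - a ∉ P) {n : ℕ}
    {x : Fin n → A} (hx : Algebra.adjoin O (Set.range x) = ⊤) :
    ∃ a : A, ∀ P ∈ minimalPrimes A, orbitDisc G a ∉ P := by
  have hfin : (minimalPrimes A).Finite := minimalPrimes.finite_of_isNoetherianRing A
  set a : O → A := fun t => ∑ j : Fin n, algebraMap O A (t ^ (j : ℕ)) * x j with ha
  have hbad : ∀ P ∈ minimalPrimes A, ∀ g h : G, g ≠ h → {t | g • a t - h • a t ∈ P}.Finite := by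
    intro P hP g h hgh
    have hP' : P.IsPrime := hP.1.1
    have hne : ∃ j, g • x j - h • x j ∉ P := by
      by_contra! hall
      obtain ⟨b, hb⟩ := exists_smul_sub_notMem hfaith hP hgh
      have hb' : b ∈ Algebra.adjoin O (Set.range x) := hx ▸ Algebra.mem_top
      have hall' : g • b - h • b ∈ P := by
        clear hb
        induction hb' using Algebra.adjoin_induction with
        | mem b hb => obtain ⟨j, rfl⟩ := hb; exact hall j
        | algebraMap c => rw [smul_algebraMap, smul_algebraMap, sub_self]; exact zero_mem _
        | add b c _ _ hb hc =>
          rw [smul_add, smul_add, add_sub_add_comm]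
          exact add_mem hb hc
        | mul b c _ _ hb hc =>
          rw [smul_mul', smul_mul', show (g • b) * (g • c) - (h • b) * (h • c) =
            (g • b) * (g • c - h • c) + (h • c) * (g • b - h • b) by ring]
          exact add_mem (P.mul_mem_left _ hc) (P.mul_mem_left _ hb)
      exact hb hall'
    obtain ⟨j₀, hj₀⟩ := hne
    set F : Polynomial (A ⧸ P) := ∑ j : Fin n, Polynomial.C (Ideal.Quotient.mk P (g • x j - h • x j)) *
      Polynomial.X ^ (j : ℕ) with hF
    have hF0 : F ≠ 0 := fun h0 => by
      have := congrArg (Polynomial.coeff · (j₀ : ℕ)) h0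
      simp only [hF, Polynomial.finsetSum_coeff, Polynomial.coeff_C_mul, Polynomial.coeff_X_pow,
        Polynomial.coeff_zero] at this
      rw [Finset.sum_eq_single j₀ (fun k _ hk => by
        rw [if_neg (fun e => hk (Fin.ext e.symm)), mul_zero]) (by simp)] at this
      rw [if_pos rfl, mul_one] at this
      exact hj₀ (Ideal.Quotient.eq_zero_iff_mem.mp this)
    have hroot : ∀ t, g • a t - h • a t ∈ P → (algebraMap O (A ⧸ P) t) ∈ F.rootSet (A ⧸ P) := by
      intro t ht
      rw [Polynomial.mem_rootSet_of_ne hF0, Polynomial.coe_aeval_eq_eval]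
      rw [← Ideal.Quotient.eq_zero_iff_mem] at ht
      rw [← ht, hF, Polynomial.eval_finsetSum, ha]
      dsimp only
      rw [Finset.smul_sum, Finset.smul_sum, ← Finset.sum_sub_distrib, map_sum]
      refine Finset.sum_congr rfl fun j _ => ?_
      rw [smul_mul', smul_mul', smul_algebraMap, smul_algebraMap, ← mul_sub, map_mul, mul_comm]
      simp only [Polynomial.eval_mul, Polynomial.eval_C, Polynomial.eval_pow, Polynomial.eval_X,
        map_pow]
      rfl
    refine Set.Finite.of_finite_image ((F.rootSet_finite (A ⧸ P)).subset
      (Set.image_subset_iff.mpr fun t ht => hroot t ht)) ?_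
    intro t _ t' _ htt
    have h1 : algebraMap O A (t - t') ∈ P := by
      rw [← Ideal.Quotient.eq_zero_iff_mem, map_sub, map_sub, sub_eq_zero]
      exact htt
    exact sub_eq_zero.mp (hinj P hP _ h1)
  have hbad' : (⋃ P ∈ minimalPrimes A, ⋃ g : G, ⋃ h : G, ⋃ _ : g ≠ h,
      {t | g • a t - h • a t ∈ P}).Finite :=
    hfin.biUnion fun P hP => Set.finite_iUnion fun g => Set.finite_iUnion fun h =>
      Set.finite_iUnion fun hgh => hbad P hP g h hgh
  obtain ⟨t, ht⟩ := hbad'.exists_notMem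
  refine ⟨a t, fun P hP hmem => ht ?_⟩
  have hP' : P.IsPrime := hP.1.1
  obtain ⟨g, -, hg⟩ := (Ideal.IsPrime.prod_mem_iff (hp := hP')).mp hmem
  rw [smul_orbitDeriv] at hg
  obtain ⟨h, hh, hgh⟩ := (Ideal.IsPrime.prod_mem_iff (hp := hP')).mp hg
  exact Set.mem_biUnion hP (Set.mem_iUnion.mpr ⟨g, Set.mem_iUnion.mpr ⟨h, Set.mem_iUnion.mpr
    ⟨(Finset.mem_erase.mp hh).1.symm, hgh⟩⟩⟩)

/-- There is a function whose trace vanishes on no component. -/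
lemma exists_trace_notMem [IsNoetherianRing A]
    (hfaith : ∀ g : G, g ≠ 1 → ∀ P ∈ minimalPrimes A, ∃ a : A, g • a - a ∉ P) :
    ∃ f : A, ∀ P ∈ minimalPrimes A, ∑ g : G, g • f ∉ P := by
  have hfin : (minimalPrimes A).Finite := minimalPrimes.finite_of_isNoetherianRing A
  have h1 : ∀ P ∈ minimalPrimes A, ∃ f : A, ∑ g : G, g • f ∉ P := by
    intro P hP
    have hP' : P.IsPrime := hP.1.1
    by_contra! hall
    have hli := linearIndependent_monoidHom A (A ⧸ P)
    set χ : G → A →* A ⧸ P := fun g =>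
      ((Ideal.Quotient.mk P).comp (MulSemiringAction.toRingHom G A g)).toMonoidHom with hχ
    have hχinj : Function.Injective χ := fun g h e => by
      by_contra hgh
      obtain ⟨a, ha⟩ := exists_smul_sub_notMem hfaith hP hgh
      refine ha (Ideal.Quotient.eq_zero_iff_mem.mp ?_)
      rw [map_sub, sub_eq_zero]
      exact DFunLike.congr_fun e a
    have := (Fintype.linearIndependent_iff.mp (hli.comp χ hχinj)) (fun _ => 1) (by
      ext f
      simp only [Function.comp_apply, one_smul, Finset.sum_apply, Pi.zero_apply]
      rw [← Ideal.Quotient.eq_zero_iff_mem.mpr (hall f), map_sum]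
      rfl) 1
    exact one_ne_zero this
  set I : Ideal (FixedPoints.subring A G) :=
    { carrier := {b | ∃ f : A, (b : A) = ∑ g : G, g • f}
      add_mem' := by
        rintro _ _ ⟨f, hf⟩ ⟨f', hf'⟩
        exact ⟨f + f', by simp [hf, hf', Finset.sum_add_distrib]⟩
      zero_mem' := ⟨0, by simp⟩
      smul_mem' := by
        rintro c _ ⟨f, hf⟩
        refine ⟨c * f, ?_⟩
        have : ∀ g : G, g • (c : A) = c := c.2
        simp [hf, Finset.mul_sum, this] } with hI
  by_contra! hall
  have hsub : (I : Set (FixedPoints.subring A G)) ⊆ ⋃ P ∈ (hfin.toFinset : Set (Ideal A)),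
      (P.comap (FixedPoints.subring A G).subtype : Set (FixedPoints.subring A G)) := by
    rintro b ⟨f, hf⟩
    obtain ⟨P, hP, hPf⟩ := hall f
    exact Set.mem_biUnion (hfin.mem_toFinset.mpr hP) (by
      change (b : A) ∈ P
      rwa [hf])
  rw [Ideal.subset_union_prime (f := fun P : Ideal A => P.comap (FixedPoints.subring A G).subtype)
    ⊥ ⊥ (fun P hP _ _ => by
      have hP' : P.IsPrime := ((hfin.mem_toFinset).mp hP).1.1
      exact Ideal.IsPrime.comap _)] at hsub
  obtain ⟨P, hP, hIP⟩ := hsub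
  obtain ⟨f, hf⟩ := h1 P (hfin.mem_toFinset.mp hP)
  refine hf (hIP (show (⟨∑ g : G, g • f, fun h => ?_⟩ : FixedPoints.subring A G) ∈ I from ⟨f, rfl⟩))
  rw [Finset.smul_sum]
  exact Fintype.sum_equiv (Equiv.mulLeft h) _ _ fun g => by simp [mul_smul]

end Separating

section Torsors

open Polynomial

variable {O G A : Type*} [CommRing O] [CommRing A] [Algebra O A] [Group G]
  [MulSemiringAction G A] [SMulCommClass G O A]

/-- The homomorphism `ψ : A → M` is equivariant and lies over the `K`-point `ξ` of `Spec A / G`. -/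
structure IsTwisted {K : Type u} [Field K] (ξ : QuotientRing O G A →+* K) (M : GEtaleAlgebra K G)
    (ψ : A →+* M.carrier) : Prop where
  restrict : ∀ b : QuotientRing O G A, ψ b = algebraMap K M.carrier (ξ b)
  smul : ∀ (g : G) (a : A), ψ (g • a) = g • ψ a

variable [Fintype G] [DecidableEq G]

/-- The discriminant of the orbit of `a` as an invariant function. -/
def invariantDisc (O G : Type*) {A : Type*} [CommRing O] [CommRing A] [Algebra O A] [Group G]
    [MulSemiringAction G A] [SMulCommClass G O A] [Fintype G] [DecidableEq G] (a : A) :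
    QuotientRing O G A :=
  ⟨orbitDisc G a, fun g => smul_orbitDisc a g⟩

omit [SMulCommClass G O A] [Algebra O A] [CommRing O] in
lemma injective_orbit {L : Type*} [CommRing L] [IsDomain L] {χ : A →+* L} {a : A}
    (h : χ (orbitDisc G a) ≠ 0) : Function.Injective fun g : G => χ (g • a) := by
  intro g g' e
  by_contra hne
  obtain ⟨c, hc⟩ := sub_dvd_orbitDisc (G := G) a hne
  refine h ?_
  rw [hc, map_mul, map_sub, sub_eq_zero.mpr e, zero_mul]

lemma eq_zero_of_aeval_orbit {K L : Type*} [Field K] [Field L] [Algebra K L] {χ : A →+* L} {a : A}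
    (h : χ (orbitDisc G a) ≠ 0) {p : K[X]} (hdeg : p.degree < Fintype.card G)
    (hp : ∀ g : G, aeval (χ (g • a)) p = 0) : p = 0 := by
  rw [← Polynomial.map_eq_zero (algebraMap K L)]
  refine Polynomial.eq_zero_of_degree_lt_of_eval_index_eq_zero (s := Finset.univ)
    (v := fun g : G => χ (g • a)) ((injective_orbit h).injOn) (by rwa [degree_map]) fun g _ => ?_
  rw [eval_map_algebraMap, hp]

section OrbitPoly

variable {a : A} {P : (QuotientRing O G A)[X]}
  (hP : P.map (algebraMap (QuotientRing O G A) A) = ∏ g : G, (X - C (g • a)))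

include hP

lemma monic_orbitPoly : P.Monic := by
  refine Polynomial.monic_of_injective (f := algebraMap (QuotientRing O G A) A)
    Subtype.val_injective ?_
  rw [hP]
  exact monic_prod_X_sub_C _ _

lemma natDegree_orbitPoly [Nontrivial A] : P.natDegree = Fintype.card G := by
  rw [← natDegree_map_eq_of_injective (f := algebraMap (QuotientRing O G A) A)
    Subtype.val_injective P, hP]
  simp

lemma map_orbitPoly {K L : Type*} [CommRing K] [CommRing L] [Algebra K L]
    {ξ : QuotientRing O G A →+* K} {χ : A →+* L}
    (hχ : ∀ b : QuotientRing O G A, χ b = algebraMap K L (ξ b)) :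
    (P.map ξ).map (algebraMap K L) = ∏ g : G, (X - C (χ (g • a))) := by
  have h1 : (algebraMap K L).comp ξ = χ.comp (algebraMap (QuotientRing O G A) A) :=
    RingHom.ext fun b => (hχ b).symm
  rw [Polynomial.map_map, h1, ← Polynomial.map_map, hP]
  simp [Polynomial.map_prod]

lemma aeval_orbitPoly {K L : Type*} [CommRing K] [CommRing L] [Algebra K L]
    {ξ : QuotientRing O G A →+* K} {χ : A →+* L}
    (hχ : ∀ b : QuotientRing O G A, χ b = algebraMap K L (ξ b)) (g : G) :
    aeval (χ (g • a)) (P.map ξ) = 0 := by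
  rw [← eval_map_algebraMap, map_orbitPoly hP hχ, eval_prod]
  exact Finset.prod_eq_zero (Finset.mem_univ g) (by simp)

lemma separable_orbitPoly {K L : Type*} [Field K] [Field L] [Algebra K L]
    {ξ : QuotientRing O G A →+* K} {χ : A →+* L}
    (hχ : ∀ b : QuotientRing O G A, χ b = algebraMap K L (ξ b)) (h : χ (orbitDisc G a) ≠ 0) :
    (P.map ξ).Separable := by
  rw [← separable_map (algebraMap K L), map_orbitPoly hP hχ]
  exact separable_prod_X_sub_C_iff.mpr (injective_orbit h)

end OrbitPoly

lemma etale_adjoinRoot {K : Type*} [Field K] {f : K[X]} (hf : f.Monic) (hsep : f.Separable) :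
    Algebra.Etale K (AdjoinRoot f) := by
  obtain ⟨p, q, hpq⟩ := hsep
  let Q : StandardEtalePair K := ⟨f, hf, 1, q, p, 0, by linear_combination hpq⟩
  have h1 : IsUnit (AdjoinRoot.mk Q.f Q.g) := by
    change IsUnit (AdjoinRoot.mk f 1)
    simp
  have e : AdjoinRoot f ≃ₐ[AdjoinRoot f] Localization.Away (AdjoinRoot.mk Q.f Q.g) :=
    IsLocalization.atUnits (AdjoinRoot f) (Submonoid.powers (AdjoinRoot.mk Q.f Q.g)) (by
      rintro _ ⟨k, rfl⟩
      exact h1.pow k)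
  exact Algebra.Etale.of_equiv (Q.equivAwayAdjoinRoot.trans (e.restrictScalars K).symm)

omit [Fintype G] [DecidableEq G] in
lemma isIntegral_quotientRing [Finite G] : Algebra.IsIntegral (QuotientRing O G A) A := by
  have hinv : Algebra.IsInvariant (QuotientRing O G A) A G := ⟨fun b hb => ⟨⟨b, hb⟩, rfl⟩⟩
  have : SMulCommClass G (QuotientRing O G A) A := ⟨fun g b a => by
    change g • ((b : A) * a) = (b : A) * g • a
    rw [smul_mul', show g • (b : A) = b from b.2 g]⟩
  exact Algebra.IsInvariant.isIntegral (QuotientRing O G A) A G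

lemma exists_lift_of_isDomain {R S L : Type*} [CommRing R] [IsDomain R] [CommRing S] [IsDomain S] [Algebra R S] [Algebra.IsIntegral R S]
   [Field L] [IsAlgClosed L] (hinj' : Function.Injective (algebraMap R S)) (ξ : R →+* L) (hinj : Function.Injective ξ) :
   ∃ χ : S →+* L, ∀ b, χ (algebraMap R S b) = ξ b := by
  let _ : Algebra R L := ξ.toAlgebra
  have : Module.IsTorsionFree R L :=
    Module.isTorsionFree_iff_algebraMap_injective.mpr hinj
  have : Module.IsTorsionFree R S :=
    Module.isTorsionFree_iff_algebraMap_injective.mpr hinj'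
  let χ : S →ₐ[R] L := IsAlgClosed.lift
  exact ⟨χ.toRingHom, fun b => χ.commutes b⟩

lemma exists_lift_of_isAlgClosed {A B : Type*} [CommRing A] [CommRing B] [Algebra B A]
    (hBA : Function.Injective (algebraMap B A)) [Algebra.IsIntegral B A]
    {L : Type*} [Field L] [IsAlgClosed L] (ξ : B →+* L) :
    ∃ χ : A →+* L, ∀ b : B, χ (algebraMap B A b) = ξ b := by
  have hk : (RingHom.ker ξ).IsPrime := RingHom.ker_isPrime ξ
  obtain ⟨q, -, hq, hqk⟩ := Ideal.exists_ideal_over_prime_of_isIntegral (RingHom.ker ξ)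
    (⊥ : Ideal A) (fun b hb => by
      have : b = 0 := hBA (by rw [map_zero]; exact hb)
      rw [this]; exact zero_mem _)
  have hlies : q.LiesOver (RingHom.ker ξ) := ⟨hqk.symm⟩
  obtain ⟨χ, hχ⟩ := exists_lift_of_isDomain (R := B ⧸ RingHom.ker ξ) (S := A ⧸ q) (FaithfulSMul.algebraMap_injective _ _) (RingHom.kerLift ξ)
     (RingHom.kerLift_injective ξ)
  refine ⟨χ.comp (Ideal.Quotient.mk q), fun b => ?_⟩
  exact hχ (Ideal.Quotient.mk _ b)

lemma exists_isTwisted_of_lift {K : Type u} [Field K] {L : Type*} [Field L] [Algebra K L]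
    {ξ : QuotientRing O G A →+* K} (a : A) (hδ : ξ (invariantDisc O G a) ≠ 0) {χ : A →+* L}
    (hχ : ∀ b : QuotientRing O G A, χ b = algebraMap K L (ξ b)) :
    ∃ (M : GEtaleAlgebra K G) (ψ : A →+* M.carrier), IsTwisted ξ M ψ := by
  have hδ' : χ (orbitDisc G a) ≠ 0 := by
    have := hχ (invariantDisc O G a)
    change χ (orbitDisc G a) = _ at this
    rw [this]
    exact (_root_.map_ne_zero _).mpr hδ
  have : Nontrivial A := χ.domain_nontrivial
  obtain ⟨P, hP⟩ := exists_orbitPoly (G := G) O a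
  have hmon := (monic_orbitPoly hP).map ξ
  have hdegP : (P.map ξ).natDegree = Fintype.card G := by
    rw [(monic_orbitPoly hP).natDegree_map, natDegree_orbitPoly hP]
  -- functions on the orbit
  set hat : A →+* (G → L) := RingHom.pi fun g => χ.comp (MulSemiringAction.toRingHom G A g) with hhat
  have hat_apply : ∀ b g, hat b g = χ (g • b) := fun _ _ => rfl
  have hat_aeval : ∀ (b : A) (p : K[X]) (g : G), aeval (hat b) p g = aeval (χ (g • b)) p := by
    intro b p g
    exact (aeval_algHom_apply (Pi.evalAlgHom K (fun _ : G => L) g) (hat b) p).symm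
  set e : AdjoinRoot (P.map ξ) →ₐ[K] (G → L) := AdjoinRoot.liftAlgHom (P.map ξ) (Algebra.ofId _ _)
    (hat a) (by
      change aeval (hat a) (P.map ξ) = 0
      ext g
      rw [hat_aeval, aeval_orbitPoly hP hχ]
      rfl) with he
  have he_mk : ∀ p : K[X], e (AdjoinRoot.mk _ p) = aeval (hat a) p := fun p => by
    rw [he, AdjoinRoot.liftAlgHom_mk]
    rfl
  have hred : ∀ m : AdjoinRoot (P.map ξ), ∃ p : K[X], p.degree < Fintype.card G ∧
      AdjoinRoot.mk _ p = m := by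
    intro m
    obtain ⟨p, rfl⟩ := AdjoinRoot.mk_surjective m
    refine ⟨p %ₘ (P.map ξ), ?_, AdjoinRoot.mk_leftInverse hmon (AdjoinRoot.mk _ p)⟩
    rw [← hdegP, ← Polynomial.degree_eq_natDegree hmon.ne_zero]
    exact degree_modByMonic_lt _ hmon
  have hinj : Function.Injective e := by
    rw [injective_iff_map_eq_zero]
    intro m hm
    obtain ⟨p, hp, rfl⟩ := hred m
    rw [he_mk] at hm
    rw [eq_zero_of_aeval_orbit hδ' hp fun g => by rw [← hat_aeval, hm]; rfl, map_zero]
  have hfin : Module.Finite K (AdjoinRoot (P.map ξ)) := hmon.finite_adjoinRoot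
  have hV : Module.Finite K e.range :=
    Module.Finite.of_surjective e.rangeRestrict.toLinearMap e.rangeRestrict_surjective
  have aeval_mem : ∀ p : K[X], aeval (hat a) p ∈ e.range := fun p => ⟨AdjoinRoot.mk _ p, he_mk p⟩
  -- all functions on `Spec A` restrict to the subalgebra generated by `a`
  have hlag : ∀ b : A, hat b * hat (orbitDeriv G a) ∈ e.range := by
    intro b
    obtain ⟨Q, hQ⟩ := exists_lagrangePoly (G := G) O a b
    have h1 : aeval (hat a) (Q.map ξ) = hat b * hat (orbitDeriv G a) := by
      rw [← map_mul, ← hQ, ← eval₂_eq_eval_map, hom_eval₂, aeval_def, eval₂_map]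
      congr 1
      ext c g
      change algebraMap K L (ξ c) = χ (g • (c : A))
      rw [show g • (c : A) = c from c.2 g, hχ]
    rw [← h1]
    exact aeval_mem _
  have hD : ∀ g, hat (orbitDeriv G a) g ≠ 0 := by
    intro g h0
    obtain ⟨c, hc⟩ := orbitDeriv_dvd_orbitDisc (G := G) a g
    refine hδ' ?_
    rw [hc, map_mul, show χ (g • orbitDeriv G a) = 0 from h0, zero_mul]
  have hDmem : hat (orbitDeriv G a) ∈ e.range := by simpa using hlag 1
  have hat_mem : ∀ b : A, hat b ∈ e.range := by
    intro b
    have hmulinj : Function.Injective (LinearMap.mulLeft K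
        (⟨hat (orbitDeriv G a), hDmem⟩ : e.range)) := by
      intro v v' hv
      have hv' := congrArg Subtype.val hv
      refine Subtype.ext (funext fun g => ?_)
      exact mul_left_cancel₀ (hD g) (congrFun hv' g)
    obtain ⟨v, hv⟩ := LinearMap.injective_iff_surjective.mp hmulinj ⟨_, hlag b⟩
    have : (v : G → L) = hat b := by
      have hv' := congrArg Subtype.val hv
      funext g
      refine mul_left_cancel₀ (hD g) ((congrFun hv' g).trans ?_)
      exact mul_comm _ _
    rw [← this]
    exact v.2
  -- the action by translations
  set τ : G → (G → L) →ₐ[K] (G → L) := fun h => Pi.algHom K _ fun g => Pi.evalAlgHom K _ (g * h) with hτ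
  have hτ_apply : ∀ h v g, τ h v g = v (g * h) := fun _ _ _ => rfl
  have hτ_hat : ∀ h b, τ h (hat b) = hat (h • b) := by
    intro h b
    funext g
    rw [hτ_apply, hat_apply, hat_apply, mul_smul]
  have hτ_mem : ∀ h v, v ∈ e.range → τ h v ∈ e.range := by
    rintro h _ ⟨m, rfl⟩
    obtain ⟨p, rfl⟩ := AdjoinRoot.mk_surjective m
    change τ h (e (AdjoinRoot.mk _ p)) ∈ _
    rw [he_mk, ← aeval_algHom_apply, hτ_hat]
    rw [show hat (h • a) = e.range.val ⟨_, hat_mem (h • a)⟩ from rfl, aeval_algHom_apply]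
    exact Subtype.property _
  set E : AdjoinRoot (P.map ξ) ≃ₐ[K] e.range := AlgEquiv.ofInjective e hinj with hE
  have hE_val : ∀ m, (E m : G → L) = e m := fun _ => rfl
  let act : MulSemiringAction G (AdjoinRoot (P.map ξ)) :=
    { smul := fun h m => E.symm ⟨τ h (E m), hτ_mem h _ (E m).2⟩
      one_smul := fun m => E.injective (Subtype.ext (funext fun g => by
        change (E (E.symm _) : G → L) g = _
        rw [E.apply_symm_apply]
        exact (hτ_apply 1 _ g).trans (by rw [mul_one])))
      mul_smul := fun h h' m => E.injective (Subtype.ext (funext fun g => by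
        change (E (E.symm _) : G → L) g = (E (E.symm ⟨τ h (E (E.symm _)), _⟩) : G → L) g
        rw [E.apply_symm_apply, E.apply_symm_apply]
        simp only [hτ_apply, E.apply_symm_apply, mul_assoc]))
      smul_zero := fun h => E.injective (Subtype.ext (by
        change (E (E.symm _) : G → L) = _
        rw [E.apply_symm_apply]
        simp))
      smul_add := fun h m m' => E.injective (Subtype.ext (by
        change (E (E.symm _) : G → L) = (E (E.symm _ + E.symm _) : G → L)
        simp only [map_add, AlgEquiv.apply_symm_apply, Subalgebra.coe_add]))
      smul_one := fun h => E.injective (Subtype.ext (by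
        change (E (E.symm _) : G → L) = _
        rw [E.apply_symm_apply]
        simp))
      smul_mul := fun h m m' => E.injective (Subtype.ext (by
        change (E (E.symm _) : G → L) = (E (E.symm _ * E.symm _) : G → L)
        simp only [map_mul, AlgEquiv.apply_symm_apply, Subalgebra.coe_mul])) }
  have hact : ∀ (h : G) m, e (h • m) = τ h (e m) := fun h m => by
    rw [← hE_val, ← hE_val]
    change (E (E.symm _) : G → L) = _
    rw [E.apply_symm_apply]
  have hcomm : SMulCommClass G K (AdjoinRoot (P.map ξ)) := ⟨fun h c m => hinj (by
    rw [hact, map_smul, map_smul, map_smul, hact])⟩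
  have hetale : Algebra.Etale K (AdjoinRoot (P.map ξ)) :=
    etale_adjoinRoot hmon (separable_orbitPoly hP hχ hδ')
  have hrank : Module.finrank K (AdjoinRoot (P.map ξ)) = Nat.card G := by
    rw [(AdjoinRoot.powerBasis' hmon).finrank, AdjoinRoot.powerBasis'_dim, hdegP,
      Nat.card_eq_fintype_card]
  have hfixed : ∀ m : AdjoinRoot (P.map ξ), (∀ g : G, g • m = m) →
      ∃ c : K, algebraMap K (AdjoinRoot (P.map ξ)) c = m := by
    intro m hm
    obtain ⟨p, hp, rfl⟩ := hred m
    have h1 : ∀ g : G, aeval (χ (g • a)) p = aeval (χ a) p := by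
      intro g
      have := congrFun (congrArg e (hm g)) 1
      rw [hact, hτ_apply, he_mk, hat_aeval, hat_aeval, one_mul, one_smul] at this
      exact this
    have h2 : p.map (algebraMap K L) - C (aeval (χ a) p) = 0 := by
      refine eq_zero_of_aeval_orbit hδ' ?_ fun g => ?_
      · refine (degree_sub_le _ _).trans_lt (max_lt (by rwa [degree_map]) ?_)
        exact degree_C_le.trans_lt (by exact_mod_cast Fintype.card_pos)
      · rw [map_sub, aeval_map_algebraMap, aeval_C, h1]
        exact sub_self _
    have h3 : p.natDegree = 0 := by
      rw [← natDegree_map (algebraMap K L), sub_eq_zero.mp h2, natDegree_C]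
    rw [natDegree_eq_zero] at h3
    obtain ⟨c, rfl⟩ := h3
    exact ⟨c, rfl⟩
  refine ⟨{ carrier := AdjoinRoot (P.map ξ), finrank_eq := hrank, exists_of_fixed := hfixed },
    E.symm.toRingEquiv.toRingHom.comp (hat.codRestrict e.range hat_mem), ?_, ?_⟩
  · intro b
    refine E.injective ((E.apply_symm_apply _).trans ?_)
    refine Subtype.ext (funext fun g => ?_)
    change χ (g • (b : A)) = (E (algebraMap K _ (ξ b)) : G → L) g
    rw [AlgEquiv.commutes, show g • (b : A) = b from b.2 g, hχ]
    rfl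
  · intro g b
    refine E.injective ((E.apply_symm_apply _).trans (Subtype.ext ?_))
    change hat (g • b) = e (g • E.symm _)
    rw [hact, ← hE_val, AlgEquiv.apply_symm_apply, ← hτ_hat]
    rfl

/-- The fibre of `Spec A → Spec A / G` over a `K`-point is a `G`-torsor. -/
theorem exists_isTwisted {K : Type u} [Field K] (ξ : QuotientRing O G A →+* K) (a : A)
    (hδ : ξ (invariantDisc O G a) ≠ 0) :
    ∃ (M : GEtaleAlgebra K G) (ψ : A →+* M.carrier), IsTwisted ξ M ψ := by
  have := isIntegral_quotientRing (O := O) (G := G) (A := A)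
  obtain ⟨χ, hχ⟩ := exists_lift_of_isAlgClosed (A := A) (B := QuotientRing O G A)
    Subtype.val_injective ((algebraMap K (AlgebraicClosure K)).comp ξ)
  exact exists_isTwisted_of_lift a hδ hχ

section Twisted

variable {K : Type u} [Field K] {ξ : QuotientRing O G A →+* K} {M : GEtaleAlgebra K G}
  {ψ : A →+* M.carrier} {a : A}

omit [Fintype G] [DecidableEq G] in
lemma GEtaleAlgebra.nontrivial [Finite G] (M : GEtaleAlgebra K G) : Nontrivial M.carrier :=
  Module.nontrivial_of_finrank_pos (R := K) (by rw [M.finrank_eq]; exact Nat.card_pos)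

lemma IsTwisted.orbitDisc_eq (h : IsTwisted ξ M ψ) :
    ψ (orbitDisc G a) = algebraMap K M.carrier (ξ (invariantDisc O G a)) :=
  h.restrict (invariantDisc O G a)

lemma IsTwisted.isUnit_orbitDisc (h : IsTwisted ξ M ψ) (hδ : ξ (invariantDisc O G a) ≠ 0) :
    IsUnit (ψ (orbitDisc G a)) := by
  rw [h.orbitDisc_eq]
  exact (IsUnit.mk0 _ hδ).map _

lemma IsTwisted.eq_zero_of_aeval (h : IsTwisted ξ M ψ) (hδ : ξ (invariantDisc O G a) ≠ 0)
    {p : K[X]} (hdeg : p.degree < Fintype.card G) (hp : aeval (ψ a) p = 0) : p = 0 := by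
  have := M.nontrivial
  obtain ⟨m, hm⟩ := Ideal.exists_maximal M.carrier
  let _ : Field (M.carrier ⧸ m) := Ideal.Quotient.field m
  refine eq_zero_of_aeval_orbit (L := M.carrier ⧸ m) (χ := (Ideal.Quotient.mk m).comp ψ)
    (a := a) (((h.isUnit_orbitDisc hδ).map (Ideal.Quotient.mk m)).ne_zero) hdeg fun g => ?_
  have h1 : aeval (ψ (g • a)) p = g • aeval (ψ a) p := by
    rw [h.smul]
    exact aeval_algHom_apply (MulSemiringAction.toAlgHom K M.carrier g) (ψ a) p
  have h2 : aeval ((Ideal.Quotient.mkₐ K m) (ψ (g • a))) p = 0 := by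
    rw [aeval_algHom_apply, h1, hp, smul_zero, map_zero]
  exact h2

lemma IsTwisted.exists_algEquiv (h : IsTwisted ξ M ψ) (hδ : ξ (invariantDisc O G a) ≠ 0)
    {P : (QuotientRing O G A)[X]}
    (hP : P.map (algebraMap (QuotientRing O G A) A) = ∏ g : G, (X - C (g • a))) :
    ∃ e : AdjoinRoot (P.map ξ) ≃ₐ[K] M.carrier, e (AdjoinRoot.root _) = ψ a := by
  have := M.nontrivial
  have : Nontrivial A := ψ.domain_nontrivial
  have hmon := (monic_orbitPoly hP).map ξ
  have hdegP : (P.map ξ).natDegree = Fintype.card G := by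
    rw [(monic_orbitPoly hP).natDegree_map, natDegree_orbitPoly hP]
  have hroot : aeval (ψ a) (P.map ξ) = 0 := by
    simpa using aeval_orbitPoly hP h.restrict 1
  let e : AdjoinRoot (P.map ξ) →ₐ[K] M.carrier :=
    AdjoinRoot.liftAlgHom (P.map ξ) (Algebra.ofId _ _) (ψ a) hroot
  have hinj : Function.Injective e := by
    rw [injective_iff_map_eq_zero]
    intro m hm
    obtain ⟨p, rfl⟩ := AdjoinRoot.mk_surjective m
    have h1 : AdjoinRoot.mk (P.map ξ) (p %ₘ (P.map ξ)) = AdjoinRoot.mk _ p :=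
      AdjoinRoot.mk_leftInverse hmon (AdjoinRoot.mk _ p)
    rw [← h1] at hm ⊢
    rw [h.eq_zero_of_aeval hδ ?_ hm, map_zero]
    rw [← hdegP, ← Polynomial.degree_eq_natDegree hmon.ne_zero]
    exact degree_modByMonic_lt _ hmon
  have hfin : Module.Finite K (AdjoinRoot (P.map ξ)) := hmon.finite_adjoinRoot
  have hrank : Module.finrank K (AdjoinRoot (P.map ξ)) = Module.finrank K M.carrier := by
    rw [(AdjoinRoot.powerBasis' hmon).finrank, AdjoinRoot.powerBasis'_dim, hdegP,
      M.finrank_eq, Nat.card_eq_fintype_card]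
  refine ⟨AlgEquiv.ofBijective e ⟨hinj, ?_⟩, ?_⟩
  · exact (LinearMap.injective_iff_surjective_of_finrank_eq_finrank hrank
      (f := e.toLinearMap)).mp hinj
  · exact AdjoinRoot.liftAlgHom_root (P.map ξ) (Algebra.ofId K M.carrier) (ψ a) hroot

/-- Two torsors with an equivariant morphism to `Spec A` over the same point are isomorphic. -/
lemma IsTwisted.iso {M' : GEtaleAlgebra K G} {ψ' : A →+* M'.carrier} (h : IsTwisted ξ M ψ)
    (h' : IsTwisted ξ M' ψ') (hδ : ξ (invariantDisc O G a) ≠ 0) : M.Iso M' := by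
  obtain ⟨P, hP⟩ := exists_orbitPoly (G := G) O a
  obtain ⟨e, he⟩ := h.exists_algEquiv hδ hP
  obtain ⟨e', he'⟩ := h'.exists_algEquiv hδ hP
  let σ : M.carrier ≃ₐ[K] M'.carrier := e.symm.trans e'
  have hσa : σ (ψ a) = ψ' a := by
    rw [← he, ← he']
    simp [σ]
  have hσ : σ.toRingEquiv.toRingHom.comp ψ = ψ' := by
    refine ringHom_eq_of_eq (O := O) (G := G) (a := a) (fun b => ?_) hσa ?_
    · change σ (ψ b) = ψ' b
      rw [h.restrict, h'.restrict, AlgEquiv.commutes]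
    · exact ((h.isUnit_orbitDisc hδ).map σ).isRegular.left
  have hσ' : ∀ b, σ (ψ b) = ψ' b := fun b => DFunLike.congr_fun hσ b
  refine ⟨σ, fun g m => ?_⟩
  have hm : ∃ p : K[X], aeval (ψ a) p = m := by
    obtain ⟨p, hp⟩ := AdjoinRoot.mk_surjective (e.symm m)
    refine ⟨p, ?_⟩
    rw [← he, aeval_algHom_apply e, AdjoinRoot.aeval_eq, hp, AlgEquiv.apply_symm_apply]
  obtain ⟨p, rfl⟩ := hm
  have h1 : g • aeval (ψ a) p = aeval (ψ (g • a)) p := by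
    rw [h.smul]
    exact (aeval_algHom_apply (MulSemiringAction.toAlgHom K M.carrier g) (ψ a) p).symm
  have h2 : g • aeval (ψ' a) p = aeval (ψ' (g • a)) p := by
    rw [h'.smul]
    exact (aeval_algHom_apply (MulSemiringAction.toAlgHom K M'.carrier g) (ψ' a) p).symm
  have h3 : ∀ b, σ (aeval (ψ b) p) = aeval (ψ' b) p := fun b => by
    rw [← hσ']
    exact (aeval_algHom_apply σ.toAlgHom (ψ b) p).symm
  rw [h1, h3, h3, h2]

omit [Fintype G] [DecidableEq G] in
lemma IsTwisted.of_iso {M' : GEtaleAlgebra K G} (h : IsTwisted ξ M ψ) (hM : M.Iso M') :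
    ∃ ψ' : A →+* M'.carrier, IsTwisted ξ M' ψ' := by
  obtain ⟨e, he⟩ := hM
  refine ⟨e.toRingEquiv.toRingHom.comp ψ, fun b => ?_, fun g b => ?_⟩
  · change e (ψ b) = _
    rw [h.restrict, AlgEquiv.commutes]
  · change e (ψ (g • b)) = g • e (ψ b)
    rw [h.smul, he]

end Twisted

end Torsors

section Counting

open scoped Pointwise

open Polynomial

variable {K : Type u} [Field K] {G : Type*} [Group G] [Finite G] (M : GEtaleAlgebra K G)

lemma GEtaleAlgebra.isReduced : IsReduced M.carrier :=
  Algebra.FormallyUnramified.isReduced_of_field K M.carrier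

lemma GEtaleAlgebra.isArtinianRing : IsArtinianRing M.carrier :=
  IsArtinianRing.of_finite K M.carrier


lemma GEtaleAlgebra.exists_smul_eq (p q : Ideal M.carrier) [p.IsPrime] [q.IsPrime] :
    ∃ s : G, q = s • p := by
  have : Algebra.IsInvariant K M.carrier G := ⟨M.exists_of_fixed⟩
  exact Algebra.IsInvariant.exists_smul_of_under_eq K M.carrier G p q
    ((Ideal.eq_bot_of_prime _).trans (Ideal.eq_bot_of_prime _).symm)

lemma GEtaleAlgebra.eq_zero_of_forall_smul_mem (p : PrimeSpectrum M.carrier) {m : M.carrier}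
    (h : ∀ s : G, s⁻¹ • m ∈ p.asIdeal) : m = 0 := by
  have := M.isReduced
  have h1 : m ∈ nilradical M.carrier := by
    rw [nilradical_eq_sInf, Ideal.mem_sInf]
    intro q hq
    have hq' : q.IsPrime := hq
    obtain ⟨s, rfl⟩ := M.exists_smul_eq p.asIdeal q
    exact Ideal.mem_pointwise_smul_iff_inv_smul_mem.mpr (h s)
  rwa [nilradical_eq_zero] at h1

variable {M} {O A : Type*} [CommRing O] [CommRing A] [Algebra O A]
  [MulSemiringAction G A] [SMulCommClass G O A] {ξ : QuotientRing O G A →+* K}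
  {ψ : A →+* M.carrier} {a : A}

lemma mem_stabilizer_smul {p : PrimeSpectrum M.carrier} {h : G} (hh : h ∈ M.stabilizer p)
    {m : M.carrier} (hm : m ∈ p.asIdeal) : h • m ∈ p.asIdeal := by
  have h1 : h • p.asIdeal = p.asIdeal := hh
  rw [← h1]
  exact Ideal.smul_mem_pointwise_smul _ _ _ hm

lemma IsTwisted.exists_conj (h : IsTwisted ξ M ψ) (p : PrimeSpectrum M.carrier) {g : G}
    (hg : g ∈ Subgroup.centralizer (M.stabilizer p : Set G)) :
    ∃ ψ' : A →+* M.carrier, IsTwisted ξ M ψ' ∧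
      ∀ (s : G) (b : A), s⁻¹ • ψ' b - ψ (g • s⁻¹ • b) ∈ p.asIdeal := by
  have := M.isReduced
  have := M.isArtinianRing
  have hex : ∀ I : MaximalSpectrum M.carrier, ∃ s : G, I.asIdeal = s • p.asIdeal := fun I =>
    have := I.isMaximal.isPrime
    M.exists_smul_eq p.asIdeal I.asIdeal
  choose σ hσ using hex
  let ψ' : A →+* M.carrier := (IsArtinianRing.equivPi M.carrier).symm.toRingEquiv.toRingHom.comp
    (RingHom.pi fun I => (Ideal.Quotient.mk I.asIdeal).comp
      ((MulSemiringAction.toRingHom G M.carrier (σ I)).comp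
        (ψ.comp (MulSemiringAction.toRingHom G A (g * (σ I)⁻¹)))))
  have h1 : ∀ I b, ψ' b - σ I • ψ ((g * (σ I)⁻¹) • b) ∈ I.asIdeal := by
    intro I b
    rw [← Ideal.Quotient.eq_zero_iff_mem, map_sub, sub_eq_zero]
    have : IsArtinianRing.equivPi M.carrier (ψ' b) I =
        Ideal.Quotient.mk I.asIdeal (σ I • ψ ((g * (σ I)⁻¹) • b)) :=
      congrFun ((IsArtinianRing.equivPi M.carrier).apply_symm_apply _) I
    exact this
  have h2 : ∀ (s : G) (b : A), s⁻¹ • ψ' b - ψ (g • s⁻¹ • b) ∈ p.asIdeal := by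
    intro s b
    have hp : (s • p.asIdeal).IsPrime := p.2.smul s
    let I : MaximalSpectrum M.carrier := ⟨s • p.asIdeal, IsArtinianRing.isMaximal_of_isPrime _⟩
    have hI : s • p.asIdeal = σ I • p.asIdeal := hσ I
    have hst : s⁻¹ * σ I ∈ M.stabilizer p := by
      change (s⁻¹ * σ I) • p.asIdeal = p.asIdeal
      rw [mul_smul, ← hI, inv_smul_smul]
    have h3 := h1 I b
    rw [hσ I, Ideal.mem_pointwise_smul_iff_inv_smul_mem, smul_sub, inv_smul_smul] at h3
    have h4 := mem_stabilizer_smul hst h3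
    rw [smul_sub, smul_smul, mul_inv_cancel_right, ← h.smul, smul_smul, ← mul_assoc,
      (Subgroup.mem_centralizer_iff.mp hg) _ hst, mul_assoc, mul_inv_cancel_right] at h4
    rwa [smul_smul]
  refine ⟨ψ', ⟨fun b => ?_, fun t b => ?_⟩, h2⟩
  · rw [← sub_eq_zero]
    refine M.eq_zero_of_forall_smul_mem p fun s => ?_
    have h3 := h2 s b
    rwa [show s⁻¹ • (b : A) = b from b.2 _, show g • (b : A) = b from b.2 _, h.restrict,
      ← smul_algebraMap s⁻¹ (ξ b), ← smul_sub] at h3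
  · rw [← sub_eq_zero]
    refine M.eq_zero_of_forall_smul_mem p fun s => ?_
    have h3 := sub_mem (h2 s (t • b)) (h2 (t⁻¹ * s) b)
    rw [mul_inv_rev, inv_inv, mul_smul, mul_smul, sub_sub_sub_cancel_right] at h3
    rwa [smul_sub]

lemma IsTwisted.exists_eq_conj [Fintype G] [DecidableEq G] {ψ' : A →+* M.carrier}
    (h : IsTwisted ξ M ψ) (h' : IsTwisted ξ M ψ') (hδ : ξ (invariantDisc O G a) ≠ 0)
    (p : PrimeSpectrum M.carrier) :
    ∃ g : G, ∀ b, ψ' b - ψ (g • b) ∈ p.asIdeal := by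
  obtain ⟨P, hP⟩ := exists_orbitPoly (G := G) O a
  set χ := (Ideal.Quotient.mk p.asIdeal).comp ψ with hχ
  set χ' := (Ideal.Quotient.mk p.asIdeal).comp ψ' with hχ'
  have hr : ∀ b : QuotientRing O G A, χ b = algebraMap K (M.carrier ⧸ p.asIdeal) (ξ b) :=
    fun b => congrArg (Ideal.Quotient.mk p.asIdeal) (h.restrict b)
  have hr' : ∀ b : QuotientRing O G A, χ' b = algebraMap K (M.carrier ⧸ p.asIdeal) (ξ b) :=
    fun b => congrArg (Ideal.Quotient.mk p.asIdeal) (h'.restrict b)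
  have h1 := aeval_orbitPoly hP hr' 1
  rw [one_smul, ← eval_map_algebraMap, map_orbitPoly hP hr, eval_prod, Finset.prod_eq_zero_iff] at h1
  obtain ⟨g, -, hg⟩ := h1
  rw [eval_sub, eval_X, eval_C, sub_eq_zero] at hg
  refine ⟨g, fun b => ?_⟩
  have h2 : χ' = χ.comp (MulSemiringAction.toRingHom G A g) := by
    refine ringHom_eq_of_eq (O := O) (G := G) (a := a) (fun b => ?_) hg ?_
    · change χ' b = χ (g • (b : A))
      rw [show g • (b : A) = b from b.2 g, hr, hr']
    · exact ((h'.isUnit_orbitDisc hδ).map (Ideal.Quotient.mk p.asIdeal)).isRegular.left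
  rw [← Ideal.Quotient.eq_zero_iff_mem, map_sub, sub_eq_zero]
  exact DFunLike.congr_fun h2 b

/-- The number of equivariant morphisms from `Spec M` to a fibre that is isomorphic to `Spec M`. -/
theorem IsTwisted.card_eq [Fintype G] [DecidableEq G] (h : IsTwisted ξ M ψ)
    (hδ : ξ (invariantDisc O G a) ≠ 0) (p : PrimeSpectrum M.carrier) :
    Nat.card {ψ' : A →+* M.carrier // IsTwisted ξ M ψ'} =
      Nat.card (Subgroup.centralizer (M.stabilizer p : Set G)) := by
  have hinj : ∀ g g' : G, ψ (g • a) - ψ (g' • a) ∈ p.asIdeal → g = g' := by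
    intro g g' hgg
    have h0 : ((Ideal.Quotient.mk p.asIdeal).comp ψ) (orbitDisc G a) ≠ 0 :=
      ((h.isUnit_orbitDisc hδ).map (Ideal.Quotient.mk p.asIdeal)).ne_zero
    refine injective_orbit h0 ?_
    rw [← Ideal.Quotient.eq_zero_iff_mem, map_sub, sub_eq_zero] at hgg
    exact hgg
  choose f hf hf' using fun g : Subgroup.centralizer (M.stabilizer p : Set G) => h.exists_conj p g.2
  symm
  refine Nat.card_eq_of_bijective (fun g => ⟨f g, hf g⟩) ⟨fun g g' e => ?_, fun ψ' => ?_⟩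
  · have e' : f g = f g' := congrArg Subtype.val e
    have h1 := sub_mem (hf' g' 1 a) (hf' g 1 a)
    rw [e', inv_one, one_smul, one_smul, sub_sub_sub_cancel_left] at h1
    exact Subtype.ext (hinj _ _ h1)
  · obtain ⟨g, hg⟩ := h.exists_eq_conj ψ'.2 hδ p
    have hgc : g ∈ Subgroup.centralizer (M.stabilizer p : Set G) := by
      rw [Subgroup.mem_centralizer_iff]
      intro t ht
      have h1 := mem_stabilizer_smul ht (hg a)
      rw [smul_sub, ← ψ'.2.smul, ← h.smul, smul_smul] at h1
      have h2 := sub_mem (hg (t • a)) h1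
      rw [sub_sub_sub_cancel_left, smul_smul] at h2
      exact hinj _ _ h2
    refine ⟨⟨g, hgc⟩, Subtype.ext (RingHom.ext fun b => ?_)⟩
    rw [← sub_eq_zero]
    refine M.eq_zero_of_forall_smul_mem p fun s => ?_
    have h1 := sub_mem (hf' ⟨g, hgc⟩ s b) (hg (s⁻¹ • b))
    rw [ψ'.2.smul, sub_sub_sub_cancel_right] at h1
    rwa [smul_sub]

end Counting

section Newton

open Polynomial

/-- Newton approximation of a root of a polynomial `F` of a not necessarily complete local ring in
which the powers of `ϖ` converge. -/
lemma exists_approx_root {Λ : Type*} [CommRing Λ] {ϖ : Λ}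
    (hc : ∀ v : ℕ → Λ, ∃ s, ∀ k, ϖ ^ k ∣ s - ∑ i ∈ Finset.range k, ϖ ^ i * v i)
    (F : Λ[X]) {z₀ w δ η : Λ} (hη : ϖ ∣ η) (h₀ : δ ^ 2 * η ∣ w * F.eval z₀)
    (h₁ : δ * ϖ ∣ w * F.derivative.eval z₀ - δ) :
    ∃ z, δ * η ∣ z - z₀ ∧ ∀ k, ϖ ^ k ∣ w * F.eval z := by
  obtain ⟨η', rfl⟩ := hη
  obtain ⟨c₀, hc₀⟩ := h₁
  let S : ℕ → Type _ := fun k => {u : Λ // δ ^ 2 * (ϖ * η') * ϖ ^ k ∣ w * F.eval (z₀ + δ * (ϖ * η') * u)}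
  have step : ∀ k (u : S k), ∃ (t : Λ) (u' : S (k + 1)), u'.1 = u.1 - ϖ ^ k * t := by
    rintro k ⟨u, t, ht⟩
    obtain ⟨c₁, hc₁⟩ := binomExpansion F (z₀ + δ * (ϖ * η') * u) (-(δ * (ϖ * η') * (ϖ ^ k * t)))
    obtain ⟨c₂, hc₂⟩ := sub_dvd_eval_sub (z₀ + δ * (ϖ * η') * u) z₀ F.derivative
    refine ⟨t, ⟨u - ϖ ^ k * t, ?_⟩, rfl⟩
    refine ⟨-(c₀ + w * η' * u * c₂) * t + w * c₁ * η' * (ϖ ^ k * t ^ 2), ?_⟩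
    rw [show z₀ + δ * (ϖ * η') * (u - ϖ ^ k * t) =
      z₀ + δ * (ϖ * η') * u + -(δ * (ϖ * η') * (ϖ ^ k * t)) by ring, hc₁, pow_succ]
    linear_combination ht - δ * (ϖ * η') * (ϖ ^ k * t) * hc₀ -
      w * δ * (ϖ * η') * (ϖ ^ k * t) * hc₂
  choose T next hnext using step
  let seq : ∀ k, S k := fun k => Nat.rec ⟨0, by simpa using h₀⟩ (fun k u => next k u) k
  have hseq : ∀ k, (seq (k + 1)).1 = (seq k).1 - ϖ ^ k * T k (seq k) := fun k => hnext k (seq k)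
  have hsum : ∀ k, (seq k).1 = -∑ i ∈ Finset.range k, ϖ ^ i * T i (seq i) := by
    intro k
    induction k with
    | zero => simp [seq]
    | succ k ih => rw [hseq, ih, Finset.sum_range_succ]; ring
  obtain ⟨s, hs⟩ := hc fun i => T i (seq i)
  refine ⟨z₀ + δ * (ϖ * η') * -s, ⟨-s, by ring⟩, fun k => ?_⟩
  have h2 : ϖ ^ k ∣ w * F.eval (z₀ + δ * (ϖ * η') * (seq k).1) :=
    (dvd_mul_left _ _).trans (seq k).2
  have h3 : ϖ ^ k ∣ w * F.eval (z₀ + δ * (ϖ * η') * -s) -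
      w * F.eval (z₀ + δ * (ϖ * η') * (seq k).1) := by
    rw [← mul_sub]
    refine dvd_mul_of_dvd_right (dvd_trans ?_ (sub_dvd_eval_sub _ _ F)) _
    rw [hsum, add_sub_add_left_eq_sub, ← mul_sub]
    refine dvd_mul_of_dvd_right ?_ _
    rw [sub_neg_eq_add, neg_add_eq_sub, ← neg_sub]
    exact (dvd_neg.mpr (hs k))
  exact (dvd_iff_dvd_of_dvd_sub h3).mpr h2

lemma dvd_eval₂_sub {B Λ : Type*} [CommRing B] [CommRing Λ] {f f' : B →+* Λ} {c : Λ}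
    (h : ∀ b, c ∣ f b - f' b) (z : Λ) (Q : B[X]) : c ∣ Q.eval₂ f z - Q.eval₂ f' z := by
  rw [eval₂_eq_sum_range, eval₂_eq_sum_range, ← Finset.sum_sub_distrib]
  refine Finset.dvd_sum fun i _ => ?_
  rw [← sub_mul]
  exact dvd_mul_of_dvd_left (h _) _

lemma sub_dvd_eval₂_sub {B Λ : Type*} [CommRing B] [CommRing Λ] (f : B →+* Λ) (z z' : Λ) (Q : B[X]) :
    z - z' ∣ Q.eval₂ f z - Q.eval₂ f z' := by
  rw [eval₂_eq_eval_map, eval₂_eq_eval_map]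
  exact sub_dvd_eval_sub _ _ _

lemma isUnit_one_add_of_isIntegral {O C : Type*} [CommRing O] [IsLocalRing O] [CommRing C]
    [Algebra O C] {t : C} (ht : IsIntegral O t) {c : O} (hc : c ∈ IsLocalRing.maximalIdeal O) :
    IsUnit (1 + algebraMap O C c * t) := by
  let t' : integralClosure O C := ⟨t, ht⟩
  have h1 : IsUnit (1 + algebraMap O (integralClosure O C) c * t') := by
    by_contra hnu
    obtain ⟨m, hm, hmem⟩ := exists_max_ideal_of_mem_nonunits hnu
    have h2 : (m.comap (algebraMap O (integralClosure O C))).IsMaximal :=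
      Ideal.isMaximal_comap_of_isIntegral_of_isMaximal m
    rw [← IsLocalRing.eq_maximalIdeal h2] at hc
    have h3 := sub_mem hmem (m.mul_mem_right t' hc)
    rw [add_sub_cancel_right] at h3
    exact hm.ne_top ((Ideal.eq_top_iff_one m).mpr h3)
  exact h1.map (integralClosure O C).val

variable {K : Type u} [Field K] [ValuativeRel K] [TopologicalSpace K]
  [IsNonarchimedeanLocalField K]

lemma isPrecomplete_integer : IsPrecomplete 𝓂[K] 𝒪[K] :=
  letI : UniformSpace K := IsTopologicalAddGroup.rightUniformSpace K
  haveI : IsUniformAddGroup K := isUniformAddGroup_of_addCommGroup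
  (inferInstance : IsAdicComplete 𝓂[K] 𝒪[K]).toIsPrecomplete

lemma exists_adic_sum {Λ : Type*} [AddCommGroup Λ] [Module 𝒪[K] Λ] [Module.Finite 𝒪[K] Λ]
    {ϖ : 𝒪[K]} (hϖ : Irreducible ϖ) (v : ℕ → Λ) :
    ∃ s, ∀ k, ∃ c, s - ∑ i ∈ Finset.range k, ϖ ^ i • v i = ϖ ^ k • c := by
  obtain ⟨n, e, he⟩ := Module.Finite.exists_fin (R := 𝒪[K]) (M := Λ)
  have h1 : ∀ i, ∃ c : Fin n → 𝒪[K], ∑ j, c j • e j = v i := fun i =>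
    (Submodule.mem_span_range_iff_exists_fun 𝒪[K]).mp (by rw [he]; trivial)
  choose c hc using h1
  have h2 : ∀ j, ∃ s : 𝒪[K], ∀ k, ϖ ^ k ∣ s - ∑ i ∈ Finset.range k, ϖ ^ i * c i j := by
    intro j
    have hlim := IsPrecomplete.prec (I := 𝓂[K]) (M := 𝒪[K])
      isPrecomplete_integer
      (f := fun k => ∑ i ∈ Finset.range k, ϖ ^ i * c i j) (by
        intro m k hmk
        rw [SModEq.sub_mem, smul_eq_mul, Ideal.mul_top, mem_maximalIdeal_pow hϖ, ← dvd_neg, neg_sub,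
          ← Finset.sum_Ico_eq_sub _ hmk]
        refine Finset.dvd_sum fun i hi => dvd_mul_of_dvd_left (pow_dvd_pow _ ?_) _
        exact (Finset.mem_Ico.mp hi).1)
    obtain ⟨s, hs⟩ := hlim
    refine ⟨s, fun k => ?_⟩
    have := hs k
    rwa [SModEq.sub_mem, smul_eq_mul, Ideal.mul_top, mem_maximalIdeal_pow hϖ, ← dvd_neg,
      neg_sub] at this
  choose s hs using h2
  refine ⟨∑ j, s j • e j, fun k => ?_⟩
  choose d hd using fun j => hs j k
  refine ⟨∑ j, d j • e j, ?_⟩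
  simp_rw [← hc, Finset.smul_sum, smul_smul]
  rw [Finset.sum_comm, ← Finset.sum_sub_distrib]
  refine Finset.sum_congr rfl fun j _ => ?_
  rw [← Finset.sum_smul, ← sub_smul, hd]

lemma eq_zero_of_forall_pow_smul {Λ : Type*} [AddCommGroup Λ] [Module 𝒪[K] Λ]
    [Module.Finite 𝒪[K] Λ] {ϖ : 𝒪[K]} (hϖ : Irreducible ϖ) {v : Λ}
    (h : ∀ k : ℕ, ∃ c : Λ, v = ϖ ^ k • c) : v = 0 := by
  have h1 := Ideal.iInf_pow_smul_eq_bot_of_isLocalRing (R := 𝒪[K]) (M := Λ) 𝓂[K]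
    (Ideal.IsPrime.ne_top inferInstance)
  rw [← Submodule.mem_bot 𝒪[K], ← h1, Submodule.mem_iInf]
  intro k
  obtain ⟨c, rfl⟩ := h k
  exact Submodule.smul_mem_smul ((mem_maximalIdeal_pow hϖ).mpr dvd_rfl) trivial

end Newton

section Deformation

open Polynomial

section Generic

variable {O G A : Type*} [CommRing O] [CommRing A] [Algebra O A] [Group G]
  [MulSemiringAction G A] [SMulCommClass G O A] [Fintype G] [DecidableEq G]

lemma exists_ringHom_of_root {K : Type u} [Field K] {ξ : QuotientRing O G A →+* K} {a : A}
    (hδ : ξ (invariantDisc O G a) ≠ 0) {P : (QuotientRing O G A)[X]}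
    (hP : P.map (algebraMap (QuotientRing O G A) A) = ∏ g : G, (X - C (g • a)))
    {C : Type*} [CommRing C] [Algebra K C] {z : C} (hz : aeval z (P.map ξ) = 0) :
    ∃ ψ : A →+* C, (∀ b : QuotientRing O G A, ψ b = algebraMap K C (ξ b)) ∧ ψ a = z := by
  obtain ⟨M, ψ', h⟩ := exists_isTwisted ξ a hδ
  obtain ⟨e, he⟩ := h.exists_algEquiv hδ hP
  let ρ : AdjoinRoot (P.map ξ) →ₐ[K] C := AdjoinRoot.liftAlgHom (P.map ξ) (Algebra.ofId K C) z hz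
  refine ⟨(ρ.comp e.symm.toAlgHom).toRingHom.comp ψ', fun b => ?_, ?_⟩
  · change ρ (e.symm (ψ' b)) = _
    rw [h.restrict, AlgEquiv.commutes, AlgHom.commutes]
  · change ρ (e.symm (ψ' a)) = z
    rw [← he, AlgEquiv.symm_apply_apply]
    exact AdjoinRoot.liftAlgHom_root (P.map ξ) (Algebra.ofId K C) z hz

lemma exists_lagrangePoly_disc (O : Type*) [CommRing O] [Algebra O A] [SMulCommClass G O A]
    (a b : A) : ∃ Q : (QuotientRing O G A)[X],
      (Q.map (algebraMap (QuotientRing O G A) A)).eval a = b * orbitDisc G a := by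
  obtain ⟨c, hc⟩ := orbitDeriv_dvd_orbitDisc (G := G) a 1
  obtain ⟨Q, hQ⟩ := exists_lagrangePoly (G := G) O a (b * c)
  rw [one_smul] at hc
  exact ⟨Q, by rw [hQ, hc]; ring⟩

lemma eval_derivative_orbitPoly {a : A} {P : (QuotientRing O G A)[X]}
    (hP : P.map (algebraMap (QuotientRing O G A) A) = ∏ g : G, (X - C (g • a))) :
    (P.derivative.map (algebraMap (QuotientRing O G A) A)).eval a = orbitDeriv G a := by
  rw [← derivative_map, hP, derivative_prod_finset, eval_finsetSum,
    Finset.sum_eq_single 1 (fun g _ hg => ?_) (by simp)]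
  · simp [orbitDeriv, eval_prod]
  · rw [eval_mul, eval_prod, Finset.prod_eq_zero (i := 1) (by simpa using hg.symm) (by simp),
      zero_mul]

end Generic

variable {K : Type u} [Field K] [ValuativeRel K] [TopologicalSpace K]
  [IsNonarchimedeanLocalField K]

/-- The `K`-point defined by an `𝒪_K`-point. -/
def IntegralPoint.toField {B : Type*} [CommRing B] [Algebra 𝒪[K] B] (x : IntegralPoint K B) :
    B →+* K :=
  (algebraMap 𝒪[K] K).comp x.eval.toRingHom

lemma IntegralPoint.toField_apply {B : Type*} [CommRing B] [Algebra 𝒪[K] B]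
    (x : IntegralPoint K B) (b : B) : x.toField b = (x.eval b : K) := rfl

variable {G A : Type*} [CommRing A] [Algebra 𝒪[K] A] [Group G]
  [MulSemiringAction G A] [SMulCommClass G 𝒪[K] A]

lemma isIntegral_of_restrict [Finite G] {C : Type*} [CommRing C] [Algebra K C] [Algebra 𝒪[K] C]
    [IsScalarTower 𝒪[K] K C] {x : IntegralPoint K (QuotientRing 𝒪[K] G A)} {ψ : A →+* C}
    (h : ∀ b : QuotientRing 𝒪[K] G A, ψ b = algebraMap K C (x.toField b)) (b : A) :
    IsIntegral 𝒪[K] (ψ b) := by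
  have := isIntegral_quotientRing (O := 𝒪[K]) (G := G) (A := A)
  refine (Algebra.IsIntegral.isIntegral (R := QuotientRing 𝒪[K] G A) b).map_of_comp_eq
    x.eval.toRingHom ψ ?_
  ext b
  change algebraMap 𝒪[K] C (x.eval b) = ψ b
  rw [h, IsScalarTower.algebraMap_apply 𝒪[K] K C]
  rfl

variable [Fintype G] [DecidableEq G]

/-- Two points of a fibre of `Spec A → Spec A / G` that are close to each other are equal. -/
lemma ringHom_eq_of_close {C : Type*} [CommRing C] [Algebra K C] [Algebra 𝒪[K] C]
    [IsScalarTower 𝒪[K] K C] {x : IntegralPoint K (QuotientRing 𝒪[K] G A)} {a : A}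
    (hδ : x.eval (invariantDisc 𝒪[K] G a) ≠ 0) {ψ ψ' : A →+* C}
    (h : ∀ b : QuotientRing 𝒪[K] G A, ψ b = algebraMap K C (x.toField b))
    (h' : ∀ b : QuotientRing 𝒪[K] G A, ψ' b = algebraMap K C (x.toField b))
    {c : 𝒪[K]} (hc : c ∈ 𝓂[K]) {v : C} (hv : IsIntegral 𝒪[K] v)
    (hcl : ψ' a - ψ a = algebraMap 𝒪[K] C (x.eval (invariantDisc 𝒪[K] G a) * c) * v) : ψ' = ψ := by
  have hunit : ∀ {ψ : A →+* C}, (∀ b : QuotientRing 𝒪[K] G A, ψ b = algebraMap K C (x.toField b)) →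
      IsUnit (ψ (orbitDisc G a)) := fun {ψ} h => by
    have h1 : ψ (orbitDisc G a) = _ := h (invariantDisc 𝒪[K] G a)
    rw [h1]
    refine (IsUnit.mk0 _ fun h0 => hδ (Subtype.ext ?_)).map _
    exact h0
  have heq : ψ (orbitDisc G a) = algebraMap 𝒪[K] C (x.eval (invariantDisc 𝒪[K] G a)) := by
    refine (h (invariantDisc 𝒪[K] G a)).trans ?_
    rw [IsScalarTower.algebraMap_apply 𝒪[K] K C]
    rfl
  refine ringHom_eq_of_eq (O := 𝒪[K]) (G := G) (a := a) (fun b => by rw [h, h']) ?_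
    (hunit h').isRegular.left
  obtain ⟨P, hP⟩ := exists_orbitPoly (G := G) 𝒪[K] a
  have h1 := aeval_orbitPoly hP h' 1
  rw [one_smul, ← eval_map_algebraMap, map_orbitPoly hP h, eval_prod,
    ← Finset.mul_prod_erase _ _ (Finset.mem_univ 1)] at h1
  have h2 : IsUnit (∏ g ∈ Finset.univ.erase (1 : G), (X - Polynomial.C (ψ (g • a))).eval (ψ' a)) := by
    rw [IsUnit.prod_iff]
    intro g hg
    obtain ⟨s, hs⟩ := sub_dvd_orbitDisc (G := G) a (Finset.ne_of_mem_erase hg).symm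
    rw [one_smul] at hs
    have hs' : algebraMap 𝒪[K] C (x.eval (invariantDisc 𝒪[K] G a)) =
        (ψ a - ψ (g • a)) * ψ s := by
      rw [← heq, hs, map_mul, map_sub]
    have h3 : (X - Polynomial.C (ψ (g • a))).eval (ψ' a) =
        (ψ a - ψ (g • a)) * (1 + algebraMap 𝒪[K] C c * (ψ s * v)) := by
      rw [eval_sub, eval_X, eval_C]
      rw [map_mul, hs'] at hcl
      linear_combination hcl
    rw [h3]
    refine IsUnit.mul (isUnit_of_dvd_unit ?_ (hunit h)) (isUnit_one_add_of_isIntegral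
      ((isIntegral_of_restrict h s).mul hv) hc)
    rw [hs, map_mul, map_sub]
    exact dvd_mul_right _ _
  have h4 := (h2.mul_left_eq_zero).mp h1
  rw [one_smul, eval_sub, eval_X, eval_C] at h4
  exact sub_eq_zero.mp h4

/-- Every point near `x` has a fibre that is isomorphic to the fibre over `x`. -/
theorem IsTwisted.exists_of_mem_ball [Algebra.FiniteType 𝒪[K] A] {M : GEtaleAlgebra K G}
    {x : IntegralPoint K (QuotientRing 𝒪[K] G A)} {a : A}
    (hδ : x.eval (invariantDisc 𝒪[K] G a) ≠ 0) {ψ : A →+* M.carrier}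
    (h : IsTwisted x.toField M ψ) :
    ∃ k, ∀ x' ∈ x.ball k, ∃ ψ' : A →+* M.carrier, IsTwisted x'.toField M ψ' := by
  have := M.nontrivial
  obtain ⟨P, hP⟩ := exists_orbitPoly (G := G) 𝒪[K] a
  obtain ⟨ϖ, hϖ⟩ := IsDiscreteValuationRing.exists_irreducible 𝒪[K]
  set δ := x.eval (invariantDisc 𝒪[K] G a) with hδdef
  obtain ⟨m, u, hu⟩ := IsDiscreteValuationRing.eq_unit_mul_pow_irreducible hδ hϖ
  -- the image of `A` in `M`
  let ψa : A →ₐ[𝒪[K]] M.carrier := { ψ with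
    commutes' := fun c => by
      refine (h.restrict (algebraMap 𝒪[K] _ c)).trans ?_
      rw [IntegralPoint.toField_apply, AlgHom.commutes, IsScalarTower.algebraMap_apply 𝒪[K] K M.carrier]
      rfl }
  have hψa : ∀ b, ψa b = ψ b := fun _ => rfl
  let Λ := ψa.range
  let ψΛ : A →ₐ[𝒪[K]] Λ := ψa.rangeRestrict
  have hψΛ : ∀ b, (ψΛ b : M.carrier) = ψ b := fun _ => rfl
  have hΛint : Algebra.IsIntegral 𝒪[K] Λ := ⟨by
    rintro ⟨_, b, rfl⟩
    exact (isIntegral_algHom_iff Λ.val Subtype.val_injective).mp (isIntegral_of_restrict h.restrict b)⟩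
  have hΛft : Algebra.FiniteType 𝒪[K] Λ :=
    Algebra.FiniteType.of_surjective ψΛ ψa.rangeRestrict_surjective
  have hΛfin : Module.Finite 𝒪[K] Λ := Algebra.IsIntegral.finite
  have hΛδ : ∀ {v v' : Λ}, algebraMap 𝒪[K] Λ δ * v = algebraMap 𝒪[K] Λ δ * v' → v = v' := by
    intro v v' hv
    have h1 := congrArg Subtype.val hv
    have h2 : IsUnit (algebraMap 𝒪[K] M.carrier δ) := by
      rw [IsScalarTower.algebraMap_apply 𝒪[K] K M.carrier]
      exact (IsUnit.mk0 _ fun h0 => hδ (Subtype.ext h0)).map _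
    exact Subtype.ext (h2.mul_left_cancel h1)
  refine ⟨3 * m + 1, fun x' hx' => ?_⟩
  have hdvd : ∀ b, δ ^ 3 * ϖ ∣ x'.eval b - x.eval b := by
    intro b
    have h1 := (mem_maximalIdeal_pow hϖ).mp (hx' b)
    refine dvd_trans ?_ h1
    have h2 : ((u : 𝒪[K]) * ((u⁻¹ : 𝒪[K]ˣ) : 𝒪[K])) ^ 3 = 1 := by rw [Units.mul_inv, one_pow]
    refine ⟨((u⁻¹ : 𝒪[K]ˣ) : 𝒪[K]) ^ 3, ?_⟩
    rw [hu]
    linear_combination -(ϖ ^ (3 * m + 1)) * h2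
  obtain ⟨c, hc⟩ := hdvd (invariantDisc 𝒪[K] G a)
  have hunit : IsUnit (1 + δ ^ 2 * ϖ * c) := by
    have h1 := isUnit_one_add_of_isIntegral (C := 𝒪[K]) (isIntegral_algebraMap (x := c))
      (c := δ ^ 2 * ϖ) (Ideal.mul_mem_left _ _ (by
        rw [hϖ.maximalIdeal_eq]; exact Ideal.mem_span_singleton_self _))
    simpa using h1
  have hδ' : x'.eval (invariantDisc 𝒪[K] G a) = δ * (1 + δ ^ 2 * ϖ * c) := by
    linear_combination hc
  have hδ'0 : x'.eval (invariantDisc 𝒪[K] G a) ≠ 0 := by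
    rw [hδ']
    exact mul_ne_zero hδ hunit.ne_zero
  have hξ' : x'.toField (invariantDisc 𝒪[K] G a) ≠ 0 := fun h0 => hδ'0 (Subtype.ext h0)
  let f : QuotientRing 𝒪[K] G A →+* Λ := (algebraMap 𝒪[K] Λ).comp x.eval.toRingHom
  let f' : QuotientRing 𝒪[K] G A →+* Λ := (algebraMap 𝒪[K] Λ).comp x'.eval.toRingHom
  set D := algebraMap 𝒪[K] Λ δ with hD
  set p := algebraMap 𝒪[K] Λ ϖ with hp
  have hff' : ∀ b, D ^ 3 * p ∣ f' b - f b := fun b => by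
    have := map_dvd (algebraMap 𝒪[K] Λ) (hdvd b)
    rwa [map_sub, map_mul, map_pow] at this
  have hf : f = ψΛ.toRingHom.comp (algebraMap (QuotientRing 𝒪[K] G A) A) := by
    ext b
    change algebraMap 𝒪[K] M.carrier (x.eval b) = ψ b
    rw [h.restrict, IsScalarTower.algebraMap_apply 𝒪[K] K M.carrier]
    rfl
  have heval : ∀ Q : (QuotientRing 𝒪[K] G A)[X], Q.eval₂ f (ψΛ a) =
      ψΛ ((Q.map (algebraMap (QuotientRing 𝒪[K] G A) A)).eval a) := fun Q => by
    rw [hf, ← eval₂_eq_eval_map]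
    exact (hom_eval₂ Q (algebraMap (QuotientRing 𝒪[K] G A) A) ψΛ.toRingHom a).symm
  obtain ⟨w, hw⟩ := orbitDeriv_dvd_orbitDisc (G := G) a 1
  rw [one_smul] at hw
  have hψδ : ψΛ (orbitDisc G a) = D := by
    have := congrArg (fun F => F (invariantDisc 𝒪[K] G a)) hf
    exact this.symm
  have hwD : ψΛ w * ψΛ (orbitDeriv G a) = D := by
    rw [← map_mul, mul_comm, ← hw, hψδ]
  have hder := heval P.derivative
  rw [eval_derivative_orbitPoly hP] at hder
  have hroot := heval P
  rw [hP, eval_prod, Finset.prod_eq_zero (Finset.mem_univ 1) (by simp), map_zero] at hroot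
  -- the root of the deformed polynomial
  obtain ⟨z, hz, hzk⟩ := exists_approx_root (Λ := Λ) (ϖ := p) (fun v => by
      obtain ⟨s, hs⟩ := exists_adic_sum hϖ v
      refine ⟨s, fun k => ?_⟩
      obtain ⟨d, hd⟩ := hs k
      refine ⟨d, ?_⟩
      simpa [Algebra.smul_def] using hd)
    (P.map f') (z₀ := ψΛ a) (w := ψΛ w) (δ := D) (η := D * p) (dvd_mul_left _ _)
    (by
      rw [eval_map]
      have h1 := dvd_eval₂_sub hff' (ψΛ a) P
      rw [hroot, sub_zero] at h1
      refine dvd_mul_of_dvd_right (dvd_trans (Dvd.intro 1 (by ring)) h1) _)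
    (by
      rw [derivative_map, eval_map]
      have h1 := dvd_eval₂_sub hff' (ψΛ a) P.derivative
      rw [hder] at h1
      rw [show ψΛ w * eval₂ f' (ψΛ a) (derivative P) - D = ψΛ w * (eval₂ f' (ψΛ a) (derivative P) -
        ψΛ (orbitDeriv G a)) by rw [mul_sub, hwD]]
      refine dvd_mul_of_dvd_right (dvd_trans (Dvd.intro (D ^ 2) (by ring)) h1) _)
  have hz0 : eval₂ f' z P = 0 := by
    rw [← eval_map]
    have h1 : ψΛ w * (P.map f').eval z = 0 := eq_zero_of_forall_pow_smul hϖ fun k => by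
      obtain ⟨d, hd⟩ := hzk k
      exact ⟨d, by rw [hd, Algebra.smul_def, map_pow]⟩
    refine hΛδ ?_
    rw [← hwD]
    linear_combination ψΛ (orbitDeriv G a) * h1
  have hcoe : ∀ Q : (QuotientRing 𝒪[K] G A)[X], ((eval₂ f' z Q : Λ) : M.carrier) =
      eval₂ ((algebraMap K M.carrier).comp x'.toField) z Q := fun Q => by
    refine (hom_eval₂ Q f' Λ.val.toRingHom z).trans ?_
    congr 1
  have hzM : aeval (z : M.carrier) (P.map x'.toField) = 0 := by
    rw [aeval_def, eval₂_map, ← hcoe, hz0]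
    rfl
  obtain ⟨ψ', hψ', hψ'a⟩ := exists_ringHom_of_root hξ' hP hzM
  obtain ⟨u', hu'⟩ := hunit
  have huu : (1 + δ ^ 2 * ϖ * c) * ((u'⁻¹ : 𝒪[K]ˣ) : 𝒪[K]) = 1 := by rw [← hu', Units.mul_inv]
  set r : 𝒪[K] := ((u'⁻¹ : 𝒪[K]ˣ) : 𝒪[K]) with hr
  have hψ'δ : ψ' (orbitDisc G a) = algebraMap 𝒪[K] M.carrier (δ * (1 + δ ^ 2 * ϖ * c)) := by
    rw [← hδ', IsScalarTower.algebraMap_apply 𝒪[K] K M.carrier]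
    exact hψ' (invariantDisc 𝒪[K] G a)
  have hunitδ : IsUnit (algebraMap 𝒪[K] M.carrier δ) := by
    rw [IsScalarTower.algebraMap_apply 𝒪[K] K M.carrier]
    exact (IsUnit.mk0 _ fun h0 => hδ (Subtype.ext h0)).map _
  have hclose : ∀ b, ∃ v : Λ, ψ' b = ψ b + algebraMap 𝒪[K] M.carrier (δ * ϖ) * v := by
    intro b
    obtain ⟨Q, hQ⟩ := exists_lagrangePoly_disc (G := G) 𝒪[K] a b
    have h1 := heval Q
    rw [hQ, map_mul, hψδ] at h1
    have h2 : ψ' b * ψ' (orbitDisc G a) = (eval₂ f' z Q : Λ) := by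
      rw [hcoe, ← map_mul, ← hQ, ← hψ'a, ← eval₂_eq_eval_map, hom_eval₂]
      congr 1
      ext b
      exact hψ' b
    obtain ⟨v₁, hv₁⟩ := hz.trans (sub_dvd_eval₂_sub f' z (ψΛ a) Q)
    obtain ⟨v₂, hv₂⟩ := dvd_eval₂_sub hff' (ψΛ a) Q
    have h3 : eval₂ f' z Q = D * (ψΛ b + D * p * (v₁ + D * v₂)) := by
      linear_combination h1 + hv₁ + hv₂
    refine ⟨algebraMap 𝒪[K] Λ r * (v₁ + D * v₂) - algebraMap 𝒪[K] Λ (δ * c * r) * ψΛ b, ?_⟩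
    rw [h3, hψ'δ, map_mul] at h2
    have h4 : ψ' b * algebraMap 𝒪[K] M.carrier (1 + δ ^ 2 * ϖ * c) =
        ((ψΛ b + D * p * (v₁ + D * v₂) : Λ) : M.carrier) := by
      refine hunitδ.mul_left_cancel ?_
      refine Eq.trans ?_ h2
      ring
    have h5 := congrArg (algebraMap 𝒪[K] M.carrier) huu
    push_cast at h4 ⊢
    rw [hψΛ] at h4 ⊢
    have hDc : (D : M.carrier) = algebraMap 𝒪[K] M.carrier δ := rfl
    have hpc : (p : M.carrier) = algebraMap 𝒪[K] M.carrier ϖ := rfl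
    rw [hDc, hpc] at h4
    rw [hDc]
    simp only [map_add, map_mul, map_one, map_pow, Subalgebra.coe_algebraMap] at h4 h5 ⊢
    linear_combination algebraMap 𝒪[K] M.carrier r * h4 + (ψ b - ψ' b) * h5
  refine ⟨ψ', hψ', fun g b => ?_⟩
  have hψ₂ : ((MulSemiringAction.toRingHom G M.carrier g⁻¹).comp
      (ψ'.comp (MulSemiringAction.toRingHom G A g))) = ψ' := by
    obtain ⟨v, hv⟩ := hclose (g • a)
    obtain ⟨v', hv'⟩ := hclose a
    have hvint : IsIntegral 𝒪[K] (g⁻¹ • (v : M.carrier)) := by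
      obtain ⟨b', hb'⟩ := v.2
      rw [← hb']
      change IsIntegral 𝒪[K] (g⁻¹ • ψ b')
      rw [← h.smul]
      exact isIntegral_of_restrict h.restrict _
    have hvint' : IsIntegral 𝒪[K] (v' : M.carrier) := by
      obtain ⟨b', hb'⟩ := v'.2
      rw [← hb']
      exact isIntegral_of_restrict h.restrict _
    refine ringHom_eq_of_close hδ'0 hψ' (fun b => ?_) (c := ϖ)
      (by rw [hϖ.maximalIdeal_eq]; exact Ideal.mem_span_singleton_self _)
      ((isIntegral_algebraMap (x := r)).mul (hvint.sub hvint')) ?_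
    · change g⁻¹ • ψ' (g • (b : A)) = _
      rw [show g • (b : A) = b from b.2 g, hψ', smul_algebraMap]
    · change g⁻¹ • ψ' (g • a) - ψ' a = _
      have hs : g⁻¹ • algebraMap 𝒪[K] M.carrier (δ * ϖ) = algebraMap 𝒪[K] M.carrier (δ * ϖ) := by
        rw [IsScalarTower.algebraMap_apply 𝒪[K] K M.carrier, smul_algebraMap]
      have h5 := congrArg (algebraMap 𝒪[K] M.carrier) huu
      rw [hv, hv', smul_add, ← h.smul, inv_smul_smul, smul_mul', hs, hδ']
      simp only [map_add, map_mul, map_one, map_pow] at h5 ⊢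
      linear_combination -(algebraMap 𝒪[K] M.carrier δ * algebraMap 𝒪[K] M.carrier ϖ *
        (g⁻¹ • (v : M.carrier) - v')) * h5
  have := DFunLike.congr_fun hψ₂ b
  change g⁻¹ • ψ' (g • b) = ψ' b at this
  rw [← this, smul_inv_smul]

end Deformation

section Generic

lemma fractionMap_injective {O R S : Type*} [CommRing O] [CommRing R] [CommRing S] [Algebra O R]
    [Algebra O S] {φ : R →ₐ[O] S}
    (h : nonZeroDivisors R ≤ (nonZeroDivisors S).comap φ.toRingHom)
    (hφ : Function.Injective φ) : Function.Injective (fractionMap φ h) := by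
  rw [injective_iff_map_eq_zero]
  intro x hx
  obtain ⟨⟨r, s⟩, hrs⟩ := IsLocalization.surj (nonZeroDivisors R) x
  have h1 := congrArg (fractionMap φ h) hrs
  rw [map_mul, hx, zero_mul, fractionMap_algebraMap] at h1
  have h2 : φ r = 0 := IsFractionRing.injective S (FractionRing S) (by rw [← h1, map_zero])
  rw [map_eq_zero_iff φ hφ] at h2
  rw [h2, map_zero] at hrs
  exact ((IsLocalization.map_units (FractionRing R) s).mul_left_eq_zero).mp hrs

lemma Normalization.isIntegral_algebraMap (R : Type*) [CommRing R] :
    (algebraMap R (Normalization R)).IsIntegral := fun x => by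
  have := x.2
  exact (isIntegral_algHom_iff (integralClosure R (FractionRing R)).val Subtype.val_injective).mp x.2

lemma Normalization.algebraMap_injective (R : Type*) [CommRing R] :
    Function.Injective (algebraMap R (Normalization R)) := fun _ _ h =>
  IsFractionRing.injective R (FractionRing R) (congrArg Subtype.val h)

variable {O R S : Type*} [CommRing O] [CommRing R] [CommRing S] [Algebra O R] [Algebra O S]
  {φ : R →ₐ[O] S} (h : nonZeroDivisors R ≤ (nonZeroDivisors S).comap φ.toRingHom)

lemma normalizationMap_algebraMap (a : R) :
    normalizationMap φ h (algebraMap R (Normalization R) a) = algebraMap S (Normalization S) (φ a) :=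
  Subtype.ext (fractionMap_algebraMap φ h a)

lemma normalizationMap_injective (hφ : Function.Injective φ) :
    Function.Injective (normalizationMap φ h) := fun x y hxy =>
  Subtype.ext (fractionMap_injective h hφ (congrArg Subtype.val hxy))

lemma normalizationMap_comp_algebraMap :
    (normalizationMap φ h).toRingHom.comp (algebraMap R (Normalization R)) =
      (algebraMap S (Normalization S)).comp φ.toRingHom :=
  RingHom.ext (normalizationMap_algebraMap h)

lemma isIntegral_comp_normalization (hφ : φ.toRingHom.IsIntegral) :
    ((algebraMap S (Normalization S)).comp φ.toRingHom).IsIntegral :=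
  RingHom.IsIntegral.trans _ _ hφ (Normalization.isIntegral_algebraMap S)

lemma normalizationMap_isIntegral (hφ : φ.toRingHom.IsIntegral) :
    (normalizationMap φ h).toRingHom.IsIntegral := by
  have := isIntegral_comp_normalization hφ
  rw [← normalizationMap_comp_algebraMap h] at this
  exact RingHom.IsIntegral.tower_top _ _ this

/-- An element of the normalization of `S` that is a quotient of elements of `R` comes from the
normalization of `R`. -/
lemma exists_normalizationMap_eq (hφ : Function.Injective φ) (hint : φ.toRingHom.IsIntegral)
    {t : Normalization S} {r s : R} (hs : φ s ∈ nonZeroDivisors S)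
    (hrs : t * algebraMap S _ (φ s) = algebraMap S _ (φ r)) : ∃ x, normalizationMap φ h x = t := by
  have hsR : s ∈ nonZeroDivisors R := by
    rw [mem_nonZeroDivisors_iff_right]
    intro y hy
    rw [← map_eq_zero_iff φ hφ]
    refine (mem_nonZeroDivisors_iff_right.mp hs) _ ?_
    rw [← map_mul, hy, map_zero]
  let x : FractionRing R := IsLocalization.mk' _ r (⟨s, hsR⟩ : nonZeroDivisors R)
  have hx : fractionMap φ h x = t.1 := by
    have h1 := congrArg (fractionMap φ h) (IsLocalization.mk'_spec (FractionRing R) r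
      (⟨s, hsR⟩ : nonZeroDivisors R))
    rw [map_mul, fractionMap_algebraMap, fractionMap_algebraMap] at h1
    have h2 := congrArg Subtype.val hrs
    change t.1 * algebraMap S (FractionRing S) (φ s) = algebraMap S (FractionRing S) (φ r) at h2
    have h3 : IsUnit (algebraMap S (FractionRing S) (φ s)) :=
      IsLocalization.map_units (FractionRing S) (⟨φ s, hs⟩ : nonZeroDivisors S)
    exact h3.mul_right_cancel (h1.trans h2.symm)
  have hxint : IsIntegral R x := by
    obtain ⟨p, hp, hpt⟩ := isIntegral_comp_normalization hint t
    refine ⟨p, hp, fractionMap_injective h hφ ?_⟩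
    rw [map_zero]
    have h4 := congrArg Subtype.val hpt
    have h5 := Polynomial.hom_eval₂ p ((algebraMap S (Normalization S)).comp φ.toRingHom)
      (integralClosure S (FractionRing S)).val.toRingHom t
    have h6 := Polynomial.hom_eval₂ p (algebraMap R (FractionRing R)) (fractionMap φ h).toRingHom x
    refine h6.trans (Eq.trans ?_ (h5.symm.trans h4))
    congr 1
    ext a
    exact fractionMap_algebraMap φ h a
  exact ⟨⟨x, hxint⟩, Subtype.ext hx⟩

end Generic

section Untwisting

variable {K : Type u} [Field K] [ValuativeRel K] {G : Type w} [Group G] [Finite G] {A : Type v}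
  [CommRing A] [Algebra 𝒪[K] A] [MulSemiringAction G A] {n : ℕ} {i : EquivariantEmbedding 𝒪[K] G A n}
  {M : GEtaleAlgebra K G} (φ : Module.Basis (Fin n) 𝒪[K] (tuningModule i M))

attribute [local instance] MvPolynomial.algebraMvPolynomial in
lemma untwistedToTwisted_injective : Function.Injective (untwistedToTwisted φ) := by
  have := M.nontrivial
  rw [injective_iff_map_eq_zero]
  intro b hb
  obtain ⟨b, rfl⟩ := Ideal.Quotient.mk_surjective b
  have hb' : scalarExtension M n b ∈ closureIdeal M.integers M.carrier (twistedIdeal φ) :=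
    Ideal.Quotient.eq_zero_iff_mem.mp hb
  obtain ⟨k, hk⟩ := hb'
  have hbc := Algebra.IsPushout.out (R := K) (S := MvPolynomial (Fin n) K) (R' := M.carrier)
    (S' := MvPolynomial (Fin n) M.carrier)
  have hff : Module.FaithfullyFlat (MvPolynomial (Fin n) K) (MvPolynomial (Fin n) M.carrier) :=
    Module.FaithfullyFlat.of_linearEquiv _ _ hbc.equiv.symm
  have hcomm : MvPolynomial.map (algebraMap M.integers M.carrier) (scalarExtension M n b) =
      algebraMap (MvPolynomial (Fin n) K) (MvPolynomial (Fin n) M.carrier)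
        (MvPolynomial.map (algebraMap 𝒪[K] K) b) :=
    DFunLike.congr_fun (map_comp_scalarExtension (M := M) (n := n)) b
  have hk' := twistedIdeal_le φ hk
  rw [hcomm, ← map_pow] at hk'
  have h1 : (MvPolynomial.map (algebraMap 𝒪[K] K) b) ^ k ∈
      (untwistedIdeal φ).map (MvPolynomial.map (algebraMap 𝒪[K] K)) := by
    rw [← Ideal.comap_map_eq_self_of_faithfullyFlat (B := MvPolynomial (Fin n) M.carrier)
      ((untwistedIdeal φ).map (MvPolynomial.map (algebraMap 𝒪[K] K)))]
    exact hk'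
  exact Ideal.Quotient.eq_zero_iff_mem.mpr ⟨k, h1⟩

lemma untwistedToTwisted_isIntegral : (untwistedToTwisted φ).toRingHom.IsIntegral := by
  intro t
  obtain ⟨t, rfl⟩ := Ideal.Quotient.mk_surjective t
  induction t using MvPolynomial.induction_on with
  | C c =>
    have hc : IsIntegral 𝒪[K] c :=
      (isIntegral_algHom_iff M.integers.val Subtype.val_injective).mp c.2
    let F : M.integers →ₐ[𝒪[K]] TwistedRing φ :=
      (Ideal.Quotient.mkₐ 𝒪[K] (closureIdeal M.integers M.carrier (twistedIdeal φ))).comp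
        (IsScalarTower.toAlgHom 𝒪[K] M.integers (MvPolynomial (Fin n) M.integers))
    let _ : Algebra (UntwistedRing φ) (TwistedRing φ) := (untwistedToTwisted φ).toRingHom.toAlgebra
    refine (hc.map F).map_of_comp_eq (algebraMap 𝒪[K] (UntwistedRing φ)) (RingHom.id _) ?_
    ext c
    exact (untwistedToTwisted φ).commutes c
  | add p q hp hq =>
    rw [map_add]
    exact RingHom.IsIntegralElem.add _ hp hq
  | mul_X p j hp =>
    rw [map_mul]
    refine RingHom.IsIntegralElem.mul _ hp ?_
    have : (untwistedToTwisted φ) (Ideal.Quotient.mk _ (MvPolynomial.X j)) =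
        Ideal.Quotient.mk _ (MvPolynomial.X j) :=
      congrArg (Ideal.Quotient.mk _) (MvPolynomial.map_X _ j)
    rw [← this]
    exact RingHom.isIntegralElem_map (untwistedToTwisted φ).toRingHom

lemma untwistedToTwistedNormalization_injective :
    Function.Injective (untwistedToTwistedNormalization φ) :=
  normalizationMap_injective _ (untwistedToTwisted_injective φ)

lemma untwistedToTwistedNormalization_isIntegral :
    (untwistedToTwistedNormalization φ).toRingHom.IsIntegral :=
  normalizationMap_isIntegral _ (untwistedToTwisted_isIntegral φ)

variable [SMulCommClass G 𝒪[K] A]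

lemma twistedToSource_restrict (s : MvPolynomial (Fin n) 𝒪[K]) :
    twistedToSource φ (i.restrict s) =
      Ideal.Quotient.mk (closureIdeal M.integers M.carrier (twistedIdeal φ)) (uMap φ s) := by
  have h1 : (Ideal.quotientKerAlgEquivOfSurjective i.restrict_surjective).symm (i.restrict s) =
      Ideal.Quotient.mk _ s := by
    rw [AlgEquiv.symm_apply_eq]
    rfl
  refine (congrArg (Ideal.Quotient.liftₐ (RingHom.ker i.restrict)
    ((Ideal.Quotient.mkₐ 𝒪[K] (closureIdeal M.integers M.carrier (twistedIdeal φ))).comp (uMap φ))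
    fun f hf => Ideal.Quotient.eq_zero_iff_mem.mpr (uMap_mem_closureIdeal φ f hf)) h1).trans rfl

/-- Traces on `Spec A` extend to functions on `V^{|M|}`. -/
lemma exists_untwistedToTwisted_eq [Fintype G] (b : A) :
    ∃ h, untwistedToTwisted φ h = twistedToSource φ (∑ g : G, g • b) := by
  obtain ⟨s, rfl⟩ := i.restrict_surjective b
  obtain ⟨h, hh⟩ := exists_scalarExtension_eq φ (∑ g : G, i.act g s) fun g => by
    rw [map_sum]
    exact Fintype.sum_equiv (Equiv.mulLeft g) _ _ fun g' => by simp [i.act_act]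
  refine ⟨Ideal.Quotient.mk _ h, ?_⟩
  rw [show ∑ g : G, g • i.restrict s = i.restrict (∑ g : G, i.act g s) by
    simp [map_sum, i.restrict_act], twistedToSource_restrict, ← hh]
  rfl

variable [Fintype G] {f : A} (hf : twistedToSource φ (∑ g : G, g • f) ∈ nonZeroDivisors (TwistedRing φ))

include hf in
lemma exists_quotientToUntwisted : ∃ θ : QuotientRing 𝒪[K] G A →ₐ[𝒪[K]] Normalization (UntwistedRing φ),
    ∀ b, untwistedToTwistedNormalization φ (θ b) = twistedNormalizationToSource φ b := by
  have hex : ∀ b : QuotientRing 𝒪[K] G A, ∃ x,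
      untwistedToTwistedNormalization φ x = twistedNormalizationToSource φ b := by
    intro b
    obtain ⟨h, hh⟩ := exists_untwistedToTwisted_eq φ (f * b)
    obtain ⟨h₁, hh₁⟩ := exists_untwistedToTwisted_eq φ f
    refine exists_normalizationMap_eq _ (untwistedToTwisted_injective φ)
      (untwistedToTwisted_isIntegral φ) (r := h) (s := h₁) (by rwa [hh₁]) ?_
    rw [hh, hh₁]
    refine (map_mul (algebraMap (TwistedRing φ) _) _ _).symm.trans ?_
    change algebraMap _ _ (twistedToSource φ (b : A) * twistedToSource φ _) = _
    rw [← map_mul, Finset.mul_sum]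
    congr 2
    refine Finset.sum_congr rfl fun g _ => ?_
    rw [smul_mul', show g • (b : A) = b from b.2 g, mul_comm]
  let F : QuotientRing 𝒪[K] G A →ₐ[𝒪[K]] (untwistedToTwistedNormalization φ).range :=
    ((twistedNormalizationToSource φ).comp (QuotientRing 𝒪[K] G A).val).codRestrict _ hex
  let e := AlgEquiv.ofInjective _ (untwistedToTwistedNormalization_injective φ)
  refine ⟨e.symm.toAlgHom.comp F, fun b => ?_⟩
  exact congrArg Subtype.val (e.apply_symm_apply (F b))

end Untwisting

section Points

variable {K : Type u} [Field K] [ValuativeRel K] {G : Type w} [Group G] [Finite G] {A : Type v}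
  [CommRing A] [Algebra 𝒪[K] A] [MulSemiringAction G A] {n : ℕ} {i : EquivariantEmbedding 𝒪[K] G A n}
  {M : GEtaleAlgebra K G} (φ : Module.Basis (Fin n) 𝒪[K] (tuningModule i M))

lemma GEtaleAlgebra.algebraMap_integer_injective (M : GEtaleAlgebra K G) :
    Function.Injective (algebraMap 𝒪[K] M.carrier) := by
  have := M.nontrivial
  exact (algebraMap K M.carrier).injective.comp Subtype.val_injective

/-- Evaluation of polynomials over `𝒪_M` at a point of the affine space over `𝒪_K`. -/
def evalPoint (M : GEtaleAlgebra K G) {n : ℕ} (c : Fin n → 𝒪[K]) :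
    MvPolynomial (Fin n) M.integers →+* M.carrier :=
  MvPolynomial.eval₂Hom (algebraMap M.integers M.carrier) fun j => algebraMap 𝒪[K] M.carrier (c j)

lemma evalPoint_scalarExtension (c : Fin n → 𝒪[K]) (h : MvPolynomial (Fin n) 𝒪[K]) :
    evalPoint M c (scalarExtension M n h) = algebraMap 𝒪[K] M.carrier (MvPolynomial.aeval c h) := by
  have : (evalPoint M c).comp (scalarExtension M n).toRingHom =
      (algebraMap 𝒪[K] M.carrier).comp (MvPolynomial.aeval (R := 𝒪[K]) c).toRingHom := by
    refine MvPolynomial.ringHom_ext (fun r => ?_) fun j => ?_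
    · simp [evalPoint]
    · simp [evalPoint]
  exact DFunLike.congr_fun this h

lemma evalPoint_eq_eval (c : Fin n → 𝒪[K]) (f : MvPolynomial (Fin n) M.integers) :
    evalPoint M c f = MvPolynomial.eval (fun j => algebraMap 𝒪[K] M.carrier (c j))
      (MvPolynomial.map (algebraMap M.integers M.carrier) f) :=
  (MvPolynomial.eval_map (algebraMap M.integers M.carrier)
    (fun j => algebraMap 𝒪[K] M.carrier (c j)) f).symm

lemma evalPoint_uMap_act (c : Fin n → 𝒪[K]) (g : G) (s : MvPolynomial (Fin n) 𝒪[K]) :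
    evalPoint M c (uMap φ (i.act g s)) = g • evalPoint M c (uMap φ s) := by
  rw [evalPoint_eq_eval, evalPoint_eq_eval, uMap_act]
  generalize MvPolynomial.map (algebraMap M.integers M.carrier) (uMap φ s) = F
  have := MvPolynomial.map_eval (MulSemiringAction.toRingHom G M.carrier g)
    (fun j => algebraMap 𝒪[K] M.carrier (c j)) F
  refine Eq.trans ?_ this.symm
  congr 2
  funext j
  exact (smul_algebraMap g ((c j : 𝒪[K]) : K)).symm

lemma evalPoint_uMap_X (c : Fin n → 𝒪[K]) (l : Fin n) :
    evalPoint M c (uMap φ (MvPolynomial.X l)) =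
      ((∑ j, c j • φ j : tuningModule i M).1 (EquivariantEmbedding.basisForm 𝒪[K] l) : M.carrier) := by
  simp [evalPoint, uMap, map_sum, Algebra.smul_def, mul_comm]

/-- A point of the affine space is determined by the induced map of linear forms. -/
lemma eq_of_evalPoint_uMap_eq {c c' : Fin n → 𝒪[K]}
    (h : ∀ s, evalPoint M c (uMap φ s) = evalPoint M c' (uMap φ s)) : c = c' := by
  have h1 : (∑ j, c j • φ j : tuningModule i M) = ∑ j, c' j • φ j := by
    refine Subtype.ext (LinearMap.pi_ext' fun l => LinearMap.ext_ring (Subtype.ext ?_))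
    have := h (MvPolynomial.X l)
    rw [evalPoint_uMap_X, evalPoint_uMap_X] at this
    exact this
  have h2 := congrArg φ.equivFun h1
  rw [← φ.equivFun_symm_apply, ← φ.equivFun_symm_apply, LinearEquiv.apply_symm_apply,
    LinearEquiv.apply_symm_apply] at h2
  exact h2

lemma aeval_eq_zero_of_mem_closureIdeal {c : Fin n → 𝒪[K]}
    (hc : ∀ h ∈ untwistedIdeal φ, MvPolynomial.aeval c h = 0) {f : MvPolynomial (Fin n) 𝒪[K]}
    (hf : f ∈ closureIdeal 𝒪[K] K (untwistedIdeal φ)) : MvPolynomial.aeval c f = 0 := by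
  obtain ⟨k, hk⟩ := hf
  have hcomm : ∀ h : MvPolynomial (Fin n) 𝒪[K],
      MvPolynomial.eval (fun j => (c j : K)) (MvPolynomial.map (algebraMap 𝒪[K] K) h) =
        (MvPolynomial.aeval c h : 𝒪[K]) := fun h => by
    rw [MvPolynomial.eval_map]
    exact (MvPolynomial.map_aeval c (algebraMap 𝒪[K] K) h).symm
  have h1 : (untwistedIdeal φ).map (MvPolynomial.map (algebraMap 𝒪[K] K)) ≤
      RingHom.ker (MvPolynomial.eval (fun j => (c j : K))) := by
    rw [Ideal.map_le_iff_le_comap]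
    intro h hh
    change MvPolynomial.eval _ _ = 0
    rw [hcomm, hc h hh]
    rfl
  have h2 := h1 hk
  rw [RingHom.mem_ker, map_pow, hcomm] at h2
  exact Subtype.ext (eq_zero_of_pow_eq_zero h2)

variable [SMulCommClass G 𝒪[K] A]

/-- An `𝒪_K`-point of `V^{|M|}` defines an equivariant morphism from `Spec M` to `Spec A`. -/
lemma exists_ringHom_of_point {c : Fin n → 𝒪[K]}
    (hc : ∀ h ∈ untwistedIdeal φ, MvPolynomial.aeval c h = 0) :
    ∃ ψ : A →+* M.carrier, (∀ s, ψ (i.restrict s) = evalPoint M c (uMap φ s)) ∧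
      ∀ (g : G) (a : A), ψ (g • a) = g • ψ a := by
  have := M.isReduced
  let F : MvPolynomial (Fin n) 𝒪[K] →+* M.carrier := (evalPoint M c).comp (uMap φ).toRingHom
  have hker : ∀ f ∈ RingHom.ker i.restrict, F f = 0 := by
    intro f hf
    obtain ⟨m, hm⟩ := i.exists_pow_mem_span f hf
    have h1 : Ideal.span i.imageIdeal ≤ RingHom.ker F := by
      rw [Ideal.span_le]
      intro f' hf'
      obtain ⟨h, hh⟩ := exists_scalarExtension_eq φ f' hf'.2
      change evalPoint M c (uMap φ f') = 0
      rw [← hh, evalPoint_scalarExtension, hc h (Ideal.subset_span ⟨f', hf', hh.symm⟩), map_zero]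
    have h2 := h1 hm
    rw [RingHom.mem_ker, map_pow] at h2
    exact eq_zero_of_pow_eq_zero h2
  let ψ : A →+* M.carrier := (Ideal.Quotient.lift (RingHom.ker i.restrict) F hker).comp
    (Ideal.quotientKerAlgEquivOfSurjective i.restrict_surjective).symm.toRingEquiv.toRingHom
  have hψ : ∀ s, ψ (i.restrict s) = evalPoint M c (uMap φ s) := fun s => by
    have h1 : (Ideal.quotientKerAlgEquivOfSurjective i.restrict_surjective).symm (i.restrict s) =
        Ideal.Quotient.mk _ s := by
      rw [AlgEquiv.symm_apply_eq]
      rfl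
    exact (congrArg (Ideal.Quotient.lift (RingHom.ker i.restrict) F hker) h1).trans
      (Ideal.Quotient.lift_mk _ _ _)
  refine ⟨ψ, hψ, fun g a => ?_⟩
  obtain ⟨s, rfl⟩ := i.restrict_surjective a
  rw [← i.restrict_act, hψ, hψ, evalPoint_uMap_act]

/-- An equivariant morphism from `Spec M` to `Spec A` defines an `𝒪_K`-point of `V^{|M|}`. -/
lemma exists_point_of_ringHom {ψ : A →+* M.carrier} (hO : ∀ r, ψ (algebraMap 𝒪[K] A r) = algebraMap 𝒪[K] M.carrier r)
    (hint : ∀ a, IsIntegral 𝒪[K] (ψ a)) (hG : ∀ (g : G) (a : A), ψ (g • a) = g • ψ a) :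
    ∃ c : Fin n → 𝒪[K], (∀ s, ψ (i.restrict s) = evalPoint M c (uMap φ s)) ∧
      ∀ h ∈ untwistedIdeal φ, MvPolynomial.aeval c h = 0 := by
  let L : (Fin n → 𝒪[K]) →ₗ[𝒪[K]] M.integers :=
    { toFun := fun v => ⟨ψ (i.toLinearMap v), hint _⟩
      map_add' := fun v v' => Subtype.ext (by simp)
      map_smul' := fun r v => Subtype.ext (by
        change ψ (i.toLinearMap (r • v)) = r • ψ (i.toLinearMap v)
        rw [map_smul, Algebra.smul_def, map_mul, hO, Algebra.smul_def]) }
  have hL : L ∈ tuningModule i M := fun g v => by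
    change ψ (i.toLinearMap (i.rep g v)) = g • ψ (i.toLinearMap v)
    rw [i.equivariant, hG]
  have hsum : (∑ j, φ.equivFun ⟨L, hL⟩ j • φ j : tuningModule i M) = ⟨L, hL⟩ :=
    φ.sum_equivFun _
  have h1 : ∀ s, ψ (i.restrict s) = evalPoint M (φ.equivFun ⟨L, hL⟩) (uMap φ s) := by
    intro s
    have : ψ.comp i.restrict.toRingHom =
        (evalPoint M (φ.equivFun ⟨L, hL⟩)).comp (uMap φ).toRingHom := by
      refine MvPolynomial.ringHom_ext (fun r => ?_) fun l => ?_
      · change ψ (i.restrict (MvPolynomial.C r)) = evalPoint M _ (uMap φ (MvPolynomial.C r))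
        rw [MvPolynomial.algHom_C, MvPolynomial.algHom_C, hO]
        simp [evalPoint, MvPolynomial.algebraMap_apply]
      · change ψ (i.restrict (MvPolynomial.X l)) = evalPoint M _ (uMap φ (MvPolynomial.X l))
        rw [evalPoint_uMap_X, hsum]
        simp [EquivariantEmbedding.restrict, L]
    exact DFunLike.congr_fun this s
  refine ⟨φ.equivFun ⟨L, hL⟩, h1, fun h hh => ?_⟩
  have h2 : untwistedIdeal φ ≤ RingHom.ker (MvPolynomial.aeval (φ.equivFun ⟨L, hL⟩)) := by
    rw [untwistedIdeal, Ideal.span_le]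
    rintro h ⟨f, hf, hfh⟩
    refine M.algebraMap_integer_injective ?_
    rw [← evalPoint_scalarExtension, ← hfh, ← h1, hf.1, map_zero, map_zero]
  exact h2 hh

end Points

section Conductor

variable {O R : Type*} [CommRing O] [CommRing R] [Algebra O R]

instance (R : Type*) [CommRing R] : Algebra.IsIntegral R (Normalization R) :=
  ⟨Normalization.isIntegral_algebraMap R⟩

lemma exists_conductor [Algebra.FiniteType O (Normalization R)] :
    ∃ s ∈ nonZeroDivisors R, ∀ x : Normalization R, ∃ r : R,
      algebraMap R _ r = algebraMap R _ s * x := by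
  have : Algebra.FiniteType R (Normalization R) :=
    Algebra.FiniteType.of_restrictScalars_finiteType O R (Normalization R)
  have hfin : Module.Finite R (Normalization R) := Algebra.IsIntegral.finite
  obtain ⟨k, e, he⟩ := Module.Finite.exists_fin (R := R) (M := Normalization R)
  obtain ⟨s, hs⟩ := IsLocalization.exist_integer_multiples (nonZeroDivisors R) Finset.univ
    (fun j => ((e j).1 : FractionRing R))
  refine ⟨s, s.2, fun x => ?_⟩
  have hx : x ∈ Submodule.span R (Set.range e) := by rw [he]; trivial
  induction hx using Submodule.span_induction with
  | mem x hx =>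
    obtain ⟨j, rfl⟩ := hx
    obtain ⟨r, hr⟩ := hs j (Finset.mem_univ j)
    exact ⟨r, Subtype.ext (hr.trans (Algebra.smul_def _ _))⟩
  | zero => exact ⟨0, by simp⟩
  | add x y _ _ hx hy =>
    obtain ⟨r, hr⟩ := hx
    obtain ⟨r', hr'⟩ := hy
    exact ⟨r + r', by rw [map_add, hr, hr', mul_add]⟩
  | smul t x _ hx =>
    obtain ⟨r, hr⟩ := hx
    exact ⟨t * r, by rw [map_mul, hr, Algebra.smul_def]; ring⟩

variable {K : Type u} [Field K] [ValuativeRel K] [TopologicalSpace K]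
  [IsNonarchimedeanLocalField K] [Algebra 𝒪[K] R] {s : R}
  (hs : ∀ x : Normalization R, ∃ r : R, algebraMap R _ r = algebraMap R _ s * x)

include hs

lemma integralPoint_normalization_ext {y y' : IntegralPoint K (Normalization R)}
    (h : ∀ r : R, y.eval (algebraMap R _ r) = y'.eval (algebraMap R _ r))
    (hys : y.eval (algebraMap R _ s) ≠ 0) : y = y' := by
  refine IntegralPoint.ext fun x => ?_
  obtain ⟨r, hr⟩ := hs x
  have h1 := h r
  rw [hr, map_mul, map_mul, ← h] at h1
  exact mul_left_cancel₀ hys h1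

lemma exists_integralPoint_normalization {y₀ : R →ₐ[𝒪[K]] 𝒪[K]} (hys : y₀ s ≠ 0) :
    ∃ y : IntegralPoint K (Normalization R), ∀ r : R, y.eval (algebraMap R _ r) = y₀ r := by
  choose r hr using hs
  have hinj := Normalization.algebraMap_injective R
  have hys' : (y₀ s : K) ≠ 0 := fun h => hys (Subtype.ext h)
  have hralg : ∀ t, r (algebraMap R _ t) = s * t := fun t => hinj (by rw [hr, map_mul])
  let F : Normalization R →+* K :=
    { toFun := fun x => (y₀ (r x) : K) / y₀ s
      map_one' := by
        rw [← map_one (algebraMap R (Normalization R)), hralg, mul_one, div_self hys']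
      map_zero' := by
        rw [← map_zero (algebraMap R (Normalization R)), hralg, mul_zero, map_zero]
        simp
      map_add' := fun x x' => by
        have : r (x + x') = r x + r x' := hinj (by rw [map_add, hr, hr, hr, mul_add])
        rw [this, map_add, ← add_div]
        rfl
      map_mul' := fun x x' => by
        have : r (x * x') * s = r x * r x' := hinj (by rw [map_mul, map_mul, hr, hr, hr]; ring)
        have h2 : (y₀ (r (x * x')) : K) * y₀ s = y₀ (r x) * y₀ (r x') := by
          
          have h3 := congrArg y₀ this
          rw [map_mul, map_mul] at h3
          exact congrArg Subtype.val h3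
        field_simp
        linear_combination h2 }
  have hF : ∀ t, F (algebraMap R _ t) = y₀ t := fun t => by
    change (y₀ (r _) : K) / y₀ s = _
    rw [hralg, map_mul, div_eq_iff hys', mul_comm]
    rfl
  have hFint : ∀ x, ∃ c : 𝒪[K], algebraMap 𝒪[K] K c = F x := by
    intro x
    rw [← IsIntegrallyClosed.isIntegral_iff]
    have hx : IsIntegral R x := Normalization.isIntegral_algebraMap R x
    refine hx.map_of_comp_eq y₀.toRingHom F ?_
    ext t
    exact (hF t).symm
  choose y hy using hFint
  have hy' : ∀ x c, F x = (c : 𝒪[K]) → y x = c := fun x c h => Subtype.ext ((hy x).trans h)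
  refine ⟨({ toFun := y
             map_one' := hy' _ _ (map_one F)
             map_zero' := hy' _ _ (map_zero F)
             map_add' := fun a b => hy' _ _ (by rw [map_add, ← hy, ← hy]; rfl)
             map_mul' := fun a b => hy' _ _ (by rw [map_mul, ← hy, ← hy]; rfl)
             commutes' := fun c => hy' _ _ (by
               rw [IsScalarTower.algebraMap_apply 𝒪[K] R, hF, AlgHom.commutes]) } : Normalization R →ₐ[𝒪[K]] 𝒪[K]), fun t => hy' _ _ (hF t)⟩

end Conductor

section TwistedPoints

variable {K : Type u} [Field K] [ValuativeRel K] {G : Type w} [Group G] [Finite G] {A : Type v}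
  [CommRing A] [Algebra 𝒪[K] A] [MulSemiringAction G A] {n : ℕ} {i : EquivariantEmbedding 𝒪[K] G A n}
  {M : GEtaleAlgebra K G} (φ : Module.Basis (Fin n) 𝒪[K] (tuningModule i M))

lemma evalPoint_sub_evalPoint {c c' : Fin n → 𝒪[K]} {e : 𝒪[K]} (h : ∀ j, e ∣ c' j - c j)
    (F : MvPolynomial (Fin n) M.integers) : ∃ v : M.carrier, IsIntegral 𝒪[K] v ∧
      evalPoint M c' F - evalPoint M c F = algebraMap 𝒪[K] M.carrier e * v := by
  let ev : (Fin n → 𝒪[K]) → MvPolynomial (Fin n) M.integers →+* M.integers := fun c =>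
    MvPolynomial.eval fun j => algebraMap 𝒪[K] M.integers (c j)
  have hev : ∀ c, (ev c F : M.carrier) = evalPoint M c F := fun c => by
    have := MvPolynomial.map_eval₂Hom (RingHom.id M.integers)
      (fun j => algebraMap 𝒪[K] M.integers (c j)) M.integers.val.toRingHom F
    exact this
  let J := Ideal.span {algebraMap 𝒪[K] M.integers e}
  have h1 : (Ideal.Quotient.mk J).comp (ev c') = (Ideal.Quotient.mk J).comp (ev c) := by
    refine MvPolynomial.ringHom_ext (fun r => ?_) fun j => ?_
    · simp [ev]
    · simp only [ev, RingHom.comp_apply, MvPolynomial.eval_X]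
      rw [← sub_eq_zero, ← map_sub, Ideal.Quotient.eq_zero_iff_mem, ← map_sub]
      exact Ideal.mem_span_singleton.mpr (map_dvd _ (h j))
  have h2 := DFunLike.congr_fun h1 F
  rw [RingHom.comp_apply, RingHom.comp_apply, ← sub_eq_zero, ← map_sub,
    Ideal.Quotient.eq_zero_iff_mem] at h2
  obtain ⟨v, hv⟩ := Ideal.mem_span_singleton.mp h2
  refine ⟨v, v.2, ?_⟩
  rw [← hev, ← hev]
  exact congrArg Subtype.val hv

variable [SMulCommClass G 𝒪[K] A]

/-- The trace of a function as a function on the quotient. -/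
def quotientTrace (O : Type*) [CommRing O] [Algebra O A] [SMulCommClass G O A] [Fintype G] (b : A) :
    QuotientRing O G A :=
  ⟨∑ g : G, g • b, fun h => by
    change h • ∑ g : G, g • b = _
    rw [Finset.smul_sum]
    exact Fintype.sum_equiv (Equiv.mulLeft h) _ _ fun g => by simp [mul_smul]⟩

omit [Finite G] in
lemma quotientTrace_mul [Fintype G] (b : A) (c : QuotientRing 𝒪[K] G A) :
    quotientTrace 𝒪[K] (b * c) = quotientTrace 𝒪[K] b * c := by
  refine Subtype.ext ?_
  change ∑ g : G, g • (b * c) = (∑ g : G, g • b) * c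
  rw [Finset.sum_mul]
  refine Finset.sum_congr rfl fun g _ => ?_
  rw [smul_mul', show g • (c : A) = c from c.2 g]

variable [Fintype G] {θ : QuotientRing 𝒪[K] G A →ₐ[𝒪[K]] Normalization (UntwistedRing φ)}
  (hθ : ∀ b, untwistedToTwistedNormalization φ (θ b) = twistedNormalizationToSource φ b)

include hθ in
lemma exists_trace_eq (b : A) : ∃ (t h : MvPolynomial (Fin n) 𝒪[K]),
    i.restrict t = (quotientTrace (G := G) 𝒪[K] b : A) ∧ scalarExtension M n h = uMap φ t ∧
      θ (quotientTrace 𝒪[K] b) = algebraMap (UntwistedRing φ) _ (Ideal.Quotient.mk _ h) := by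
  obtain ⟨s, rfl⟩ := i.restrict_surjective b
  obtain ⟨h, hh⟩ := exists_scalarExtension_eq φ (∑ g : G, i.act g s) fun g => by
    rw [map_sum]
    exact Fintype.sum_equiv (Equiv.mulLeft g) _ _ fun g' => by simp [i.act_act]
  have ht : i.restrict (∑ g : G, i.act g s) = (quotientTrace (G := G) 𝒪[K] (i.restrict s) : A) := by
    simp [quotientTrace, map_sum, i.restrict_act]
  refine ⟨_, h, ht, hh, untwistedToTwistedNormalization_injective φ ?_⟩
  rw [hθ, ← ht]
  refine Eq.trans (congrArg (algebraMap (TwistedRing φ) _) ?_)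
    (normalizationMap_algebraMap _ _).symm
  refine Eq.trans (twistedToSource_restrict φ _) ?_
  rw [← hh]
  rfl

variable [TopologicalSpace K] [IsNonarchimedeanLocalField K]

include hθ in
/-- The `𝒪_K`-points of the normalization of `V^{|M|}` over a general point of the quotient
correspond to the equivariant morphisms from `Spec M` to its fibre. -/
theorem exists_twisted_of_point {f : A} {s : UntwistedRing φ}
    (hs : ∀ x : Normalization (UntwistedRing φ), ∃ r : UntwistedRing φ,
      algebraMap _ (Normalization (UntwistedRing φ)) r = algebraMap _ _ s * x)
    {c : QuotientRing 𝒪[K] G A} (hc : ∀ p : Ideal (Normalization (UntwistedRing φ)), p.IsPrime →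
      algebraMap _ _ s ∈ p → θ c ∈ p) :
    ∃ Ψ : IntegralPoint K (Normalization (UntwistedRing φ)) → (A →+* M.carrier),
      (∀ y, (y.map θ).eval (quotientTrace 𝒪[K] f) ≠ 0 → IsTwisted (y.map θ).toField M (Ψ y)) ∧
      (∀ y y', (y.map θ).eval c ≠ 0 → Ψ y = Ψ y' → y = y') ∧
      (∀ x ψ, x.eval c ≠ 0 → x.eval (quotientTrace 𝒪[K] f) ≠ 0 → IsTwisted x.toField M ψ →
        ∃ y, y.map θ = x ∧ Ψ y = ψ) ∧
      ∀ (a : A) (e : 𝒪[K]) y y', (∀ b, e ∣ y'.eval b - y.eval b) → ∃ v : M.carrier,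
        IsIntegral 𝒪[K] v ∧ Ψ y' a - Ψ y a = algebraMap 𝒪[K] M.carrier e * v := by
  let q : MvPolynomial (Fin n) 𝒪[K] →ₐ[𝒪[K]] Normalization (UntwistedRing φ) :=
    (IsScalarTower.toAlgHom 𝒪[K] (UntwistedRing φ) (Normalization (UntwistedRing φ))).comp
      (Ideal.Quotient.mkₐ 𝒪[K] (closureIdeal 𝒪[K] K (untwistedIdeal φ)))
  have hq : ∀ h, q h = algebraMap (UntwistedRing φ) _ (Ideal.Quotient.mk _ h) := fun _ => rfl
  let pt : IntegralPoint K (Normalization (UntwistedRing φ)) → Fin n → 𝒪[K] := fun y j =>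
    y.eval (q (MvPolynomial.X j))
  have hpt : ∀ y h, MvPolynomial.aeval (pt y) h = y.eval (q h) := by
    intro y h
    have : MvPolynomial.aeval (pt y) = y.eval.comp q :=
      MvPolynomial.algHom_ext fun j => by simp [pt]
    exact DFunLike.congr_fun this h
  have hpt0 : ∀ y, ∀ h ∈ untwistedIdeal φ, MvPolynomial.aeval (pt y) h = 0 := by
    intro y h hh
    have h0 : q h = 0 := (congrArg (algebraMap (UntwistedRing φ) _)
      (Ideal.Quotient.eq_zero_iff_mem.mpr
        (subset_closureIdeal 𝒪[K] K (untwistedIdeal φ) h 1 (by rwa [pow_one])))).trans (map_zero _)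
    rw [hpt, h0, map_zero]
  choose Ψ hΨ hΨG using fun y => exists_ringHom_of_point φ (hpt0 y)
  have htr : ∀ y b, Ψ y (quotientTrace (G := G) 𝒪[K] b : QuotientRing 𝒪[K] G A) =
      algebraMap 𝒪[K] M.carrier (y.eval (θ (quotientTrace 𝒪[K] b))) := by
    intro y b
    obtain ⟨t, h, ht, hh, hb⟩ := exists_trace_eq φ hθ b
    rw [← ht, hΨ, ← hh, evalPoint_scalarExtension, hpt, hb, hq]
  have hsy : ∀ y : IntegralPoint K (Normalization (UntwistedRing φ)), (y.map θ).eval c ≠ 0 → y.eval (algebraMap _ _ s) ≠ 0 := by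
    intro y hy h0
    exact hy (hc (RingHom.ker y.eval) (RingHom.ker_isPrime _) h0)
  refine ⟨Ψ, fun y hy => ⟨fun b => ?_, hΨG y⟩, fun y y' hy hyy => ?_, fun x ψ hxc hxf hψ => ?_,
    fun a e y y' hyy => ?_⟩
  · have h1 := htr y f
    have h2 := htr y (f * b)
    rw [quotientTrace_mul, map_mul, map_mul, map_mul] at h2
    have h3 : IsUnit (algebraMap 𝒪[K] M.carrier (y.eval (θ (quotientTrace 𝒪[K] f)))) := by
      rw [IsScalarTower.algebraMap_apply 𝒪[K] K M.carrier]
      exact (IsUnit.mk0 _ fun h0 => hy (Subtype.ext h0)).map _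
    rw [← h1] at h2 h3
    refine Eq.trans (h3.mul_left_cancel ((map_mul (Ψ y) _ _).symm.trans h2)) ?_
    exact IsScalarTower.algebraMap_apply 𝒪[K] K M.carrier _
  · have h1 : pt y = pt y' := eq_of_evalPoint_uMap_eq φ fun t => by
      rw [← hΨ, ← hΨ, hyy]
    refine integralPoint_normalization_ext hs (fun r => ?_) (hsy y hy)
    obtain ⟨r, rfl⟩ := Ideal.Quotient.mk_surjective r
    exact (hpt y r).symm.trans ((DFunLike.congr_fun (congrArg MvPolynomial.aeval h1) r).trans
      (hpt y' r))
  · have hO : ∀ r, ψ (algebraMap 𝒪[K] A r) = algebraMap 𝒪[K] M.carrier r := fun r => by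
      refine (hψ.restrict (algebraMap 𝒪[K] _ r)).trans ?_
      rw [IntegralPoint.toField_apply, AlgHom.commutes,
        IsScalarTower.algebraMap_apply 𝒪[K] K M.carrier]
      rfl
    have hψB : ∀ b : QuotientRing 𝒪[K] G A, ψ b = algebraMap 𝒪[K] M.carrier (x.eval b) := fun b => by
      rw [hψ.restrict, IsScalarTower.algebraMap_apply 𝒪[K] K M.carrier]
      rfl
    obtain ⟨c₀, hc₀, hc₀'⟩ := exists_point_of_ringHom φ hO (isIntegral_of_restrict hψ.restrict)
      hψ.smul
    let y₀ : UntwistedRing φ →ₐ[𝒪[K]] 𝒪[K] := Ideal.Quotient.liftₐ _ (MvPolynomial.aeval c₀)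
      fun h hh => aeval_eq_zero_of_mem_closureIdeal φ hc₀' hh
    have hy₀ : ∀ h, y₀ (Ideal.Quotient.mk _ h) = MvPolynomial.aeval c₀ h := fun _ => rfl
    have htr₀ : ∀ b, ∃ h, θ (quotientTrace 𝒪[K] b) = q h ∧
        y₀ (Ideal.Quotient.mk _ h) = x.eval (quotientTrace 𝒪[K] b) := by
      intro b
      obtain ⟨t, h, ht, hh, hb⟩ := exists_trace_eq φ hθ b
      refine ⟨h, hb, M.algebraMap_integer_injective ?_⟩
      rw [hy₀, ← evalPoint_scalarExtension, hh, ← hc₀, ht, hψB]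
    have hy₀s : y₀ s ≠ 0 := by
      intro h0
      have hk : (RingHom.ker y₀).IsPrime := RingHom.ker_isPrime _
      obtain ⟨p, -, hp, hpk⟩ := Ideal.exists_ideal_over_prime_of_isIntegral (RingHom.ker y₀)
        (⊥ : Ideal (Normalization (UntwistedRing φ))) (fun b hb => by
          have : b = 0 := Normalization.algebraMap_injective _ (by rw [map_zero]; exact hb)
          rw [this]; exact zero_mem _)
      have hsp : algebraMap _ _ s ∈ p := by
        have : s ∈ RingHom.ker y₀ := h0
        rwa [← hpk] at this
      obtain ⟨h, hh, hxh⟩ := htr₀ (f * c)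
      have h1 : θ (quotientTrace 𝒪[K] (f * c)) ∈ p := by
        rw [quotientTrace_mul, map_mul]
        exact p.mul_mem_left _ (hc p hp hsp)
      rw [hh, hq] at h1
      have h2 : Ideal.Quotient.mk _ h ∈ RingHom.ker y₀ := by
        rw [← hpk]
        exact h1
      have h3 := hxh.symm.trans h2
      rw [quotientTrace_mul, map_mul] at h3
      exact mul_ne_zero hxf hxc h3
    obtain ⟨y, hy⟩ := exists_integralPoint_normalization hs hy₀s
    have htr₁ : ∀ b, y.eval (θ (quotientTrace 𝒪[K] b)) = x.eval (quotientTrace 𝒪[K] b) := fun b => by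
      obtain ⟨h, hh, hxh⟩ := htr₀ b
      rw [hh]
      exact (hy _).trans hxh
    refine ⟨y, IntegralPoint.ext fun b => ?_, ?_⟩
    · have h1 := htr₁ (f * b)
      rw [quotientTrace_mul, map_mul, map_mul, map_mul, htr₁] at h1
      exact mul_left_cancel₀ hxf h1
    · have h1 : pt y = c₀ := by
        funext j
        exact (hy _).trans ((hy₀ _).trans (MvPolynomial.aeval_X _ _))
      refine RingHom.ext fun a => ?_
      obtain ⟨t, rfl⟩ := i.restrict_surjective a
      rw [hΨ, hc₀, h1]
  · obtain ⟨t, rfl⟩ := i.restrict_surjective a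
    rw [hΨ, hΨ]
    exact evalPoint_sub_evalPoint (fun j => hyy _) _

end TwistedPoints

section Norm

variable {K : Type u} [Field K] [ValuativeRel K] [TopologicalSpace K]
  [IsNonarchimedeanLocalField K] {B N : Type*} [CommRing B] [Algebra 𝒪[K] B] [CommRing N]
  [Algebra 𝒪[K] N] {d : ℕ}

lemma IsVariety.eq_zero_of_algebraMap_mem (hB : IsVariety 𝒪[K] B d) :
    ∀ P ∈ minimalPrimes B, ∀ c : 𝒪[K], algebraMap 𝒪[K] B c ∈ P → c = 0 := by
  intro P hP c hc
  by_contra h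
  have := hB.flat
  refine notMem_minimalPrimes_of_mem_nonZeroDivisors ?_ hP hc
  rw [mem_nonZeroDivisors_iff_right]
  intro x hx
  refine Module.Flat.isSMulRegular_of_nonZeroDivisors (mem_nonZeroDivisors_of_ne_zero h) ?_
  change c • x = c • 0
  rw [smul_zero, Algebra.smul_def, mul_comm, hx]

lemma IsVariety.exists_mem_smoothLocus (hB : IsVariety 𝒪[K] B d) :
    ∃ h ∈ nonZeroDivisors B, ∀ p : PrimeSpectrum B, h ∉ p.asIdeal → p ∈ Algebra.smoothLocus 𝒪[K] B := by
  have := hB.isNoetherianRing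
  have := hB.isReduced
  have hfin : (minimalPrimes B).Finite := minimalPrimes.finite_of_isNoetherianRing B
  obtain ⟨I, hI⟩ := (PrimeSpectrum.isClosed_iff_zeroLocus_ideal _).mp
    hB.isOpen_smoothLocus.isClosed_compl
  have hIU : ∀ p : PrimeSpectrum B, ¬ I ≤ p.asIdeal ↔ p ∈ Algebra.smoothLocus 𝒪[K] B := fun p => by
    rw [← not_iff_not, not_not, ← Set.mem_compl_iff, hI]
    exact Iff.rfl
  have h1 : ¬ (I : Set B) ⊆ ⋃ Q ∈ (hfin.toFinset : Set (Ideal B)), (Q : Set B) := by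
    rw [Ideal.subset_union_prime ⊥ ⊥ fun Q hQ _ _ => (hfin.mem_toFinset.mp hQ).1.1]
    rintro ⟨Q, hQ, hIQ⟩
    have hQ' := hfin.mem_toFinset.mp hQ
    exact (hIU ⟨Q, hQ'.1.1⟩).mpr
      (minimalPrimes_mem_of_dense hB.dense_smoothLocus hB.isOpen_smoothLocus hQ') hIQ
  obtain ⟨h, hhI, hh⟩ := Set.not_subset.mp h1
  refine ⟨h, mem_nonZeroDivisors_of_forall_notMem fun P hP hhP => hh ?_, fun p hp =>
    (hIU p).mp fun hle => hp (hle hhI)⟩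
  exact Set.mem_biUnion (hfin.mem_toFinset.mpr hP) hhP

lemma comap_mem_minimalPrimes [IsNoetherianRing B] [IsReduced B] [IsReduced N] (hBn : IsNormal B)
    {θ : B →ₐ[𝒪[K]] N} (hθ : nonZeroDivisors B ≤ (nonZeroDivisors N).comap θ.toRingHom) {Q : Ideal N}
    (hQ : Q ∈ minimalPrimes N) : Q.comap θ ∈ minimalPrimes B := by
  have hQp : Q.IsPrime := hQ.1.1
  have hp : (Q.comap θ).IsPrime := Ideal.comap_isPrime _ _
  obtain ⟨P, hP, hPQ⟩ := Ideal.exists_minimalPrimes_le (bot_le (a := Q.comap θ))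
  obtain ⟨e, he'⟩ := hBn.exists_idempotent hP
  have he : IsComponentIdempotent P e := he'
  have hPp : P.IsPrime := hP.1.1
  have : P = Q.comap θ := by
    refine le_antisymm hPQ fun x hx => ?_
    by_contra hxP
    refine notMem_minimalPrimes_of_mem_nonZeroDivisors (hθ (he.mem_nonZeroDivisors hxP)) hQ ?_
    exact (Q.comap θ).add_mem (Ideal.mul_mem_right _ _ hx) (hPQ he.1)
  exact this ▸ hP

/-- A generically quasi-finite morphism of varieties of the same dimension maps proper closed
subsets to proper closed subsets. -/
lemma exists_mem_of_mem_prime (hB : IsVariety 𝒪[K] B d) (hBn : IsNormal B)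
    (hN : IsVariety 𝒪[K] N d) {θ : B →ₐ[𝒪[K]] N}
    (hθ : nonZeroDivisors B ≤ (nonZeroDivisors N).comap θ.toRingHom) {b : N}
    (hb : b ∈ nonZeroDivisors N) :
    ∃ c ∈ nonZeroDivisors B, ∀ p : Ideal N, p.IsPrime → b ∈ p → θ c ∈ p := by
  have := hB.isNoetherianRing
  have := hN.isNoetherianRing
  have := hB.isReduced
  have := hN.isReduced
  have hfin : (minimalPrimes N).Finite := minimalPrimes.finite_of_isNoetherianRing N
  have key : ∀ Q ∈ minimalPrimes N, ∃ c ∈ nonZeroDivisors B, θ c ∈ Ideal.span {b} ⊔ Q := by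
    intro Q hQ
    have hQp : Q.IsPrime := hQ.1.1
    have hP := comap_mem_minimalPrimes hBn hθ hQ
    set P := Q.comap θ with hPdef
    have hPp : P.IsPrime := hP.1.1
    obtain ⟨e, he'⟩ := hBn.exists_idempotent hP
    have he : IsComponentIdempotent P e := he'
    let θ' : B ⧸ P →ₐ[𝒪[K]] N ⧸ Q := Ideal.quotientMapₐ Q θ le_rfl
    let _ : Algebra (B ⧸ P) (N ⧸ Q) := θ'.toRingHom.toAlgebra
    have hst : IsScalarTower 𝒪[K] (B ⧸ P) (N ⧸ Q) :=
      IsScalarTower.of_algebraMap_eq fun c => (θ'.commutes c).symm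
    have hinj : Function.Injective (algebraMap (B ⧸ P) (N ⧸ Q)) :=
      Ideal.quotientMap_injective
    have hfaith : FaithfulSMul (B ⧸ P) (N ⧸ Q) :=
      (faithfulSMul_iff_algebraMap_injective _ _).mpr hinj
    have halg : Algebra.IsAlgebraic (B ⧸ P) (N ⧸ Q) := by
      have hf : FaithfulSMul 𝒪[K] (B ⧸ P) := by
        rw [faithfulSMul_iff_algebraMap_injective, injective_iff_map_eq_zero]
        intro c hc
        exact hB.eq_zero_of_algebraMap_mem P hP c (Ideal.Quotient.eq_zero_iff_mem.mp hc)
      rw [← trdeg_eq_zero_iff]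
      have h1 := lift_trdeg_add_eq 𝒪[K] (B ⧸ P) (N ⧸ Q)
      rw [hB.trdeg_eq P hP, hN.trdeg_eq Q hQ] at h1
      simp only [Cardinal.lift_natCast] at h1
      rw [← Cardinal.lift_eq_zero]
      exact Cardinal.eq_of_add_eq_add_left (h1.trans (add_zero _).symm) Cardinal.natCast_lt_aleph0
    have hbQ : Ideal.Quotient.mk Q b ≠ 0 := fun h =>
      notMem_minimalPrimes_of_mem_nonZeroDivisors hb hQ (Ideal.Quotient.eq_zero_iff_mem.mp h)
    obtain ⟨c, hc, hcb⟩ := (halg.isAlgebraic (Ideal.Quotient.mk Q b)).exists_nonzero_dvd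
      (mem_nonZeroDivisors_of_ne_zero hbQ)
    obtain ⟨c, rfl⟩ := Ideal.Quotient.mk_surjective c
    have hcP : c ∉ P := fun h => hc (Ideal.Quotient.eq_zero_iff_mem.mpr h)
    obtain ⟨t, ht⟩ := hcb
    obtain ⟨t, rfl⟩ := Ideal.Quotient.mk_surjective t
    have h2 : θ c - b * t ∈ Q := by
      rw [← Ideal.Quotient.eq_zero_iff_mem, map_sub, map_mul, sub_eq_zero]
      exact ht
    refine ⟨_, he.mem_nonZeroDivisors hcP, ?_⟩
    rw [map_add, map_mul]
    refine Ideal.add_mem _ (Ideal.mul_mem_right _ _ ?_) (Ideal.mem_sup_right he.1)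
    rw [← sub_add_cancel (θ c) (b * t)]
    exact Ideal.add_mem _ (Ideal.mem_sup_right h2) (Ideal.mem_sup_left
      (Ideal.mul_mem_right _ _ (Ideal.mem_span_singleton_self b)))
  choose! c hc hcb using key
  refine ⟨∏ Q ∈ hfin.toFinset, c Q, Submonoid.prod_mem _ fun Q hQ => hc Q (hfin.mem_toFinset.mp hQ),
    fun p hp hbp => ?_⟩
  obtain ⟨Q, hQ, hQp⟩ := Ideal.exists_minimalPrimes_le (bot_le (a := p))
  rw [map_prod]
  exact (Ideal.IsPrime.prod_mem_iff (hp := hp)).mpr ⟨Q, hfin.mem_toFinset.mpr hQ,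
    (sup_le ((Ideal.span_singleton_le_iff_mem _).mpr hbp) hQp) (hcb Q hQ)⟩

end Norm

section Fibres

/-- Going up for an injective integral homomorphism. -/
lemma exists_le_comap_eq {R S : Type*} [CommRing R] [CommRing S] {β : R →+* S}
    (hβ : Function.Injective β) (hint : β.IsIntegral) {x y : PrimeSpectrum R} (hxy : x ≤ y) :
    ∃ q p : PrimeSpectrum S, q ≤ p ∧ PrimeSpectrum.comap β q = x ∧ PrimeSpectrum.comap β p = y := by
  let _ : Algebra R S := β.toAlgebra
  have : Algebra.IsIntegral R S := ⟨hint⟩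
  obtain ⟨q, -, hq, hqx⟩ := Ideal.exists_ideal_over_prime_of_isIntegral x.asIdeal (⊥ : Ideal S)
    (fun b hb => by
      have : b = 0 := hβ (by rw [map_zero]; exact hb)
      rw [this]
      exact zero_mem _)
  obtain ⟨p, hqp, hp, hpy⟩ := Ideal.exists_ideal_over_prime_of_isIntegral y.asIdeal q
    (hqx.le.trans hxy)
  exact ⟨⟨q, hq⟩, ⟨p, hp⟩, hqp, PrimeSpectrum.ext hqx, PrimeSpectrum.ext hpy⟩

variable {O G A : Type*} [CommRing O] [CommRing A] [Algebra O A] [Group G] [Finite G]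
  [MulSemiringAction G A] [SMulCommClass G O A]

lemma isIntegral_val_quotientRing : (QuotientRing O G A).val.toRingHom.IsIntegral := fun a =>
  (isIntegral_quotientRing (O := O) (G := G)).isIntegral a

lemma exists_isTranslate_of_comap_eq {p q : PrimeSpectrum A}
    (h : PrimeSpectrum.comap (QuotientRing O G A).val.toRingHom p =
      PrimeSpectrum.comap (QuotientRing O G A).val.toRingHom q) : ∃ g : G, IsTranslate g p q := by
  have : Algebra.IsInvariant (QuotientRing O G A) A G := ⟨fun b hb => ⟨⟨b, hb⟩, rfl⟩⟩
  have : SMulCommClass G (QuotientRing O G A) A := ⟨fun g b a => by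
    rw [Algebra.smul_def, Algebra.smul_def, smul_mul']
    congr 1
    exact b.2 g⟩
  obtain ⟨g, hg⟩ := Algebra.IsInvariant.exists_smul_of_under_eq (QuotientRing O G A) A G
    p.asIdeal q.asIdeal (congrArg PrimeSpectrum.asIdeal h)
  exact ⟨g, fun a => by rw [hg]; exact (Ideal.smul_mem_pointwise_smul_iff).symm⟩

lemma mem_image_comap_iff {T N : Type*} [CommRing T] [CommRing N] {α : A →+* T} {β : N →+* T}
    {θ : QuotientRing O G A →+* N} (hθ : ∀ b, β (θ b) = α b) (hβ : Function.Injective β)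
    (hint : β.IsIntegral) {C : Set (PrimeSpectrum A)} (hC : IsStableSet G C) (y : PrimeSpectrum N) :
    y ∈ PrimeSpectrum.comap β '' (PrimeSpectrum.comap α ⁻¹' C) ↔
      PrimeSpectrum.comap θ y ∈ PrimeSpectrum.comap (QuotientRing O G A).val.toRingHom '' C := by
  have hcomp : ∀ t : PrimeSpectrum T, PrimeSpectrum.comap θ (PrimeSpectrum.comap β t) =
      PrimeSpectrum.comap (QuotientRing O G A).val.toRingHom (PrimeSpectrum.comap α t) := fun t =>
    PrimeSpectrum.ext (Ideal.ext fun b => by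
      change β (θ b) ∈ t.asIdeal ↔ α b ∈ t.asIdeal
      rw [hθ])
  constructor
  · rintro ⟨t, ht, rfl⟩
    exact ⟨_, ht, (hcomp t).symm⟩
  · rintro ⟨c, hc, hcy⟩
    obtain ⟨-, t, -, -, ht⟩ := exists_le_comap_eq hβ hint (le_refl y)
    rw [← ht, hcomp] at hcy
    obtain ⟨g, hg⟩ := exists_isTranslate_of_comap_eq hcy
    exact ⟨t, hC g _ _ hg hc, ht⟩

end Fibres

section EvenCoverings

variable {K : Type u} [Field K] [ValuativeRel K] [TopologicalSpace K]
  [IsNonarchimedeanLocalField K]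

/-- A locally injective continuous map of compact spaces is an even covering where its fibres
have constant cardinality. -/
lemma exists_even_cover {B : Type v} {N : Type w} [CommRing B] [Algebra 𝒪[K] B] [CommRing N]
    [Algebra 𝒪[K] N] [Algebra.FiniteType 𝒪[K] B] [Algebra.FiniteType 𝒪[K] N] {θ : B →ₐ[𝒪[K]] N}
    {S : Set (IntegralPoint K B)} (hS : IsOpen S) {x : IntegralPoint K B} (hx : x ∈ S) {m : ℕ}
    (hm : m ≠ 0) (hcard : ∀ x ∈ S, Nat.card {y : IntegralPoint K N // y.map θ = x} = m)
    {O : IntegralPoint K N → Set (IntegralPoint K N)} (hO : ∀ y, y.map θ = x → O y ∈ nhds y)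
    (hinj : ∀ y, y.map θ = x → (O y).InjOn (IntegralPoint.map θ)) :
    ∃ (U : Set (IntegralPoint K B)) (V : Fin m → Set (IntegralPoint K N)),
      IsClopen U ∧ x ∈ U ∧ U ⊆ S ∧ Pairwise (Function.onFun Disjoint V) ∧
      ⋃ j, V j = IntegralPoint.map θ ⁻¹' U ∧ ∀ j, IsClopen (V j) ∧
        (∃ y, y.map θ = x ∧ V j ⊆ O y) ∧ IntegralPoint.map θ '' V j = U := by
  have hcx := hcard x hx
  have hfin : Finite {y : IntegralPoint K N // y.map θ = x} :=
    Nat.finite_of_card_ne_zero (hcx ▸ hm)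
  let e := (Finite.equivFinOfCardEq hcx).symm
  obtain ⟨T, hT, hTd⟩ := Set.Finite.t2_separation
    (s := {y : IntegralPoint K N | y.map θ = x}) (Set.finite_coe_iff.mp hfin)
  have hk : ∀ j : Fin m, ∃ k, (e j).1.ball k ⊆ T (e j).1 ∩ O (e j).1 := fun j =>
    IntegralPoint.exists_ball_subset
      (Filter.inter_mem ((hT _).2.mem_nhds (hT _).1) (hO _ (e j).2))
  choose k hk using hk
  let W : Fin m → Set (IntegralPoint K N) := fun j => (e j).1.ball (k j)
  have hW : ∀ j, IsClopen (W j) := fun j => IntegralPoint.isClopen_ball _ _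
  have hWd : Pairwise (Function.onFun Disjoint W) := fun j j' hjj =>
    (hTd (e j).2 (e j').2 fun h => hjj (e.injective (Subtype.ext h))).mono
      ((hk j).trans Set.inter_subset_left) ((hk j').trans Set.inter_subset_left)
  have hF : IsClosed (⋃ j, W j)ᶜ := (isOpen_iUnion fun j => (hW j).2).isClosed_compl
  have hπF := (hF.isCompact.image (IntegralPoint.continuous_map θ)).isClosed
  have hxF : x ∉ IntegralPoint.map θ '' (⋃ j, W j)ᶜ := by
    rintro ⟨y, hy, hyx⟩
    refine hy (Set.mem_iUnion.mpr ⟨e.symm ⟨y, hyx⟩, ?_⟩)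
    change y ∈ (e (e.symm ⟨y, hyx⟩)).1.ball _
    rw [Equiv.apply_symm_apply]
    exact IntegralPoint.mem_ball_self y _
  obtain ⟨l, hl⟩ := IntegralPoint.exists_ball_subset
    ((hS.inter hπF.isOpen_compl).mem_nhds ⟨hx, hxF⟩)
  have hU := IntegralPoint.isClopen_ball x l
  have hWi : ∀ j, (W j).InjOn (IntegralPoint.map θ) := fun j =>
    (hinj _ (e j).2).mono ((hk j).trans Set.inter_subset_right)
  have hcov : ∀ y : IntegralPoint K N, y.map θ ∈ x.ball l → ∃ j, y ∈ W j := by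
    intro y hy
    by_contra hne
    exact (hl hy).2 ⟨y, fun h => hne (Set.mem_iUnion.mp h), rfl⟩
  refine ⟨x.ball l, fun j => W j ∩ IntegralPoint.map θ ⁻¹' x.ball l, hU,
    IntegralPoint.mem_ball_self x l, hl.trans Set.inter_subset_left, fun j j' hjj =>
      (hWd hjj).mono Set.inter_subset_left Set.inter_subset_left, ?_, fun j =>
      ⟨(hW j).inter (hU.preimage (IntegralPoint.continuous_map θ)), ⟨_, (e j).2,
        Set.inter_subset_left.trans ((hk j).trans Set.inter_subset_right)⟩, ?_⟩⟩
  · rw [← Set.iUnion_inter]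
    exact Set.inter_eq_right.mpr fun y hy => Set.mem_iUnion.mpr (hcov y hy)
  · refine Set.Subset.antisymm (Set.image_subset_iff.mpr Set.inter_subset_right) fun z hz => ?_
    choose c hc using fun y : {y : IntegralPoint K N // y.map θ = z} => hcov y.1 (y.2.symm ▸ hz)
    have hci : Function.Injective c := fun y y' hyy => Subtype.ext
      (hWi (c y) (hc y) (hyy ▸ hc y') (y.2.trans y'.2.symm))
    have hcb := hci.bijective_of_nat_card_le (by
      rw [hcard z (hl hz).1, Nat.card_eq_fintype_card, Fintype.card_fin])
    obtain ⟨y, rfl⟩ := hcb.2 j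
    exact ⟨y.1, ⟨hc y, by rwa [Set.mem_preimage, y.2]⟩, y.2⟩

variable [MeasurableSpace K] [BorelSpace K]

section Partition

variable {A : Type v} [CommRing A] [Algebra 𝒪[K] A] {d : ℕ} {D : QDivisor A}

lemma isChartOn_empty (r : ℕ) : IsChartOn D r (0 : Fin d → A) 0 1 (∅ : Set (IntegralPoint K A)) where
  isClopen := isClopen_empty
  injOn := Set.injOn_empty _
  etale _ h := h.elim
  isLocalGenerator _ h := h.elim

/-- The stringy measure is additive up to the zeros of countably many functions. -/
lemma stringyMeasure_eq_tsum_stringyMeasure (hD : IsLogPair 𝒪[K] d D) {S : Set (IntegralPoint K A)}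
    {ι : Type*} {T : ι → Set (IntegralPoint K A)} (hT : ∀ i, IsOpen (T i)) (hTS : ∀ i, T i ⊆ S)
    (hdisj : Pairwise (Function.onFun Disjoint T)) {κ : Type*} [Countable κ] {h : κ → A}
    (hh : ∀ j, ∀ Q ∈ minimalPrimes A, h j ∉ Q)
    (hcov : ∀ x ∈ S, (∃ i, x ∈ T i) ∨ ∃ j, x.eval (h j) = 0) :
    stringyMeasure K d D S = ∑' i, stringyMeasure K d D (T i) := by
  have hA := hD.isVariety
  have := hA.finiteType
  obtain ⟨r, hr⟩ := hD.qCartier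
  obtain ⟨c, hc, hcs⟩ := hA.exists_mem_smoothLocus
  have hc' : ∀ Q ∈ minimalPrimes A, c ∉ Q := fun Q hQ =>
    notMem_minimalPrimes_of_mem_nonZeroDivisors hc hQ
  have key : ∀ i, ∃ (W : ℕ → Set (IntegralPoint K A)) (f : ℕ → Fin d → A) (num : ℕ → A)
      (den : ℕ → nonZeroDivisors A), (∀ l, IsChartOn D r (f l) (num l) (den l) (W l)) ∧
      Pairwise (Function.onFun Disjoint W) ∧ ⋃ l, W l = T i ∩ {x | x.eval c ≠ 0} := by
    intro i
    obtain ⟨W, hW, hWd, hWT⟩ := exists_clopen_partition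
      (P := fun U => ∃ (f : Fin d → A) (num : A) (den : nonZeroDivisors A), IsChartOn D r f num den U)
      (S := T i ∩ {x : IntegralPoint K A | x.eval c ≠ 0}) ⟨_, _, _, isChartOn_empty r⟩
      (fun U V hV hVU ⟨f, num, den, h⟩ => ⟨f, num, den, h.mono hV hVU⟩) fun x hx => by
        obtain ⟨f, num, den, U, hxU, hU⟩ := exists_isChartOn hA hD.isNormal hr (hcs x.generic hx.2)
        obtain ⟨k, hk⟩ := IntegralPoint.exists_ball_subset
          ((hU.isClopen.2.inter ((hT i).inter (IntegralPoint.isOpen_eval_ne_zero c))).mem_nhds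
            ⟨hxU, hx⟩)
        exact ⟨_, IntegralPoint.isClopen_ball x k, IntegralPoint.mem_ball_self x k,
          hk.trans Set.inter_subset_right, f, num, den, hU.mono (IntegralPoint.isClopen_ball x k)
            (hk.trans Set.inter_subset_left)⟩
    choose f num den h using fun l => (hW l).2
    exact ⟨W, f, num, den, h, hWd, hWT⟩
  choose W f num den hW hWd hWT using key
  have hWi : ∀ i l, W i l ⊆ T i := fun i l =>
    (Set.subset_iUnion (W i) l).trans ((hWT i).le.trans Set.inter_subset_left)
  have hmem : ∀ i, ∀ x ∈ T i, x.eval c ≠ 0 → ∃ l, x ∈ W i l := fun i x hx hxc =>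
    Set.mem_iUnion.mp (hWT i ▸ ⟨hx, hxc⟩)
  have h1 : ∀ i, stringyMeasure K d D (T i) =
      ∑' l, vol (coordK (f i l)) (density r (num i l) (den i l)) (W i l) := fun i =>
    stringyMeasure_eq_tsum hA hD.isNormal hr (hW i) (hWi i) (hWd i) (fun _ : Unit => c)
      (fun _ => hc') fun x hx => by
        by_cases hxc : x.eval c = 0
        · exact .inr ⟨(), hxc⟩
        · exact .inl (hmem i x hx hxc)
  rw [tsum_congr h1, ← ENNReal.tsum_sigma' (fun p : (_ : ι) × ℕ =>
    vol (coordK (f p.1 p.2)) (density r (num p.1 p.2) (den p.1 p.2)) (W p.1 p.2))]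
  refine stringyMeasure_eq_tsum hA hD.isNormal hr (W := fun p : (_ : ι) × ℕ => W p.1 p.2)
    (fun p => hW p.1 p.2) (fun p => (hWi p.1 p.2).trans (hTS p.1)) ?_
    (fun o : Option κ => o.elim c h) ?_ ?_
  · rintro ⟨i, l⟩ ⟨i', l'⟩ hne
    by_cases hii : i = i'
    · subst hii
      exact hWd i fun hl => hne (Sigma.ext rfl (heq_of_eq hl))
    · exact (hdisj hii).mono (hWi i l) (hWi i' l')
  · rintro (_ | j)
    · exact hc'
    · exact hh j
  · intro x hx
    by_cases hxc : x.eval c = 0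
    · exact .inr ⟨none, hxc⟩
    rcases hcov x hx with ⟨i, hi⟩ | ⟨j, hj⟩
    · obtain ⟨l, hl⟩ := hmem i x hi hxc
      exact .inl ⟨⟨i, l⟩, hl⟩
    · exact .inr ⟨some j, hj⟩

end Partition

/-- The stringy measure of the preimage under a morphism that is crepant in the sense of a
roof and has fibres with `m` points. -/
theorem stringyMeasure_preimage {B : Type v} {N : Type w} {T : Type*} [CommRing B] [Algebra 𝒪[K] B]
    [CommRing N] [Algebra 𝒪[K] N] [CommRing T] [Algebra 𝒪[K] T] {d : ℕ} {D : QDivisor B}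
    {D' : QDivisor N} {D'' : QDivisor T} (hD : IsLogPair 𝒪[K] d D) (hD' : IsLogPair 𝒪[K] d D')
    (hD'' : IsLogPair 𝒪[K] d D'') {θ : B →ₐ[𝒪[K]] N} {β : N →ₐ[𝒪[K]] T} {r : ℕ}
    (hr : IsCartierIndex 𝒪[K] d r D) (hr' : IsCartierIndex 𝒪[K] d r D')
    (hα : PullsBackGenerators d (β.comp θ) D D'' r) (hβ : PullsBackGenerators d β D' D'' r)
    (hθ : nonZeroDivisors B ≤ (nonZeroDivisors N).comap θ.toRingHom)
    (hinj : Function.Injective β) (hint : β.toRingHom.IsIntegral) {S : Set (IntegralPoint K B)}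
    (hS : IsOpen S) {c : B} (hc : c ∈ nonZeroDivisors B) {m : ℕ} (hm : m ≠ 0)
    (hcard : ∀ x ∈ S, x.eval c ≠ 0 → Nat.card {y : IntegralPoint K N // y.map θ = x} = m)
    (hloc : ∀ y : IntegralPoint K N, y.map θ ∈ S → (y.map θ).eval c ≠ 0 →
      ∃ O ∈ nhds y, O.InjOn (IntegralPoint.map θ)) :
    stringyMeasure K d D' (IntegralPoint.map θ ⁻¹' S) = m * stringyMeasure K d D S := by
  have hB := hD.isVariety
  have hN := hD'.isVariety
  have := hB.finiteType
  have := hN.finiteType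
  obtain ⟨c₁, hc₁, hcs₁⟩ := hB.exists_mem_smoothLocus
  obtain ⟨c₂, hc₂, hcs₂⟩ := hN.exists_mem_smoothLocus
  obtain ⟨c₃, hc₃, hcs₃⟩ := exists_mem_of_mem_prime hB hD.isNormal hN hθ hc₂
  have hc' : c * (c₁ * c₃) ∈ nonZeroDivisors B := mul_mem hc (mul_mem hc₁ hc₃)
  set c' := c * (c₁ * c₃) with hcdef
  have hne : ∀ x : IntegralPoint K B, x.eval c' ≠ 0 →
      x.eval c ≠ 0 ∧ x.eval c₁ ≠ 0 ∧ x.eval c₃ ≠ 0 := fun x hx => by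
    rw [hcdef, map_mul, map_mul] at hx
    exact ⟨left_ne_zero_of_mul hx, left_ne_zero_of_mul (right_ne_zero_of_mul hx),
      right_ne_zero_of_mul (right_ne_zero_of_mul hx)⟩
  have hsm : ∀ y : IntegralPoint K N, (y.map θ).eval c' ≠ 0 →
      y.generic ∈ Algebra.smoothLocus 𝒪[K] N := fun y hy =>
    hcs₂ _ fun h => (hne _ hy).2.2 (hcs₃ y.generic.asIdeal y.generic.2 h)
  have hover : ∀ y : IntegralPoint K N, ∃ q p : PrimeSpectrum T, q ≤ p ∧
      PrimeSpectrum.comap β.toRingHom q = y.generic ∧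
      PrimeSpectrum.comap β.toRingHom p = y.special := fun y =>
    exists_le_comap_eq hinj hint y.generic_le_special
  have hnorm : ∀ b ∈ nonZeroDivisors N, ∃ c ∈ nonZeroDivisors B, ∀ y : IntegralPoint K N,
      y.eval b = 0 → y.eval (θ c) = 0 := fun b hb => by
    obtain ⟨c, hc, h⟩ := exists_mem_of_mem_prime hB hD.isNormal hN hθ hb
    exact ⟨c, hc, fun y hy => h y.generic.asIdeal y.generic.2 hy⟩
  obtain ⟨W, hW, hWd, hWS⟩ := exists_clopen_partition
    (P := fun U => ∃ (f : Fin d → B) (num : B) (den : nonZeroDivisors B)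
      (V : Fin m → Set (IntegralPoint K N)) (f' : Fin m → Fin d → N) (num' : Fin m → N)
      (den' : Fin m → nonZeroDivisors N), IsChartOn D r f num den U ∧
      Pairwise (Function.onFun Disjoint V) ∧ ⋃ j, V j = IntegralPoint.map θ ⁻¹' U ∧
      ∀ j, IsChartOn D' r (f' j) (num' j) (den' j) (V j) ∧
        (V j).InjOn (IntegralPoint.map θ) ∧ IntegralPoint.map θ '' V j = U)
    (S := S ∩ {x : IntegralPoint K B | x.eval c' ≠ 0})
    ⟨_, _, _, fun _ => ∅, fun _ => 0, fun _ => 0, fun _ => 1, isChartOn_empty r,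
      fun _ _ _ => Set.disjoint_empty _, by simp, fun _ => ⟨isChartOn_empty r, Set.injOn_empty _,
        Set.image_empty _⟩⟩
    (fun U U' hU' hUU' ⟨f, num, den, V, f', num', den', h, hVd, hVU, hV⟩ =>
      ⟨f, num, den, fun j => V j ∩ IntegralPoint.map θ ⁻¹' U', f', num', den', h.mono hU' hUU',
        fun j j' hjj => (hVd hjj).mono Set.inter_subset_left Set.inter_subset_left, by
          rw [← Set.iUnion_inter, hVU]
          exact Set.inter_eq_right.mpr (Set.preimage_mono hUU'), fun j =>
        ⟨(hV j).1.mono ((hV j).1.isClopen.inter (hU'.preimage (IntegralPoint.continuous_map θ)))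
          Set.inter_subset_left, (hV j).2.1.mono Set.inter_subset_left, by
          rw [Set.image_inter_preimage, (hV j).2.2]
          exact Set.inter_eq_right.mpr hUU'⟩⟩)
    fun x hx => by
      obtain ⟨f, num, den, U₁, hxU₁, hU₁⟩ := exists_isChartOn hB hD.isNormal hr
        (hcs₁ x.generic (hne x hx.2).2.1)
      have hO : ∀ y : IntegralPoint K N, ∃ O : Set (IntegralPoint K N), y.map θ = x →
          O ∈ nhds y ∧ O.InjOn (IntegralPoint.map θ) ∧
            ∃ (f' : Fin d → N) (num' : N) (den' : nonZeroDivisors N),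
              IsChartOn D' r f' num' den' O := by
        intro y
        by_cases hy : y.map θ = x
        · obtain ⟨f', num', den', U₂, hyU₂, hU₂⟩ := exists_isChartOn hN hD'.isNormal hr'
            (hsm y (hy ▸ hx.2))
          obtain ⟨O, hO, hOi⟩ := hloc y (hy ▸ hx.1) (hy ▸ (hne x hx.2).1)
          obtain ⟨k, hk⟩ := IntegralPoint.exists_ball_subset
            (Filter.inter_mem hO (hU₂.isClopen.2.mem_nhds hyU₂))
          exact ⟨y.ball k, fun _ => ⟨(IntegralPoint.isOpen_ball y k).mem_nhds
            (IntegralPoint.mem_ball_self y k), hOi.mono (hk.trans Set.inter_subset_left),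
            f', num', den', hU₂.mono (IntegralPoint.isClopen_ball y k)
              (hk.trans Set.inter_subset_right)⟩⟩
        · exact ⟨∅, fun h => (hy h).elim⟩
      choose O hO using hO
      obtain ⟨U, V, hU, hxU, hUS, hVd, hVU, hV⟩ := exists_even_cover (θ := θ)
        (S := U₁ ∩ (S ∩ {x : IntegralPoint K B | x.eval c' ≠ 0}))
        (hU₁.isClopen.2.inter (hS.inter (IntegralPoint.isOpen_eval_ne_zero c'))) ⟨hxU₁, hx⟩ hm
        (fun z hz => hcard z hz.2.1 (hne z hz.2.2).1) (fun y hy => (hO y hy).1)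
        (fun y hy => (hO y hy).2.1)
      have hV' : ∀ j, ∃ (f' : Fin d → N) (num' : N) (den' : nonZeroDivisors N),
          IsChartOn D' r f' num' den' (V j) ∧ (V j).InjOn (IntegralPoint.map θ) := by
        intro j
        obtain ⟨hVc, ⟨y, hy, hVO⟩, -⟩ := hV j
        obtain ⟨-, hi, f', num', den', h⟩ := hO y hy
        exact ⟨f', num', den', h.mono hVc hVO, hi.mono hVO⟩
      choose f' num' den' hV' using hV'
      exact ⟨U, hU, hxU, hUS.trans Set.inter_subset_right, f, num, den, V, f', num', den',
        hU₁.mono hU (hUS.trans Set.inter_subset_left), hVd, hVU, fun j =>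
          ⟨(hV' j).1, (hV' j).2, (hV j).2.2⟩⟩
  choose f num den V f' num' den' hWc hVd hVW hV using fun l => (hW l).2
  have hWS' : ∀ l, W l ⊆ S := fun l =>
    (Set.subset_iUnion W l).trans (hWS.le.trans Set.inter_subset_left)
  have hVl : ∀ l j, V l j ⊆ IntegralPoint.map θ ⁻¹' W l := fun l j =>
    (Set.subset_iUnion (V l) j).trans (hVW l).le
  rw [stringyMeasure_eq_tsum hB hD.isNormal hr hWc hWS' hWd (fun _ : Unit => c')
      (fun _ _ hQ => notMem_minimalPrimes_of_mem_nonZeroDivisors hc' hQ) fun x hx => ?_,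
    stringyMeasure_eq_tsum hN hD'.isNormal hr' (W := fun p : (_ : ℕ) × Fin m => V p.1 p.2)
      (fun p => (hV p.1 p.2).1) (fun p => (hVl p.1 p.2).trans (Set.preimage_mono (hWS' p.1)))
      ?_ (fun _ : Unit => θ c')
      (fun _ _ hQ => notMem_minimalPrimes_of_mem_nonZeroDivisors (hθ hc') hQ) fun y hy => ?_]
  · rw [ENNReal.tsum_sigma', ← ENNReal.tsum_mul_left]
    refine tsum_congr fun l => ?_
    have h1 : ∀ j, vol (coordK (f' l j)) (density r (num' l j) (den' l j)) (V l j) =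
        vol (coordK (f l)) (density r (num l) (den l)) (W l) := fun j => by
      have h2 := vol_eq_of_pullsBackGenerators hB hD.isNormal hN hD'.isNormal hD''.isVariety
        hD''.isNormal hr.pos hα hβ hθ hover hnorm (hV l j).2.1 ((hV l j).2.2.symm ▸ hWc l)
        (hV l j).1
      rw [← h2, (hV l j).2.2]
    rw [tsum_congr h1]
    simp
  · rintro ⟨l, j⟩ ⟨l', j'⟩ hne
    by_cases hll : l = l'
    · subst hll
      exact hVd l fun hj => hne (Sigma.ext rfl (heq_of_eq hj))
    · exact ((hWd hll).preimage (IntegralPoint.map θ)).mono (hVl l j) (hVl l' j')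
  · by_cases hyc : y.eval (θ c') = 0
    · exact .inr ⟨(), hyc⟩
    have h1 : y.map θ ∈ ⋃ l, W l := hWS ▸ ⟨hy, hyc⟩
    obtain ⟨l, hl⟩ := Set.mem_iUnion.mp h1
    have h2 : y ∈ ⋃ j, V l j := hVW l ▸ hl
    obtain ⟨j, hj⟩ := Set.mem_iUnion.mp h2
    exact .inl ⟨⟨l, j⟩, hj⟩
  · by_cases hxc : x.eval c' = 0
    · exact .inr ⟨(), hxc⟩
    · exact .inl (Set.mem_iUnion.mp (hWS ▸ ⟨hx, hxc⟩))

end EvenCoverings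

section Quotient

variable {K : Type u} [Field K] [ValuativeRel K] [TopologicalSpace K]
  [IsNonarchimedeanLocalField K] {G : Type w} [Group G] [Fintype G] [DecidableEq G] {A : Type v}
  [CommRing A] [Algebra 𝒪[K] A] [MulSemiringAction G A] [SMulCommClass G 𝒪[K] A]

/-- The points of the quotient, outside the zeros of the discriminant of `a`, whose fibre in
`Spec A` is the torsor given by `M`. -/
def twistedLocus (M : GEtaleAlgebra K G) (a : A) :
    Set (IntegralPoint K (QuotientRing 𝒪[K] G A)) :=
  {x | x.eval (invariantDisc 𝒪[K] G a) ≠ 0 ∧ ∃ ψ : A →+* M.carrier, IsTwisted x.toField M ψ}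

lemma isOpen_twistedLocus [Algebra.FiniteType 𝒪[K] A]
    [Algebra.FiniteType 𝒪[K] (QuotientRing 𝒪[K] G A)] (M : GEtaleAlgebra K G) (a : A) :
    IsOpen (twistedLocus M a) := by
  rw [isOpen_iff_forall_mem_open]
  rintro x ⟨hx, ψ, hψ⟩
  obtain ⟨k, hk⟩ := hψ.exists_of_mem_ball hx
  obtain ⟨l, hl⟩ := IntegralPoint.exists_ball_subset
    ((IntegralPoint.isOpen_eval_ne_zero (invariantDisc 𝒪[K] G a)).mem_nhds hx)
  exact ⟨x.ball k ∩ x.ball l, fun z hz => ⟨hl hz.2, hk z hz.1⟩,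
    (IntegralPoint.isOpen_ball x k).inter (IntegralPoint.isOpen_ball x l),
    IntegralPoint.mem_ball_self x k, IntegralPoint.mem_ball_self x l⟩

omit [Fintype G] [DecidableEq G] [TopologicalSpace K] [IsNonarchimedeanLocalField K] in
lemma mem_nonZeroDivisors_of_val {b : QuotientRing 𝒪[K] G A} (hb : (b : A) ∈ nonZeroDivisors A) :
    b ∈ nonZeroDivisors (QuotientRing 𝒪[K] G A) := by
  rw [mem_nonZeroDivisors_iff_right] at hb ⊢
  exact fun x hx => Subtype.ext (hb x (congrArg Subtype.val hx))

/-- Equivariant morphisms over close points of the quotient that are close are equal. -/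
lemma exists_nhds_injOn {N : Type*} [CommRing N] [Algebra 𝒪[K] N] [Algebra.FiniteType 𝒪[K] N]
    {θ : QuotientRing 𝒪[K] G A →ₐ[𝒪[K]] N} {M : GEtaleAlgebra K G}
    {Ψ : IntegralPoint K N → (A →+* M.carrier)} {a : A} {S : Set (IntegralPoint K N)}
    (h₁ : ∀ y ∈ S, IsTwisted (y.map θ).toField M (Ψ y))
    (h₂ : ∀ y ∈ S, ∀ y' ∈ S, Ψ y = Ψ y' → y = y')
    (h₄ : ∀ (e : 𝒪[K]) y y', (∀ b, e ∣ y'.eval b - y.eval b) → ∃ v : M.carrier,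
      IsIntegral 𝒪[K] v ∧ Ψ y' a - Ψ y a = algebraMap 𝒪[K] M.carrier e * v)
    (hS : IsOpen S) {y : IntegralPoint K N} (hy : y ∈ S)
    (hδ : (y.map θ).eval (invariantDisc 𝒪[K] G a) ≠ 0) :
    ∃ O ∈ nhds y, O.InjOn (IntegralPoint.map θ) := by
  obtain ⟨ϖ, hϖ⟩ := IsDiscreteValuationRing.exists_irreducible 𝒪[K]
  obtain ⟨m, u, hu⟩ := IsDiscreteValuationRing.eq_unit_mul_pow_irreducible hδ hϖ
  obtain ⟨l, hl⟩ := IntegralPoint.exists_ball_subset (hS.mem_nhds hy)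
  refine ⟨y.ball (m + 1) ∩ y.ball l, Filter.inter_mem
    ((IntegralPoint.isOpen_ball y _).mem_nhds (IntegralPoint.mem_ball_self y _))
    ((IntegralPoint.isOpen_ball y _).mem_nhds (IntegralPoint.mem_ball_self y _)), ?_⟩
  rintro y₁ ⟨hy₁, hyl₁⟩ y₂ ⟨hy₂, hyl₂⟩ hyy
  have hyS₁ := hl hyl₁
  have hyS₂ := hl hyl₂
  obtain ⟨t, ht⟩ := (mem_maximalIdeal_pow hϖ).mp (hy₁ (θ (invariantDisc 𝒪[K] G a)))
  have hunit : IsUnit ((u : 𝒪[K]) + ϖ * t) := by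
    by_contra hne
    have h1 : (u : 𝒪[K]) + ϖ * t ∈ 𝓂[K] := hne
    have h2 : ϖ * t ∈ 𝓂[K] := Ideal.mul_mem_right _ _ hϖ.not_isUnit
    exact ((Submodule.add_mem_iff_left _ h2).mp h1) u.isUnit
  obtain ⟨u', hu'⟩ := hunit
  have hδ₁ : (y₁.map θ).eval (invariantDisc 𝒪[K] G a) = u' * ϖ ^ m := by
    rw [hu']
    have h1 : y₁.eval (θ (invariantDisc 𝒪[K] G a)) = _ := sub_eq_iff_eq_add.mp ht
    have h2 : y.eval (θ (invariantDisc 𝒪[K] G a)) = _ := hu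
    rw [IntegralPoint.eval_map, h1, h2]
    ring
  have hdiv : ∀ b, (y₁.map θ).eval (invariantDisc 𝒪[K] G a) * ϖ ∣ y₂.eval b - y₁.eval b := by
    intro b
    rw [hδ₁, mul_assoc, ← pow_succ, Units.mul_left_dvd, ← mem_maximalIdeal_pow hϖ, ← sub_sub_sub_cancel_right _ _ (y.eval b)]
    exact sub_mem (hy₂ b) (hy₁ b)
  obtain ⟨v, hv, hvv⟩ := h₄ _ y₁ y₂ hdiv
  refine h₂ _ hyS₁ _ hyS₂ (ringHom_eq_of_close (x := y₁.map θ) (a := a) ?_ (h₁ y₁ hyS₁).restrict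
    ?_ (c := ϖ) hϖ.not_isUnit hv hvv).symm
  · rw [hδ₁]
    exact mul_ne_zero u'.ne_zero (pow_ne_zero _ hϖ.ne_zero)
  · rw [hyy]
    exact (h₁ y₂ hyS₂).restrict

variable {n : ℕ} {i : EquivariantEmbedding 𝒪[K] G A n} {d : ℕ} {E : QDivisor A}
  {D : QDivisor (QuotientRing 𝒪[K] G A)} [MeasurableSpace K] [BorelSpace K]

/-- The `M`-stringy point count of `C` is the contribution to the stringy point count of the
quotient of the points whose fibre is the torsor given by `M`. -/
theorem mStringyCount_eq (hE : IsLogPair 𝒪[K] d E) (hD : IsLogPair 𝒪[K] d D)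
    (hDE : IsCrepant d (QuotientRing 𝒪[K] G A).val D E) {M : GEtaleAlgebra K G}
    (φ : Module.Basis (Fin n) 𝒪[K] (tuningModule i M)) (p : PrimeSpectrum M.carrier)
    {E' : QDivisor (Normalization (UntwistedRing φ))} (hE' : IsUntwistedDivisor d φ E E')
    {a f : A} (ha : ∀ P ∈ minimalPrimes A, orbitDisc G a ∉ P)
    (hf : ∀ P ∈ minimalPrimes A, ∑ g : G, g • f ∉ P) {C : Set (PrimeSpectrum A)}
    (hC : IsStableSet G C) :
    mStringyCount d φ p E' C = (Nat.card 𝓀[K] : ℝ≥0∞) ^ d * stringyMeasure K d D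
      ({x | x.special ∈ PrimeSpectrum.comap (QuotientRing 𝒪[K] G A).val.toRingHom '' C} ∩
        twistedLocus M a) := by
  obtain ⟨hE', E'', hE'', hα, hβ⟩ := hE'
  have hA := hE.isVariety
  have := hA.isReduced
  have := hA.finiteType
  have := hD.isVariety.finiteType
  have := hE'.isVariety.finiteType
  have hfA : (quotientTrace (G := G) 𝒪[K] f : A) ∈ nonZeroDivisors A :=
    mem_nonZeroDivisors_of_forall_notMem hf
  have hfT : twistedToSource φ (∑ g : G, g • f) ∈ nonZeroDivisors (TwistedRing φ) := by
    have h1 : algebraMap (TwistedRing φ) (Normalization (TwistedRing φ))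
        (twistedToSource φ (∑ g : G, g • f)) ∈ nonZeroDivisors _ := hα.1 hfA
    rw [mem_nonZeroDivisors_iff_right] at h1 ⊢
    intro x hx
    refine Normalization.algebraMap_injective _ ((h1 _ ?_).trans (map_zero _).symm)
    rw [← map_mul, hx, map_zero]
  obtain ⟨θ, hθ⟩ := exists_quotientToUntwisted φ hfT
  have hinj := untwistedToTwistedNormalization_injective φ
  have hint := untwistedToTwistedNormalization_isIntegral φ
  have hcomp : (untwistedToTwistedNormalization φ).comp θ =
      (twistedNormalizationToSource φ).comp (QuotientRing 𝒪[K] G A).val := AlgHom.ext hθ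
  have hθ0 : nonZeroDivisors (QuotientRing 𝒪[K] G A) ≤
      (nonZeroDivisors (Normalization (UntwistedRing φ))).comap θ.toRingHom := by
    intro b hb
    have h1 : twistedNormalizationToSource φ (b : A) ∈
        nonZeroDivisors (Normalization (TwistedRing φ)) := hα.1 (hDE.1 hb)
    rw [← hθ] at h1
    change θ b ∈ nonZeroDivisors (Normalization (UntwistedRing φ))
    rw [mem_nonZeroDivisors_iff_right] at h1 ⊢
    intro x hx
    refine hinj ((h1 _ ?_).trans (map_zero _).symm)
    rw [← map_mul, hx, map_zero]
  obtain ⟨s, hs0, hs⟩ := exists_conductor (R := UntwistedRing φ) (O := 𝒪[K])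
  have hs0' : algebraMap (UntwistedRing φ) (Normalization (UntwistedRing φ)) s ∈
      nonZeroDivisors (Normalization (UntwistedRing φ)) := by
    rw [mem_nonZeroDivisors_iff_right]
    intro x hx
    exact Subtype.ext ((IsLocalization.map_units (FractionRing (UntwistedRing φ))
      (⟨s, hs0⟩ : nonZeroDivisors (UntwistedRing φ))).mul_left_eq_zero.mp (congrArg Subtype.val hx))
  obtain ⟨c₁, hc₁, hcs⟩ := exists_mem_of_mem_prime hD.isVariety hD.isNormal hE'.isVariety hθ0 hs0'
  obtain ⟨Ψ, h₁, h₂, h₃, h₄⟩ := exists_twisted_of_point φ hθ (f := f) hs hcs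
  have hδ : invariantDisc 𝒪[K] G a ∈ nonZeroDivisors _ :=
    mem_nonZeroDivisors_of_val (mem_nonZeroDivisors_of_forall_notMem ha)
  have hc : c₁ * (quotientTrace 𝒪[K] f * invariantDisc 𝒪[K] G a) ∈ nonZeroDivisors _ :=
    mul_mem hc₁ (mul_mem (mem_nonZeroDivisors_of_val hfA) hδ)
  set c := c₁ * (quotientTrace 𝒪[K] f * invariantDisc 𝒪[K] G a) with hcdef
  have hne : ∀ x : IntegralPoint K (QuotientRing 𝒪[K] G A), x.eval c ≠ 0 → x.eval c₁ ≠ 0 ∧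
      x.eval (quotientTrace 𝒪[K] f) ≠ 0 ∧ x.eval (invariantDisc 𝒪[K] G a) ≠ 0 := fun x hx => by
    rw [hcdef, map_mul, map_mul] at hx
    exact ⟨left_ne_zero_of_mul hx, left_ne_zero_of_mul (right_ne_zero_of_mul hx),
      right_ne_zero_of_mul (right_ne_zero_of_mul hx)⟩
  set S : Set (IntegralPoint K (QuotientRing 𝒪[K] G A)) :=
    {x | x.special ∈ PrimeSpectrum.comap (QuotientRing 𝒪[K] G A).val.toRingHom '' C} with hSdef
  have hSL : IsOpen (S ∩ twistedLocus M a) :=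
    (IntegralPoint.isOpen_special_mem _).inter (isOpen_twistedLocus M a)
  set m := Nat.card (Subgroup.centralizer (M.stabilizer p : Set G)) with hmdef
  have hm : m ≠ 0 := Nat.card_pos.ne'
  have hcard : ∀ x ∈ S ∩ twistedLocus M a, x.eval c ≠ 0 →
      Nat.card {y : IntegralPoint K (Normalization (UntwistedRing φ)) // y.map θ = x} = m := by
    rintro x ⟨-, hxδ, ψ, hψ⟩ hxc
    obtain ⟨hx1, hxf, -⟩ := hne x hxc
    rw [hmdef, ← hψ.card_eq (a := a) (fun h => hxδ (Subtype.ext h)) p]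
    refine Nat.card_eq_of_bijective (fun y => ⟨Ψ y.1, by
      have := h₁ y.1 (by rw [y.2]; exact hxf)
      rwa [y.2] at this⟩) ⟨fun y y' hyy => Subtype.ext (h₂ _ _ (by rw [y.2]; exact hx1)
        (congrArg Subtype.val hyy)), fun ψ' => ?_⟩
    obtain ⟨y, hy, hyψ⟩ := h₃ x ψ'.1 hx1 hxf ψ'.2
    exact ⟨⟨y, hy⟩, Subtype.ext hyψ⟩
  have hloc : ∀ y : IntegralPoint K (Normalization (UntwistedRing φ)),
      y.map θ ∈ S ∩ twistedLocus M a → (y.map θ).eval c ≠ 0 →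
        ∃ O ∈ nhds y, O.InjOn (IntegralPoint.map θ) := fun y _ hyc =>
    exists_nhds_injOn (Ψ := Ψ) (S := {y | y.eval (θ c) ≠ 0}) (fun y hy => h₁ y (hne (y.map θ) hy).2.1)
      (fun y hy y' _ => h₂ y y' (hne (y.map θ) hy).1) (h₄ a) (IntegralPoint.isOpen_eval_ne_zero _) hyc
      (hne _ hyc).2.2
  obtain ⟨r₁, hr₁⟩ := hD.qCartier
  obtain ⟨r₂, hr₂⟩ := hE.qCartier
  obtain ⟨r₃, hr₃⟩ := hE'.qCartier
  obtain ⟨r₄, hr₄⟩ := hE''.qCartier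
  have p₁ := hr₁.pos
  have p₂ := hr₂.pos
  have p₃ := hr₃.pos
  have p₄ := hr₄.pos
  have q₁ : IsCartierIndex 𝒪[K] d (r₁ * r₂ * r₃ * r₄) D := by
    rw [mul_assoc, mul_assoc]
    exact hr₁.mul hD.isVariety hD.isNormal (by positivity)
  have q₂ : IsCartierIndex 𝒪[K] d (r₁ * r₂ * r₃ * r₄) E := by
    rw [mul_comm r₁, mul_assoc, mul_assoc]
    exact hr₂.mul hE.isVariety hE.isNormal (by positivity)
  have q₃ : IsCartierIndex 𝒪[K] d (r₁ * r₂ * r₃ * r₄) E' := by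
    rw [mul_comm _ r₃, mul_assoc]
    exact hr₃.mul hE'.isVariety hE'.isNormal (by positivity)
  have q₄ : IsCartierIndex 𝒪[K] d (r₁ * r₂ * r₃ * r₄) E'' := by
    rw [mul_comm]
    exact hr₄.mul hE''.isVariety hE''.isNormal (by positivity)
  have hpull : PullsBackGenerators d ((untwistedToTwistedNormalization φ).comp θ) D E''
      (r₁ * r₂ * r₃ * r₄) := by
    rw [hcomp]
    exact (hDE.pullsBackGenerators q₁ q₂).comp (hα.pullsBackGenerators q₂ q₄)
  have key := stringyMeasure_preimage hD hE' hE'' q₁ q₃ hpull (hβ.pullsBackGenerators q₃ q₄) hθ0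
    hinj hint hSL hc hm hcard hloc
  have hset : {y : IntegralPoint K (Normalization (UntwistedRing φ)) |
      y.special ∈ untwistedSet φ C} = IntegralPoint.map θ ⁻¹' S := Set.ext fun y =>
    mem_image_comap_iff (θ := θ.toRingHom) (β := (untwistedToTwistedNormalization φ).toRingHom)
      (α := (twistedNormalizationToSource φ).toRingHom) hθ hinj hint hC y.special
  have hadd := stringyMeasure_eq_tsum_stringyMeasure hE' (S := IntegralPoint.map θ ⁻¹' S)
    (T := fun _ : Unit => IntegralPoint.map θ ⁻¹' (S ∩ twistedLocus M a))
    (fun _ => hSL.preimage (IntegralPoint.continuous_map θ))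
    (fun _ => Set.preimage_mono Set.inter_subset_left) (fun j j' h => (h rfl).elim)
    (h := fun _ : Unit => θ c)
    (fun _ _ hQ => notMem_minimalPrimes_of_mem_nonZeroDivisors (hθ0 hc) hQ) fun y hy => by
      by_cases hyc : y.eval (θ c) = 0
      · exact .inr ⟨(), hyc⟩
      · obtain ⟨-, hyf, hyδ⟩ := hne (y.map θ) hyc
        exact .inl ⟨(), hy, hyδ, Ψ y, h₁ y hyf⟩
  have hm0 : (m : ℝ≥0∞) ≠ 0 := Nat.cast_ne_zero.mpr hm
  rw [mStringyCount, stringyCount, hset, hadd, tsum_fintype, Fintype.sum_unique, key, mul_left_comm,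
    ← hmdef, mul_comm, ENNReal.mul_div_cancel_right hm0 (ENNReal.natCast_ne_top m)]

/-- The stringy point count of the quotient is the `G`-stringy point count. -/
theorem gStringyCount_eq (hE : IsGLogPair 𝒪[K] G d E) (hD : IsLogPair 𝒪[K] d D)
    (hDE : IsCrepant d (QuotientRing 𝒪[K] G A).val D E) {R : Set (GEtaleAlgebra K G)}
    (hR : IsSetOfRepresentatives R)
    (φ : ∀ M : R, Module.Basis (Fin n) 𝒪[K] (tuningModule i M.1))
    (p : ∀ M : R, PrimeSpectrum M.1.carrier)
    (E' : ∀ M : R, QDivisor (Normalization (UntwistedRing (φ M))))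
    (hE' : ∀ M : R, IsUntwistedDivisor d (φ M) E (E' M)) {C : Set (PrimeSpectrum A)}
    (hC : IsStableSet G C) : gStringyCount d φ p E' C = stringyCount K d D
      (PrimeSpectrum.comap (QuotientRing 𝒪[K] G A).val.toRingHom '' C) := by
  have hA := hE.isLogPair.isVariety
  have := hA.isReduced
  have := hA.finiteType
  have := hA.isNoetherianRing
  have := hD.isVariety.finiteType
  have : Infinite 𝒪[K] := by
    by_contra h
    have := not_infinite_iff_finite.mp h
    exact IsDiscreteValuationRing.not_isField 𝒪[K] (Finite.isField_of_domain 𝒪[K])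
  obtain ⟨l, g, hg⟩ := IntegralPoint.exists_generators (K := K) (A := A)
  obtain ⟨a, ha⟩ := exists_orbitDisc_notMem hA.eq_zero_of_algebraMap_mem hE.faithful hg
  obtain ⟨f, hf⟩ := exists_trace_notMem hE.faithful
  have hδ : invariantDisc 𝒪[K] G a ∈ nonZeroDivisors _ :=
    mem_nonZeroDivisors_of_val (mem_nonZeroDivisors_of_forall_notMem ha)
  have hne : ∀ {x : IntegralPoint K (QuotientRing 𝒪[K] G A)},
      x.eval (invariantDisc 𝒪[K] G a) ≠ 0 → x.toField (invariantDisc 𝒪[K] G a) ≠ 0 :=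
    fun hx h => hx (Subtype.ext h)
  have h1 : ∀ M : R, mStringyCount d (φ M) (p M) (E' M) C = _ := fun M =>
    mStringyCount_eq hE.isLogPair hD hDE (φ M) (p M) (hE' M) ha hf hC
  refine (tsum_congr h1).trans (ENNReal.tsum_mul_left.trans (congrArg _ ?_))
  let T : R → Set (IntegralPoint K (QuotientRing 𝒪[K] G A)) := fun M =>
    {x | x.special ∈ PrimeSpectrum.comap (QuotientRing 𝒪[K] G A).val.toRingHom '' C} ∩
      twistedLocus M.1 a
  have hT : ∀ M, IsOpen (T M) := fun M =>
    (IntegralPoint.isOpen_special_mem _).inter (isOpen_twistedLocus M.1 a)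
  have hdisj : Pairwise (Function.onFun Disjoint T) := by
    intro M M' hne'
    refine Set.disjoint_left.mpr ?_
    rintro x ⟨-, hx, ψ, hψ⟩ ⟨-, -, ψ', hψ'⟩
    obtain ⟨M₀, -, huniq⟩ := hR M.1
    exact hne' (Subtype.ext ((huniq M.1 ⟨M.2, hψ.iso hψ (hne hx)⟩).trans
      (huniq M'.1 ⟨M'.2, hψ.iso hψ' (hne hx)⟩).symm))
  refine (stringyMeasure_eq_tsum_stringyMeasure hD hT (fun M => Set.inter_subset_left) hdisj
    (h := fun _ : Unit => invariantDisc 𝒪[K] G a)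
    (fun _ _ hQ => notMem_minimalPrimes_of_mem_nonZeroDivisors hδ hQ) fun x hx => ?_).symm
  by_cases hxδ : x.eval (invariantDisc 𝒪[K] G a) = 0
  · exact .inr ⟨(), hxδ⟩
  · obtain ⟨M, ψ, hψ⟩ := exists_isTwisted x.toField a (hne hxδ)
    obtain ⟨M', ⟨hM', hiso⟩, -⟩ := hR M
    exact .inl ⟨⟨M', hM'⟩, hx, hxδ, hψ.of_iso hiso⟩

omit [DecidableEq G] [MeasurableSpace K] [BorelSpace K] in
lemma isStableSet_specialFibre : IsStableSet G (specialFibre K A) := by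
  intro g p p' h hp c hc
  have := (h _).mp (hp c hc)
  rwa [smul_algebraMap] at this

omit [DecidableEq G] [MeasurableSpace K] [BorelSpace K] in
lemma image_specialFibre : PrimeSpectrum.comap (QuotientRing 𝒪[K] G A).val.toRingHom ''
    specialFibre K A = specialFibre K (QuotientRing 𝒪[K] G A) := by
  refine Set.Subset.antisymm ?_ fun y hy => ?_
  · rintro _ ⟨p, hp, rfl⟩ c hc
    exact hp c hc
  · obtain ⟨-, p, -, -, hp⟩ := exists_le_comap_eq (β := (QuotientRing 𝒪[K] G A).val.toRingHom)
      Subtype.val_injective isIntegral_val_quotientRing (le_refl y)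
    refine ⟨p, fun c hc => ?_, hp⟩
    have := hy c hc
    rw [← hp] at this
    exact this

end Quotient

end

end WildMcKay

/-- Let `(V, E)`, `V = Spec A`, be an affine `G`-log pair over the ring of integers of a
non-archimedean local field `K`, and let `D` be the divisor on `X = V/G` with `(V, E) → (X, D)`
crepant.  For every equivariant embedding of `V` into an affine space with linear `G`-action and all
choices in the construction (representatives `M` of the `G`-étale algebras, a basis `φ M` of each
tuning module, a component `p M` of `Spec M`), with `E' M` the divisor `E^{|M|,ν}` on `V^{|M|,ν}`, and
for every `G`-stable subset `C` of the special fibre, `♯^G_st(V, E)_C = ♯_st(X, D)_{C̄}`;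
in particular `♯^G_st(V, E) = ♯_st(X, D)`. -/
theorem mainTheorem1
    {K : Type u} [Field K] [ValuativeRel K] [TopologicalSpace K] [IsNonarchimedeanLocalField K]
    [MeasurableSpace K] [BorelSpace K]
    {G : Type w} [Group G] [Finite G]
    {A : Type v} [CommRing A] [Algebra 𝒪[K] A] [MulSemiringAction G A] [SMulCommClass G 𝒪[K] A]
    (d : ℕ) (E : WildMcKay.QDivisor A) (hE : WildMcKay.IsGLogPair 𝒪[K] G d E)
    (D : WildMcKay.QDivisor (WildMcKay.QuotientRing 𝒪[K] G A))
    (hD : WildMcKay.IsLogPair 𝒪[K] d D)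
    (hDE : WildMcKay.IsCrepant d (WildMcKay.QuotientRing 𝒪[K] G A).val D E)
    (n : ℕ) (i : WildMcKay.EquivariantEmbedding 𝒪[K] G A n)
    (R : Set (WildMcKay.GEtaleAlgebra K G)) (hR : WildMcKay.IsSetOfRepresentatives R)
    (φ : ∀ M : R, Module.Basis (Fin n) 𝒪[K] (WildMcKay.tuningModule i M.1))
    (p : ∀ M : R, PrimeSpectrum M.1.carrier)
    (E' : ∀ M : R, WildMcKay.QDivisor (WildMcKay.Normalization (WildMcKay.UntwistedRing (φ M))))
    (hE' : ∀ M : R, WildMcKay.IsUntwistedDivisor d (φ M) E (E' M)) :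
    (∀ C ⊆ WildMcKay.specialFibre K A, WildMcKay.IsStableSet G C →
      WildMcKay.gStringyCount d φ p E' C = WildMcKay.stringyCount K d D
        (PrimeSpectrum.comap (WildMcKay.QuotientRing 𝒪[K] G A).val.toRingHom '' C)) ∧
    WildMcKay.gStringyCount d φ p E' (WildMcKay.specialFibre K A) =
      WildMcKay.stringyCount K d D
        (WildMcKay.specialFibre K (WildMcKay.QuotientRing 𝒪[K] G A)) := by
  classical
  have := Fintype.ofFinite G
  have key : ∀ C : Set (PrimeSpectrum A), WildMcKay.IsStableSet G C →
      WildMcKay.gStringyCount d φ p E' C = WildMcKay.stringyCount K d D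
        (PrimeSpectrum.comap (WildMcKay.QuotientRing 𝒪[K] G A).val.toRingHom '' C) := fun C hC =>
    WildMcKay.gStringyCount_eq hE hD hDE hR φ p E' hE' hC
  refine ⟨fun C _ hC => key C hC, ?_⟩
  rw [key _ WildMcKay.isStableSet_specialFibre, WildMcKay.image_specialFibre]
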